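/- Use units with $c=1$, the metric $g=\mathrm{diag}(-1,1,1,1)$, Greek indices $0,\dots,3$ and Latin indices $1,2,3$, summed when repeated. Let $N\ge 0$ point charges with charges $q_n$ and masses $m_n$ move on $C^\infty$ world-lines ${\bf z}_n(t)$ with velocities $|{\bf v}_n|<1$, such that the past light cone of every event meets every world-line; let $\gamma_n=(1-{\bf v}_n^2)^{-1/2}$ and $u_n^i=\gamma_n v_n^i$. Let $A^\mu=A^\mu_{\rm in}+\sum_n A^\mu_{n,{\rm ret}}$, where $A_{n,{\rm ret}}$ is the Liénard–Wiechert retarded potential of the $n$-th charge, $A^\mu_{n,{\rm ret}}=\frac{q_n}{4\pi}\frac{(1,{\bf v}_n)^\mu}{|{\bf R}|-{\bf R}\cdot{\bf v}_n}$ at the retarded time, with ${\bf R}={\bf x}-{\bf z}_n$ there, and $A_{\rm in}$ is any $C^\infty$ potential (in particular any smooth solution of the free field equations). Fix a time $t$ at which the positions ${\bf z}_n={\bf z}_n(t)$ are distinct and at which the fields vanish sufficiently fast at infinity, meaning that for large $|{\bf x}|$ the potentials are $O(|{\bf x}|^{-1})$, while the spatial derivatives of $A^\mu$ of orders $1,2,3$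 and those of $\partial_0A^\mu$ of orders $0,1,2$ are $O(|{\bf x}|^{-2})$. Finite parts. If $f(r)=a/r+b+O(r)$ as $r\to0^+$, put ${\cal R}\lim_{r\to0}f=b$, and let ${\cal R}\!\int d^3{\bf x}\,G$ be the ${\cal R}$-limit as $r\to0$ of the integral of $G$ over $\{|{\bf x}-{\bf z}_n|>r\ \forall n\}$. If $f(\Lambda)=c\Lambda+d+O(\Lambda^{-1})$ as $\Lambda\to\infty$, put ${\cal R}\lim_{\Lambda\to\infty}f=d$, and let ${\cal R}\!\int d^3{\bf k}\,g={\cal R}\lim_{\Lambda\to\infty}\int_{|{\bf k}|<\Lambda}d^3{\bf k}\,g$. Definitions. Put $$\widetilde A^\mu(z_n)={\cal R}\lim_{r\to0}\int_{|{\bf x}|=r}\frac{d\Omega_{\bf x}}{4\pi}A^\mu({\bf z}_n+{\bf x},t),\qquad p_n^i=m_nu_n^i+q_n\widetilde A^i(z_n),$$ $F_{\mu\nu}=\partial_\mu A_\nu-\partial_\nu A_\mu$, $\pi_i=F_{0i}$, $\pi^0=-\pi_0=\partial_\mu A^\mu$, and $$P^i=-{\cal R}\!\int d^3{\bf x}\,\pi_\mu\partial^iA^\mu+\sum_np_n^i,$$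 $$P^0={\cal R}\!\int d^3{\bf x}\left(\tfrac14F_{ij}F^{ij}+\tfrac12\pi_\mu\pi^\mu-\pi^i\partial_iA^0+\pi^0\partial_iA^i\right)+\sum_n\left[q_n\widetilde A^0(z_n)+\sqrt{({\bf p}_n-q_n\widetilde{\bf A}(z_n))^2+m_n^2}\right].$$ Let $a^\mu({\bf k})$ be Fourier amplitudes at time $t$, that is, measurable functions with $|a^\mu|/\big(|{\bf k}|(1+|{\bf k}|)^m\big)$ integrable for some $m$, such that, with $k^0=|{\bf k}|$ and as tempered distributions in ${\bf x}$, $$A^\mu=\frac1{2(2\pi)^3}\int\frac{d^3{\bf k}}{k^0}\left[a^\mu e^{i{\bf k}\cdot{\bf x}}+a^{\mu*}e^{-i{\bf k}\cdot{\bf x}}\right],\qquad \partial_0A^\mu=-\frac i{2(2\pi)^3}\int d^3{\bf k}\left[a^\mu e^{i{\bf k}\cdot{\bf x}}-a^{\mu*}e^{-i{\bf k}\cdot{\bf x}}\right].$$ Theorem. All the ${\cal R}$-limits and ${\cal R}$-integrals above and below exist, and $$P^i=\frac1{2(2\pi)^3}{\cal R}\!\int\frac{d^3{\bf k}}{k^0}k^ia^\nu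 a^*_\nu+\sum_np_n^i,$$ $$P^0=\frac1{2(2\pi)^3}{\cal R}\!\int d^3{\bf k}\,a^\nu a^*_\nu+\sum_n\left[q_n\widetilde A^0(z_n)+\sqrt{({\bf p}_n-q_n\widetilde{\bf A}(z_n))^2+m_n^2}\right],$$ $$\widetilde A_\mu(z_n)=\frac1{2(2\pi)^3}{\cal R}\!\int\frac{d^3{\bf k}}{k^0}\left[a_\mu e^{i{\bf k}\cdot{\bf z}_n}+a^*_\mu e^{-i{\bf k}\cdot{\bf z}_n}\right].$$ -/

import Mathlib

open MeasureTheory Filter Topology Asymptotics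
open scoped ContDiff

noncomputable section

namespace PointChargeED

/-- Three-dimensional Euclidean space. -/
abbrev Space := EuclideanSpace ℝ (Fin 3)

/-- Space-time points `(t, x)` in a fixed inertial frame, units with `c = 1`. -/
abbrev Spacetime := ℝ × Space

/-- Diagonal entries of the metric `g = diag (-1, 1, 1, 1)`. -/
def eta : Fin 4 → ℝ := ![-1, 1, 1, 1]

/-- Coordinate vectors: index `0` is time, indices `1, 2, 3` are space. -/
def basisVec : Fin 4 → Spacetime :=
  Fin.cons (1, 0) fun i : Fin 3 => (0, EuclideanSpace.single i 1)

/-- The partial derivative `∂_ν f`. -/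
def pd (ν : Fin 4) (f : Spacetime → ℝ) (p : Spacetime) : ℝ :=
  fderiv ℝ f p (basisVec ν)

/-! ### Finite parts -/

/-- `f r = a / r + b + O(r)` as `r → 0+`: the finite part (`R`-limit) of `f` at `0` is `b`. -/
def HasRLimZero (f : ℝ → ℝ) (b : ℝ) : Prop :=
  ∃ a : ℝ, (fun r => f r - (a / r + b)) =O[𝓝[>] (0 : ℝ)] fun r => r

/-- The part of space at distance greater than `r` from all the points `z n`. -/
def outside {N : ℕ} (z : Fin N → Space) (r : ℝ) : Set Space :=
  {x | ∀ n, r < ‖x - z n‖}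

/-- The `R`-integral over all space of a function `G` singular at the points `z n` is `b`. -/
def HasRIntegral {N : ℕ} (z : Fin N → Space) (G : Space → ℝ) (b : ℝ) : Prop :=
  (∀ r > 0, IntegrableOn G (outside z r)) ∧
    HasRLimZero (fun r => ∫ x in outside z r, G x) b

/-- `f Λ = c * Λ + d + O(1/Λ)` as `Λ → ∞`: the finite part (`R`-limit) of `f` at `∞` is `d`. -/
def HasRLimTop (f : ℝ → ℂ) (d : ℂ) : Prop :=
  ∃ c : ℂ, (fun Λ : ℝ => f Λ - (c * (Λ : ℂ) + d)) =O[atTop] fun Λ : ℝ => Λ⁻¹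

/-- The `R`-integral of `g` over wave-vector space is `d`. -/
def HasRIntegralK (g : Space → ℂ) (d : ℂ) : Prop :=
  (∀ Λ > 0, IntegrableOn g (Metric.ball (0 : Space) Λ)) ∧
    HasRLimTop (fun Λ => ∫ k in Metric.ball (0 : Space) Λ, g k) d

/-! ### Particles and fields -/

/-- `N` point charges on smooth subluminal world-lines, together with a smooth incident
potential `A_in^μ`. -/
structure ChargeSystem (N : ℕ) where
  /-- The charges `q_n`. -/
  charge : Fin N → ℝ
  /-- The (physical) masses `m_n`. -/
  mass : Fin N → ℝ
  /-- The positions `z_n(t)`. -/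
  pos : Fin N → ℝ → Space
  /-- The contravariant components of the incident potential. -/
  inField : Spacetime → Fin 4 → ℝ
  pos_smooth : ∀ n, ContDiff ℝ ∞ (pos n)
  subluminal : ∀ n s, ‖deriv (pos n) s‖ < 1
  /-- The past light cone of every event meets every world-line
  (automatic if the past speeds are bounded away from `1`). -/
  exists_retarded : ∀ n t x, ∃ s, t - s = ‖x - pos n s‖
  inField_smooth : ContDiff ℝ ∞ inField

/-- The time at which the world-line `z` meets the past light cone of `p = (t, x)`. For a
subluminal world-line the set below has at most one element. -/
def retardedTime (z : ℝ → Space) (p : Spacetime) : ℝ :=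
  sSup {s : ℝ | p.1 - s = ‖p.2 - z s‖}

/-- The Lienard-Wiechert retarded potential `A_ret^μ` of a charge `q` on the world-line `z`:
`(q / 4π) (1, v)^μ / (|R| - R · v)`, where `R = x - z(s)`, `v = dz/ds` are taken at the
retarded time `s`. -/
def retardedPotential (q : ℝ) (z : ℝ → Space) (p : Spacetime) (μ : Fin 4) : ℝ :=
  let s := retardedTime z p
  let R := p.2 - z s
  let v := deriv z s
  q / (4 * Real.pi) * (Fin.cons (1 : ℝ) (fun i : Fin 3 => v i) : Fin 4 → ℝ) μ
    / (‖R‖ - inner ℝ R v)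

namespace ChargeSystem

variable {N : ℕ} (S : ChargeSystem N)

/-- The total potential `A^μ`, contravariant components. -/
def potential (p : Spacetime) (μ : Fin 4) : ℝ :=
  S.inField p μ + ∑ n, retardedPotential (S.charge n) (S.pos n) p μ

/-- The velocity `v_n`. -/
def velocity (t : ℝ) (n : Fin N) : Space := deriv (S.pos n) t

/-- The Lorentz factor `γ_n`. -/
def gamma (t : ℝ) (n : Fin N) : ℝ := 1 / Real.sqrt (1 - ‖S.velocity t n‖ ^ 2)

/-- The mixed derivatives `∂_ν A^μ`. -/
def dA (ν μ : Fin 4) (p : Spacetime) : ℝ := pd ν (fun p' => S.potential p' μ) p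

/-- The field tensor `F_{μν} = ∂_μ A_ν - ∂_ν A_μ`, covariant components. -/
def fieldTensor (μ ν : Fin 4) (p : Spacetime) : ℝ :=
  eta ν * S.dA μ ν p - eta μ * S.dA ν μ p

/-- The covariant canonical field momenta `π_μ = ∂L/∂(∂_0 A^μ)` for the density
`L = -(1/4) F_{μν} F^{μν} - (1/2) (∂_μ A^μ)^2`: `π_0 = -∂_μ A^μ` and `π_i = F_{0i}`. -/
def fieldMomentum (p : Spacetime) : Fin 4 → ℝ :=
  Fin.cons (-∑ ν, S.dA ν ν p) fun i : Fin 3 => S.fieldTensor 0 i.succ p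

/-- The canonical densities of the field. Component `0` is
`(1/4) F_{ij} F^{ij} + (1/2) π_μ π^μ - π^i ∂_i A^0 + π^0 ∂_i A^i`, component `k` is
`-π_μ ∂^k A^μ`. -/
def fieldDensity (p : Spacetime) : Fin 4 → ℝ :=
  Fin.cons
    (1 / 4 * ∑ i : Fin 3, ∑ j : Fin 3, S.fieldTensor i.succ j.succ p ^ 2
      + 1 / 2 * ∑ μ, eta μ * S.fieldMomentum p μ ^ 2
      - ∑ i : Fin 3, S.fieldMomentum p i.succ * S.dA i.succ 0 p
      + (eta 0 * S.fieldMomentum p 0) * ∑ i : Fin 3, S.dA i.succ i.succ p)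
    fun k : Fin 3 => -∑ μ, S.fieldMomentum p μ * S.dA k.succ μ p

/-- At time `t` the potentials vanish at infinity as `O(1/|x|)`, and their derivatives, up to the
third order in all and up to the first order in time, as `O(1/|x|^2)`. -/
def VanishesAtInfinity (t : ℝ) : Prop :=
  ∃ C R : ℝ, ∀ x : Space, R ≤ ‖x‖ →
    ‖S.potential (t, x)‖ ≤ C / ‖x‖ ∧
    (∀ j : ℕ, 1 ≤ j → j ≤ 3 →
      ‖iteratedFDeriv ℝ j (fun x' : Space => S.potential (t, x')) x‖ ≤ C / ‖x‖ ^ 2) ∧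
    (∀ j : ℕ, j ≤ 2 →
      ‖iteratedFDeriv ℝ j (fun (x' : Space) (μ : Fin 4) => S.dA 0 μ (t, x')) x‖ ≤ C / ‖x‖ ^ 2)

/-- The functions `a^μ(k)` are the Fourier amplitudes at time `t` of the potential:
`A^μ(x) = (1 / 2(2π)^3) ∫ d^3k / k^0 [a^μ(k) e^{ik·x} + c.c.]` and
`∂_0 A^μ(x) = -(i / 2(2π)^3) ∫ d^3k [a^μ(k) e^{ik·x} - c.c.]` with `k^0 = |k|`, as
tempered distributions in `x`, that is, after multiplication by any Schwartz function `φ(x)` and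
integration over `x` (performed under the `k`-integral on the right). -/
structure IsFourierAmplitude (t : ℝ) (a : Space → Fin 4 → ℂ) : Prop where
  measurable : ∀ μ, AEStronglyMeasurable (fun k => a k μ) volume
  tempered : ∃ m : ℕ, ∀ μ, Integrable (fun k => ‖a k μ‖ / (‖k‖ * (1 + ‖k‖) ^ m)) volume
  potential_eq : ∀ (μ : Fin 4) (φ : SchwartzMap Space ℂ),
    ∫ x, (S.potential (t, x) μ : ℂ) * φ x
      = 1 / (2 * (2 * (Real.pi : ℂ)) ^ 3) * ∫ k : Space, 1 / (‖k‖ : ℂ) *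
        (a k μ * (∫ x, Complex.exp (Complex.I * (inner ℝ k x : ℝ)) * φ x)
          + star (a k μ) * (∫ x, Complex.exp (-(Complex.I * (inner ℝ k x : ℝ))) * φ x))
  deriv_eq : ∀ (μ : Fin 4) (φ : SchwartzMap Space ℂ),
    ∫ x, (S.dA 0 μ (t, x) : ℂ) * φ x
      = -Complex.I / (2 * (2 * (Real.pi : ℂ)) ^ 3) * ∫ k : Space,
        (a k μ * (∫ x, Complex.exp (Complex.I * (inner ℝ k x : ℝ)) * φ x)
          - star (a k μ) * (∫ x, Complex.exp (-(Complex.I * (inner ℝ k x : ℝ))) * φ x))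

/-- `b` is the regularized potential `Ã^μ(z_n)`: the finite part as `r → 0` of the mean of `A^μ`
over the sphere of radius `r` centred at `z_n(t)`. -/
def IsRegularizedPotential (t : ℝ) (n : Fin N) (μ : Fin 4) (b : ℝ) : Prop :=
  (∀ᶠ r in 𝓝[>] (0 : ℝ), Integrable
    (fun w : Metric.sphere (0 : Space) 1 => S.potential (t, S.pos n t + r • (w : Space)) μ)
    (volume : Measure Space).toSphere) ∧
  HasRLimZero (fun r => ⨍ w : Metric.sphere (0 : Space) 1,
    S.potential (t, S.pos n t + r • (w : Space)) μ ∂(volume : Measure Space).toSphere) b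

/-- The canonical momentum `p_n^i = m_n u_n^i + q_n Ã^i(z_n)`, with `u_n^i = γ_n v_n^i`. -/
def canonicalMomentum (t : ℝ) (At : Fin N → Fin 4 → ℝ) (n : Fin N) (i : Fin 3) : ℝ :=
  S.mass n * (S.gamma t n * S.velocity t n i) + S.charge n * At n i.succ

/-- The particle terms of the energy-momentum: for the energy the sum over `n` of
`q_n Ã^0(z_n) + √((p_n - q_n Ã(z_n))^2 + m_n^2)`, for the momentum the sum of the `p_n^i`. -/
def particleTerm (t : ℝ) (At : Fin N → Fin 4 → ℝ) : Fin 4 → ℝ :=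
  Fin.cons
    (∑ n, (S.charge n * At n 0 + Real.sqrt
      (∑ i : Fin 3, (S.canonicalMomentum t At n i - S.charge n * At n i.succ) ^ 2
        + S.mass n ^ 2)))
    fun i : Fin 3 => ∑ n, S.canonicalMomentum t At n i

/-- `P` is the canonical energy-momentum at time `t`: the Hamiltonian `P^0` and the total momentum
`P^i`, with `R`-integrals of the canonical field densities over the space. -/
def IsCanonicalEnergyMomentum (t : ℝ) (At : Fin N → Fin 4 → ℝ) (P : Fin 4 → ℝ) : Prop :=
  ∃ G : Fin 4 → ℝ, (∀ μ, HasRIntegral (fun n => S.pos n t) (fun x => S.fieldDensity (t, x) μ) (G μ)) ∧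
    ∀ μ, P μ = G μ + S.particleTerm t At μ

end ChargeSystem

/-! ### Wave-vector expressions -/

/-- The light-like four-vector `k^μ = (|k|, k)`. -/
def waveVec (k : Space) : Fin 4 → ℝ := Fin.cons ‖k‖ fun i : Fin 3 => k i

/-- The integrand `(k^μ / k^0) a^ν a*_ν`. -/
def waveDensity (a : Space → Fin 4 → ℂ) (μ : Fin 4) (k : Space) : ℂ :=
  ((waveVec k μ / ‖k‖ : ℝ) : ℂ) * ∑ ν, (eta ν : ℂ) * (a k ν * star (a k ν))

/-- The integrand `(1 / k^0) [a^μ(k) e^{ik·x} + a^μ*(k) e^{-ik·x}]`. -/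
def planeWaves (a : Space → Fin 4 → ℂ) (x : Space) (μ : Fin 4) (k : Space) : ℂ :=
  1 / (‖k‖ : ℂ) * (a k μ * Complex.exp (Complex.I * (inner ℝ k x : ℝ))
    + star (a k μ) * Complex.exp (-(Complex.I * (inner ℝ k x : ℝ))))

end PointChargeED

end

open MeasureTheory Filter Topology Asymptotics
open scoped ContDiff
open Complex (I exp norm_real continuous_ofReal I_sq sin ofRealCLM norm_I star_def norm_exp_ofReal_mul_I real_smul cos ofReal_re I_re mul_re conj_re conj_im exp_add conj_ofReal add_re ofReal_zero ofReal_neg mul_im ofReal_im I_im ofReal_one sub_re normSq_apply add_im neg_re neg_im conj_I re_sum sub_im)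
open Metric (ball sphere closedBall isOpen_ball mem_ball ball_mem_nhds)
open Real (norm_of_nonneg norm_eq_abs sqrt_pos sqrt_sq pi_ne_zero pi_pos sq_sqrt exp_pos)
open EuclideanSpace (single norm_eq inner_single_right norm_sq_eq)
open Set (Ioi indicator_of_mem indicator_of_notMem Icc mem_ofPred_eq Iio)
open Finset (univ sum_congr mul_sum sum_mul induction_on sum_insert sum_add_distrib sum_eq_zero mem_univ sum_empty sum_mul_sum)
open Function (Injective comp_def comp_apply)
open ENNReal (ofReal ofReal_mul ofReal_le_ofReal ofNNReal_toNNReal ofReal_pow toReal_mul toReal_ofReal)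
open SchwartzMap (fourierInv_coe)
open ContinuousLinearMap (mul_apply' toSpanSingleton_apply id_apply coe_fst' coe_snd')
open intervalIntegral (integral_congr integral_of_le)

noncomputable section

namespace PointChargeED

open scoped Real
local notation "SC" => Space → ℂ
local notation "SR" => Space → ℝ
local notation "Sm₀" f:max => ContDiffOn ℝ ∞ f {0}ᶜ
local notation "C∞" => ContDiff ℝ ∞
local notation "⟪" x "," y "⟫" => inner ℝ x y
local notation "gs" ε:max l:max => Real.exp (-ε * l ^ 2)
local notation "𝕊" => sphere (0 : Space) 1
local notation "vol" => (volume : Measure Space)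

section

/-! ### Surface measure of the unit sphere and polar coordinates -/

/-- The surface measure of the unit sphere, as a measure on the space. -/
def σ : Measure Space :=
  (vol).toSphere.map ((↑) : 𝕊 → Space)

instance : IsFiniteMeasure σ := by
  unfold σ; infer_instance

lemma measurableEmbedding_sphere : MeasurableEmbedding ((↑) : 𝕊 → Space) :=
  MeasurableEmbedding.subtype_coe Metric.isClosed_sphere.measurableSet

lemma ae_σ : ∀ᵐ w ∂σ, ‖w‖ = 1 := by
  unfold σ
  rw [measurableEmbedding_sphere.ae_map_iff]
  exact Eventually.of_forall fun w => by simpa using w.2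

lemma σ_apply {s : Set Space} (hs : MeasurableSet s) :
    σ s = 3 * volume {x : Space | x ≠ 0 ∧ ‖x‖ < 1 ∧ ‖x‖⁻¹ • x ∈ s} := by
  unfold σ
  rw [Measure.map_apply measurable_subtype_coe hs, Measure.toSphere_apply' _ (measurable_subtype_coe hs)]
  congr 1
  · simp
  · congr 1
    ext x
    simp only [Set.mem_smul, Set.mem_Ioo, Set.mem_image, Set.mem_preimage, mem_ofPred_eq]
    constructor
    · rintro ⟨r, ⟨h0, h1⟩, y, ⟨w, hw, rfl⟩, rfl⟩
      have hw1 : ‖(w : Space)‖ = 1 := by simpa using w.2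
      have hw0 : (w : Space) ≠ 0 := by rw [← norm_ne_zero_iff, hw1]; exact one_ne_zero
      refine ⟨smul_ne_zero h0.ne' hw0, by rw [norm_smul, hw1]; simpa [abs_of_pos h0] using h1, ?_⟩
      rw [norm_smul, hw1, smul_smul, mul_one, norm_of_nonneg h0.le, inv_mul_cancel₀ h0.ne', one_smul]
      exact hw
    · rintro ⟨h0, h1, hs⟩
      have hx : 0 < ‖x‖ := norm_pos_iff.2 h0
      refine ⟨‖x‖, ⟨hx, h1⟩, ‖x‖⁻¹ • x, ⟨⟨‖x‖⁻¹ • x, ?_⟩, hs, rfl⟩, ?_⟩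
      · simp [norm_smul, hx.ne']
      · rw [smul_smul, mul_inv_cancel₀ hx.ne', one_smul]

lemma measurePreserving_linearIsometryEquiv_σ (e : Space ≃ₗᵢ[ℝ] Space) :
    MeasurePreserving e σ σ := by
  refine ⟨e.continuous.measurable, ?_⟩
  ext s hs
  rw [Measure.map_apply e.continuous.measurable hs, σ_apply hs,
    σ_apply (e.continuous.measurable hs)]
  congr 1
  have hm : MeasurableSet {x : Space | x ≠ 0 ∧ ‖x‖ < 1 ∧ ‖x‖⁻¹ • x ∈ s} := by
    refine (measurableSet_singleton (0 : Space)).compl.inter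
      ((measurableSet_lt measurable_norm measurable_const).inter ?_)
    exact (measurable_norm.inv.smul measurable_id) hs
  rw [← e.measurePreserving.measure_preimage hm.nullMeasurableSet]
  congr 1
  ext x
  simp

/-- The density `r^2` on the half-line. -/
def radM : Measure ℝ :=
  (volume.restrict (Ioi (0 : ℝ))).withDensity fun r => ((r ^ 2).toNNReal : ENNReal)

instance : SFinite radM := by unfold radM; infer_instance

lemma radM_eq_map : radM = (Measure.volumeIoiPow 2).map ((↑) : Ioi (0 : ℝ) → ℝ) := by
  have he : MeasurableEmbedding ((↑) : Ioi (0 : ℝ) → ℝ) :=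
    MeasurableEmbedding.subtype_coe measurableSet_Ioi
  ext s hs
  unfold radM Measure.volumeIoiPow
  rw [he.map_apply, withDensity_apply _ hs, withDensity_apply _ (he.measurable hs)]
  rw [← lintegral_indicator hs, ← lintegral_indicator (he.measurable hs), ← lintegral_subtype_comap measurableSet_Ioi]
  rfl

lemma measurePreserving_polar : MeasurePreserving (fun p : Space × ℝ => p.2 • p.1) (σ.prod radM)
      vol := by
  have h := ((vol).measurePreserving_homeomorphUnitSphereProd).symm
    (homeomorphUnitSphereProd Space).toMeasurableEquiv
  have hc : MeasurableEmbedding ((↑) : ({0}ᶜ : Set Space) → Space) :=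
    MeasurableEmbedding.subtype_coe (measurableSet_singleton _).compl
  have hv : Measure.map ((↑) : ({0}ᶜ : Set Space) → Space) ((vol).comap (↑)) = volume := by
    rw [hc.map_comap, Subtype.range_coe]
    exact Measure.restrict_eq_self_of_ae_mem (by simp [ae_iff])
  have h2 : MeasurePreserving ((↑) : ({0}ᶜ : Set Space) → Space)
      ((vol).comap (↑)) volume := ⟨hc.measurable, hv⟩
  have h3 := h2.comp h
  refine ⟨by fun_prop, ?_⟩
  rw [radM_eq_map, σ, Measure.map_prod_map _ _ measurable_subtype_coe
    measurable_subtype_coe, Measure.map_map (by fun_prop) (by fun_prop)]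
  have h4 := h3.map_eq
  rw [show Module.finrank ℝ Space - 1 = 2 by simp] at h4
  exact h4

variable {F : Type*} [NormedAddCommGroup F] [NormedSpace ℝ F]

lemma integral_radM (g : ℝ → F) : ∫ r, g r ∂radM = ∫ r in Ioi (0 : ℝ), r ^ 2 • g r := by
  unfold radM
  rw [integral_withDensity_eq_integral_smul (by fun_prop)]
  refine setIntegral_congr_fun measurableSet_Ioi fun r _ => ?_
  rw [NNReal.smul_def, Real.coe_toNNReal _ (sq_nonneg r)]

lemma integrable_polar {f : Space → F} (hf : Integrable f) :
    Integrable (fun p : Space × ℝ => f (p.2 • p.1)) (σ.prod radM) :=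
  measurePreserving_polar.integrable_comp_of_integrable hf

lemma integral_polar {f : Space → F} (hf : Integrable f) :
    ∫ x, f x = ∫ r in Ioi (0 : ℝ), r ^ 2 • ∫ w, f (r • w) ∂σ := by
  have h1 : ∫ x, f x = ∫ p, f (p.2 • p.1) ∂(σ.prod radM) := by
    rw [← measurePreserving_polar.map_eq, integral_map measurePreserving_polar.measurable.aemeasurable]
    rw [measurePreserving_polar.map_eq]; exact hf.1
  rw [h1, integral_prod_symm _ (integrable_polar hf), integral_radM]

lemma integrable_σ_of_continuousOn {f : Space → F}
    (hf : ContinuousOn f 𝕊) : Integrable f σ := by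
  unfold σ
  rw [measurableEmbedding_sphere.integrable_map_iff]
  have h : Continuous (f ∘ ((↑) : 𝕊 → Space)) :=
    continuousOn_iff_continuous_domRestrict.1 hf
  haveI : CompactSpace 𝕊 :=
    isCompact_iff_compactSpace.1 (isCompact_sphere _ _)
  exact h.integrable_of_hasCompactSupport (HasCompactSupport.of_compactSpace _)

end

section

variable {h F : SC} {i j : Fin 3} {x : Space}

/-! ### Rotations and integration by parts on the sphere -/

/-- The infinitesimal rotation in the plane of the axes `i`, `j`. -/
def rotGen (i j : Fin 3) : Space →L[ℝ] Space :=
  (EuclideanSpace.proj i : Space →L[ℝ] ℝ).smulRight (single j 1)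
    - (EuclideanSpace.proj j : Space →L[ℝ] ℝ).smulRight (single i 1)

lemma rotGen_apply (i j : Fin 3) (x : Space) : rotGen i j x = x i • single j 1 - x j • single i 1 := by
  simp [rotGen]

/-- The rotation by the angle `τ` in the plane of the axes `i`, `j`, as a linear map. -/
def rotMap (i j : Fin 3) (τ : ℝ) : Space →ₗ[ℝ] Space :=
  LinearMap.id + ((EuclideanSpace.proj i : Space →L[ℝ] ℝ) : Space →ₗ[ℝ] ℝ).smulRight
      ((Real.cos τ - 1) • single i 1 + Real.sin τ • single j 1)
    + ((EuclideanSpace.proj j : Space →L[ℝ] ℝ) : Space →ₗ[ℝ] ℝ).smulRight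
      ((Real.cos τ - 1) • single j 1 - Real.sin τ • single i 1)

lemma rotMap_apply (i j : Fin 3) (τ : ℝ) (x : Space) : rotMap i j τ x = x
    + x i • ((Real.cos τ - 1) • single i 1 + Real.sin τ • single j 1)
    + x j • ((Real.cos τ - 1) • single j 1 - Real.sin τ • single i 1) := by
  simp [rotMap]

lemma norm_rotMap (hij : i ≠ j) (τ : ℝ) (x : Space) : ‖rotMap i j τ x‖ = ‖x‖ := by
  have hc := Real.sin_sq_add_cos_sq τ
  rw [rotMap_apply, norm_eq, norm_eq]
  congr 1
  simp only [Fin.sum_univ_three, norm_eq_abs, sq_abs]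
  have key : ∀ a b c s : ℝ, s ^ 2 + c ^ 2 = 1 →
      (a + a * (c - 1) - b * s) ^ 2 + (b + a * s + b * (c - 1)) ^ 2 = a ^ 2 + b ^ 2 := by
    intro a b c s h
    linear_combination (a ^ 2 + b ^ 2) * h
  have h1 := key (x i) (x j) _ _ hc
  fin_cases i <;> fin_cases j <;> first | exact absurd rfl hij | (simp at h1 ⊢; linarith)

/-- The rotation by the angle `τ` in the plane of the axes `i`, `j`. -/
def rot {i j : Fin 3} (hij : i ≠ j) (τ : ℝ) : Space ≃ₗᵢ[ℝ] Space :=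
  LinearIsometry.toLinearIsometryEquiv ⟨rotMap i j τ, norm_rotMap hij τ⟩ rfl

lemma rot_apply (hij : i ≠ j) (τ : ℝ) (x : Space) : rot hij τ x = rotMap i j τ x := rfl

lemma rot_zero (hij : i ≠ j) (x : Space) : rot hij 0 x = x := by
  rw [rot_apply, rotMap_apply]; simp

lemma hasDerivAt_rot (hij : i ≠ j) (τ : ℝ) (x : Space) :
    HasDerivAt (fun τ => rot hij τ x) (rotGen i j (rot hij τ x)) τ := by
  have h1 : HasDerivAt (fun τ => rot hij τ x) (x i • ((-Real.sin τ) • single i 1 + Real.cos τ • single j 1)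
    + x j • ((-Real.sin τ) • single j 1 - Real.cos τ • single i (1 : ℝ))) τ := by
    simp only [rot_apply, rotMap_apply]
    have hc : HasDerivAt (fun τ => Real.cos τ - 1) (-Real.sin τ) τ :=
      (Real.hasDerivAt_cos τ).sub_const 1
    have hs := Real.hasDerivAt_sin τ
    exact ((((hc.smul_const _).add (hs.smul_const _)).const_smul (x i)).const_add x).add
      (((hc.smul_const _).sub (hs.smul_const _)).const_smul (x j))
  convert h1 using 1
  rw [rotGen_apply, rot_apply, rotMap_apply]
  ext k
  fin_cases i <;> fin_cases j <;> first | exact absurd rfl hij | (fin_cases k <;> simp <;> ring)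

/-- The derivative along an infinitesimal rotation. -/
def lder (i j : Fin 3) (F : SC) (x : Space) : ℂ := fderiv ℝ F x (rotGen i j x)

lemma contDiffOn_lder (hF : Sm₀ F) (i j : Fin 3) : Sm₀ (lder i j F) :=
  (hF.fderiv_of_isOpen isOpen_compl_singleton (m := ∞) (by simp)).clm_apply (rotGen i j).contDiff.contDiffOn

lemma diffAt {G : Type*} [NormedAddCommGroup G] [NormedSpace ℝ G]
    {F : Space → G} (hF : Sm₀ F)
    (hx : x ≠ 0) : DifferentiableAt ℝ F x :=
  (hF.contDiffAt (isOpen_compl_singleton.mem_nhds hx)).differentiableAt (by simp)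

lemma lder_mul {G : SC} (hF : DifferentiableAt ℝ F x)
    (hG : DifferentiableAt ℝ G x) (i j : Fin 3) :
    lder i j (fun x => F x * G x) x = lder i j F x * G x + F x * lder i j G x := by
  unfold lder
  rw [fderiv_fun_mul hF hG]
  simp
  ring

lemma sphere_subset : 𝕊 ⊆ {0}ᶜ := by
  intro x hx h
  rw [Set.mem_singleton_iff.1 h] at hx
  simp at hx

lemma integrable_sphere (hF : Sm₀ F) : Integrable F σ :=
  integrable_σ_of_continuousOn (hF.continuousOn.mono sphere_subset)

lemma exists_bound_sphere (hF : Sm₀ F) : ∃ C, 0 ≤ C ∧ ∀ x, ‖x‖ = 1 → ‖F x‖ ≤ C := by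
  obtain ⟨C, hC⟩ := (isCompact_sphere (0 : Space) 1).exists_bound_of_continuousOn (hF.continuousOn.mono sphere_subset)
  exact ⟨max C 0, le_max_right _ _, fun x hx => (hC x (by simpa using hx)).trans (le_max_left _ _)⟩

lemma integral_lder (hF : Sm₀ F) (i j : Fin 3) :
    ∫ w, lder i j F w ∂σ = 0 := by
  by_cases hij : i = j
  · subst hij
    have : ∀ w, lder i i F w = 0 := fun w => by simp [lder, rotGen_apply]
    simp [this]
  obtain ⟨C, -, hC⟩ := exists_bound_sphere (contDiffOn_lder hF i j)
  have hinv : ∀ τ, ∫ w, F (rot hij τ w) ∂σ = ∫ w, F w ∂σ := fun τ =>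
    (measurePreserving_linearIsometryEquiv_σ (rot hij τ)).integral_comp
      (rot hij τ).toHomeomorph.measurableEmbedding F
  have hint : ∀ τ, Integrable (fun w => F (rot hij τ w)) σ := fun τ =>
    (measurePreserving_linearIsometryEquiv_σ
      (rot hij τ)).integrable_comp_of_integrable (integrable_sphere hF)
  have h := hasDerivAt_integral_of_dominated_loc_of_deriv_le (μ := σ) (x₀ := (0 : ℝ))
    (F := fun τ w => F (rot hij τ w)) (F' := fun τ w => lder i j F (rot hij τ w))
    (bound := fun _ => C) univ_mem (Eventually.of_forall fun τ => (hint τ).1) (hint 0)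
    ?_ ?_ (integrable_const C) ?_
  · have h2 : HasDerivAt (fun τ => ∫ w, F (rot hij τ w) ∂σ) 0 0 := by
      simp only [hinv]; exact hasDerivAt_const _ _
    have h3 := h.2.unique h2
    simpa only [rot_zero] using h3
  · simp only [rot_zero]
    exact (integrable_sphere (contDiffOn_lder hF i j)).1
  · filter_upwards [ae_σ] with w hw τ _
    exact hC _ (by rw [LinearIsometryEquiv.norm_map, hw])
  · filter_upwards [ae_σ] with w hw τ _
    have hne : rot hij τ w ≠ 0 := by
      rw [← norm_ne_zero_iff, LinearIsometryEquiv.norm_map, hw]; exact one_ne_zero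
    exact ((diffAt hF hne).hasFDerivAt.comp_hasDerivAt τ (hasDerivAt_rot hij τ w))

/-! ### Oscillatory integrals over the sphere -/

/-- The phase factor `e^{i λ w·d}`. -/
def phase (d : Space) (l : ℝ) (w : Space) : ℂ :=
  exp (I * ((l * ⟪w,d⟫ : ℝ) : ℂ))

lemma norm_phase (d : Space) (l : ℝ) (w : Space) : ‖phase d l w‖ = 1 := by
  unfold phase; rw [mul_comm]; exact norm_exp_ofReal_mul_I _

lemma contDiff_phase (d : Space) (l : ℝ) : C∞ (phase d l) := by
  unfold phase
  have : C∞ fun w : Space => (l * ⟪w,d⟫ : ℝ) :=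
    contDiff_const.mul (contDiff_id.inner ℝ contDiff_const)
  exact (contDiff_const.mul (ofRealCLM.contDiff.comp this)).cexp

/-- The linear function `w·d` with complex values. -/
def crd (d : Space) (w : Space) : ℂ := (⟪w,d⟫ : ℂ)

lemma contDiff_crd (d : Space) : C∞ (crd d) :=
  ofRealCLM.contDiff.comp (contDiff_id.inner ℝ contDiff_const)

lemma hasFDerivAt_crd (d x : Space) : HasFDerivAt (crd d) (ofRealCLM.comp (innerSL ℝ d)) x := by
  have h : crd d = fun w => (ofRealCLM.comp (innerSL ℝ d)) w := by
    ext w; simp [crd, real_inner_comm]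
  rw [h]
  exact (ofRealCLM.comp (innerSL ℝ d)).hasFDerivAt

lemma lder_crd (d : Space) (i j : Fin 3) (x : Space) :
    lder i j (crd d) x = ((x i * d j - x j * d i : ℝ) : ℂ) := by
  unfold lder
  rw [(hasFDerivAt_crd d x).fderiv, rotGen_apply]
  simp [inner_single_right, inner_sub_right, inner_smul_right]

lemma lder_lder_crd (d : Space) (hij : i ≠ j) (x : Space) :
    lder i j (lder i j (crd d)) x = ((-(x i * d i + x j * d j) : ℝ) : ℂ) := by
  have h : lder i j (crd d) = fun w => (ofRealCLM.comp (d j • (EuclideanSpace.proj i : Space →L[ℝ] ℝ)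
        - d i • (EuclideanSpace.proj j : Space →L[ℝ] ℝ))) w := by
    ext w; rw [lder_crd]; simp; ring
  rw [h]
  unfold lder
  rw [ContinuousLinearMap.fderiv, rotGen_apply]
  simp [hij, hij.symm]
  ring

lemma hasFDerivAt_phase (d : Space) (l : ℝ) (x : Space) : HasFDerivAt (phase d l)
      ((I * l * phase d l x) • (ofRealCLM.comp (innerSL ℝ d))) x := by
  have h : phase d l = fun w => exp (I * l * crd d w) := by
    ext w; simp only [phase, crd]; congr 1; push_cast; ring
  rw [h]
  have h1 := ((hasFDerivAt_crd d x).const_mul (I * l)).cexp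
  refine h1.congr_fderiv ?_
  rw [smul_smul]
  congr 1
  ring

lemma lder_phase (d : Space) (l : ℝ) (i j : Fin 3) (x : Space) :
    lder i j (phase d l) x = I * l * lder i j (crd d) x * phase d l x := by
  unfold lder
  rw [(hasFDerivAt_phase d l x).fderiv, (hasFDerivAt_crd d x).fderiv]
  simp
  ring

/-- The oscillatory integral `∫ h(w) e^{i λ w·d} dΩ`. -/
def osc (h : SC) (d : Space) (l : ℝ) : ℂ := ∫ w, h w * phase d l w ∂σ

lemma norm_osc_le (hh : Sm₀ h) : ∃ C, 0 ≤ C ∧ ∀ d l, ‖osc h d l‖ ≤ C := by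
  obtain ⟨C, hC0, hC⟩ := exists_bound_sphere hh
  refine ⟨C * σ.real Set.univ, by positivity, fun d l => ?_⟩
  refine norm_integral_le_of_norm_le_const ?_
  filter_upwards [ae_σ] with w hw
  rw [norm_mul, norm_phase, mul_one]
  exact hC w hw

lemma integrable_mul_phase (hh : Sm₀ h) (d : Space) (l : ℝ) :
    Integrable (fun w => h w * phase d l w) σ :=
  integrable_sphere (hh.mul (contDiff_phase d l).contDiffOn)

lemma hasDerivAt_osc (hh : Sm₀ h) (d : Space) (l : ℝ) :
    HasDerivAt (osc h d) (I * osc (fun w => crd d w * h w) d l) l := by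
  have hu : Sm₀ (fun w => crd d w * h w) :=
    (contDiff_crd d).contDiffOn.mul hh
  obtain ⟨C, -, hC⟩ := exists_bound_sphere hu
  have h1 := hasDerivAt_integral_of_dominated_loc_of_deriv_le (μ := σ) (x₀ := l)
    (F := fun l w => h w * phase d l w)
    (F' := fun l w => I * ((crd d w * h w) * phase d l w))
    (bound := fun _ => C) univ_mem
    (Eventually.of_forall fun τ => (integrable_mul_phase hh d τ).1) (integrable_mul_phase hh d l)
    ((integrable_mul_phase hu d l).const_mul _).1 ?_ (integrable_const C) ?_
  · have h2 := h1.2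
    rw [integral_const_mul] at h2
    exact h2
  · filter_upwards [ae_σ] with w hw τ _
    rw [norm_mul, norm_mul, norm_phase, mul_one, norm_I, one_mul]
    exact hC w hw
  · refine Eventually.of_forall fun w τ _ => ?_
    have h3 : HasDerivAt (fun l : ℝ => phase d l w) (phase d τ w * (I * crd d w)) τ := by
      unfold phase crd
      have h4 : HasDerivAt (fun l : ℝ => ((l * ⟪w,d⟫ : ℝ) : ℂ)) (⟪w,d⟫ : ℂ) τ := by
        have := ((hasDerivAt_id τ).mul_const ⟪w,d⟫).ofReal_comp
        simpa using this
      exact (h4.const_mul I).cexp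
    exact (h3.const_mul (h w)).congr_deriv (by ring)

lemma osc_lder {p : SC} (hp : Sm₀ p) (d : Space) (l : ℝ) (i j : Fin 3) :
    osc (lder i j p) d l = -(I * l) * osc (fun w => lder i j (crd d) w * p w) d l := by
  have hl : Sm₀ (fun w => lder i j (crd d) w * p w) :=
    (contDiffOn_lder (contDiff_crd d).contDiffOn i j).mul hp
  have h0 := integral_lder (hp.mul (contDiff_phase d l).contDiffOn) i j
  have h1 : ∫ w, lder i j (fun x => p x * phase d l x) w ∂σ = ∫ w, (lder i j p w * phase d l w
        + I * l * ((lder i j (crd d) w * p w) * phase d l w)) ∂σ := by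
    refine integral_congr_ae ?_
    filter_upwards [ae_σ] with w hw
    have hne : w ≠ 0 := by rw [← norm_ne_zero_iff, hw]; exact one_ne_zero
    rw [lder_mul (diffAt hp hne) ((contDiff_phase d l).differentiable (by simp) w), lder_phase]
    ring
  have h2 : ∫ w, lder i j (fun x => p x * phase d l x) w ∂σ = 0 := h0
  rw [h1, integral_add (integrable_mul_phase (contDiffOn_lder hp i j) d l)
    ((integrable_mul_phase hl d l).const_mul _), integral_const_mul] at h2
  unfold osc
  linear_combination h2

/-- Twice the Laplace operator of the sphere. -/
def sphLap (h : SC) (x : Space) : ℂ := ∑ i, ∑ j, lder i j (lder i j h) x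

lemma contDiffOn_sphLap (hh : Sm₀ h) : Sm₀ (sphLap h) :=
  ContDiffOn.sum fun i _ => ContDiffOn.sum fun j _ => contDiffOn_lder (contDiffOn_lder hh i j) i j

lemma osc_sum {ι : Type*} (s : Finset ι) {h : ι → SC}
    (hh : ∀ i ∈ s, Sm₀ (h i)) (d : Space) (l : ℝ) :
    osc (fun w => ∑ i ∈ s, h i w) d l = ∑ i ∈ s, osc (h i) d l := by
  unfold osc
  simp only [sum_mul]
  exact integral_finsetSum _ fun i hi => integrable_mul_phase (hh i hi) d l

lemma osc_congr {h' : SC} (hh : ∀ w, ‖w‖ = 1 → h w = h' w) (d : Space) (l : ℝ) : osc h d l = osc h' d l := by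
  refine integral_congr_ae ?_
  filter_upwards [ae_σ] with w hw
  rw [hh w hw]

lemma osc_add {h' : SC} (hh : Sm₀ h) (hh' : Sm₀ h')
    (d : Space) (l : ℝ) : osc (fun w => h w + h' w) d l = osc h d l + osc h' d l := by
  unfold osc
  simp only [add_mul]
  exact integral_add (integrable_mul_phase hh d l) (integrable_mul_phase hh' d l)

lemma osc_const_mul (c : ℂ) (h : SC) (d : Space) (l : ℝ) : osc (fun w => c * h w) d l = c * osc h d l := by
  unfold osc
  simp only [mul_assoc]
  exact integral_const_mul _ _

lemma osc_lap_pair (hh : Sm₀ h) (d : Space) (l : ℝ) (i j : Fin 3) :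
    osc (lder i j (lder i j h)) d l = -(I * l) *
      (-(I * l) * osc (fun w => lder i j (crd d) w * (lder i j (crd d) w * h w)) d l
        - osc (fun w => lder i j (lder i j (crd d)) w * h w) d l) := by
  have hc := contDiffOn_lder (contDiff_crd d).contDiffOn i j
  have hch : Sm₀ (fun w => lder i j (crd d) w * h w) := hc.mul hh
  rw [osc_lder (contDiffOn_lder hh i j)]
  congr 1
  have h1 := osc_lder hch d l i j
  have h2 : osc (lder i j (fun w => lder i j (crd d) w * h w)) d l
      = osc (fun w => lder i j (lder i j (crd d)) w * h w + lder i j (crd d) w * lder i j h w) d l := by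
    refine osc_congr (fun w hw => ?_) d l
    have hne : w ≠ 0 := by rw [← norm_ne_zero_iff, hw]; exact one_ne_zero
    exact lder_mul (diffAt hc hne) (diffAt hh hne) i j
  rw [h2, osc_add ((contDiffOn_lder hc i j).mul hh) (hc.mul (contDiffOn_lder hh i j))] at h1
  linear_combination h1

lemma osc_ode (hh : Sm₀ h) {d : Space} (hd : ‖d‖ = 1) (l : ℝ) :
    (l : ℂ) ^ 2 * (osc h d l - osc (fun w => crd d w * (crd d w * h w)) d l)
      + 2 * l * (I * osc (fun w => crd d w * h w) d l)
      = -(1 / 2) * osc (sphLap h) d l := by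
  have hu : Sm₀ (fun w => crd d w * h w) :=
    (contDiff_crd d).contDiffOn.mul hh
  have huu : Sm₀ (fun w => crd d w * (crd d w * h w)) :=
    (contDiff_crd d).contDiffOn.mul hu
  have hc := fun i j => contDiffOn_lder (contDiff_crd d).contDiffOn i j (F := crd d)
  have hA : ∑ i, ∑ j, osc (fun w => lder i j (crd d) w * (lder i j (crd d) w * h w)) d l
      = 2 * (osc h d l - osc (fun w => crd d w * (crd d w * h w)) d l) := by
    simp_rw [← osc_sum univ fun j _ => (hc _ j).mul ((hc _ j).mul hh)]
    rw [← osc_sum univ fun i _ => ContDiffOn.sum fun j _ => (hc i j).mul ((hc i j).mul hh)]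
    have : osc h d l - osc (fun w => crd d w * (crd d w * h w)) d l
        = osc (fun w => h w + (-1) * (crd d w * (crd d w * h w))) d l := by
      rw [osc_add hh (contDiffOn_const.mul huu), osc_const_mul]; ring
    rw [this, ← osc_const_mul]
    refine osc_congr (fun w hw => ?_) d l
    have h1 : ∑ i : Fin 3, w i ^ 2 = 1 := by
      have := norm_sq_eq w; rw [hw] at this; simpa using this.symm
    have h2 : ∑ i : Fin 3, d i ^ 2 = 1 := by
      have := norm_sq_eq d; rw [hd] at this; simpa using this.symm
    simp only [lder_crd, crd]
    have h3 : ⟪w,d⟫ = ∑ i : Fin 3, w i * d i := by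
      simp [PiLp.inner_apply, mul_comm]
    rw [h3]
    simp only [Fin.sum_univ_three] at h1 h2 ⊢
    have h4 : ((w 0 ^ 2 + w 1 ^ 2 + w 2 ^ 2 : ℝ) : ℂ) * ((d 0 ^ 2 + d 1 ^ 2 + d 2 ^ 2 : ℝ) : ℂ) = 1 := by
      rw [h1, h2]; simp
    push_cast at h4 ⊢
    linear_combination (2 * h w) * h4
  have hB : ∑ i, ∑ j, osc (fun w => lder i j (lder i j (crd d)) w * h w) d l
      = -4 * osc (fun w => crd d w * h w) d l := by
    have hcc := fun i j => contDiffOn_lder (hc i j) i j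
    simp_rw [← osc_sum univ fun j _ => (hcc _ j).mul hh]
    rw [← osc_sum univ fun i _ => ContDiffOn.sum fun j _ => (hcc i j).mul hh, ← osc_const_mul]
    refine osc_congr (fun w _ => ?_) d l
    have h0 : ∀ i, lder i i (lder i i (crd d)) w = 0 := fun i => by simp [lder, rotGen_apply]
    have h3 : ⟪w,d⟫ = ∑ i : Fin 3, w i * d i := by
      simp [PiLp.inner_apply, mul_comm]
    simp only [Fin.sum_univ_three, h0, crd, h3]
    rw [lder_lder_crd d (by decide), lder_lder_crd d (by decide),
      lder_lder_crd d (by decide), lder_lder_crd d (by decide),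
      lder_lder_crd d (by decide), lder_lder_crd d (by decide)]
    push_cast
    ring
  have hS : osc (sphLap h) d l = ∑ i, ∑ j, osc (lder i j (lder i j h)) d l := by
    have hcc := fun i j => contDiffOn_lder (contDiffOn_lder hh i j) i j
    simp_rw [← osc_sum univ fun j _ => hcc _ j]
    rw [← osc_sum univ fun i _ => ContDiffOn.sum fun j _ => hcc i j]
    rfl
  simp_rw [osc_lap_pair hh] at hS
  simp_rw [← mul_sum, Finset.sum_sub_distrib, ← mul_sum] at hS
  rw [hA, hB] at hS
  rw [hS]
  linear_combination ((l : ℂ) ^ 2 * (osc h d l - osc (fun w => crd d w * (crd d w * h w)) d l)) * I_sq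
  

end

section

variable {h : SC} {d : Space}

/-! ### Decay of the oscillatory integrals -/

lemma norm_le_of_norm_deriv_le {f f' : ℝ → ℂ} {B B' : ℝ → ℝ} {a b : ℝ} (hab : a ≤ b)
    (hf : ∀ x, a ≤ x → HasDerivAt f (f' x) x) (hB : ∀ x, a ≤ x → HasDerivAt B (B' x) x)
    (ha : ‖f a‖ ≤ B a) (h : ∀ x, a ≤ x → ‖f' x‖ ≤ B' x) : ‖f b‖ ≤ B b :=
  image_norm_le_of_norm_deriv_right_le_deriv_boundary' (fun x hx => (hf x hx.1).continuousAt.continuousWithinAt)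
    (fun x hx => (hf x hx.1).hasDerivWithinAt) ha
    (fun x hx => (hB x hx.1).continuousAt.continuousWithinAt)
    (fun x hx => (hB x hx.1).hasDerivWithinAt) (fun x hx => h x hx.1) ⟨hab, le_rfl⟩

lemma forced_oscillator_bound {K K1 K2 : ℝ → ℂ} {B B' : ℝ → ℝ}
    (hK : ∀ x, HasDerivAt K (K1 x) x) (hK1 : ∀ x, HasDerivAt K1 (K2 x) x)
    (hB : ∀ x, 1 ≤ x → HasDerivAt B (B' x) x) (hr : ∀ x, 1 ≤ x → ‖K2 x + K x‖ ≤ B' x) :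
    ∃ C, ∀ x, 1 ≤ x → ‖K x‖ ≤ C + B x ∧ ‖K1 x‖ ≤ C + B x := by
  have key : ∀ s : ℂ, s ^ 2 = -1 → ‖s‖ = 1 → (∀ x : ℝ, ‖exp (-s * x)‖ = 1) →
      ∀ x, 1 ≤ x → ‖K1 x + s * K x‖ ≤ (‖K1 1 + s * K 1‖ - B 1) + B x := by
    intro s hs hs1 he x hx
    have h1 : ‖exp (-s * x) * (K1 x + s * K x)‖ ≤ (‖K1 1 + s * K 1‖ - B 1) + B x := by
      refine norm_le_of_norm_deriv_le (B := fun x => (‖K1 1 + s * K 1‖ - B 1) + B x) (B' := B')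
        (f := fun x : ℝ => exp (-s * x) * (K1 x + s * K x))
        (f' := fun x : ℝ => exp (-s * x) * (K2 x + K x)) hx (fun y _ => ?_)
        (fun y hy => (hB y hy).const_add _) ?_ (fun y hy => ?_)
      · have h2 : HasDerivAt (fun x : ℝ => exp (-s * x)) (exp (-s * y) * (-s * 1)) y :=
          (((hasDerivAt_id (y : ℂ)).const_mul (-s)).cexp).comp_ofReal
        refine (h2.mul ((hK1 y).add ((hK y).const_mul s))).congr_deriv ?_
        simp only [Pi.add_apply]
        linear_combination (-(exp (-s * y) * K y)) * hs
      · rw [norm_mul, he]; simp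
      · rw [norm_mul, he, one_mul]; exact hr y hy
    rwa [norm_mul, he, one_mul] at h1
  have hp := key I I_sq norm_I fun x => by
    rw [show -I * (x : ℂ) = ((-x : ℝ) : ℂ) * I by push_cast; ring]
    exact norm_exp_ofReal_mul_I _
  have hm := key (-I) (by rw [neg_sq, I_sq]) (by simp) fun x => by
    rw [show -(-I) * (x : ℂ) = (x : ℂ) * I by ring]
    exact norm_exp_ofReal_mul_I _
  refine ⟨max (‖K1 1 + I * K 1‖ - B 1) (‖K1 1 + -I * K 1‖ - B 1), fun x hx => ?_⟩
  have h1 := (hp x hx).trans (add_le_add_left (le_max_left _ (‖K1 1 + -I * K 1‖ - B 1)) _)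
  have h2 := (hm x hx).trans (add_le_add_left (le_max_right (‖K1 1 + I * K 1‖ - B 1) _) _)
  constructor
  · have h3 : 2 * ‖K x‖ = ‖(K1 x + I * K x) - (K1 x + -I * K x)‖ := by
      rw [show (K1 x + I * K x) - (K1 x + -I * K x) = (2 * I) * K x by ring]
      simp
    have h4 := norm_sub_le (K1 x + I * K x) (K1 x + -I * K x)
    linarith
  · have h3 : 2 * ‖K1 x‖ = ‖(K1 x + I * K x) + (K1 x + -I * K x)‖ := by
      rw [show (K1 x + I * K x) + (K1 x + -I * K x) = 2 * K1 x by ring]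
      simp
    have h4 := norm_add_le (K1 x + I * K x) (K1 x + -I * K x)
    linarith

/-- `λ J(λ)`. -/
def oscK (h : SC) (d : Space) (l : ℝ) : ℂ := l * osc h d l

/-- The derivative of `λ J(λ)`. -/
def oscK' (h : SC) (d : Space) (l : ℝ) : ℂ :=
  osc h d l + l * (I * osc (fun w => crd d w * h w) d l)

/-- The second derivative of `λ J(λ)`. -/
def oscK'' (h : SC) (d : Space) (l : ℝ) : ℂ :=
  2 * (I * osc (fun w => crd d w * h w) d l) - l * osc (fun w => crd d w * (crd d w * h w)) d l

lemma hasDerivAt_oscK (hh : Sm₀ h) (d : Space) (l : ℝ) :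
    HasDerivAt (oscK h d) (oscK' h d l) l := by
  have h1 := (hasDerivAt_id l).ofReal_comp.mul (hasDerivAt_osc hh d l)
  refine h1.congr_deriv ?_
  simp [oscK']

lemma hasDerivAt_oscK' (hh : Sm₀ h) (d : Space) (l : ℝ) :
    HasDerivAt (oscK' h d) (oscK'' h d l) l := by
  have hu : Sm₀ (fun w => crd d w * h w) :=
    (contDiff_crd d).contDiffOn.mul hh
  have h1 := (hasDerivAt_osc hh d l).add ((hasDerivAt_id l).ofReal_comp.mul ((hasDerivAt_osc hu d l).const_mul I))
  refine h1.congr_deriv ?_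
  simp only [oscK'', ofReal_one, id]
  linear_combination (l * osc (fun w => crd d w * (crd d w * h w)) d l) * I_sq

lemma oscK_ode (hh : Sm₀ h) (hd : ‖d‖ = 1)
    {l : ℝ} (hl : 0 < l) : oscK'' h d l + oscK h d l = -(1 / (2 * l)) * osc (sphLap h) d l := by
  have h1 := osc_ode hh hd l
  have hl' : (l : ℂ) ≠ 0 := by exact_mod_cast hl.ne'
  have h2 : (l : ℂ) * (oscK'' h d l + oscK h d l) = l * (-(1 / (2 * l)) * osc (sphLap h) d l) := by
    unfold oscK oscK''
    rw [show (l : ℂ) * (-(1 / (2 * l)) * osc (sphLap h) d l) = -(1 / 2) * osc (sphLap h) d l by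
      field_simp]
    rw [← h1]
    ring
  exact mul_left_cancel₀ hl' h2

lemma norm_oscK_add (hh : Sm₀ h) (hd : ‖d‖ = 1)
    {l : ℝ} (hl : 0 < l) : ‖oscK'' h d l + oscK h d l‖ = 1 / (2 * l) * ‖osc (sphLap h) d l‖ := by
  rw [oscK_ode hh hd hl, norm_mul, norm_neg, norm_div, norm_mul]
  simp [abs_of_pos hl]

lemma oscK_sqrt_bound (hh : Sm₀ h) (hd : ‖d‖ = 1) :
    ∃ C, 0 ≤ C ∧ ∀ l, 1 ≤ l → ‖oscK h d l‖ ≤ C * Real.sqrt l := by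
  obtain ⟨C, hC0, hC⟩ := norm_osc_le (contDiffOn_sphLap hh)
  obtain ⟨D, hD⟩ := forced_oscillator_bound (hasDerivAt_oscK hh d) (hasDerivAt_oscK' hh d)
    (B := fun x => C * Real.sqrt x) (B' := fun x => C * (1 / (2 * Real.sqrt x)))
    (fun x hx => (Real.hasDerivAt_sqrt (by positivity)).const_mul C) (fun x hx => by
      have hx0 : 0 < x := by linarith
      rw [norm_oscK_add hh hd hx0, mul_comm]
      gcongr
      · exact hC d x
      · rw [Real.sqrt_le_left hx0.le]; nlinarith)
  refine ⟨|D| + C, by positivity, fun l hl => (hD l hl).1.trans ?_⟩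
  have h1 : 1 ≤ Real.sqrt l := Real.one_le_sqrt.2 hl
  nlinarith [le_abs_self D, abs_nonneg D]

lemma oscK_bound (hh : Sm₀ h) (hd : ‖d‖ = 1) :
    ∃ C, 0 ≤ C ∧ ∀ l, 1 ≤ l → ‖oscK h d l‖ ≤ C ∧ ‖oscK' h d l‖ ≤ C := by
  obtain ⟨C, hC0, hC⟩ := oscK_sqrt_bound (contDiffOn_sphLap hh) hd
  obtain ⟨D, hD⟩ := forced_oscillator_bound (hasDerivAt_oscK hh d) (hasDerivAt_oscK' hh d)
    (B := fun x => -C * (Real.sqrt x)⁻¹)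
    (B' := fun x => -C * (-(1 / (2 * Real.sqrt x)) / Real.sqrt x ^ 2))
    (fun x hx => ((Real.hasDerivAt_sqrt (by positivity)).inv
      (Real.sqrt_ne_zero'.2 (by linarith))).const_mul (-C)) (fun x hx => by
      have hx0 : 0 < x := by linarith
      rw [norm_oscK_add hh hd hx0]
      have h2 := hC x hx
      unfold oscK at h2
      rw [norm_mul, Complex.norm_of_nonneg hx0.le] at h2
      have hs : 0 < Real.sqrt x := sqrt_pos.2 hx0
      have hsx := sq_sqrt hx0.le
      rw [show -C * (-(1 / (2 * Real.sqrt x)) / Real.sqrt x ^ 2) = 1 / (2 * x) * (C * Real.sqrt x / x) by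
          rw [hsx]; field_simp; rw [hsx]]
      gcongr
      rw [le_div_iff₀ hx0, mul_comm]; exact h2)
  refine ⟨|D|, by positivity, fun l hl => ?_⟩
  have h1 : 0 ≤ C * (Real.sqrt l)⁻¹ := by positivity
  have := hD l hl
  constructor <;> nlinarith [le_abs_self D]

lemma continuous_osc (hh : Sm₀ h) (d : Space) : Continuous (osc h d) :=
  continuous_iff_continuousAt.2 fun l => (hasDerivAt_osc hh d l).continuousAt

lemma osc_decay_of_norm_eq_one (hh : Sm₀ h)
    (hd : ‖d‖ = 1) : ∃ C, 0 ≤ C ∧ ∀ l, 1 ≤ l → ‖osc h d l‖ ≤ C / l := by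
  obtain ⟨C, hC0, hC⟩ := oscK_bound hh hd
  refine ⟨C, hC0, fun l hl => ?_⟩
  have hl0 : 0 < l := by linarith
  have := (hC l hl).1
  unfold oscK at this
  rw [norm_mul, Complex.norm_of_nonneg hl0.le] at this
  rw [le_div_iff₀ hl0, mul_comm]; exact this

lemma integral_osc_of_norm_eq_one (hh : Sm₀ h)
    (hd : ‖d‖ = 1) : ∃ C, 0 ≤ C ∧ ∀ a b, 1 ≤ a → a ≤ b → ‖∫ l in a..b, osc h d l‖ ≤ C / a := by
  obtain ⟨C, hC0, hC⟩ := oscK_bound hh hd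
  obtain ⟨D, hD0, hD⟩ := osc_decay_of_norm_eq_one (contDiffOn_sphLap hh) hd
  refine ⟨D + 2 * C + 4 * C, by positivity, fun a b ha hab => ?_⟩
  have ha0 : 0 < a := by linarith
  set Y : ℝ → ℂ := fun l => oscK' h d l / l + oscK h d l / l ^ 2 with hY
  have hYb : ∀ l, a ≤ l → ‖Y l‖ ≤ 2 * C / a := by
    intro l hl
    have hl0 : 0 < l := by linarith
    have h1 := hC l (by linarith)
    calc ‖Y l‖ ≤ ‖oscK' h d l‖ / l + ‖oscK h d l‖ / l ^ 2 := by
          refine (norm_add_le _ _).trans (le_of_eq ?_)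
          simp [abs_of_pos hl0]
      _ ≤ C / a + C / a := by
          gcongr
          · exact h1.2
          · exact h1.1
          · nlinarith
      _ = 2 * C / a := by ring
  have h1 : ‖(∫ l in a..b, osc h d l) + (Y b - Y a)‖ ≤ (D + 2 * C) * (a⁻¹ - b⁻¹) := by
    refine norm_le_of_norm_deriv_le (f := fun t => (∫ l in a..t, osc h d l) + (Y t - Y a))
      (f' := fun l => (oscK'' h d l + oscK h d l) / l - 2 * oscK h d l / l ^ 3)
      (B := fun t => (D + 2 * C) * (a⁻¹ - t⁻¹)) (B' := fun t => (D + 2 * C) * (0 - -(t ^ 2)⁻¹))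
      hab (fun x hx => ?_) (fun x hx => ?_) ?_ (fun x hx => ?_)
    · have hx0 : 0 < x := by linarith
      have hxc : (x : ℂ) ≠ 0 := by exact_mod_cast hx0.ne'
      have e1 : HasDerivAt (fun t => ∫ l in a..t, osc h d l) (osc h d x) x :=
        intervalIntegral.integral_hasDerivAt_right ((continuous_osc hh d).intervalIntegrable _ _)
          (continuous_osc hh d).stronglyMeasurable.stronglyMeasurableAtFilter
          (continuous_osc hh d).continuousAt
      have ex := (hasDerivAt_id x).ofReal_comp
      have e2 := ((hasDerivAt_oscK' hh d x).div ex hxc).add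
        ((hasDerivAt_oscK hh d x).div (ex.pow 2) (pow_ne_zero 2 hxc))
      refine (e1.add (e2.sub_const (Y a))).congr_deriv ?_
      simp only [id, ofReal_one, Pi.pow_apply]
      unfold oscK
      field_simp
      ring
    · exact ((hasDerivAt_inv (by linarith : x ≠ 0)).const_sub a⁻¹).const_mul _ |>.congr_deriv (by ring)
    · simp
    · have hx0 : 0 < x := by linarith
      have hx1 : 1 ≤ x := by linarith
      calc ‖(oscK'' h d x + oscK h d x) / x - 2 * oscK h d x / x ^ 3‖
          ≤ ‖oscK'' h d x + oscK h d x‖ / x + 2 * ‖oscK h d x‖ / x ^ 3 := by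
            refine (norm_sub_le _ _).trans (le_of_eq ?_)
            simp [abs_of_pos hx0]
        _ ≤ D / x ^ 2 + 2 * C / x ^ 2 := by
            rw [norm_oscK_add hh hd hx0]
            have h2 := hD x hx1
            have h3 : 1 / (2 * x) * ‖osc (sphLap h) d x‖ / x ≤ 1 / (2 * x) * (D / x) / x := by gcongr
            have h4 : 1 / (2 * x) * (D / x) / x ≤ D / x ^ 2 := by
              rw [show 1 / (2 * x) * (D / x) / x = (D / x ^ 2) * (1 / (2 * x)) by field_simp]
              refine mul_le_of_le_one_right (by positivity) ?_
              rw [div_le_one (by positivity)]; linarith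
            have h5 : 2 * ‖oscK h d x‖ / x ^ 3 ≤ 2 * C / x ^ 2 := by
              gcongr
              · exact (hC x hx1).1
              · norm_num
            linarith
        _ = (D + 2 * C) * (0 - -(x ^ 2)⁻¹) := by field_simp; ring
  have h2 : (∫ l in a..b, osc h d l) = ((∫ l in a..b, osc h d l) + (Y b - Y a)) - (Y b - Y a) := by
    ring
  rw [h2]
  refine (norm_sub_le _ _).trans ?_
  have h3 := norm_sub_le (Y b) (Y a)
  have h4 : (D + 2 * C) * (a⁻¹ - b⁻¹) ≤ (D + 2 * C) * a⁻¹ := by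
    gcongr
    have : 0 < b⁻¹ := inv_pos.2 (by linarith)
    linarith
  have h5 := hYb b hab
  have h6 := hYb a le_rfl
  calc _ ≤ (D + 2 * C) * a⁻¹ + (2 * C / a + 2 * C / a) := by linarith
    _ = _ := by field_simp; ring

lemma osc_smul (h : SC) (d : Space) (c l : ℝ) : osc h (c • d) l = osc h d (c * l) := by
  unfold osc phase
  simp only [inner_smul_right, ← mul_assoc, mul_comm c l]

lemma osc_decay (hh : Sm₀ h) (hd : d ≠ 0) :
    ∃ C, 0 ≤ C ∧ (∀ l, 0 < l → ‖osc h d l‖ ≤ C / l) ∧ ∀ a b, 1 ≤ a → a ≤ b → ‖∫ l in a..b, osc h d l‖ ≤ C / a := by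
  set c := ‖d‖ with hc
  have hc0 : 0 < c := norm_pos_iff.2 hd
  set e := c⁻¹ • d with he
  have he1 : ‖e‖ = 1 := by rw [he, norm_smul, norm_inv, norm_of_nonneg hc0.le, ← hc, inv_mul_cancel₀ hc0.ne']
  have hde : d = c • e := by rw [he, smul_smul, mul_inv_cancel₀ hc0.ne', one_smul]
  obtain ⟨A, hA0, hA⟩ := norm_osc_le hh
  obtain ⟨B, hB0, hB⟩ := osc_decay_of_norm_eq_one hh he1
  obtain ⟨D, hD0, hD⟩ := integral_osc_of_norm_eq_one hh he1
  have hdec : ∀ l, 0 < l → ‖osc h d l‖ ≤ (A + B) / c / l := by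
    intro l hl
    rw [hde, osc_smul, div_div]
    rcases le_total 1 (c * l) with h1 | h1
    · refine (hB _ h1).trans ?_
      gcongr; linarith
    · refine (hA e _).trans ?_
      rw [le_div_iff₀ (by positivity)]
      nlinarith
  have hlarge : ∀ a b, 1 ≤ c * a → a ≤ b → ‖∫ l in a..b, osc h d l‖ ≤ D / c ^ 2 / a := by
    intro a b ha hab
    have ha0 : 0 < a := pos_of_mul_pos_right (by linarith) hc0.le
    have h1 : ∫ l in a..b, osc h d l = c⁻¹ • ∫ l in (c * a)..(c * b), osc h e l := by
      rw [← intervalIntegral.integral_comp_mul_left _ hc0.ne']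
      rw [hde]; simp only [osc_smul]
    rw [h1, norm_smul, norm_of_nonneg (by positivity)]
    refine (mul_le_mul_of_nonneg_left (hD _ _ ha (by gcongr)) (by positivity)).trans (le_of_eq ?_)
    field_simp
  refine ⟨(A + B) / c + (A / c ^ 2 + D / c ^ 2) , by positivity, fun l hl => (hdec l hl).trans ?_, fun a b ha hab => ?_⟩
  · gcongr
    have : 0 ≤ A / c ^ 2 + D / c ^ 2 := by positivity
    linarith
  have ha0 : 0 < a := by linarith
  have hi : ∀ x y, IntervalIntegrable (osc h d) volume x y := fun x y =>
    (continuous_osc hh d).intervalIntegrable _ _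
  have hAB : 0 ≤ (A + B) / c := by positivity
  have hsmall : ∀ x, a ≤ x → x ≤ c⁻¹ → ‖∫ l in a..x, osc h d l‖ ≤ A / c ^ 2 / a := by
    intro x hax hxc
    have h1 := intervalIntegral.norm_integral_le_of_norm_le_const (f := osc h d) (C := A)
      (a := a) (b := x) fun l _ => hA d l
    refine h1.trans ?_
    rw [abs_of_nonneg (by linarith), le_div_iff₀ ha0, le_div_iff₀ (by positivity)]
    have hx1 : c * x ≤ 1 := by
      rw [← one_div, le_div_iff₀ hc0] at hxc; linarith
    have hca : c * a ≤ 1 := le_trans (by gcongr) hx1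
    have h3 : (x - a) * c ≤ 1 := by nlinarith
    calc A * (x - a) * a * c ^ 2 = A * (((x - a) * c) * (c * a)) := by ring
      _ ≤ A * (1 * 1) := by
          gcongr
      _ = A := by ring
  rcases le_total 1 (c * a) with h1 | h1
  · refine (hlarge a b h1 hab).trans ?_
    gcongr
    have : 0 ≤ A / c ^ 2 := by positivity
    linarith
  · have hac : a ≤ c⁻¹ := by rw [← one_div, le_div_iff₀ hc0]; linarith
    rcases le_total b c⁻¹ with h2 | h2
    · refine (hsmall b hab h2).trans ?_
      gcongr
      have : 0 ≤ D / c ^ 2 := by positivity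
      linarith
    · rw [← intervalIntegral.integral_add_adjacent_intervals (hi a c⁻¹) (hi c⁻¹ b)]
      refine (norm_add_le _ _).trans ?_
      have h3 := hsmall c⁻¹ hac le_rfl
      have h4 := hlarge c⁻¹ b (by rw [mul_inv_cancel₀ hc0.ne']) h2
      have h5 : D / c ^ 2 / c⁻¹ ≤ D / c ^ 2 / a := by gcongr
      calc _ ≤ A / c ^ 2 / a + D / c ^ 2 / a := by linarith
        _ = (0 + (A / c ^ 2 + D / c ^ 2)) / a := by ring
        _ ≤ _ := by gcongr

lemma osc_one (d : Space) (l : ℝ) :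
    (l * ‖d‖ : ℂ) * osc (fun _ => 1) d l = σ.real Set.univ * sin (l * ‖d‖) := by
  have key : ∀ e : Space, ‖e‖ = 1 → ∀ x : ℝ, oscK (fun _ => 1) e x = σ.real Set.univ * sin x := by
    intro e he x
    have hh : Sm₀ (fun _ : Space => (1 : ℂ)) := contDiffOn_const
    have hlap : sphLap (fun _ => 1) = fun _ => 0 := by
      ext w
      have h1 : ∀ i j, lder i j (fun _ : Space => (1 : ℂ)) = fun _ => 0 := by
        intro i j; ext w; simp [lder]
      simp only [sphLap, h1]
      simp [lder]
    set M : ℂ := ((σ.real Set.univ : ℝ) : ℂ) with hM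
    have hode : ∀ l : ℝ, oscK'' (fun _ => 1) e l + oscK (fun _ => 1) e l = 0 := by
      intro l
      have h1 := osc_ode hh he l
      rw [hlap] at h1
      rcases eq_or_ne l 0 with rfl | hl
      · have h0 : osc (fun w => crd e w * 1) e 0 = 0 := by
          have h2 : ∫ w, (fun w => crd e w * 1 * phase e 0 w) (LinearIsometryEquiv.neg ℝ w)
              ∂σ = osc (fun w => crd e w * 1) e 0 :=
            (measurePreserving_linearIsometryEquiv_σ (LinearIsometryEquiv.neg ℝ)).integral_comp
              (LinearIsometryEquiv.neg ℝ).toHomeomorph.measurableEmbedding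
              (fun w => crd e w * 1 * phase e 0 w)
          have h3 : ∫ w, (fun w => crd e w * 1 * phase e 0 w) (LinearIsometryEquiv.neg ℝ w)
              ∂σ = - osc (fun w => crd e w * 1) e 0 := by
            unfold osc
            rw [← integral_neg]
            congr 1; ext w
            simp [crd, phase]
          have h4 := h2.symm.trans h3
          exact self_eq_neg.1 h4
        simp only [oscK'', oscK, h0]
        simp
      · have hl' : (l : ℂ) ≠ 0 := by exact_mod_cast hl
        refine mul_left_cancel₀ hl' ?_
        have h2 : osc (fun _ => 0) e l = 0 := by simp [osc]
        rw [h2] at h1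
        unfold oscK oscK''
        linear_combination h1
    have hd : ∀ y : ℝ, HasDerivAt (fun y : ℝ => (oscK (fun _ => 1) e y - M * sin y) * cos y
        - (oscK' (fun _ => 1) e y - M * cos y) * sin y) 0 y := by
      intro y
      have hs := (Complex.hasDerivAt_sin (y : ℂ)).comp_ofReal
      have hc := (Complex.hasDerivAt_cos (y : ℂ)).comp_ofReal
      refine ((((hasDerivAt_oscK hh e y).sub (hs.const_mul M)).mul hc).sub
        (((hasDerivAt_oscK' hh e y).sub (hc.const_mul M)).mul hs)).congr_deriv ?_
      simp only [Pi.sub_apply]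
      linear_combination (-sin y) * hode y
    have hd2 : ∀ y : ℝ, HasDerivAt (fun y : ℝ => (oscK (fun _ => 1) e y - M * sin y) * sin y
        + (oscK' (fun _ => 1) e y - M * cos y) * cos y) 0 y := by
      intro y
      have hs := (Complex.hasDerivAt_sin (y : ℂ)).comp_ofReal
      have hc := (Complex.hasDerivAt_cos (y : ℂ)).comp_ofReal
      refine ((((hasDerivAt_oscK hh e y).sub (hs.const_mul M)).mul hs).add
        (((hasDerivAt_oscK' hh e y).sub (hc.const_mul M)).mul hc)).congr_deriv ?_
      simp only [Pi.sub_apply]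
      linear_combination (cos y) * hode y
    have h0 : osc (fun _ => 1) e 0 = M := by
      simp [osc, phase, hM]
    have hK0 : oscK (fun _ => 1) e 0 = 0 := by simp [oscK]
    have hK'0 : oscK' (fun _ => 1) e 0 = M := by simp [oscK', h0]
    have e1 := is_const_of_deriv_eq_zero (fun y => (hd y).differentiableAt) (fun y => (hd y).deriv) x 0
    have e2 := is_const_of_deriv_eq_zero (fun y => (hd2 y).differentiableAt) (fun y => (hd2 y).deriv) x 0
    simp [hK0, hK'0] at e1 e2
    have e3 := Complex.sin_sq_add_cos_sq (x : ℂ)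
    linear_combination (cos x) * e1 + (sin x) * e2 - (oscK (fun _ => 1) e x - M * sin x) * e3
  rcases eq_or_ne d 0 with rfl | hd
  · simp
  have hc0 : 0 < ‖d‖ := norm_pos_iff.2 hd
  have hde : d = ‖d‖ • (‖d‖⁻¹ • d) := by rw [smul_smul, mul_inv_cancel₀ hc0.ne', one_smul]
  have h1 := key (‖d‖⁻¹ • d) (by rw [norm_smul]; simp [hc0.ne']) (‖d‖ * l)
  unfold oscK at h1
  rw [← osc_smul, ← hde] at h1
  push_cast at h1
  rw [mul_comm (l : ℂ)]
  exact h1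

end

section

variable {h g : SC} {f : ℝ → ℂ} {b : ℂ} {C : ℝ}

/-! ### Finite parts at infinity -/

lemma HasRLimTop.add {g : ℝ → ℂ} {c : ℂ} (hf : HasRLimTop f b) (hg : HasRLimTop g c) :
    HasRLimTop (fun x => f x + g x) (b + c) := by
  obtain ⟨p, hp⟩ := hf
  obtain ⟨q, hq⟩ := hg
  refine ⟨p + q, (hp.add hq).congr_left fun x => ?_⟩
  ring

lemma HasRLimTop.const_mul (a : ℂ) (hf : HasRLimTop f b) :
    HasRLimTop (fun x => a * f x) (a * b) := by
  obtain ⟨p, hp⟩ := hf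
  refine ⟨a * p, (hp.const_mul_left a).congr_left fun x => ?_⟩
  ring

lemma hasRLimTop_const (b : ℂ) : HasRLimTop (fun _ => b) b :=
  ⟨0, by simpa using isBigO_zero _ _⟩

lemma HasRLimTop.sum {ι : Type*} (s : Finset ι) {f : ι → ℝ → ℂ} {b : ι → ℂ} (h : ∀ i ∈ s, HasRLimTop (f i) (b i)) :
    HasRLimTop (fun x => ∑ i ∈ s, f i x) (∑ i ∈ s, b i) := by
  classical
  induction s using induction_on with
  | empty => simpa using hasRLimTop_const 0
  | insert i s hi ih =>
    simp only [sum_insert hi]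
    exact (h i (Finset.mem_insert_self _ _)).add (ih fun j hj => h j (Finset.mem_insert_of_mem hj))

lemma HasRLimTop.congr {g : ℝ → ℂ} (hf : HasRLimTop f b) (h : f =ᶠ[atTop] g) : HasRLimTop g b := by
  obtain ⟨p, hp⟩ := hf
  exact ⟨p, hp.congr' (h.mono fun x hx => by simp only [hx]) EventuallyEq.rfl⟩

lemma HasRLimTop.re (hf : HasRLimTop f b) : HasRLimTop (fun x => ((f x).re : ℂ)) (b.re : ℂ) := by
  obtain ⟨p, hp⟩ := hf
  refine ⟨(p.re : ℂ), IsBigO.trans (IsBigO.of_bound 1 (Eventually.of_forall fun x => ?_)) hp⟩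
  rw [one_mul]
  have : (((f x).re : ℂ) - ((p.re : ℂ) * (x : ℂ) + (b.re : ℂ))) = (((f x - (p * (x : ℂ) + b)).re : ℝ) : ℂ) := by
    simp
  rw [this, norm_real]
  exact Complex.abs_re_le_norm _

lemma exists_hasRLimTop_of_cauchy
    (h : ∀ a b, 1 ≤ a → a ≤ b → ‖f b - f a‖ ≤ C / a) : ∃ d, HasRLimTop f d := by
  have hcau : Cauchy (map f atTop) := by
    rw [Metric.cauchy_iff]
    refine ⟨inferInstance, fun e he => ?_⟩
    refine ⟨f '' Set.Ici (max 1 (4 * |C| / e)), image_mem_map (Ici_mem_atTop _), ?_⟩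
    rintro _ ⟨x, hx, rfl⟩ _ ⟨y, hy, rfl⟩
    set a := max 1 (4 * |C| / e) with ha
    have ha1 : 1 ≤ a := le_max_left _ _
    have ha2 : 4 * |C| / e ≤ a := le_max_right _ _
    have h1 := h a x ha1 hx
    have h2 := h a y ha1 hy
    have h3 : C / a ≤ e / 4 := by
      rw [div_le_iff₀ (by linarith)]
      rw [div_le_iff₀ he] at ha2
      nlinarith [le_abs_self C]
    have h4 : dist (f x) (f y) ≤ ‖f x - f a‖ + ‖f y - f a‖ := by
      rw [dist_eq_norm, show f x - f y = (f x - f a) - (f y - f a) by ring]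
      exact norm_sub_le _ _
    linarith
  obtain ⟨d, hd⟩ := CompleteSpace.complete hcau
  refine ⟨d, 0, IsBigO.of_bound C ?_⟩
  filter_upwards [eventually_ge_atTop 1] with a ha
  have h1 : Tendsto (fun b => ‖f b - f a‖) atTop (𝓝 ‖d - f a‖) :=
    (Tendsto.sub_const (show Tendsto f atTop (𝓝 d) from hd) _).norm
  have h2 : ‖d - f a‖ ≤ C / a :=
    le_of_tendsto h1 ((eventually_ge_atTop a).mono fun b hb => h a b ha hb)
  rw [zero_mul, zero_add, norm_sub_rev, norm_of_nonneg (by positivity), ← div_eq_mul_inv]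
  exact h2

/-! ### Elementary oscillating terms -/

/-- The direction of a wave vector. -/
def khat (k : Space) : Space := ‖k‖⁻¹ • k

/-- The set `1 ≤ |k| < Λ`. -/
def annulus (L : ℝ) : Set Space := {k | 1 ≤ ‖k‖ ∧ ‖k‖ < L}

lemma measurableSet_annulus (L : ℝ) : MeasurableSet (annulus L) :=
  (measurableSet_le measurable_const measurable_norm).inter (measurableSet_lt measurable_norm measurable_const)

lemma khat_smul {r : ℝ} (hr : 0 < r) {w : Space} (hw : ‖w‖ = 1) : khat (r • w) = w := by
  unfold khat
  rw [norm_smul, hw, mul_one, norm_of_nonneg hr.le, smul_smul, inv_mul_cancel₀ hr.ne', one_smul]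

lemma norm_khat {k : Space} (hk : k ≠ 0) : ‖khat k‖ = 1 := by
  unfold khat; rw [norm_smul]; simp [hk]

lemma contDiffOn_khat : Sm₀ khat := by
  intro k hk
  exact (((contDiffAt_norm ℝ hk).inv (norm_ne_zero_iff.2 hk)).smul contDiffAt_id).contDiffWithinAt

lemma contDiffOn_comp_khat {F : Type*} [NormedAddCommGroup F] [NormedSpace ℝ F]
    {h : Space → F} (hh : Sm₀ h) : Sm₀ (fun k => h (khat k)) :=
  hh.comp contDiffOn_khat fun k hk => by
    rw [Set.mem_compl_singleton_iff, ← norm_ne_zero_iff, norm_khat hk]; exact one_ne_zero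

/-- The term `h(k̂) e^{i k·d} / |k|^j`. -/
def elem (j : ℕ) (h : SC) (d : Space) (k : Space) : ℂ :=
  h (khat k) * phase d 1 k / (‖k‖ : ℂ) ^ j

lemma continuousOn_elem (j : ℕ) (hh : Sm₀ h) (d : Space) :
    ContinuousOn (elem j h d) {0}ᶜ := by
  refine ((contDiffOn_comp_khat hh).continuousOn.mul
    (contDiff_phase d 1).continuous.continuousOn).div (by fun_prop) fun k hk => ?_
  exact pow_ne_zero _ (by exact_mod_cast (norm_ne_zero_iff.2 hk))

lemma intOn_annulus {F : Type*} [NormedAddCommGroup F]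
    {f : Space → F} (hf : ContinuousOn f {0}ᶜ) (L : ℝ) : IntegrableOn f (annulus L) := by
  have hc : IsCompact (closedBall (0 : Space) L \ ball 0 1) :=
    (isCompact_closedBall _ _).diff isOpen_ball
  refine ((hf.mono ?_).integrableOn_compact hc).mono_set ?_
  · intro k hk h0
    rw [Set.mem_singleton_iff.1 h0] at hk
    simp at hk
  · intro k hk
    simpa [annulus] using And.intro hk.2.le hk.1

lemma integral_annulus_elem (j : ℕ) (hh : Sm₀ h) (d : Space)
    {L : ℝ} (hL : 1 ≤ L) :
    ∫ k in annulus L, elem j h d k = ∫ r in (1 : ℝ)..L, (r : ℂ) ^ 2 / (r : ℂ) ^ j * osc h d r := by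
  have hi := (intOn_annulus (continuousOn_elem j hh d) L)
  rw [← integral_indicator (measurableSet_annulus L),
    integral_polar (hi.integrable_indicator (measurableSet_annulus L)),
    integral_of_le hL]
  have h1 : ∀ r ∈ Ioi (0 : ℝ), r ^ 2 • ∫ w, (annulus L).indicator (elem j h d) (r • w) ∂σ
      = (Set.Ico 1 L).indicator (fun r : ℝ => (r : ℂ) ^ 2 / (r : ℂ) ^ j * osc h d r) r := by
    intro r hr
    have hr0 : 0 < r := hr
    by_cases hm : r ∈ Set.Ico 1 L
    · rw [indicator_of_mem hm]
      have h2 : ∫ w, (annulus L).indicator (elem j h d) (r • w) ∂σ = (1 / (r : ℂ) ^ j) * osc h d r := by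
        unfold osc
        rw [← integral_const_mul]
        refine integral_congr_ae ?_
        filter_upwards [ae_σ] with w hw
        have hn : ‖r • w‖ = r := by rw [norm_smul, hw, mul_one, norm_of_nonneg hr0.le]
        rw [indicator_of_mem (by simpa [annulus, hn] using hm)]
        unfold elem
        rw [khat_smul hr0 hw, hn]
        have : phase d 1 (r • w) = phase d r w := by
          simp [phase, inner_smul_left]
        rw [this]; ring
      rw [h2, real_smul]; push_cast; ring
    · rw [indicator_of_notMem hm]
      have h2 : ∫ w, (annulus L).indicator (elem j h d) (r • w) ∂σ = 0 := by
        refine integral_eq_zero_of_ae ?_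
        filter_upwards [ae_σ] with w hw
        have hn : ‖r • w‖ = r := by rw [norm_smul, hw, mul_one, norm_of_nonneg hr0.le]
        rw [indicator_of_notMem (by simpa [annulus, hn] using hm)]; rfl
      rw [h2, smul_zero]
  rw [setIntegral_congr_fun measurableSet_Ioi h1, setIntegral_indicator measurableSet_Ico]
  rw [Set.inter_eq_self_of_subset_right (s := Ioi (0 : ℝ)) (t := Set.Ico 1 L)
    (fun r hr => Set.mem_Ioi.2 (lt_of_lt_of_le one_pos hr.1)), integral_Ico_eq_integral_Ioc]

lemma intervalIntegrable_radial (j : ℕ) (hh : Sm₀ h) (d : Space)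
    {a b : ℝ} (ha : 1 ≤ a) (hb : 1 ≤ b) :
    IntervalIntegrable (fun r : ℝ => (r : ℂ) ^ 2 / (r : ℂ) ^ j * osc h d r) volume a b := by
  refine ContinuousOn.intervalIntegrable ?_
  refine ContinuousOn.mul (ContinuousOn.div (by fun_prop) (by fun_prop) fun r hr => ?_)
    (continuous_osc hh d).continuousOn
  have : 0 < r := by
    have := hr.1
    have h1 : 1 ≤ min a b := le_min ha hb
    linarith
  exact pow_ne_zero _ (by exact_mod_cast this.ne')

lemma exists_hasRLimTop_elem (j : ℕ) (hh : Sm₀ h) (d : Space)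
    (hC : ∀ a b, 1 ≤ a → a ≤ b → ‖∫ r in a..b, (r : ℂ) ^ 2 / (r : ℂ) ^ j * osc h d r‖ ≤ C / a) :
    ∃ b, HasRLimTop (fun L => ∫ k in annulus L, elem j h d k) b := by
  refine exists_hasRLimTop_of_cauchy (C := C) fun a b ha hab => ?_
  rw [integral_annulus_elem j hh d ha, integral_annulus_elem j hh d (ha.trans hab),
    intervalIntegral.integral_interval_sub_left (intervalIntegrable_radial j hh d le_rfl (ha.trans hab))
      (intervalIntegrable_radial j hh d le_rfl ha)]
  exact hC a b ha hab

lemma elem_two (hh : Sm₀ h) (d : Space) :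
    ∃ b, HasRLimTop (fun L => ∫ k in annulus L, elem 2 h d k) b := by
  have hsimp : ∀ a b : ℝ, 1 ≤ a → 1 ≤ b → ∫ r in a..b, (r : ℂ) ^ 2 / (r : ℂ) ^ 2 * osc h d r
      = ∫ r in a..b, osc h d r := by
    intro a b ha hb
    refine integral_congr fun r hr => ?_
    have h1 : 1 ≤ min a b := le_min ha hb
    have : (r : ℂ) ≠ 0 := by
      have := hr.1
      exact_mod_cast (by linarith : (0 : ℝ) < r).ne'
    rw [div_self (pow_ne_zero _ this), one_mul]
  by_cases hd : d = 0
  · subst hd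
    have h0 : ∀ r, osc h 0 r = osc h 0 0 := fun r => by simp [osc, phase]
    refine ⟨-osc h 0 0, osc h 0 0, ?_⟩
    refine (isBigO_zero _ _).congr' ?_ EventuallyEq.rfl
    filter_upwards [eventually_ge_atTop 1] with L hL
    rw [integral_annulus_elem 2 hh 0 hL, hsimp 1 L le_rfl hL]
    simp only [h0]
    rw [intervalIntegral.integral_const, real_smul]
    push_cast; ring
  · obtain ⟨C, -, -, hC⟩ := osc_decay hh hd
    exact exists_hasRLimTop_elem 2 hh d (C := C) fun a b ha hab => by
      rw [hsimp a b ha (ha.trans hab)]; exact hC a b ha hab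

lemma radial_bound (hC : 0 ≤ C) (hf : ∀ r, 1 ≤ r → ‖f r‖ ≤ C / r ^ 2)
    {a b : ℝ} (ha : 1 ≤ a) (hab : a ≤ b) : ‖∫ r in a..b, f r‖ ≤ C / a := by
  have ha0 : 0 < a := by linarith
  have hne : ∀ x ∈ Set.uIcc a b, x ≠ 0 := fun x hx => by
    rw [Set.uIcc_of_le hab] at hx; linarith [hx.1]
  have hint : ∫ r in a..b, C / r ^ 2 = C * (a⁻¹ - b⁻¹) := by
    rw [intervalIntegral.integral_eq_sub_of_hasDerivAt (f := fun r => -C * r⁻¹)]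
    · ring
    · intro x hx
      exact ((hasDerivAt_inv (hne x hx)).const_mul (-C)).congr_deriv (by ring)
    · exact ContinuousOn.intervalIntegrable (ContinuousOn.div (by fun_prop) (by fun_prop)
        fun x hx => pow_ne_zero _ (hne x hx))
  refine (intervalIntegral.norm_integral_le_of_norm_le hab (g := fun r => C / r ^ 2) ?_ ?_).trans ?_
  · exact Eventually.of_forall fun r hr => hf r (ha.trans hr.1.le)
  · exact ContinuousOn.intervalIntegrable (ContinuousOn.div (by fun_prop) (by fun_prop)
        fun x hx => pow_ne_zero _ (hne x hx))
  · rw [hint, div_eq_mul_inv]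
    have : 0 ≤ b⁻¹ := inv_nonneg.2 (by linarith)
    gcongr
    linarith

lemma elem_three (hh : Sm₀ h) {d : Space} (hd : d ≠ 0) :
    ∃ b, HasRLimTop (fun L => ∫ k in annulus L, elem 3 h d k) b := by
  obtain ⟨C, hC0, hC, -⟩ := osc_decay hh hd
  refine exists_hasRLimTop_elem 3 hh d (C := C) fun a b ha hab =>
    radial_bound hC0 (fun r hr => ?_) ha hab
  have hr0 : 0 < r := by linarith
  have h1 := hC r hr0
  rw [norm_mul, norm_div, norm_pow, norm_pow, Complex.norm_of_nonneg hr0.le]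
  calc r ^ 2 / r ^ 3 * ‖osc h d r‖ ≤ r ^ 2 / r ^ 3 * (C / r) := by gcongr
    _ = C / r ^ 2 := by field_simp

lemma elem_four (hh : Sm₀ h) (d : Space) :
    ∃ b, HasRLimTop (fun L => ∫ k in annulus L, elem 4 h d k) b := by
  obtain ⟨C, hC0, hC⟩ := norm_osc_le hh
  refine exists_hasRLimTop_elem 4 hh d (C := C) fun a b ha hab =>
    radial_bound hC0 (fun r hr => ?_) ha hab
  have hr0 : 0 < r := by linarith
  have h1 := hC d r
  rw [norm_mul, norm_div, norm_pow, norm_pow, Complex.norm_of_nonneg hr0.le]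
  calc r ^ 2 / r ^ 4 * ‖osc h d r‖ ≤ r ^ 2 / r ^ 4 * C := by gcongr
    _ = C / r ^ 2 := by field_simp

/-! ### Remainders -/

/-- Wave vectors of modulus at least `Λ`. -/
def tailSet (L : ℝ) : Set Space := {k | L ≤ ‖k‖}

lemma measurableSet_tailSet (L : ℝ) : MeasurableSet (tailSet L) :=
  measurableSet_le measurable_const measurable_norm

/-- The integral of `f` over `|k| ≥ Λ` is `O(1/Λ)`. -/
def TailBound (f : Space → ENNReal) : Prop :=
  ∃ C : NNReal, ∀ L : ℝ, 1 ≤ L → ∫⁻ k in tailSet L, f k ≤ C * ofReal L⁻¹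

lemma TailBound.mono {f g : Space → ENNReal} (hg : TailBound g) (h : ∀ k, 1 ≤ ‖k‖ → f k ≤ g k) : TailBound f := by
  obtain ⟨C, hC⟩ := hg
  refine ⟨C, fun L hL => le_trans (setLIntegral_mono' (measurableSet_tailSet L) fun k hk => ?_) (hC L hL)⟩
  exact h k (hL.trans hk)

lemma TailBound.add {f g : Space → ENNReal} (hfm : AEMeasurable f) (hf : TailBound f)
    (hg : TailBound g) : TailBound (fun k => f k + g k) := by
  obtain ⟨C, hC⟩ := hf
  obtain ⟨D, hD⟩ := hg
  refine ⟨C + D, fun L hL => ?_⟩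
  rw [lintegral_add_left' hfm.restrict]
  push_cast
  rw [add_mul]
  exact add_le_add (hC L hL) (hD L hL)

lemma TailBound.const_mul {f : Space → ENNReal} (c : NNReal) (hf : TailBound f) : TailBound (fun k => c * f k) := by
  obtain ⟨C, hC⟩ := hf
  refine ⟨c * C, fun L hL => ?_⟩
  rw [lintegral_const_mul' _ _ ENNReal.coe_ne_top]
  push_cast
  rw [mul_assoc]
  gcongr
  exact hC L hL

lemma exists_hasRLimTop_of_tailBound (hi : ∀ L, IntegrableOn g (annulus L))
    (h : TailBound fun k => ‖g k‖ₑ) :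
    ∃ d, HasRLimTop (fun L => ∫ k in annulus L, g k) d := by
  obtain ⟨C, hC⟩ := h
  refine exists_hasRLimTop_of_cauchy (C := C) fun a b ha hab => ?_
  have hsub : annulus a ⊆ annulus b := fun k hk => ⟨hk.1, hk.2.trans_le hab⟩
  rw [← setIntegral_sdiff₀ (measurableSet_annulus a).nullMeasurableSet (hi b) hsub]
  have h1 : ∫⁻ k in annulus b \ annulus a, ‖g k‖ₑ ≤ C * ofReal a⁻¹ := by
    refine (lintegral_mono_set ?_).trans (hC a ha)
    rintro k ⟨hk, hk'⟩
    simp only [annulus, mem_ofPred_eq, not_and, not_lt] at hk hk'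
    exact hk' hk.1
  have h2 : ‖∫ k in annulus b \ annulus a, g k‖ₑ ≤ C * ofReal a⁻¹ :=
    (enorm_integral_le_lintegral_enorm _).trans h1
  have h3 := ENNReal.toReal_mono (by finiteness) h2
  rw [toReal_enorm, toReal_mul, toReal_ofReal (by positivity)] at h3
  rw [div_eq_mul_inv]; exact h3

/-- Remainders in the expansions for large wave vectors. -/
def Remainder (ρ : SC) : Prop :=
  TailBound (fun k => ‖ρ k‖ₑ * ofReal ‖k‖⁻¹) ∧ TailBound (fun k => ‖ρ k‖ₑ ^ 2)

lemma Remainder.add {f : SC} (hfm : AEStronglyMeasurable f volume)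
    (hf : Remainder f) (hg : Remainder g) : Remainder (fun k => f k + g k) := by
  constructor
  · refine (TailBound.add (f := fun k => ‖f k‖ₑ * ofReal ‖k‖⁻¹)
      (hfm.enorm.mul (by fun_prop)) hf.1 hg.1).mono fun k _ => ?_
    simp only
    rw [← add_mul]
    gcongr
    exact enorm_add_le _ _
  · refine (((hf.2.add (hfm.enorm.pow_const 2) hg.2)).const_mul 2).mono fun k _ => ?_
    simp only
    have h1 : ‖f k + g k‖ₑ ^ 2 ≤ (‖f k‖ₑ + ‖g k‖ₑ) ^ 2 := by gcongr; exact enorm_add_le _ _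
    refine h1.trans ?_
    rw [enorm_eq_nnnorm, enorm_eq_nnnorm]
    exact_mod_cast add_sq_le (a := ‖f k‖₊) (b := ‖g k‖₊)

lemma Remainder.mono {f : SC} (hg : Remainder g) (c : NNReal)
    (h : ∀ k, 1 ≤ ‖k‖ → ‖f k‖ₑ ≤ c * ‖g k‖ₑ) : Remainder f := by
  constructor
  · refine (hg.1.const_mul c).mono fun k hk => ?_
    rw [← mul_assoc]
    gcongr
    exact h k hk
  · refine (hg.2.const_mul (c ^ 2)).mono fun k hk => ?_
    push_cast
    rw [← mul_pow]
    gcongr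
    exact h k hk

end

section

/-! ### Expansions for large wave vectors -/

variable {N : ℕ}
variable {z : Fin N → Space} {u w f : SC} {g g' : Fin N → SR}

/-- The leading terms, of orders `1/|k|` and `1/|k|^2`, of the expansion of the transform of a field
singular at the points `z n`. -/
def lead (z : Fin N → Space) (g g' : Fin N → SR) (k : Space) : ℂ :=
  ∑ n, phase (-z n) 1 k * (g n (khat k) / (‖k‖ : ℂ) + I * g' n (khat k) / (‖k‖ : ℂ) ^ 2)

/-- `u` has an expansion with real coefficients `g n (k̂) / |k| + i g' n (k̂) / |k|^2` for large wave
vectors. -/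
def KExp (z : Fin N → Space) (u : SC) : Prop :=
  AEStronglyMeasurable u volume ∧ ∃ g g' : Fin N → SR,
    (∀ n, Sm₀ (g n)) ∧ (∀ n, Sm₀ (g' n)) ∧
      Remainder (fun k => u k - lead z g g' k)

lemma continuousOn_lead (z : Fin N → Space)
    (hg : ∀ n, Sm₀ (g n)) (hg' : ∀ n, Sm₀ (g' n)) :
    ContinuousOn (lead z g g') {0}ᶜ := by
  have hn : ContinuousOn (fun k : Space => (‖k‖ : ℂ)) {0}ᶜ := by fun_prop
  have hn0 : ∀ k ∈ ({0}ᶜ : Set Space), (‖k‖ : ℂ) ≠ 0 := fun k hk => by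
    exact_mod_cast (norm_ne_zero_iff.2 hk)
  refine continuousOn_finsetSum _ fun n _ => ContinuousOn.mul
    (contDiff_phase _ 1).continuous.continuousOn (ContinuousOn.add ?_ ?_)
  · exact (continuous_ofReal.comp_continuousOn (contDiffOn_comp_khat (hg n)).continuousOn).div hn hn0
  · exact (continuousOn_const.mul (continuous_ofReal.comp_continuousOn
      (contDiffOn_comp_khat (hg' n)).continuousOn)).div (hn.pow 2) fun k hk => pow_ne_zero _ (hn0 k hk)

lemma aesm_of_continuousOn {F : Type*} [NormedAddCommGroup F] {f : Space → F}
    (hf : ContinuousOn f {0}ᶜ) : AEStronglyMeasurable f volume := by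
  have h := hf.aestronglyMeasurable (μ := volume) (measurableSet_singleton (0 : Space)).compl
  rwa [Measure.restrict_eq_self_of_ae_mem (by simp [ae_iff])] at h

lemma lead_add (z : Fin N → Space) (g g' h h' : Fin N → SR) (k : Space) :
    lead z (fun n w => g n w + h n w) (fun n w => g' n w + h' n w) k = lead z g g' k + lead z h h' k := by
  unfold lead
  rw [← sum_add_distrib]
  refine sum_congr rfl fun n _ => ?_
  push_cast
  ring

lemma KExp.add (hu : KExp z u)
    (hw : KExp z w) : KExp z (fun k => u k + w k) := by
  obtain ⟨hum, g, g', hg, hg', hr⟩ := hu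
  obtain ⟨hwm, h, h', hh, hh', hs⟩ := hw
  refine ⟨hum.add hwm, fun n w => g n w + h n w, fun n w => g' n w + h' n w,
    fun n => (hg n).add (hh n), fun n => (hg' n).add (hh' n), ?_⟩
  have hm : AEStronglyMeasurable (fun k => u k - lead z g g' k) volume :=
    hum.sub (aesm_of_continuousOn (continuousOn_lead z hg hg'))
  convert hr.add hm hs using 2 with k
  rw [lead_add]; ring

lemma KExp.dir_mul (hu : KExp z u)
    {c : SR} (hc : Sm₀ c) :
    KExp z (fun k => (c (khat k) : ℂ) * u k) := by
  obtain ⟨hum, g, g', hg, hg', hr⟩ := hu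
  obtain ⟨C, hC⟩ := (isCompact_sphere (0 : Space) 1).exists_bound_of_continuousOn (hc.continuousOn.mono sphere_subset)
  refine ⟨(aesm_of_continuousOn (continuous_ofReal.comp_continuousOn
      (contDiffOn_comp_khat hc).continuousOn)).mul hum,
    fun n w => c w * g n w, fun n w => c w * g' n w,
    fun n => hc.mul (hg n), fun n => hc.mul (hg' n), hr.mono C.toNNReal fun k hk => ?_⟩
  have hk0 : k ≠ 0 := by rw [← norm_ne_zero_iff]; linarith
  have h1 : (c (khat k) : ℂ) * u k - lead z (fun n w => c w * g n w) (fun n w => c w * g' n w) k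
      = (c (khat k) : ℂ) * (u k - lead z g g' k) := by
    rw [mul_sub]
    congr 1
    unfold lead
    rw [mul_sum]
    refine sum_congr rfl fun n _ => ?_
    push_cast
    ring
  rw [h1, enorm_mul]
  gcongr
  rw [enorm_eq_nnnorm]
  norm_cast
  rw [← NNReal.coe_le_coe, coe_nnnorm]
  exact (hC _ (by simpa using norm_khat hk0)).trans (Real.le_coe_toNNReal C)

lemma KExp.const_mul (hu : KExp z u)
    (c : ℝ) : KExp z (fun k => (c : ℂ) * u k) :=
  hu.dir_mul (c := fun _ => c) contDiffOn_const

lemma hasKExpansion_zero (z : Fin N → Space) : KExp z (fun _ => 0) := by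
  refine ⟨aestronglyMeasurable_const, fun _ _ => 0, fun _ _ => 0, fun _ => contDiffOn_const,
    fun _ => contDiffOn_const, ?_⟩
  constructor <;> refine ⟨0, fun L _ => ?_⟩ <;> simp [lead]

lemma KExp.sum {ι : Type*} (s : Finset ι) {u : ι → SC}
    (hu : ∀ i ∈ s, KExp z (u i)) : KExp z (fun k => ∑ i ∈ s, u i k) := by
  classical
  induction s using induction_on with
  | empty => simpa using hasKExpansion_zero z
  | insert i s hi ih =>
    simp only [sum_insert hi]
    exact (hu i (Finset.mem_insert_self _ _)).add (ih fun j hj => hu j (Finset.mem_insert_of_mem hj))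

lemma KExp.congr_ae (hu : KExp z u)
    (h : u =ᵐ[volume] w) : KExp z w := by
  obtain ⟨hum, g, g', hg, hg', ⟨C, hC⟩, ⟨D, hD⟩⟩ := hu
  refine ⟨hum.congr h, g, g', hg, hg', ⟨C, fun L hL => le_trans (le_of_eq ?_) (hC L hL)⟩,
    ⟨D, fun L hL => le_trans (le_of_eq ?_) (hD L hL)⟩⟩
  · exact lintegral_congr_ae (ae_restrict_of_ae (h.mono fun k hk => by simp only [hk]))
  · exact lintegral_congr_ae (ae_restrict_of_ae (h.mono fun k hk => by simp only [hk]))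

lemma lead_bound (z : Fin N → Space)
    (hg : ∀ n, Sm₀ (g n)) (hg' : ∀ n, Sm₀ (g' n)) :
    ∃ C : ℝ, 0 ≤ C ∧ ∀ k, 1 ≤ ‖k‖ → ‖lead z g g' k‖ ≤ C * ‖k‖⁻¹ := by
  choose A hA using fun n => (isCompact_sphere (0 : Space) 1).exists_bound_of_continuousOn
    ((hg n).continuousOn.mono sphere_subset)
  choose B hB using fun n => (isCompact_sphere (0 : Space) 1).exists_bound_of_continuousOn
    ((hg' n).continuousOn.mono sphere_subset)
  refine ⟨∑ n, (|A n| + |B n|), by positivity, fun k hk => ?_⟩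
  have hk1 : 0 < ‖k‖ := by linarith
  have hs : khat k ∈ 𝕊 := by
    simpa using norm_khat (norm_pos_iff.1 hk1)
  unfold lead
  rw [sum_mul]
  refine norm_sum_le_of_le _ fun n _ => ?_
  rw [norm_mul, norm_phase, one_mul]
  refine (norm_add_le _ _).trans ?_
  rw [norm_div, norm_div, norm_mul, norm_I, one_mul, norm_real, norm_real,
    norm_pow, Complex.norm_of_nonneg hk1.le, add_mul, div_eq_mul_inv, div_eq_mul_inv]
  have h1 := (hA n _ hs).trans (le_abs_self _)
  have h2 := (hB n _ hs).trans (le_abs_self _)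
  have h3 : (‖k‖ ^ 2)⁻¹ ≤ ‖k‖⁻¹ := by gcongr; nlinarith
  rw [norm_real, norm_norm]
  exact add_le_add (mul_le_mul_of_nonneg_right h1 (by positivity)) (mul_le_mul h2 h3 (by positivity) (by positivity))

lemma integral_ball_eq (hf : ∀ L > 0, IntegrableOn f (ball 0 L)) :
    (fun L => (∫ k in ball (0 : Space) 1, f k) + ∫ k in annulus L, f k)
      =ᶠ[atTop] fun L => ∫ k in ball (0 : Space) L, f k := by
  filter_upwards [eventually_ge_atTop 1] with L hL
  have h1 : ball (0 : Space) L = ball 0 1 ∪ annulus L := by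
    ext k
    simp only [mem_ball, dist_zero_right, annulus, Set.mem_union, mem_ofPred_eq]
    constructor
    · intro h; rcases lt_or_ge ‖k‖ 1 with h1 | h1
      · exact Or.inl h1
      · exact Or.inr ⟨h1, h⟩
    · rintro (h | h) <;> linarith
  have hdis : Disjoint (ball (0 : Space) 1) (annulus L) := by
    rw [Set.disjoint_left]
    intro k hk hk'
    simp at hk
    linarith [hk'.1]
  rw [h1, setIntegral_union hdis (measurableSet_annulus L) (hf 1 one_pos)]
  exact (hf L (by linarith)).mono_set (h1 ▸ Set.subset_union_right)

lemma annulus_subset_ball (L : ℝ) : annulus L ⊆ ball 0 L := fun k hk => by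
  simpa using hk.2

lemma exists_hasRLimTop_ball {e : SC} {d : ℂ}
    (hf : ∀ L > 0, IntegrableOn f (ball 0 L)) (he : ContinuousOn e {0}ᶜ)
    (hd : HasRLimTop (fun L => ∫ k in annulus L, e k) d)
    (hr : TailBound fun k => ‖f k - e k‖ₑ) :
    ∃ b, HasRIntegralK f b := by
  have hfa : ∀ L, IntegrableOn f (annulus L) := fun L => by
    refine (hf (max L 1) (by positivity)).mono_set ((annulus_subset_ball L).trans ?_)
    exact Metric.ball_subset_ball (le_max_left _ _)
  have hea := intOn_annulus he
  obtain ⟨b, hb⟩ := exists_hasRLimTop_of_tailBound (g := fun k => f k - e k) (fun L => (hfa L).sub (hea L)) hr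
  refine ⟨_, hf, ((hasRLimTop_const (∫ k in ball (0 : Space) 1, f k)).add
    ((hd.add hb).congr (g := fun L => ∫ k in annulus L, f k)
      (Eventually.of_forall fun L => ?_))).congr (integral_ball_eq hf)⟩
  have hfe : IntegrableOn (fun k => f k - e k) (annulus L) := (hfa L).sub (hea L)
  simp only
  rw [← integral_add (hea L) hfe]
  congr 1; ext k; simp

lemma elem_zero_fn (j : ℕ) (d : Space) :
    ∃ b, HasRLimTop (fun L => ∫ k in annulus L, elem j (fun _ => 0) d k) b :=
  ⟨0, by simpa [elem] using hasRLimTop_const 0⟩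

lemma phase_mul (a b k : Space) : phase a 1 k * phase b 1 k = phase (a + b) 1 k := by
  unfold phase
  rw [← exp_add]
  congr 1
  rw [inner_add_right]; push_cast; ring

lemma conj_phase (a k : Space) : (starRingEnd ℂ) (phase a 1 k) = phase (-a) 1 k := by
  unfold phase
  rw [← Complex.exp_conj]
  congr 1
  simp

lemma contDiffOn_ofReal {h : SR} (hh : Sm₀ h) : Sm₀ (fun w => (h w : ℂ)) :=
  ofRealCLM.contDiff.comp_contDiffOn hh

lemma exists_hasRLimTop_normSq_lead (hz : Injective z)
    (hg : ∀ n, Sm₀ (g n))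
    (hg' : ∀ n, Sm₀ (g' n)) :
    ∃ b, HasRLimTop (fun L => ∫ k in annulus L, ((‖lead z g g' k‖ ^ 2 : ℝ) : ℂ)) b := by
  set h2 : Fin N → Fin N → SC := fun n m w => ((g n w * g m w : ℝ) : ℂ) with hh2
  set h3 : Fin N → Fin N → SC := fun n m w =>
    I * ((g' n w * g m w - g n w * g' m w : ℝ) : ℂ) with hh3
  set h4 : Fin N → Fin N → SC := fun n m w => ((g' n w * g' m w : ℝ) : ℂ) with hh4
  have c2 : ∀ n m, Sm₀ (h2 n m) := fun n m => contDiffOn_ofReal ((hg n).mul (hg m))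
  have c3 : ∀ n m, Sm₀ (h3 n m) := fun n m => contDiffOn_const.mul
    (contDiffOn_ofReal (((hg' n).mul (hg m)).sub ((hg n).mul (hg' m))))
  have c4 : ∀ n m, Sm₀ (h4 n m) := fun n m => contDiffOn_ofReal ((hg' n).mul (hg' m))
  have key : ∀ k, ((‖lead z g g' k‖ ^ 2 : ℝ) : ℂ) = ∑ n, ∑ m,
      (elem 2 (h2 n m) (-z n + z m) k + elem 3 (h3 n m) (-z n + z m) k
        + elem 4 (h4 n m) (-z n + z m) k) := by
    intro k
    rw [← Complex.normSq_eq_norm_sq, ← Complex.mul_conj, lead, map_sum, sum_mul_sum]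
    refine sum_congr rfl fun n _ => sum_congr rfl fun m _ => ?_
    simp only [elem, hh2, hh3, hh4, ← phase_mul, map_mul, map_add, map_div₀, map_pow, conj_phase,
      neg_neg, conj_I, conj_ofReal]
    push_cast
    by_cases hk : (‖k‖ : ℂ) = 0
    · simp [hk]
    field_simp
    linear_combination (-(phase (-z n) 1 k * phase (z m) 1 k * (g' n (khat k) : ℂ) * (g' m (khat k) : ℂ))) * I_sq
  choose b2 hb2 using fun n m => elem_two (c2 n m) (-z n + z m)
  choose b4 hb4 using fun n m => elem_four (c4 n m) (-z n + z m)
  have e3 : ∀ n m, ∃ b, HasRLimTop (fun L => ∫ k in annulus L, elem 3 (h3 n m) (-z n + z m) k) b := by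
    intro n m
    by_cases hnm : n = m
    · subst hnm
      have : h3 n n = fun _ => 0 := by ext w; simp [hh3, mul_comm]
      rw [this]
      exact elem_zero_fn 3 _
    · refine elem_three (c3 n m) fun h => hnm (hz ?_)
      exact neg_inj.1 (eq_neg_of_add_eq_zero_left h)
  choose b3 hb3 using e3
  have hi : ∀ j (h : SC), Sm₀ h → ∀ d L,
      IntegrableOn (elem j h d) (annulus L) := fun j h hh d L =>
    intOn_annulus (continuousOn_elem j hh d) L
  refine ⟨∑ n, ∑ m, (b2 n m + b3 n m + b4 n m), ?_⟩
  refine (HasRLimTop.sum univ fun n _ => HasRLimTop.sum univ fun m _ =>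
    ((hb2 n m).add (hb3 n m)).add (hb4 n m)).congr (Eventually.of_forall fun L => ?_)
  simp only [key]
  have hI : ∀ n m, IntegrableOn (fun k => elem 2 (h2 n m) (-z n + z m) k
      + elem 3 (h3 n m) (-z n + z m) k + elem 4 (h4 n m) (-z n + z m) k) (annulus L) :=
    fun n m => ((hi 2 _ (c2 n m) _ L).add (hi 3 _ (c3 n m) _ L)).add (hi 4 _ (c4 n m) _ L)
  rw [integral_finsetSum _ fun n _ => integrable_finsetSum _ fun m _ => hI n m]
  refine sum_congr rfl fun n _ => ?_
  rw [integral_finsetSum _ fun m _ => hI n m]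
  refine sum_congr rfl fun m _ => ?_
  have h23 : IntegrableOn (fun k => elem 2 (h2 n m) (-z n + z m) k
      + elem 3 (h3 n m) (-z n + z m) k) (annulus L) :=
    (hi 2 _ (c2 n m) _ L).add (hi 3 _ (c3 n m) _ L)
  rw [integral_add h23 (hi 4 _ (c4 n m) _ L), integral_add (hi 2 _ (c2 n m) _ L) (hi 3 _ (c3 n m) _ L)]

lemma KExp.exists_normSq (hz : Injective z) (hu : KExp z u)
    (hi : ∀ L > 0, IntegrableOn (fun k => ‖u k‖ ^ 2) (ball 0 L)) :
    ∃ b, HasRIntegralK (fun k => ((‖u k‖ ^ 2 : ℝ) : ℂ)) b := by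
  obtain ⟨hum, g, g', hg, hg', hr⟩ := hu
  obtain ⟨d, hd⟩ := exists_hasRLimTop_normSq_lead hz hg hg'
  obtain ⟨C, hC0, hC⟩ := lead_bound z hg hg'
  have hmc := continuousOn_lead z hg hg'
  refine exists_hasRLimTop_ball (fun L hL => (hi L hL).ofReal)
    (continuous_ofReal.comp_continuousOn (hmc.norm.pow 2)) hd ?_
  have hρ : AEStronglyMeasurable (fun k => u k - lead z g g' k) volume :=
    hum.sub (aesm_of_continuousOn hmc)
  refine ((hr.2.add (hρ.enorm.pow_const 2) (hr.1.const_mul (2 * C.toNNReal)))).mono fun k hk => ?_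
  set ρ := u k - lead z g g' k with hρk
  set M := lead z g g' k with hM
  have hu : u k = ρ + M := by rw [hρk]; ring
  have h1 : ‖((‖u k‖ ^ 2 : ℝ) : ℂ) - ((‖M‖ ^ 2 : ℝ) : ℂ)‖ ≤ ‖ρ‖ ^ 2 + 2 * C * (‖ρ‖ * ‖k‖⁻¹) := by
    rw [← Complex.ofReal_sub, norm_real, norm_eq_abs,
      show ‖u k‖ ^ 2 - ‖M‖ ^ 2 = (‖u k‖ - ‖M‖) * (‖u k‖ + ‖M‖) by ring, abs_mul]
    have h2 : |‖u k‖ - ‖M‖| ≤ ‖ρ‖ := abs_norm_sub_norm_le _ _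
    have h3 : ‖u k‖ ≤ ‖ρ‖ + ‖M‖ := hu ▸ norm_add_le _ _
    have h4 : ‖M‖ ≤ C * ‖k‖⁻¹ := hC k hk
    rw [abs_of_nonneg (by positivity : 0 ≤ ‖u k‖ + ‖M‖)]
    calc |‖u k‖ - ‖M‖| * (‖u k‖ + ‖M‖) ≤ ‖ρ‖ * (‖ρ‖ + 2 * (C * ‖k‖⁻¹)) := by
          refine mul_le_mul h2 ?_ (by positivity) (by positivity)
          linarith
      _ = _ := by ring
  rw [← ofReal_norm]
  refine (ofReal_le_ofReal h1).trans (le_of_eq ?_)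
  rw [ENNReal.ofReal_add (by positivity) (by positivity), ofReal_pow (by positivity),
    ofReal_norm, ofReal_mul (by positivity), ofReal_mul (by positivity),
    ofReal_mul (by positivity), ofReal_norm]
  congr 2
  simp [ofReal]

lemma KExp.exists_planeWave (hz : Injective z)
    {α : SC} (hu : KExp z fun k => (‖k‖ : ℂ) * α k) (m : Fin N)
    (hi : ∀ L > 0, IntegrableOn α (ball 0 L)) :
    ∃ b, HasRIntegralK (fun k => (((α k * phase (z m) 1 k).re : ℝ) : ℂ)) b := by
  obtain ⟨hum, g, g', hg, hg', hr⟩ := hu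
  set h2 : Fin N → SC := fun n w => (g n w : ℂ) with hh2
  set h3 : Fin N → SC := fun n w => if n = m then 0 else I * (g' n w : ℂ) with hh3
  have c2 : ∀ n, Sm₀ (h2 n) := fun n => contDiffOn_ofReal (hg n)
  have c3 : ∀ n, Sm₀ (h3 n) := fun n => by
    by_cases hnm : n = m
    · simp only [hh3, hnm, if_true]; exact contDiffOn_const
    · simp only [hh3, hnm, if_false]; exact contDiffOn_const.mul (contDiffOn_ofReal (hg' n))
  have ie : ∀ j (h : SC), Sm₀ h → ∀ d L,
      IntegrableOn (elem j h d) (annulus L) := fun j h hh d L =>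
    intOn_annulus (continuousOn_elem j hh d) L
  set E : SC := fun k => ∑ n, (elem 2 (h2 n) (-z n + z m) k + elem 3 (h3 n) (-z n + z m) k) with hE
  have hEc : ContinuousOn E {0}ᶜ := continuousOn_finsetSum _ fun n _ =>
    (continuousOn_elem 2 (c2 n) _).add (continuousOn_elem 3 (c3 n) _)
  have hEre : ∀ k, k ≠ 0 → (E k).re = (lead z g g' k * phase (z m) 1 k / (‖k‖ : ℂ)).re := by
    intro k hk
    have hk' : (‖k‖ : ℂ) ≠ 0 := by exact_mod_cast norm_ne_zero_iff.2 hk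
    rw [hE, lead, sum_mul, Finset.sum_div, re_sum, re_sum]
    refine sum_congr rfl fun n _ => ?_
    by_cases hnm : n = m
    · subst hnm
      have h1 : phase (-z n) 1 k * phase (z n) 1 k = 1 := by rw [phase_mul]; simp [phase]
      have h3' : phase (-z n) 1 k * (g n (khat k) / (‖k‖ : ℂ)
          + I * g' n (khat k) / (‖k‖ : ℂ) ^ 2) * phase (z n) 1 k / (‖k‖ : ℂ)
          = ((g n (khat k) / ‖k‖ ^ 2 : ℝ) : ℂ) + ((g' n (khat k) / ‖k‖ ^ 3 : ℝ) : ℂ) * I := by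
        push_cast
        field_simp
        linear_combination ((‖k‖ : ℂ) * g n (khat k) + I * g' n (khat k)) * h1
      rw [h3']
      have h4 : elem 2 (h2 n) (-z n + z n) k + elem 3 (h3 n) (-z n + z n) k
          = ((g n (khat k) / ‖k‖ ^ 2 : ℝ) : ℂ) := by
        simp [elem, hh2, hh3, phase]
      rw [h4]
      simp only [add_re, ofReal_re, Complex.re_ofReal_mul, I_re]
      ring
    · congr 1
      simp only [elem, hh2, hh3, hnm, if_false, ← phase_mul]
      field_simp
  obtain ⟨d, hd⟩ : ∃ d, HasRLimTop (fun L => ∫ k in annulus L, E k) d := by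
    choose b2 hb2 using fun n => elem_two (c2 n) (-z n + z m)
    have e3 : ∀ n, ∃ b, HasRLimTop (fun L => ∫ k in annulus L, elem 3 (h3 n) (-z n + z m) k) b := by
      intro n
      by_cases hnm : n = m
      · have : h3 n = fun _ => 0 := by ext w; simp [hh3, hnm]
        rw [this]
        exact elem_zero_fn 3 _
      · refine elem_three (c3 n) fun h => hnm (hz ?_)
        exact neg_inj.1 (eq_neg_of_add_eq_zero_left h)
    choose b3 hb3 using e3
    refine ⟨∑ n, (b2 n + b3 n), (HasRLimTop.sum univ fun n _ =>
      (hb2 n).add (hb3 n)).congr (Eventually.of_forall fun L => ?_)⟩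
    simp only [hE]
    have h23 : ∀ n, IntegrableOn (fun k => elem 2 (h2 n) (-z n + z m) k
        + elem 3 (h3 n) (-z n + z m) k) (annulus L) := fun n =>
      (ie 2 _ (c2 n) _ L).add (ie 3 _ (c3 n) _ L)
    rw [integral_finsetSum _ fun n _ => h23 n]
    refine sum_congr rfl fun n _ => ?_
    rw [integral_add (ie 2 _ (c2 n) _ L) (ie 3 _ (c3 n) _ L)]
  have hd' : HasRLimTop (fun L => ∫ k in annulus L, (((E k).re : ℝ) : ℂ)) (d.re : ℂ) := by
    refine hd.re.congr (Eventually.of_forall fun L => ?_)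
    simp only
    rw [integral_complex_ofReal]
    congr 1
    exact (integral_re (intOn_annulus hEc L)).symm
  have hpm : AEStronglyMeasurable (phase (z m) 1) volume :=
    (contDiff_phase (z m) 1).continuous.aestronglyMeasurable
  refine exists_hasRLimTop_ball (fun L hL => ?_)
    (continuous_ofReal.comp_continuousOn (Complex.continuous_re.comp_continuousOn hEc)) hd' ?_
  · have h1 : IntegrableOn (fun k => α k * phase (z m) 1 k) (ball 0 L) :=
      Integrable.mul_bdd (c := 1) (hi L hL) hpm.restrict (Eventually.of_forall fun k => (norm_phase _ _ _).le)
    exact h1.re.ofReal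
  refine hr.1.mono fun k hk => ?_
  have hk1 : 0 < ‖k‖ := by linarith
  have hk' : (‖k‖ : ℂ) ≠ 0 := by exact_mod_cast hk1.ne'
  have h1 : (((α k * phase (z m) 1 k).re : ℝ) : ℂ) - (((E k).re : ℝ) : ℂ)
      = ((((‖k‖ : ℂ) * α k - lead z g g' k) * phase (z m) 1 k / (‖k‖ : ℂ)).re : ℝ) := by
    rw [hEre k (norm_pos_iff.1 hk1), ← Complex.ofReal_sub, ← sub_re]
    congr 2
    field_simp
  show ‖(((α k * phase (z m) 1 k).re : ℝ) : ℂ) - (((E k).re : ℝ) : ℂ)‖ₑ ≤ _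
  rw [h1, ← ofReal_norm, ← ofReal_norm, ← ofReal_mul (norm_nonneg _)]
  refine ofReal_le_ofReal ?_
  rw [norm_real]
  refine (Complex.abs_re_le_norm _).trans (le_of_eq ?_)
  rw [norm_div, norm_mul, norm_phase, mul_one, Complex.norm_of_nonneg hk1.le, div_eq_mul_inv]

end

section

lemma integral_weight {ε : ℝ} (hε : 0 < ε) (r : ℝ) :
    IntegrableOn (fun L : ℝ => 2 * ε * L * gs ε L) (Ioi r) ∧
    ∫ L in Ioi r, 2 * ε * L * gs ε L = gs ε r := by
  have hi : Integrable (fun L : ℝ => 2 * ε * L * gs ε L) := by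
    have := (integrable_mul_exp_neg_mul_sq hε).const_mul (2 * ε)
    simpa only [mul_assoc] using this
  refine ⟨hi.integrableOn, ?_⟩
  have hd : ∀ L ∈ Set.Ici r, HasDerivAt (fun L : ℝ => -gs ε L)
      (2 * ε * L * gs ε L) L := by
    intro L _
    have := (((hasDerivAt_pow 2 L).const_mul (-ε)).exp).neg
    refine this.congr_deriv ?_
    push_cast; ring
  have ht : Tendsto (fun L : ℝ => -gs ε L) atTop (𝓝 0) := by
    rw [← neg_zero]
    refine Tendsto.neg (Real.tendsto_exp_atBot.comp ?_)
    exact Tendsto.const_mul_atTop_of_neg (neg_lt_zero.2 hε) (tendsto_pow_atTop two_ne_zero)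
  rw [integral_Ioi_of_hasDerivAt_of_tendsto' hd hi.integrableOn ht]
  ring

lemma integral_two_mul_sq_mul_exp {ε : ℝ} (hε : 0 < ε) :
    IntegrableOn (fun L : ℝ => 2 * ε * L ^ 2 * gs ε L) (Ioi 0) ∧
    ∫ L in Ioi (0 : ℝ), 2 * ε * L ^ 2 * gs ε L
      = (∫ L in Ioi (0 : ℝ), 2 * L ^ 2 * Real.exp (-L ^ 2)) / √ε := by
  constructor
  · have := (integrable_rpow_mul_exp_neg_mul_sq hε (s := 2) (by norm_num)).const_mul (2 * ε)
    simp only [Real.rpow_two, ← mul_assoc] at this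
    exact this.integrableOn
  · have h := integral_comp_mul_left_Ioi (fun L : ℝ => 2 * L ^ 2 * Real.exp (-L ^ 2)) 0 (sqrt_pos.2 hε)
    rw [mul_zero, smul_eq_mul] at h
    rw [div_eq_inv_mul, ← h]
    congr 1; ext L
    rw [mul_pow, sq_sqrt hε.le]
    ring_nf

lemma HasRIntegralK.tendsto_gaussian {g : SC} {d : ℂ} (h : HasRIntegralK g d)
    (hg : ∀ ε > 0, Integrable fun k => g k * (gs ε ‖k‖ : ℂ)) :
    ∃ c : ℂ, Tendsto (fun ε : ℝ => (∫ k, g k * (gs ε ‖k‖ : ℂ)) - c / (√ε : ℂ)) (𝓝[>] 0) (𝓝 d) := by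
  obtain ⟨hloc, c, hO⟩ := h
  set I : ℝ → ℂ := fun L => ∫ k in ball (0 : Space) L, g k with hI
  -- the remainder is bounded by `C / L` on the whole half-line
  obtain ⟨C, hC⟩ : ∃ C : ℝ, ∀ L > 0, ‖I L - (c * (L : ℂ) + d)‖ ≤ C / L := by
    obtain ⟨C, hC⟩ := hO.bound
    obtain ⟨L₀, hL₀⟩ := eventually_atTop.1 hC
    set L₁ := max L₀ 1
    have hL₁ : 0 < L₁ := lt_of_lt_of_le one_pos (le_max_right _ _)
    set B := ∫ k in ball (0 : Space) L₁, ‖g k‖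
    refine ⟨max C (L₁ * (B + ‖c‖ * L₁ + ‖d‖)), fun L hL => ?_⟩
    rcases le_total L₁ L with hLL | hLL
    · have := hL₀ L ((le_max_left _ _).trans hLL)
      rw [norm_inv, norm_of_nonneg hL.le] at this
      refine this.trans ?_
      rw [div_eq_mul_inv]
      exact mul_le_mul_of_nonneg_right (le_max_left _ _) (inv_nonneg.2 hL.le)
    · have h1 : ‖I L‖ ≤ B := (norm_integral_le_integral_norm _).trans
        (setIntegral_mono_set (hloc _ hL₁).norm (ae_of_all _ fun _ => norm_nonneg _)
          (Metric.ball_subset_ball hLL).eventuallyLE)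
      have h2 : ‖I L - (c * (L : ℂ) + d)‖ ≤ B + ‖c‖ * L₁ + ‖d‖ := by
        calc _ ≤ ‖I L‖ + (‖c * (L : ℂ)‖ + ‖d‖) := (norm_sub_le _ _).trans (by gcongr; exact norm_add_le _ _)
          _ ≤ _ := by
            rw [norm_mul, norm_real, norm_of_nonneg hL.le]
            have := mul_le_mul_of_nonneg_left hLL (norm_nonneg c)
            linarith
      rw [le_div_iff₀ hL]
      refine le_trans ?_ (le_max_right _ _)
      rw [mul_comm]
      exact mul_le_mul hLL h2 (norm_nonneg _) hL₁.le
  have key : ∀ ε > 0, IntegrableOn (fun L : ℝ => (2 * ε * L * gs ε L : ℝ) * I L)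
      (Ioi 0) ∧ ∫ k, g k * (gs ε ‖k‖ : ℂ)
        = ∫ L in Ioi (0 : ℝ), (2 * ε * L * gs ε L : ℝ) * I L := by
    intro ε hε
    set w : ℝ → ℝ := fun L => 2 * ε * L * gs ε L with hw
    have hwc : Continuous w := by fun_prop
    set K : Space × ℝ → ℂ := fun p => {p : Space × ℝ | ‖p.1‖ < p.2}.indicator (fun p => g p.1 * (w p.2 : ℂ)) p with hK
    have hms : MeasurableSet {p : Space × ℝ | ‖p.1‖ < p.2} :=
      measurableSet_lt (by fun_prop) (by fun_prop)
    have hgm : AEStronglyMeasurable g volume := by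
      have := (hg 1 one_pos).aestronglyMeasurable.mul (f := fun k : Space => g k * (gs 1 ‖k‖ : ℂ))
        (g := fun k : Space => (Real.exp (‖k‖ ^ 2) : ℂ))
        (Continuous.aestronglyMeasurable (by fun_prop))
      refine this.congr (ae_of_all _ fun k => ?_)
      simp only [Pi.mul_apply]
      rw [mul_assoc, ← Complex.ofReal_mul, ← Real.exp_add]; simp
    have hKm : AEStronglyMeasurable K (volume.prod (volume.restrict (Ioi (0 : ℝ)))) := by
      refine AEStronglyMeasurable.indicator ?_ hms
      exact hgm.comp_fst.mul (Continuous.aestronglyMeasurable (by fun_prop))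
    have hsec : ∀ k : Space, (fun L => K (k, L)) = (Ioi ‖k‖).indicator fun L => g k * (w L : ℂ) := by
      intro k; ext L; simp [hK, Set.indicator]
    have hsub : ∀ k : Space, Ioi (0 : ℝ) ∩ Ioi ‖k‖ = Ioi ‖k‖ := fun k =>
      Set.inter_eq_right.2 (Set.Ioi_subset_Ioi (norm_nonneg _))
    have hint : ∀ k, ∫ L in Ioi (0 : ℝ), K (k, L) = g k * (gs ε ‖k‖ : ℂ) := by
      intro k
      rw [hsec, setIntegral_indicator measurableSet_Ioi, hsub, integral_const_mul,
        integral_complex_ofReal, (integral_weight hε _).2]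
    have hKi : Integrable K (volume.prod (volume.restrict (Ioi (0 : ℝ)))) := by
      rw [integrable_prod_iff hKm]
      constructor
      · refine ae_of_all _ fun k => ?_
        rw [hsec, integrable_indicator_iff measurableSet_Ioi, IntegrableOn,
          Measure.restrict_restrict measurableSet_Ioi, Set.inter_comm, hsub]
        exact ((integral_weight hε ‖k‖).1.ofReal).const_mul _
      · refine (hg ε hε).norm.congr (ae_of_all _ fun k => ?_)
        have : (fun L => ‖K (k, L)‖) = (Ioi ‖k‖).indicator fun L => ‖g k‖ * ‖w L‖ := by
          ext L
          rw [show K (k, L) = _ from congrFun (hsec k) L]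
          by_cases hL : L ∈ Ioi ‖k‖ <;> simp [hL]
        beta_reduce
        rw [this, setIntegral_indicator measurableSet_Ioi, hsub, integral_const_mul, norm_mul]
        congr 1
        rw [norm_real, norm_of_nonneg (exp_pos _).le, ← (integral_weight hε _).2]
        refine setIntegral_congr_fun measurableSet_Ioi fun L hL => ?_
        have : 0 < L := lt_of_le_of_lt (norm_nonneg _) hL
        exact (norm_of_nonneg (by positivity)).symm
    have hswap : ∀ L : ℝ, ∫ k, K (k, L) = (w L : ℂ) * I L := by
      intro L
      have : (fun k => K (k, L)) = (ball (0 : Space) L).indicator fun k => (w L : ℂ) * g k := by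
        ext k; simp [hK, Set.indicator, mul_comm]
      rw [this, integral_indicator isOpen_ball.measurableSet, integral_const_mul]
    constructor
    · refine hKi.integral_prod_right.congr (ae_of_all _ fun L => hswap L)
    · rw [← integral_congr_ae (ae_of_all _ hint), integral_integral_swap (f := fun k L => K (k, L)) hKi]
      exact integral_congr_ae (ae_of_all _ hswap)
  set T : ℝ := ∫ L in Ioi (0 : ℝ), 2 * L ^ 2 * Real.exp (-L ^ 2)
  refine ⟨c * T, ?_⟩
  rw [tendsto_iff_norm_sub_tendsto_zero]
  have hlim : Tendsto (fun ε : ℝ => C * √(π * ε)) (𝓝[>] 0) (𝓝 0) := by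
    have : Continuous fun ε : ℝ => C * √(π * ε) := by fun_prop
    have h0 := this.tendsto 0
    simp only [mul_zero, Real.sqrt_zero] at h0
    exact h0.mono_left nhdsWithin_le_nhds
  refine squeeze_zero' (Eventually.of_forall fun _ => norm_nonneg _) ?_ hlim
  filter_upwards [self_mem_nhdsWithin] with ε hε
  have hε : 0 < ε := hε
  obtain ⟨hi, he⟩ := key ε hε
  have i1 := (integral_weight hε 0)
  have i2 := integral_two_mul_sq_mul_exp hε
  have j1 : IntegrableOn (fun L : ℝ => d * ((2 * ε * L * gs ε L : ℝ) : ℂ))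
    (Ioi 0) := i1.1.ofReal.const_mul d
  have j2 : IntegrableOn (fun L : ℝ => c * ((2 * ε * L ^ 2 * gs ε L : ℝ) : ℂ))
    (Ioi 0) := i2.1.ofReal.const_mul c
  have e1 : ∫ L in Ioi (0 : ℝ), d * ((2 * ε * L * gs ε L : ℝ) : ℂ) = d := by
    rw [integral_const_mul, integral_complex_ofReal, i1.2]; simp
  have e2 : ∫ L in Ioi (0 : ℝ), c * ((2 * ε * L ^ 2 * gs ε L : ℝ) : ℂ) = c * T / (√ε : ℂ) := by
    rw [integral_const_mul, integral_complex_ofReal, i2.2]; push_cast; ring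
  have hsplit : (∫ k, g k * (gs ε ‖k‖ : ℂ)) - c * T / (√ε : ℂ) - d
      = ∫ L in Ioi (0 : ℝ), (2 * ε * L * gs ε L : ℝ) * (I L - (c * (L : ℂ) + d)) := by
    rw [he, ← e2]
    conv_lhs => rw [← e1]
    rw [← integral_sub hi j2]
    have j3 : IntegrableOn (fun L : ℝ => (2 * ε * L * gs ε L : ℝ) * I L -
      c * ((2 * ε * L ^ 2 * gs ε L : ℝ) : ℂ)) (Ioi 0) := hi.sub j2
    rw [← integral_sub j3 j1]
    congr 1; ext L
    push_cast; ring
  rw [hsplit]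
  have hgi : IntegrableOn (fun L : ℝ => C * (2 * ε * gs ε L)) (Ioi 0) :=
    (((integrable_exp_neg_mul_sq hε).const_mul (2 * ε)).const_mul C).integrableOn
  refine (norm_integral_le_of_norm_le hgi ?_).trans ?_
  · refine (ae_restrict_iff' measurableSet_Ioi).2 (ae_of_all _ fun L hL => ?_)
    have hL : 0 < L := hL
    rw [norm_mul, norm_real, norm_of_nonneg (by positivity)]
    calc _ ≤ (2 * ε * L * gs ε L) * (C / L) := by
          exact mul_le_mul_of_nonneg_left (hC L hL) (by positivity)
      _ = _ := by field_simp
  · rw [integral_const_mul, integral_const_mul, integral_gaussian_Ioi]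
    apply le_of_eq
    have : √(π * ε) = ε * √(π / ε) := by
      rw [← sqrt_sq hε.le, ← Real.sqrt_mul (by positivity), sqrt_sq hε.le]
      congr 1; field_simp
    rw [this]; ring

end

section

variable {f g u w : SC} {C : ℝ}
open scoped SchwartzMap FourierTransform

/-- The (non-normalised) Fourier integral `∫ e^{i k·x} φ(x) dx`. -/
def fint (φ : SC) (k : Space) : ℂ :=
  ∫ x, exp (I * ⟪k,x⟫) * φ x

lemma fint_eq (φ : SC) (k : Space) : fint φ k = 𝓕⁻ φ ((2 * π)⁻¹ • k) := by
  rw [Real.fourierInv_eq', fint]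
  congr 1; ext x
  rw [smul_eq_mul, inner_smul_right, real_inner_comm]
  congr 2
  have : (π : ℂ) ≠ 0 := by exact_mod_cast pi_ne_zero
  push_cast; field_simp

lemma fint_smul (φ : SC) (k : Space) : fint φ ((2 * π) • k) = 𝓕⁻ φ k := by
  rw [fint_eq, smul_smul, inv_mul_cancel₀ (by positivity), one_smul]

/-- Functions that define tempered distributions by integration. -/
def Tempered (f : SC) : Prop :=
  AEStronglyMeasurable f volume ∧ ∃ m : ℕ, Integrable fun x => ‖f x‖ / (1 + ‖x‖) ^ m

/-- `f(x) = (2π)^{-3} ∫ u(k) e^{i k·x} dk` in the sense of tempered distributions. -/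
def WeakFT (f u : SC) : Prop :=
  Tempered f ∧ Tempered u ∧ ∀ φ : 𝓢(Space, ℂ),
    ∫ x, f x * φ x = (1 / (2 * (π : ℂ)) ^ 3) * ∫ k, u k * fint φ k

lemma schwartzMap_exists_norm_mul_pow_le (φ : 𝓢(Space, ℂ)) (m : ℕ) : ∃ C, ∀ x, (1 + ‖x‖) ^ m * ‖φ x‖ ≤ C := by
  have := fun x => SchwartzMap.one_add_le_sup_seminorm_apply (𝕜 := ℝ) (m := (m, 0)) le_rfl le_rfl φ x
  simp only [norm_iteratedFDeriv_zero] at this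
  exact ⟨_, this⟩

lemma Tempered.integrable_mul (hf : Tempered f) (φ : 𝓢(Space, ℂ)) :
    Integrable fun x => f x * φ x := by
  obtain ⟨hm, m, hi⟩ := hf
  obtain ⟨C, hC⟩ := schwartzMap_exists_norm_mul_pow_le φ m
  refine (hi.mul_const C).mono' (hm.mul φ.continuous.aestronglyMeasurable) (ae_of_all _ fun x => ?_)
  have hp : 0 < (1 + ‖x‖) ^ m := by positivity
  rw [norm_mul, div_mul_eq_mul_div, le_div_iff₀ hp, mul_assoc]
  refine mul_le_mul_of_nonneg_left ?_ (norm_nonneg _)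
  rw [mul_comm]; exact hC x

lemma schwartzMap_exists_dilation (φ : 𝓢(Space, ℂ)) {c : ℝ} (hc : c ≠ 0) :
    ∃ ψ : 𝓢(Space, ℂ), ∀ x, ψ x = φ (c • x) := by
  have hg : Function.HasTemperateGrowth fun k : Space => c • k := by fun_prop
  have ha : AntilipschitzWith ‖c⁻¹‖₊ fun k : Space => c • k := by
    refine AntilipschitzWith.of_le_mul_dist fun x y => ?_
    rw [dist_smul₀, coe_nnnorm, ← mul_assoc, ← norm_mul, inv_mul_cancel₀ hc, norm_one, one_mul]
  exact ⟨SchwartzMap.compCLMOfAntilipschitz ℂ hg ha φ, fun x => rfl⟩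

lemma schwartzMap_exists_fint_eq (φ : 𝓢(Space, ℂ)) : ∃ ψ : 𝓢(Space, ℂ), ∀ k, fint φ k = ψ k := by
  obtain ⟨ψ, hψ⟩ := schwartzMap_exists_dilation (𝓕⁻ φ) (c := (2 * π)⁻¹) (by positivity)
  exact ⟨ψ, fun k => by rw [hψ, fint_eq, fourierInv_coe]⟩

lemma schwartzMap_exists_fint (ψ : 𝓢(Space, ℂ)) : ∃ φ : 𝓢(Space, ℂ), ∀ k, fint φ k = ψ k := by
  have hc : (2 * π) ≠ 0 := by positivity
  obtain ⟨χ, hχ⟩ := schwartzMap_exists_dilation ψ hc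
  refine ⟨𝓕 χ, fun k => ?_⟩
  rw [fint_eq, ← fourierInv_coe, FourierTransform.fourierInv_fourier_eq, hχ,
    smul_smul, mul_inv_cancel₀ hc, one_smul]

lemma Tempered.integrable_mul_fint (hf : Tempered f)
    (φ : 𝓢(Space, ℂ)) : Integrable fun x => f x * fint φ x := by
  obtain ⟨ψ, hψ⟩ := schwartzMap_exists_fint_eq φ
  simp only [hψ]; exact hf.integrable_mul ψ

lemma Tempered.locallyIntegrable (hf : Tempered f) : LocallyIntegrable f := by
  obtain ⟨hm, m, hi⟩ := hf
  rw [locallyIntegrable_iff]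
  intro K hK
  obtain ⟨R, hR⟩ := hK.isBounded.exists_norm_le
  refine Integrable.mono' (hi.mul_const ((1 + |R|) ^ m)).integrableOn hm.restrict ?_
  refine (ae_restrict_iff' hK.measurableSet).2 (ae_of_all _ fun x hx => ?_)
  have hp : 0 < (1 + ‖x‖) ^ m := by positivity
  rw [div_mul_eq_mul_div, le_div_iff₀ hp]
  refine mul_le_mul_of_nonneg_left ?_ (norm_nonneg _)
  have := (hR x hx).trans (le_abs_self R)
  gcongr

lemma aesm_norm_div (hf : AEStronglyMeasurable f volume) (m : ℕ) :
    AEStronglyMeasurable (fun x => ‖f x‖ / (1 + ‖x‖) ^ m) volume :=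
  (hf.norm.aemeasurable.div (by fun_prop : Measurable fun x : Space => (1 + ‖x‖) ^ m).aemeasurable).aestronglyMeasurable

lemma Tempered.add (hf : Tempered f) (hg : Tempered g) : Tempered fun x => f x + g x := by
  obtain ⟨hm, m, hi⟩ := hf
  obtain ⟨hm', m', hi'⟩ := hg
  refine ⟨hm.add hm', max m m', (hi.add hi').mono' ?_ (ae_of_all _ fun x => ?_)⟩
  · exact aesm_norm_div (hm.add hm') _
  · have h1 : (1 : ℝ) ≤ 1 + ‖x‖ := by linarith [norm_nonneg x]
    have hp : 0 < 1 + ‖x‖ := by positivity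
    rw [norm_of_nonneg (by positivity)]
    simp only [Pi.add_apply]
    calc _ ≤ (‖f x‖ + ‖g x‖) / (1 + ‖x‖) ^ max m m' := by gcongr; exact norm_add_le _ _
      _ = ‖f x‖ / (1 + ‖x‖) ^ max m m' + ‖g x‖ / (1 + ‖x‖) ^ max m m' := add_div _ _ _
      _ ≤ _ := by
        gcongr
        · exact le_max_left _ _
        · exact le_max_right _ _

lemma Tempered.const_mul (hf : Tempered f) (c : ℂ) : Tempered fun x => c * f x := by
  obtain ⟨hm, m, hi⟩ := hf
  refine ⟨hm.const_mul c, m, (hi.const_mul ‖c‖).congr (ae_of_all _ fun x => ?_)⟩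
  simp only [norm_mul]; ring

lemma Tempered.congr (hf : Tempered f) (h : f =ᵐ[volume] g) : Tempered g := by
  obtain ⟨hm, m, hi⟩ := hf
  refine ⟨hm.congr h, m, hi.congr ?_⟩
  filter_upwards [h] with x hx
  rw [hx]

lemma isTempered_zero : Tempered fun _ => 0 :=
  ⟨aestronglyMeasurable_const, 0, by simp⟩

lemma Tempered.sum {ι : Type*} {s : Finset ι} {f : ι → SC}
    (hf : ∀ i ∈ s, Tempered (f i)) : Tempered fun x => ∑ i ∈ s, f i x := by
  classical
  induction s using induction_on with
  | empty => simpa using isTempered_zero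
  | insert i s hi ih =>
    simp only [sum_insert hi]
    exact (hf i (by simp)).add (ih fun j hj => hf j (by simp [hj]))

lemma Tempered.of_le (hf : Tempered f) (hg : AEStronglyMeasurable g volume) {j : ℕ}
    (h : ∀ᵐ x, ‖g x‖ ≤ C * (1 + ‖x‖) ^ j * ‖f x‖) : Tempered g := by
  obtain ⟨hm, m, hi⟩ := hf
  refine ⟨hg, m + j, (hi.const_mul C).mono' ?_ ?_⟩
  · exact aesm_norm_div hg _
  · filter_upwards [h] with x hx
    have hp : 0 < (1 + ‖x‖) := by positivity
    rw [norm_of_nonneg (by positivity), div_le_iff₀ (by positivity), pow_add]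
    refine hx.trans (le_of_eq ?_)
    field_simp

lemma _root_.MeasureTheory.Integrable.isTempered (hf : Integrable f) : Tempered f :=
  ⟨hf.aestronglyMeasurable, 0, by simpa using hf.norm⟩

lemma integrable_one_div_pow : Integrable fun x : Space => 1 / (1 + ‖x‖) ^ 4 := by
  have := integrable_one_add_norm (E := Space) (μ := volume) (r := 4) (by simp; norm_num)
  refine this.congr (ae_of_all _ fun x => ?_)
  have hp : 0 < (1 + ‖x‖) := by positivity
  simp only [one_div]
  rw [Real.rpow_neg hp.le]
  norm_cast

lemma isTempered_one : Tempered fun _ => 1 := by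
  refine ⟨aestronglyMeasurable_const, 4, ?_⟩
  simpa using integrable_one_div_pow

lemma isTempered_of_bound (hg : AEStronglyMeasurable g volume) {j : ℕ}
    (h : ∀ᵐ x, ‖g x‖ ≤ C * (1 + ‖x‖) ^ j) : Tempered g :=
  isTempered_one.of_le hg (by simpa using h)

lemma _root_.MeasureTheory.MemLp.isTempered (hf : MemLp f 2 volume) : Tempered f := by
  refine ⟨hf.aestronglyMeasurable, 4, ?_⟩
  have h2 : Integrable fun x => ‖f x‖ ^ 2 := hf.integrable_norm_pow two_ne_zero
  refine (h2.add integrable_one_div_pow).mono' ?_ (ae_of_all _ fun x => ?_)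
  · exact aesm_norm_div hf.aestronglyMeasurable _
  · have hp : 1 ≤ (1 + ‖x‖) ^ 4 := one_le_pow₀ (by linarith [norm_nonneg x])
    rw [norm_of_nonneg (by positivity)]
    simp only [Pi.add_apply]
    set q := (1 + ‖x‖) ^ 4
    have h1 : q⁻¹ ≤ 1 := inv_le_one_of_one_le₀ hp
    have h0 : 0 < q⁻¹ := by positivity
    rw [div_eq_mul_inv, one_div]
    nlinarith [sq_nonneg (‖f x‖ - 1), norm_nonneg (f x), mul_nonneg (sub_nonneg.2 h1) (sq_nonneg ‖f x‖), mul_nonneg h0.le (sq_nonneg (‖f x‖ - 1))]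

/-! ### Linearity and uniqueness -/

lemma WeakFT.add (hf : WeakFT f u) (hg : WeakFT g w) :
    WeakFT (fun x => f x + g x) fun k => u k + w k := by
  refine ⟨hf.1.add hg.1, hf.2.1.add hg.2.1, fun φ => ?_⟩
  simp only [add_mul]
  rw [integral_add (hf.1.integrable_mul φ) (hg.1.integrable_mul φ),
    integral_add (hf.2.1.integrable_mul_fint φ) (hg.2.1.integrable_mul_fint φ),
    hf.2.2, hg.2.2]
  ring

lemma WeakFT.const_mul (hf : WeakFT f u) (c : ℂ) : WeakFT (fun x => c * f x) fun k => c * u k := by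
  refine ⟨hf.1.const_mul c, hf.2.1.const_mul c, fun φ => ?_⟩
  simp only [mul_assoc]
  rw [integral_const_mul, integral_const_mul, hf.2.2]
  ring

lemma WeakFT.sub (hf : WeakFT f u) (hg : WeakFT g w) :
    WeakFT (fun x => f x - g x) fun k => u k - w k := by
  have := hf.add (hg.const_mul (-1))
  simpa [sub_eq_add_neg] using this

lemma weakFT_zero : WeakFT (fun _ => 0) fun _ => 0 :=
  ⟨isTempered_zero, isTempered_zero, fun φ => by simp⟩

lemma WeakFT.sum {ι : Type*} {s : Finset ι} {f u : ι → SC} (h : ∀ i ∈ s, WeakFT (f i) (u i)) :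
    WeakFT (fun x => ∑ i ∈ s, f i x) fun k => ∑ i ∈ s, u i k := by
  classical
  induction s using induction_on with
  | empty => simpa using weakFT_zero
  | insert i s hi ih =>
    simp only [sum_insert hi]
    exact (h i (by simp)).add (ih fun j hj => h j (by simp [hj]))

lemma WeakFT.congr (h : WeakFT f u) (hf : f =ᵐ[volume] g)
    (hu : u =ᵐ[volume] w) : WeakFT g w := by
  refine ⟨h.1.congr hf, h.2.1.congr hu, fun φ => ?_⟩
  rw [← integral_congr_ae (hf.mono fun x hx => show f x * φ x = g x * φ x by rw [hx]), h.2.2 φ]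
  congr 1
  exact integral_congr_ae (hu.mono fun x hx => by simp only [hx])

lemma WeakFT.ae_eq (hu : WeakFT f u) (hw : WeakFT f w) : u =ᵐ[volume] w := by
  refine ae_eq_of_integral_contDiff_smul_eq hu.2.1.locallyIntegrable hw.2.1.locallyIntegrable fun g hg hc => ?_
  have hg₁ : HasCompactSupport (ofRealCLM ∘ g) := hc.comp_left rfl
  have hg₂ : C∞ (ofRealCLM ∘ g) := by fun_prop
  obtain ⟨φ, hφ⟩ := schwartzMap_exists_fint (hg₁.toSchwartzMap hg₂)
  have h := (hu.2.2 φ).symm.trans (hw.2.2 φ)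
  have hpi : (π : ℂ) ≠ 0 := by exact_mod_cast pi_ne_zero
  have h2 := mul_left_cancel₀ (by simp [hpi]) h
  simp only [hφ] at h2
  simpa [mul_comm] using h2

lemma integral_mul_fint (u : SC) (φ : SC) :
    (1 / (2 * (π : ℂ)) ^ 3) * ∫ k, u k * fint φ k = ∫ k, u ((2 * π) • k) * 𝓕⁻ φ k := by
  have := Measure.integral_comp_smul vol (fun k => u k * fint φ k) (2 * π)
  simp only [fint_smul] at this
  rw [this, finrank_euclideanSpace_fin, abs_of_pos (by positivity), real_smul]
  push_cast; rw [one_div]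

/-! ### Integrable and square integrable functions -/

lemma weakFT_of_integrable (hf : Integrable f) : WeakFT f fun k => fint f (-k) := by
  have hb : ∀ k, ‖fint f k‖ ≤ ∫ x, ‖f x‖ := by
    intro k
    refine (norm_integral_le_integral_norm _).trans (le_of_eq ?_)
    congr 1; ext x
    rw [norm_mul, Complex.norm_exp]; simp
  have he : (fun k : Space => fint f (-k)) = fun k => 𝓕 f ((2 * π)⁻¹ • k) := by
    ext k; rw [fint_eq, Real.fourierInv_eq_fourier_neg]; simp
  have hc : Continuous fun k => fint f (-k) := by
    rw [he]
    exact (VectorFourier.fourierIntegral_continuous Real.continuous_fourierChar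
      (by exact continuous_inner) hf).comp (by fun_prop)
  refine ⟨hf.isTempered, isTempered_of_bound (C := ∫ x, ‖f x‖) (j := 0)
    hc.aestronglyMeasurable (ae_of_all _ fun k => by simpa using hb _), fun φ => ?_⟩
  rw [he, integral_mul_fint]
  simp only [smul_smul, inv_mul_cancel₀ (show (2 * π) ≠ 0 by positivity), one_smul]
  have h := VectorFourier.integral_fourierIntegral_smul_eq_flip (μ := volume) (ν := volume)
    (L := innerₗ Space) (f := f) (g := (𝓕⁻ φ : 𝓢(Space, ℂ))) Real.continuous_fourierChar
    (by exact continuous_inner) hf (𝓕⁻ φ).integrable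
  rw [flip_innerₗ] at h
  have h1 : VectorFourier.fourierIntegral Real.fourierChar volume (innerₗ Space)
      ((𝓕⁻ φ : 𝓢(Space, ℂ)) : SC) = φ := by
    change 𝓕 ((𝓕⁻ φ : 𝓢(Space, ℂ)) : SC) = φ
    rw [← SchwartzMap.fourier_coe, FourierTransform.fourier_fourierInv_eq]
  rw [h1] at h
  rw [← fourierInv_coe]
  exact h.symm

lemma exists_weakFT_of_memLp (hf : MemLp f 2 volume) : ∃ u, MemLp u 2 volume ∧ WeakFT f u ∧
      ∫ k, ‖u k‖ ^ 2 = (2 * π) ^ 3 * ∫ x, ‖f x‖ ^ 2 := by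
  set F := hf.toLp f
  set g : Lp ℂ 2 vol := 𝓕 F with hg
  have hc : (2 * π) ≠ 0 := by positivity
  have hn : ∀ h : Lp ℂ 2 vol, ∫ x, ‖h x‖ ^ 2 = ‖h‖ ^ 2 := by
    intro h
    have h1 := L2.inner_def (𝕜 := ℂ) h h
    have h2 : (inner ℂ h h : ℂ) = (‖h‖ ^ 2 : ℝ) := by
      rw [inner_self_eq_norm_sq_to_K]; simp
    rw [h2] at h1
    have h3 : ∀ x, inner ℂ (h x) (h x) = ((‖h x‖ ^ 2 : ℝ) : ℂ) := fun x => by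
      rw [inner_self_eq_norm_sq_to_K]; simp
    simp only [h3, integral_complex_ofReal] at h1
    exact_mod_cast h1.symm
  have hq : Measure.QuasiMeasurePreserving (fun k : Space => (2 * π)⁻¹ • k) volume volume := by
    refine ⟨by fun_prop, ?_⟩
    rw [Measure.map_addHaar_smul _ (inv_ne_zero hc)]
    exact Measure.smul_absolutelyContinuous
  have hmeas : AEStronglyMeasurable (fun k => g ((2 * π)⁻¹ • k)) volume :=
    (Lp.aestronglyMeasurable g).comp_quasiMeasurePreserving hq
  have hgi : Integrable fun k => ‖g k‖ ^ 2 := (Lp.memLp g).integrable_norm_pow two_ne_zero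
  have hmem : MemLp (fun k => g ((2 * π)⁻¹ • k)) 2 volume := by
    rw [memLp_two_iff_integrable_sq_norm hmeas]
    exact hgi.comp_smul (inv_ne_zero hc)
  refine ⟨fun k => g ((2 * π)⁻¹ • k), hmem, ⟨hf.isTempered, hmem.isTempered, fun φ => ?_⟩, ?_⟩
  · rw [integral_mul_fint]
    simp only [smul_smul, inv_mul_cancel₀ hc, one_smul]
    have h := congrArg (fun T => T (𝓕⁻ φ)) (Lp.fourier_toTemperedDistribution_eq F)
    simp only [TemperedDistribution.fourier_apply, Lp.toTemperedDistribution_apply,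
      FourierTransform.fourier_fourierInv_eq] at h
    rw [← fourierInv_coe]
    refine Eq.trans ?_ (h.trans ?_)
    · refine integral_congr_ae ?_
      filter_upwards [hf.coeFn_toLp] with x hx
      rw [smul_eq_mul, mul_comm, hx]
    · congr 1; ext k; rw [smul_eq_mul, mul_comm]
  · rw [Measure.integral_comp_smul vol (fun k => ‖g k‖ ^ 2), hn, hg,
      Lp.norm_fourier_eq, ← hn, finrank_euclideanSpace_fin]
    have h1 : ∫ x, ‖F x‖ ^ 2 = ∫ x, ‖f x‖ ^ 2 := by
      refine integral_congr_ae ?_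
      filter_upwards [hf.coeFn_toLp] with x hx
      rw [hx]
    rw [h1, smul_eq_mul, ← inv_pow, inv_inv, abs_of_pos (by positivity)]

end

section

variable {ε : ℝ} {u : SC}
open scoped SchwartzMap FourierTransform LineDeriv

/-- An integrable majorant with an inverse square singularity. -/
def env (x : Space) : ℝ := (‖x‖ ^ 2 * (1 + ‖x‖ ^ 2))⁻¹

lemma env_nonneg (x : Space) : 0 ≤ env x := by unfold env; positivity

lemma integrable_env : Integrable env := by
  have := (integrable_fun_norm_addHaar vol (f := fun r : ℝ => (r ^ 2 * (1 + r ^ 2))⁻¹)).2 ?_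
  · exact this
  · rw [finrank_euclideanSpace_fin]
    refine (integrable_inv_one_add_sq.integrableOn (s := Ioi 0)).congr_fun (fun r hr => ?_) measurableSet_Ioi
    have : (0 : ℝ) < r := hr
    simp only [smul_eq_mul]; field_simp

lemma inv_sq_le_env {x : Space} (hx : ‖x‖ ≤ 1) : (‖x‖ ^ 2)⁻¹ ≤ 2 * env x := by
  unfold env
  rw [mul_inv, ← mul_assoc, mul_comm (2 : ℝ), mul_assoc]
  refine le_mul_of_one_le_right (by positivity) ?_
  rw [← div_eq_mul_inv, le_div_iff₀ (by positivity)]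
  have := pow_le_one₀ (n := 2) (norm_nonneg x) hx
  linarith

lemma schwartzMap_fint_lineDeriv (φ : 𝓢(Space, ℂ)) (m k : Space) :
    fint (∂_{m} φ : 𝓢(Space, ℂ)) k = -(I * ⟪k,m⟫) * fint φ k := by
  have hm : (inner ℝ · m : SR).HasTemperateGrowth := by fun_prop
  rw [fint_eq, fint_eq, ← fourierInv_coe, SchwartzMap.fourierInv_lineDerivOp_eq, ← fourierInv_coe]
  simp only [smul_apply, SchwartzMap.smulLeftCLM_apply_apply hm, inner_smul_left, smul_eq_mul, real_smul]
  have : (π : ℂ) ≠ 0 := by exact_mod_cast pi_ne_zero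
  simp only [conj_trivial]
  push_cast
  field_simp

lemma WeakFT.hasLineDerivAt {f f' : SC} (h : WeakFT f u) (m : Space)
    (hf' : Tempered f') (z : Space) (hd : ∀ x, x ≠ z → HasLineDerivAt ℝ f (f' x) x m)
    {C : ℝ} (hC : ∀ x, ‖x - z‖ < 1 → x ≠ z → ‖f x‖ ≤ C / ‖x - z‖) :
    WeakFT f' fun k => I * ⟪k,m⟫ * u k := by
  have hu : Tempered fun k => I * ⟪k,m⟫ * u k := by
    refine h.2.1.of_le (C := ‖m‖) (j := 1)
      ((Continuous.aestronglyMeasurable (by fun_prop)).mul h.2.1.1) (ae_of_all _ fun k => ?_)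
    rw [norm_mul, norm_mul, norm_I, one_mul, norm_real]
    refine mul_le_mul_of_nonneg_right ((norm_inner_le_norm k m).trans ?_) (norm_nonneg _)
    rw [pow_one, mul_comm]
    exact mul_le_mul_of_nonneg_left (by linarith) (norm_nonneg _)
  refine ⟨hf', hu, fun φ => ?_⟩
  -- integration by parts
  suffices hibp : ∫ x, f' x * φ x = -∫ x, f x * (∂_{m} φ : 𝓢(Space, ℂ)) x by
    rw [hibp, h.2.2 (∂_{m} φ), ← mul_neg, ← integral_neg]
    congr 2; ext k
    rw [schwartzMap_fint_lineDeriv]; ring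
  let b : ContDiffBump (0 : Space) := ⟨1, 2, one_pos, one_lt_two⟩
  obtain ⟨B, hB⟩ : ∃ B, ∀ x, ‖fderiv ℝ b x‖ ≤ B := by
    obtain ⟨x₀, hx₀⟩ := ((b.contDiff (n := 1)).continuous_fderiv (by norm_num)).norm.exists_forall_ge_of_hasCompactSupport
      (b.hasCompactSupport.fderiv (𝕜 := ℝ)).norm
    exact ⟨_, hx₀⟩
  have hB0 : 0 ≤ B := (norm_nonneg _).trans (hB 0)
  set s : ℕ → ℝ := fun n => (n : ℝ) + 3 with hs
  have hs0 : ∀ n, 0 < s n := fun n => by simp only [hs]; positivity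
  set η : ℕ → SR := fun n x => 1 - b (s n • (x - z)) with hη
  set η' : ℕ → SR := fun n x => -(s n * fderiv ℝ b (s n • (x - z)) m) with hη'
  have hηd : ∀ n x, HasLineDerivAt ℝ (η n) (η' n x) x m := by
    intro n x
    have h1 : HasFDerivAt (fun x : Space => s n • (x - z)) (s n • ContinuousLinearMap.id ℝ Space) x :=
      ((hasFDerivAt_id x).sub_const z).const_smul (s n)
    have h2 := ((b.contDiff (n := 1)).differentiable (by norm_num) (s n • (x - z))).hasFDerivAt.comp x h1
    have h3 := (h2.const_sub 1).hasLineDerivAt m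
    refine h3.congr_deriv ?_
    simp [hη']
  have hη1 : ∀ n x, ‖η n x‖ ≤ 1 := fun n x => by
    rw [norm_eq_abs, abs_le]
    have h1 := b.nonneg (x := s n • (x - z)); have h2 := b.le_one (x := s n • (x - z))
    simp only [hη]; constructor <;> linarith
  have hsup : ∀ n x, η' n x ≠ 0 → s n * ‖x - z‖ ≤ 2 := by
    intro n x hx
    by_contra! hlt
    apply hx
    have : s n • (x - z) ∉ tsupport (b : SR) := by
      rw [b.tsupport_eq, Metric.mem_closedBall, dist_zero_right, norm_smul, norm_of_nonneg (hs0 n).le]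
      exact not_le.2 hlt
    have h0 := fderiv_of_notMem_tsupport (𝕜 := ℝ) this
    simp [hη', h0]
  have hη'b : ∀ n x, ‖η' n x‖ ≤ s n * B * ‖m‖ := fun n x => by
    rw [norm_neg, norm_mul, norm_of_nonneg (hs0 n).le, mul_assoc]
    exact mul_le_mul_of_nonneg_left (((fderiv ℝ b _).le_opNorm m).trans
      (mul_le_mul_of_nonneg_right (hB _) (norm_nonneg _))) (hs0 n).le
  have hηc : ∀ n, Continuous (η n) := fun n => by
    have := b.continuous; simp only [hη]; fun_prop
  have hη'c : ∀ n, Continuous (η' n) := fun n => by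
    have := (b.contDiff (n := 1)).continuous_fderiv (by norm_num)
    simp only [hη']; fun_prop
  have hlim : ∀ x, x ≠ z → ∀ᶠ n : ℕ in atTop, 2 < s n * ‖x - z‖ := by
    intro x hx
    have hp : 0 < ‖x - z‖ := norm_pos_iff.2 (sub_ne_zero.2 hx)
    have : Tendsto (fun n : ℕ => s n * ‖x - z‖) atTop atTop :=
      (tendsto_atTop_add_const_right _ _ tendsto_natCast_atTop_atTop).atTop_mul_const hp
    exact this.eventually_gt_atTop 2
  have hηe : ∀ x, x ≠ z → ∀ᶠ n : ℕ in atTop, η n x = 1 ∧ η' n x = 0 := by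
    intro x hx
    filter_upwards [hlim x hx] with n hn
    constructor
    · have : b (s n • (x - z)) = 0 := b.zero_of_le_dist (by
        rw [dist_zero_right, norm_smul, norm_of_nonneg (hs0 n).le]; exact hn.le)
      simp [hη, this]
    · by_contra h0
      exact absurd (hsup n x h0) (not_le.2 hn)
  have hae : ∀ᵐ x : Space, x ≠ z := by
    rw [ae_iff]; simp
  set φ' : 𝓢(Space, ℂ) := ∂_{m} φ
  have hφd : ∀ x, HasLineDerivAt ℝ φ (φ' x) x m := fun x => φ.differentiableAt.hasFDerivAt.hasLineDerivAt m
  have bdd : ∀ {F : SC} {e : SR} {c : ℝ}, Integrable F → Continuous e →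
      (∀ x, ‖e x‖ ≤ c) → Integrable fun x => F x * (e x : ℂ) := by
    intro F e c hF he hc
    exact hF.mul_bdd (c := c) (Continuous.aestronglyMeasurable (by fun_prop))
      (ae_of_all _ fun x => by rw [norm_real]; exact hc x)
  have i1 := hf'.integrable_mul φ
  have i2 := h.1.integrable_mul φ'
  have i3 := h.1.integrable_mul φ
  have ibp : ∀ n, ∫ x, f' x * φ x * (η n x : ℂ)
      = -((∫ x, f x * φ' x * (η n x : ℂ)) + ∫ x, f x * φ x * (η' n x : ℂ)) := by
    intro n
    have j1 := bdd i2 (hηc n) (hη1 n)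
    have j2 := bdd i3 (hη'c n) (hη'b n)
    rw [← integral_add j1 j2, ← neg_eq_iff_eq_neg]
    have := integral_bilinear_hasLineDerivAt_right_eq_neg_left_of_integrable (μ := volume) (v := m)
      (f := f) (f' := f') (g := fun x => φ x * (η n x : ℂ))
      (g' := fun x => φ' x * (η n x : ℂ) + φ x * (η' n x : ℂ)) (B := ContinuousLinearMap.mul ℝ ℂ) ?_ ?_ ?_ ?_ ?_
    · simp only [mul_apply', ← mul_assoc] at this
      rw [← this]
      congr 1; ext x; ring
    · simpa only [mul_apply', ← mul_assoc] using bdd i1 (hηc n) (hη1 n)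
    · have j3 : Integrable fun x => f x * φ' x * (η n x : ℂ) + f x * φ x * (η' n x : ℂ) := j1.add j2
      simpa only [mul_apply', mul_add, ← mul_assoc] using j3
    · simpa only [mul_apply', ← mul_assoc] using bdd i3 (hηc n) (hη1 n)
    · intro x hx
      refine hd x fun hxz => ?_
      subst hxz
      refine absurd hx (notMem_tsupport_iff_eventuallyEq.2 ?_)
      have : ∀ᶠ y in 𝓝 x, ‖s n • (y - x)‖ < 1 := by
        have hc : Continuous fun y : Space => ‖s n • (y - x)‖ := by fun_prop
        exact hc.continuousAt.eventually_lt continuousAt_const (by simp)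
      filter_upwards [this] with y hy
      have h1 : b (s n • (y - x)) = 1 := b.one_of_mem_closedBall (by
        rw [Metric.mem_closedBall, dist_zero_right]; exact hy.le)
      simp [hη, h1]
    · intro x _
      have h1 : HasDerivAt (fun t : ℝ => φ (x + t • m)) (φ' x) 0 := hφd x
      have h2 : HasDerivAt (fun t : ℝ => η n (x + t • m)) (η' n x) 0 := hηd n x
      change HasDerivAt (fun t : ℝ => φ (x + t • m) * (η n (x + t • m) : ℂ)) _ 0
      exact (h1.mul h2.ofReal_comp).congr_deriv (by simp)
  have t1 : Tendsto (fun n => ∫ x, f' x * φ x * (η n x : ℂ)) atTop (𝓝 (∫ x, f' x * φ x)) := by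
    refine tendsto_integral_of_dominated_convergence _ (fun n => (bdd i1 (hηc n) (hη1 n)).1) i1.norm
      (fun n => ae_of_all _ fun x => ?_) ?_
    · rw [norm_mul _ (η n x : ℂ), norm_real]
      exact mul_le_of_le_one_right (norm_nonneg _) (hη1 n x)
    · filter_upwards [hae] with x hx
      refine tendsto_const_nhds.congr' ?_
      filter_upwards [hηe x hx] with n hn
      simp [hn.1]
  have t2 : Tendsto (fun n => ∫ x, f x * φ' x * (η n x : ℂ)) atTop (𝓝 (∫ x, f x * φ' x)) := by
    refine tendsto_integral_of_dominated_convergence _ (fun n => (bdd i2 (hηc n) (hη1 n)).1) i2.norm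
      (fun n => ae_of_all _ fun x => ?_) ?_
    · rw [norm_mul _ (η n x : ℂ), norm_real]
      exact mul_le_of_le_one_right (norm_nonneg _) (hη1 n x)
    · filter_upwards [hae] with x hx
      refine tendsto_const_nhds.congr' ?_
      filter_upwards [hηe x hx] with n hn
      simp [hn.1]
  obtain ⟨M, hM⟩ := schwartzMap_exists_norm_mul_pow_le φ 0
  simp only [pow_zero, one_mul] at hM
  have t3 : Tendsto (fun n => ∫ x, f x * φ x * (η' n x : ℂ)) atTop (𝓝 0) := by
    rw [← integral_zero Space ℂ (μ := volume)]
    refine tendsto_integral_of_dominated_convergence (fun x => |C| * M * (2 * B * ‖m‖) * (2 * env (x - z)))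
      (fun n => (bdd i3 (hη'c n) (hη'b n)).1)
      (((integrable_env.comp_sub_right z).const_mul 2).const_mul _) (fun n => ?_) ?_
    · filter_upwards [hae] with x hx
      have hM0 : 0 ≤ M := (norm_nonneg _).trans (hM 0)
      have hp : 0 < ‖x - z‖ := norm_pos_iff.2 (sub_ne_zero.2 hx)
      by_cases h0 : η' n x = 0
      · rw [h0]; simp only [ofReal_zero, mul_zero, norm_zero]
        have := env_nonneg (x - z); positivity
      · have h2 := hsup n x h0
        have h3 : s n ≤ 2 / ‖x - z‖ := by rw [le_div_iff₀ hp]; exact h2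
        have hn3 : (3 : ℝ) ≤ s n := by simp [hs]
        have h4 : ‖x - z‖ < 1 := by nlinarith
        rw [norm_mul, norm_mul, norm_real]
        calc ‖f x‖ * ‖φ x‖ * ‖η' n x‖ ≤ (|C| / ‖x - z‖) * M * (2 / ‖x - z‖ * B * ‖m‖) := by
              refine mul_le_mul (mul_le_mul ((hC x h4 hx).trans ?_) (hM x) (norm_nonneg _) (by positivity))
                ((hη'b n x).trans ?_) (norm_nonneg _) (by positivity)
              · gcongr; exact le_abs_self C
              · gcongr
          _ = |C| * M * (2 * B * ‖m‖) * (‖x - z‖ ^ 2)⁻¹ := by field_simp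
          _ ≤ _ := by
            refine mul_le_mul_of_nonneg_left (inv_sq_le_env h4.le) (by positivity)
    · filter_upwards [hae] with x hx
      refine tendsto_const_nhds.congr' ?_
      filter_upwards [hηe x hx] with n hn
      simp [hn.2]
  have t4 := (t2.add t3).neg
  rw [add_zero] at t4
  exact tendsto_nhds_unique (t1.congr ibp) t4

/-! ### Gaussians -/

/-- The Gaussian `(4πε)^{-3/2} exp (-|x|²/4ε)`. -/
def heat (ε : ℝ) (x : Space) : ℝ := ((4 * π * ε) ^ (3 / 2 : ℝ))⁻¹ * Real.exp (-(4 * ε)⁻¹ * ‖x‖ ^ 2)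

lemma iteratedDeriv_ofReal_exp (n : ℕ) :
    iteratedDeriv n (fun r : ℝ => (Real.exp r : ℂ)) = fun r : ℝ => (Real.exp r : ℂ) := by
  induction n with
  | zero => simp
  | succ n ih =>
    rw [iteratedDeriv_succ, ih]
    ext r
    exact (Real.hasDerivAt_exp r).ofReal_comp.deriv

lemma exists_schwartzMap_gaussian {b : ℝ} (hb : 0 < b) :
    ∃ φ : 𝓢(Space, ℂ), ∀ x, φ x = (gs b ‖x‖ : ℂ) := by
  set f : SR := fun x => -b * ‖x‖ ^ 2 with hf
  have hft : f.HasTemperateGrowth :=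
    (Function.HasTemperateGrowth.const (-b)).mul (Function.hasTemperateGrowth_norm_sq (H := Space))
  have hg : C∞ (fun r : ℝ => (Real.exp r : ℂ)) :=
    ofRealCLM.contDiff.comp Real.contDiff_exp
  have hfs : C∞ f := hft.1
  refine ⟨⟨(fun r : ℝ => (Real.exp r : ℂ)) ∘ f, hg.comp hfs, fun k n => ?_⟩, fun x => rfl⟩
  obtain ⟨j, C, hC0, hC⟩ := hft.norm_iteratedFDeriv_le_uniform n
  set m : ℕ := k + j * n
  refine ⟨n.factorial * (1 + C) ^ n * Real.exp (m ^ 2 / (4 * b)), fun x => ?_⟩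
  have h1 : 1 ≤ (1 + C) * (1 + ‖x‖) ^ j := by
    refine one_le_mul_of_one_le_of_one_le (by linarith) (one_le_pow₀ (by linarith [norm_nonneg x]))
  have hb := norm_iteratedFDeriv_comp_le (𝕜 := ℝ) (n := n) hg hfs (by exact_mod_cast le_top) x
    (C := Real.exp (f x)) (D := (1 + C) * (1 + ‖x‖) ^ j) (fun i _ => by
      rw [norm_iteratedFDeriv_eq_norm_iteratedDeriv, iteratedDeriv_ofReal_exp, norm_real,
        norm_of_nonneg (exp_pos _).le]) (fun i hi hin => by
      refine (hC i hin x).trans ((?_ : _ ≤ (1 + C) * (1 + ‖x‖) ^ j).trans (le_self_pow₀ h1 (by omega)))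
      exact mul_le_mul_of_nonneg_right (by linarith) (by positivity))
  have hx0 := norm_nonneg x
  calc ‖x‖ ^ k * _ ≤ (1 + ‖x‖) ^ k * (n.factorial * Real.exp (f x) * ((1 + C) * (1 + ‖x‖) ^ j) ^ n) := by
        refine mul_le_mul (pow_le_pow_left₀ hx0 (by linarith) k) hb (norm_nonneg _) (by positivity)
    _ = n.factorial * (1 + C) ^ n * ((1 + ‖x‖) ^ m * Real.exp (f x)) := by
        simp only [m, pow_add, pow_mul, mul_pow]; ring
    _ ≤ _ := by
        refine mul_le_mul_of_nonneg_left ?_ (by positivity)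
        calc (1 + ‖x‖) ^ m * Real.exp (f x) ≤ Real.exp ‖x‖ ^ m * Real.exp (f x) := by
              gcongr; linarith [Real.add_one_le_exp ‖x‖]
          _ = Real.exp (m * ‖x‖ + f x) := by rw [← Real.exp_nat_mul, ← Real.exp_add]
          _ ≤ _ := by
            apply Real.exp_le_exp.2
            rw [le_div_iff₀ (by positivity)]
            simp only [hf]
            nlinarith [sq_nonneg (m - 2 * b * ‖x‖ : ℝ)]

lemma fint_heat (hε : 0 < ε) (k : Space) :
    fint (fun x => (heat ε x : ℂ)) k = (gs ε ‖k‖ : ℂ) := by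
  have hb : 0 < (((4 * ε)⁻¹ : ℝ) : ℂ).re := by simp; positivity
  have h := fourier_gaussian_innerProductSpace hb (-((2 * π)⁻¹ • k))
  have hc : ((π : ℂ) / (((4 * ε)⁻¹ : ℝ) : ℂ)) ^ ((Module.finrank ℝ Space : ℂ) / 2)
      = (((4 * π * ε) ^ (3 / 2 : ℝ) : ℝ) : ℂ) := by
    rw [Complex.ofReal_cpow (by positivity), finrank_euclideanSpace_fin]
    congr 1
    · push_cast; field_simp
    · push_cast; ring
  rw [hc] at h
  have he : (fun x => (heat ε x : ℂ)) = fun x => ((((4 * π * ε) ^ (3 / 2 : ℝ))⁻¹ : ℝ) : ℂ) *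
      exp (-(((4 * ε)⁻¹ : ℝ) : ℂ) * ‖x‖ ^ 2) := by
    ext x; simp [heat]
  rw [he, fint]
  have hcomm : ∀ x : Space, exp (I * ⟪k,x⟫) * (((((4 * π * ε) ^ (3 / 2 : ℝ))⁻¹ : ℝ) : ℂ) *
      exp (-(((4 * ε)⁻¹ : ℝ) : ℂ) * ‖x‖ ^ 2)) = ((((4 * π * ε) ^ (3 / 2 : ℝ))⁻¹ : ℝ) : ℂ) *
      (exp (I * ⟪k,x⟫) * exp (-(((4 * ε)⁻¹ : ℝ) : ℂ) * ‖x‖ ^ 2)) :=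
    fun x => by ring
  simp only [hcomm]
  rw [integral_const_mul]
  have hfi := fint_eq (fun x : Space => exp (-(((4 * ε)⁻¹ : ℝ) : ℂ) * ‖x‖ ^ 2)) k
  rw [fint] at hfi
  rw [hfi, Real.fourierInv_eq_fourier_neg, h, ← mul_assoc, ← Complex.ofReal_mul, inv_mul_cancel₀ (by positivity)]
  rw [norm_neg, norm_smul, norm_inv, norm_of_nonneg (by positivity)]
  push_cast
  rw [one_mul]
  congr 1
  have hpi : (π : ℂ) ≠ 0 := by exact_mod_cast pi_ne_zero
  have hε' : (ε : ℂ) ≠ 0 := by exact_mod_cast hε.ne'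
  field_simp
  ring

lemma exists_schwartzMap_heat (hε : 0 < ε) (y : Space) :
    ∃ φ : 𝓢(Space, ℂ), (∀ x, φ x = (heat ε (x - y) : ℂ)) ∧
      ∀ k, fint φ k = exp (I * ⟪k,y⟫) * (gs ε ‖k‖ : ℂ) := by
  obtain ⟨φ, hφ⟩ := exists_schwartzMap_gaussian (b := (4 * ε)⁻¹) (by positivity)
  have hg : Function.HasTemperateGrowth fun x : Space => x - y := by fun_prop
  have ha : AntilipschitzWith 1 fun x : Space => x - y := by
    refine AntilipschitzWith.of_le_mul_dist fun a b => ?_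
    simp
  set c : ℂ := ((((4 * π * ε) ^ (3 / 2 : ℝ))⁻¹ : ℝ) : ℂ)
  set ψ : 𝓢(Space, ℂ) := c • SchwartzMap.compCLMOfAntilipschitz ℂ hg ha φ
  have hψ : ∀ x, ψ x = (heat ε (x - y) : ℂ) := by
    intro x
    change c * φ (x - y) = _
    rw [hφ]; simp [heat, c]
  refine ⟨ψ, hψ, fun k => ?_⟩
  rw [fint]
  simp only [hψ]
  rw [← integral_add_right_eq_self _ y]
  simp only [add_sub_cancel_right, inner_add_right, Complex.ofReal_add, mul_add, exp_add]
  rw [← fint_heat hε k, fint, ← integral_const_mul]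
  congr 1; ext x; ring

/-- The Gaussian mean of `f` around `y`. -/
def moll (ε : ℝ) (f : SR) (y : Space) : ℝ := ∫ x, f x * heat ε (x - y)

lemma WeakFT.moll_eq {f : SR} (h : WeakFT (fun x => (f x : ℂ)) u)
    (hε : 0 < ε) (y : Space) :
    (moll ε f y : ℂ) = (1 / (2 * (π : ℂ)) ^ 3) *
      ∫ k, u k * (gs ε ‖k‖ : ℂ) * exp (I * ⟪k,y⟫) := by
  obtain ⟨φ, hφ, hφ'⟩ := exists_schwartzMap_heat hε y
  have := h.2.2 φ
  simp only [hφ, hφ'] at this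
  rw [moll, ← integral_complex_ofReal]
  push_cast
  rw [this]
  congr 2; ext k
  push_cast; ring

lemma Tempered.integrable_mul_gaussian (hu : Tempered u) (hε : 0 < ε) :
    Integrable fun k => u k * (gs ε ‖k‖ : ℂ) := by
  obtain ⟨φ, hφ⟩ := exists_schwartzMap_gaussian hε
  simpa only [hφ] using hu.integrable_mul φ

lemma WeakFT.integral_sq_gaussian {f : SR}
    (h : WeakFT (fun x => (f x : ℂ)) u) (hε : 0 < ε) (hf : MemLp (moll ε f) 2 volume) :
    Integrable (fun k => ‖u k‖ ^ 2 * Real.exp (-(2 * ε) * ‖k‖ ^ 2)) ∧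
    ∫ k, ‖u k‖ ^ 2 * Real.exp (-(2 * ε) * ‖k‖ ^ 2) = (2 * π) ^ 3 * ∫ x, moll ε f x ^ 2 := by
  set w : SC := fun k => u k * (gs ε ‖k‖ : ℂ) with hw
  have hwi : Integrable w := h.2.1.integrable_mul_gaussian hε
  have hF : MemLp (fun x => (moll ε f x : ℂ)) 2 volume := hf.ofReal
  obtain ⟨w', hw'm, hw', hw'p⟩ := exists_weakFT_of_memLp hF
  have hwf : WeakFT (fun x => (moll ε f x : ℂ)) w := by
    refine ⟨hF.isTempered, hwi.isTempered, fun φ => ?_⟩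
    have hK : Integrable (fun p : Space × Space => w p.2 * (exp (I * ⟪p.2,p.1⟫) * φ p.1))
        (volume.prod volume) := by
      have := (φ.integrable (μ := volume)).mul_prod hwi
      refine (this.bdd_mul (c := 1) (f := fun p : Space × Space => exp (I * ⟪p.2,p.1⟫))
        (Continuous.aestronglyMeasurable (by fun_prop)) (ae_of_all _ fun p => ?_)).congr (ae_of_all _ fun p => ?_)
      · rw [Complex.norm_exp]; simp
      · simp only; ring
    have hsw := integral_integral_swap (f := fun x k => w k * (exp (I * ⟪k,x⟫) * φ x)) hK
    simp only [integral_const_mul] at hsw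
    have hx : ∀ x, (moll ε f x : ℂ) * φ x = (1 / (2 * (π : ℂ)) ^ 3) *
        ∫ k, w k * (exp (I * ⟪k,x⟫) * φ x) := by
      intro x
      rw [h.moll_eq hε, mul_assoc, ← integral_mul_const]
      congr 2; ext k; simp only [hw]; ring
    simp only [hx]
    rw [integral_const_mul, hsw]
    rfl
  have hww := hwf.ae_eq hw'
  have hsq : ∀ k, ‖w k‖ ^ 2 = ‖u k‖ ^ 2 * Real.exp (-(2 * ε) * ‖k‖ ^ 2) := by
    intro k
    rw [hw, norm_mul, mul_pow, norm_real, norm_of_nonneg (exp_pos _).le, ← Real.exp_nat_mul]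
    congr 2; push_cast; ring
  constructor
  · have := (hw'm.ae_eq hww.symm).integrable_norm_pow two_ne_zero
    simpa only [hsq] using this
  · simp only [← hsq]
    rw [integral_congr_ae (hww.mono fun k hk => show ‖w k‖ ^ 2 = ‖w' k‖ ^ 2 by rw [hk]), hw'p]
    simp

end

section

variable {f g : SR} {ε : ℝ} {C : ℝ} {a x y : Space}
open scoped SchwartzMap FourierTransform LineDeriv

/-! ### Gaussian means -/

lemma heat_eq (hε : 0 < ε) (x : Space) :
    heat ε x = (√(4 * π * ε) ^ 3)⁻¹ * Real.exp (-(π * (‖x‖ / √(4 * π * ε)) ^ 2)) := by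
  have h0 : 0 ≤ 4 * π * ε := by positivity
  have h1 : (4 * π * ε) ^ (3 / 2 : ℝ) = √(4 * π * ε) ^ 3 := by
    rw [Real.sqrt_eq_rpow, ← Real.rpow_natCast, ← Real.rpow_mul h0]; norm_num
  rw [heat, h1, div_pow, sq_sqrt h0]
  congr 2
  have := pi_pos
  field_simp

lemma heat_nonneg (hε : 0 < ε) (x : Space) : 0 ≤ heat ε x := by
  rw [heat_eq hε]; positivity

lemma continuous_heat (ε : ℝ) : Continuous (heat ε) := by unfold heat; fun_prop

lemma heat_neg (ε : ℝ) (x : Space) : heat ε (-x) = heat ε x := by simp [heat]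

lemma integrable_heat (hε : 0 < ε) (y : Space) : Integrable fun x => heat ε (x - y) := by
  obtain ⟨φ, hφ, -⟩ := exists_schwartzMap_heat hε y
  have h := (φ.integrable (μ := volume)).re
  simpa [hφ] using h

lemma integral_heat (hε : 0 < ε) (y : Space) : ∫ x, heat ε (x - y) = 1 := by
  rw [integral_sub_right_eq_self (heat ε)]
  have h := fint_heat hε 0
  simp only [fint, inner_zero_left, ofReal_zero, mul_zero, Complex.exp_zero, one_mul,
    integral_complex_ofReal] at h
  have h2 : ((∫ x, heat ε x : ℝ) : ℂ) = (1 : ℝ) := by rw [h]; simp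
  exact_mod_cast h2

lemma heat_le_const (hε : 0 < ε) (x : Space) : heat ε x ≤ (√(4 * π * ε) ^ 3)⁻¹ := by
  rw [heat_eq hε]
  refine mul_le_of_le_one_right (by positivity) (Real.exp_le_one_iff.2 ?_)
  have := pi_pos
  rw [neg_nonpos]; positivity

lemma pow_four_mul_exp_le (v : ℝ) : v ^ 4 * Real.exp (-(π * v ^ 2)) ≤ 1 := by
  rw [Real.exp_neg, ← div_eq_mul_inv, div_le_one (exp_pos _)]
  have h := Real.quadratic_le_exp_of_nonneg (x := π * v ^ 2) (by have := pi_pos; positivity)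
  have h3 := Real.pi_gt_three
  have h4 : v ^ 4 ≤ (π * v ^ 2) ^ 2 / 2 := by
    have : (9 : ℝ) ≤ π ^ 2 := by nlinarith
    nlinarith [sq_nonneg (v ^ 2), mul_le_mul_of_nonneg_right this (sq_nonneg (v ^ 2))]
  have : 0 ≤ π * v ^ 2 := by positivity
  linarith

lemma heat_le_inv_pow_four (hε : 0 < ε) (hx : x ≠ 0) :
    heat ε x ≤ √(4 * π * ε) * (‖x‖ ^ 4)⁻¹ := by
  have hp : 0 < ‖x‖ := norm_pos_iff.2 hx
  have hq : 0 < √(4 * π * ε) := by have := pi_pos; positivity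
  rw [heat_eq hε]
  set q := √(4 * π * ε)
  have h := mul_le_mul_of_nonneg_left (pow_four_mul_exp_le (‖x‖ / q)) (show 0 ≤ q * (‖x‖ ^ 4)⁻¹ by positivity)
  rw [mul_one] at h
  refine le_trans (le_of_eq ?_) h
  field_simp

lemma heat_le_inv_pow_three (hε : 0 < ε) (hx : x ≠ 0) : heat ε x ≤ 2 * (‖x‖ ^ 3)⁻¹ := by
  have hp : 0 < ‖x‖ := norm_pos_iff.2 hx
  have hq : 0 < √(4 * π * ε) := by have := pi_pos; positivity
  rw [heat_eq hε]
  set q := √(4 * π * ε)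
  set v := ‖x‖ / q with hv
  have hv0 : 0 < v := by positivity
  have h1 : v ^ 3 * Real.exp (-(π * v ^ 2)) ≤ 2 := by
    have h2 := pow_four_mul_exp_le v
    have h3 : Real.exp (-(π * v ^ 2)) ≤ 1 :=
      Real.exp_le_one_iff.2 (by have := pi_pos; rw [neg_nonpos]; positivity)
    have h4 : v ^ 3 ≤ 1 + v ^ 4 := by
      rcases le_total v 1 with h | h
      · have := pow_le_one₀ (n := 3) hv0.le h; have := pow_pos hv0 4; linarith
      · have := pow_le_pow_right₀ h (show 3 ≤ 4 by norm_num); linarith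
    have h5 := mul_le_mul_of_nonneg_right h4 (exp_pos (-(π * v ^ 2))).le
    linarith
  have h := mul_le_mul_of_nonneg_left h1 (show 0 ≤ (‖x‖ ^ 3)⁻¹ by positivity)
  rw [mul_comm 2]
  refine le_trans (le_of_eq ?_) h
  rw [hv]; field_simp

/-- Functions with an inverse square majorant centred at `a`. -/
def SqBound (f : SR) (a : Space) : Prop :=
  AEStronglyMeasurable f volume ∧ ∃ C, 0 ≤ C ∧ ∀ᵐ x, |f x| ≤ C * (‖x - a‖ ^ 2)⁻¹

lemma inv_sq_le_env_add (x : Space) : (‖x‖ ^ 2)⁻¹ ≤ 2 * env x + 1 := by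
  rcases le_total ‖x‖ 1 with h | h
  · linarith [inv_sq_le_env h]
  · have := inv_le_one_of_one_le₀ (one_le_pow₀ (n := 2) h); linarith [env_nonneg x]

lemma SqBound.integrable_div (hf : SqBound f a) :
    Integrable fun x => ‖(f x : ℂ)‖ / (1 + ‖x‖) ^ 4 := by
  obtain ⟨hm, C, hC0, hC⟩ := hf
  refine ((((integrable_env.comp_sub_right a).const_mul 2).add integrable_one_div_pow).const_mul C).mono'
    (aesm_norm_div (continuous_ofReal.comp_aestronglyMeasurable hm) 4) ?_
  filter_upwards [hC] with x hx
  rw [norm_real, norm_of_nonneg (by positivity), norm_eq_abs]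
  simp only [Pi.add_apply]
  have h1 : (1 : ℝ) ≤ (1 + ‖x‖) ^ 4 := one_le_pow₀ (by linarith [norm_nonneg x])
  have h2 := inv_sq_le_env_add (x - a)
  have h3 := env_nonneg (x - a)
  calc _ ≤ C * (2 * env (x - a) + 1) / (1 + ‖x‖) ^ 4 := by
        gcongr; exact hx.trans (mul_le_mul_of_nonneg_left h2 hC0)
    _ = C * (2 * env (x - a) / (1 + ‖x‖) ^ 4 + 1 / (1 + ‖x‖) ^ 4) := by ring
    _ ≤ _ := by
      gcongr
      exact div_le_self (by positivity) h1

lemma SqBound.isTempered (hf : SqBound f a) : Tempered fun x => (f x : ℂ) :=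
  ⟨continuous_ofReal.comp_aestronglyMeasurable hf.1, 4, hf.integrable_div⟩

lemma Tempered.integrable_mul_heat (hf : Tempered fun x => (f x : ℂ))
    (hε : 0 < ε) (y : Space) : Integrable fun x => f x * heat ε (x - y) := by
  obtain ⟨φ, hφ, -⟩ := exists_schwartzMap_heat hε y
  have h := (hf.integrable_mul φ).re
  simpa [hφ] using h

lemma moll_add (hf : Tempered fun x => (f x : ℂ))
    (hg : Tempered fun x => (g x : ℂ)) (hε : 0 < ε) (y : Space) :
    moll ε (fun x => f x + g x) y = moll ε f y + moll ε g y := by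
  unfold moll
  rw [← integral_add (hf.integrable_mul_heat hε y) (hg.integrable_mul_heat hε y)]
  congr 1; ext x; ring

lemma moll_sum {ι : Type*} {s : Finset ι} {f : ι → SR}
    (hf : ∀ i ∈ s, Tempered fun x => (f i x : ℂ)) (hε : 0 < ε) (y : Space) :
    moll ε (fun x => ∑ i ∈ s, f i x) y = ∑ i ∈ s, moll ε (f i) y := by
  unfold moll
  rw [← integral_finsetSum s fun i hi => (hf i hi).integrable_mul_heat hε y]
  congr 1; ext x; rw [sum_mul]

lemma moll_comp_sub (ε : ℝ) (f : SR) (a y : Space) :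
    moll ε (fun x => f (x - a)) y = moll ε f (y - a) := by
  unfold moll
  rw [← integral_add_right_eq_self _ a]
  congr 1; ext x
  beta_reduce
  rw [add_sub_cancel_right]; congr 2; abel

lemma moll_congr_ae (h : f =ᵐ[volume] g) (ε : ℝ) (y : Space) : moll ε f y = moll ε g y :=
  integral_congr_ae (h.mono fun x hx => by simp only [hx])

lemma aestronglyMeasurable_moll (hf : AEStronglyMeasurable f volume) (ε : ℝ) :
    AEStronglyMeasurable (moll ε f) volume := by
  have : AEStronglyMeasurable (fun p : Space × Space => f p.2 * heat ε (p.2 - p.1)) (volume.prod volume) :=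
    hf.comp_snd.mul ((continuous_heat ε).comp (by fun_prop)).aestronglyMeasurable
  exact this.integral_prod_right'

lemma integrableOn_inv_sq (R : ℝ) : IntegrableOn (fun x : Space => (‖x‖ ^ 2)⁻¹) (ball 0 R) ∧
    (0 ≤ R → ∫ x in ball (0 : Space) R, (‖x‖ ^ 2)⁻¹ = (3 * volume.real (ball (0 : Space) 1)) * R) := by
  have hind : ∀ x : Space, (ball (0 : Space) R).indicator (fun x : Space => (‖x‖ ^ 2)⁻¹) x
      = (Iio R).indicator (fun r : ℝ => (r ^ 2)⁻¹) ‖x‖ := by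
    intro x; simp [Set.indicator]
  have hr : ∀ r ∈ Ioi (0 : ℝ), r ^ 2 • (Iio R).indicator (fun r : ℝ => (r ^ 2)⁻¹) r
      = (Iio R).indicator (fun _ => (1 : ℝ)) r := by
    intro r hr
    have : (0 : ℝ) < r := hr
    by_cases h : r ∈ Iio R
    · rw [indicator_of_mem h, indicator_of_mem h, smul_eq_mul]; field_simp
    · rw [indicator_of_notMem h, indicator_of_notMem h, smul_zero]
  constructor
  · rw [← integrable_indicator_iff isOpen_ball.measurableSet]
    simp only [funext hind]
    rw [integrable_fun_norm_addHaar vol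
      (f := (Iio R).indicator (fun r : ℝ => (r ^ 2)⁻¹)), finrank_euclideanSpace_fin]
    refine IntegrableOn.congr_fun ?_ (fun r h => (hr r h).symm) measurableSet_Ioi
    rw [IntegrableOn, integrable_indicator_iff measurableSet_Iio, IntegrableOn, Measure.restrict_restrict measurableSet_Iio]
    refine integrable_const_iff.2 (Or.inr ?_)
    refine ⟨?_⟩
    rw [Measure.restrict_apply_univ, Set.inter_comm, Set.Ioi_inter_Iio]
    simp
  · intro hR
    rw [← integral_indicator isOpen_ball.measurableSet, funext hind, integral_fun_norm_addHaar vol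
      (f := (Iio R).indicator (fun r : ℝ => (r ^ 2)⁻¹)), finrank_euclideanSpace_fin,
      setIntegral_congr_fun measurableSet_Ioi hr, setIntegral_indicator measurableSet_Iio, Set.Ioi_inter_Iio]
    simp [hR]
    ring

lemma moll_inv_sq_le : ∃ K, 0 ≤ K ∧ ∀ ε > 0, ∀ y : Space, y ≠ 0 →
    ∫ x, (‖x‖ ^ 2)⁻¹ * heat ε (x - y) ≤ K * (‖y‖ ^ 2)⁻¹ := by
  refine ⟨4 + 24 * (volume.real (ball (0 : Space) 1)), by positivity, fun ε hε y hy => ?_⟩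
  have hp : 0 < ‖y‖ := norm_pos_iff.2 hy
  have hb : ∀ x : Space, (‖x‖ ^ 2)⁻¹ * heat ε (x - y) ≤ 4 * (‖y‖ ^ 2)⁻¹ * heat ε (x - y) +
      (ball (0 : Space) (‖y‖ / 2)).indicator (fun x => 16 * (‖y‖ ^ 3)⁻¹ * (‖x‖ ^ 2)⁻¹) x := by
    intro x
    have hh := heat_nonneg hε (x - y)
    by_cases hx : x ∈ ball (0 : Space) (‖y‖ / 2)
    · rw [indicator_of_mem hx]
      rw [mem_ball_zero_iff] at hx
      have h1 : ‖y‖ / 2 ≤ ‖x - y‖ := by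
        have := norm_sub_norm_le y x; rw [norm_sub_rev] at this; linarith
      have h2 : x - y ≠ 0 := norm_pos_iff.1 (by linarith)
      have h3 : heat ε (x - y) ≤ 16 * (‖y‖ ^ 3)⁻¹ := by
        refine (heat_le_inv_pow_three hε h2).trans ?_
        have : (‖x - y‖ ^ 3)⁻¹ ≤ ((‖y‖ / 2) ^ 3)⁻¹ := by gcongr
        calc _ ≤ 2 * ((‖y‖ / 2) ^ 3)⁻¹ := by linarith
          _ = _ := by field_simp; norm_num
      have h4 : 0 ≤ 4 * (‖y‖ ^ 2)⁻¹ * heat ε (x - y) := by positivity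
      have h5 := mul_le_mul_of_nonneg_left h3 (show 0 ≤ (‖x‖ ^ 2)⁻¹ by positivity)
      linarith
    · rw [indicator_of_notMem hx, add_zero]
      rw [mem_ball_zero_iff, not_lt] at hx
      refine mul_le_mul_of_nonneg_right ?_ hh
      calc (‖x‖ ^ 2)⁻¹ ≤ ((‖y‖ / 2) ^ 2)⁻¹ := by gcongr
        _ = _ := by field_simp; norm_num
  have i1 := (integrable_heat hε y).const_mul (4 * (‖y‖ ^ 2)⁻¹)
  have i2 := (integrable_indicator_iff isOpen_ball.measurableSet).2
    ((integrableOn_inv_sq (‖y‖ / 2)).1.const_mul (16 * (‖y‖ ^ 3)⁻¹))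
  refine (integral_mono_of_nonneg (ae_of_all _ fun x => ?_) (i1.add i2) (ae_of_all _ hb)).trans ?_
  · exact mul_nonneg (by positivity) (heat_nonneg hε _)
  · simp only [Pi.add_apply]
    rw [integral_add i1 i2, integral_const_mul, integral_heat hε, integral_indicator isOpen_ball.measurableSet,
      integral_const_mul, (integrableOn_inv_sq (‖y‖ / 2)).2 (by positivity)]
    apply le_of_eq
    field_simp
    ring

lemma integrable_inv_sq_mul_heat (hε : 0 < ε) (a y : Space) :
    Integrable fun x : Space => (‖x - a‖ ^ 2)⁻¹ * heat ε (x - y) := by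
  have hm : Measurable fun x : Space => (‖x - a‖ ^ 2)⁻¹ := by fun_prop
  have : SqBound (fun x : Space => (‖x - a‖ ^ 2)⁻¹) a := by
    refine ⟨hm.aestronglyMeasurable, 1, zero_le_one, ae_of_all _ fun x => ?_⟩
    rw [abs_of_nonneg (by positivity), one_mul]
  exact this.isTempered.integrable_mul_heat hε y

lemma abs_moll_le (hfg : ∀ᵐ x, |f x| ≤ g x) (hε : 0 < ε)
    (hg : Integrable fun x => g x * heat ε (x - y)) : |moll ε f y| ≤ ∫ x, g x * heat ε (x - y) := by
  rw [moll, ← norm_eq_abs]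
  refine norm_integral_le_of_norm_le hg ?_
  filter_upwards [hfg] with x hx
  rw [norm_mul, norm_of_nonneg (heat_nonneg hε _)]
  exact mul_le_mul_of_nonneg_right hx (heat_nonneg hε _)

lemma SqBound.moll_le (hf : SqBound f a) :
    ∃ K, 0 ≤ K ∧ ∀ ε > 0, ∀ y, y ≠ a → |moll ε f y| ≤ K * (‖y - a‖ ^ 2)⁻¹ := by
  obtain ⟨hm, C, hC0, hC⟩ := hf
  obtain ⟨K, hK0, hK⟩ := moll_inv_sq_le
  refine ⟨C * K, by positivity, fun ε hε y hy => ?_⟩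
  have h := abs_moll_le hC hε (y := y) (by
    simpa only [mul_assoc] using (integrable_inv_sq_mul_heat hε a y).const_mul C)
  refine h.trans ?_
  simp only [mul_assoc]
  rw [integral_const_mul]
  refine mul_le_mul_of_nonneg_left ?_ hC0
  have h2 := moll_comp_sub ε (fun x => (‖x‖ ^ 2)⁻¹) a y
  unfold moll at h2
  rw [h2]
  exact hK ε hε _ (sub_ne_zero.2 hy)

lemma moll_le_of_inv (hC0 : 0 ≤ C) (hf : ∀ᵐ x, |f x| ≤ C * ‖x - a‖⁻¹) :
    ∃ K, 0 ≤ K ∧ ∀ ε > 0, ∀ y, y ≠ a → |moll ε f y| ≤ K * ‖y - a‖⁻¹ := by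
  obtain ⟨K, hK0, hK⟩ := moll_inv_sq_le
  refine ⟨C * (1 / 2 * (K + 1)), by positivity, fun ε hε y hy => ?_⟩
  have hp : 0 < ‖y - a‖ := norm_pos_iff.2 (sub_ne_zero.2 hy)
  have hb : ∀ᵐ x, |f x| ≤ C * (1 / 2 * (‖y - a‖ * (‖x - a‖ ^ 2)⁻¹ + ‖y - a‖⁻¹)) := by
    filter_upwards [hf] with x hx
    refine hx.trans (mul_le_mul_of_nonneg_left ?_ hC0)
    set u := ‖x - a‖⁻¹
    have : (‖x - a‖ ^ 2)⁻¹ = u ^ 2 := by rw [inv_pow]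
    rw [this]
    set v := ‖y - a‖
    have h1 : v * v⁻¹ = 1 := mul_inv_cancel₀ hp.ne'
    have h2 : 0 ≤ v * (u - v⁻¹) ^ 2 := by positivity
    have h3 : v * (u - v⁻¹) ^ 2 = v * u ^ 2 - 2 * u * (v * v⁻¹) + v⁻¹ * (v * v⁻¹) := by ring
    rw [h1] at h3
    linarith
  have i1 := ((integrable_inv_sq_mul_heat hε a y).const_mul ‖y - a‖)
  have i2 := ((integrable_heat hε y).const_mul ‖y - a‖⁻¹)
  have he : (fun x => C * (1 / 2 * (‖y - a‖ * (‖x - a‖ ^ 2)⁻¹ + ‖y - a‖⁻¹)) * heat ε (x - y))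
      = fun x => C * (1 / 2) * (‖y - a‖ * ((‖x - a‖ ^ 2)⁻¹ * heat ε (x - y)) + ‖y - a‖⁻¹ * heat ε (x - y)) := by
    ext x; ring
  have i3 : Integrable fun x => C * (1 / 2) * (‖y - a‖ * ((‖x - a‖ ^ 2)⁻¹ * heat ε (x - y)) + ‖y - a‖⁻¹ * heat ε (x - y)) :=
    (i1.add i2).const_mul _
  refine (abs_moll_le hb hε (y := y) (by rw [he]; exact i3)).trans ?_
  rw [he, integral_const_mul, integral_add i1 i2, integral_const_mul, integral_const_mul, integral_heat hε]
  have h2 := moll_comp_sub ε (fun x => (‖x‖ ^ 2)⁻¹) a y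
  unfold moll at h2
  rw [h2]
  have h3 := hK ε hε _ (sub_ne_zero.2 hy)
  rw [mul_assoc, mul_assoc C, mul_assoc (1 / 2)]
  refine mul_le_mul_of_nonneg_left ?_ hC0
  refine mul_le_mul_of_nonneg_left ?_ (by norm_num)
  have h4 := mul_le_mul_of_nonneg_left h3 hp.le
  calc _ ≤ ‖y - a‖ * (K * (‖y - a‖ ^ 2)⁻¹) + ‖y - a‖⁻¹ * 1 := by linarith
    _ = _ := by field_simp

lemma moll_le_of_bound (hf : ∀ᵐ x, |f x| ≤ C) (hε : 0 < ε)
    (y : Space) : |moll ε f y| ≤ C := by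
  refine (abs_moll_le hf hε ((integrable_heat hε y).const_mul C)).trans ?_
  rw [integral_const_mul, integral_heat hε, mul_one]

lemma SqBound.moll_bounded (hf : SqBound f a) (hε : 0 < ε) :
    ∃ K, 0 ≤ K ∧ ∀ y, |moll ε f y| ≤ K := by
  obtain ⟨hm, C, hC0, hC⟩ := hf
  set c := (√(4 * π * ε) ^ 3)⁻¹
  have hc0 : 0 ≤ c := by positivity
  have hE : 0 ≤ ∫ x, env x := integral_nonneg env_nonneg
  refine ⟨C * (2 * c * (∫ x, env x) + 1), by positivity, fun y => ?_⟩
  have i1 : Integrable fun x => C * (2 * c * env (x - a) + heat ε (x - y)) :=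
    (((integrable_env.comp_sub_right a).const_mul (2 * c)).add (integrable_heat hε y)).const_mul C
  rw [moll, ← norm_eq_abs]
  refine (norm_integral_le_of_norm_le i1 ?_).trans (le_of_eq ?_)
  · filter_upwards [hC] with x hx
    have hh := heat_nonneg hε (x - y)
    rw [norm_mul, norm_of_nonneg hh, norm_eq_abs]
    have h1 := heat_le_const hε (x - y)
    have h2 := mul_le_mul_of_nonneg_left (inv_sq_le_env_add (x - a)) hC0
    have h3 := env_nonneg (x - a)
    calc _ ≤ C * (2 * env (x - a) + 1) * heat ε (x - y) := mul_le_mul_of_nonneg_right (hx.trans h2) hh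
      _ = C * (2 * env (x - a) * heat ε (x - y) + heat ε (x - y)) := by ring
      _ ≤ C * (2 * env (x - a) * c + heat ε (x - y)) := by gcongr
      _ = _ := by ring
  · rw [integral_const_mul, integral_add ((integrable_env.comp_sub_right a).const_mul _) (integrable_heat hε y),
      integral_const_mul, integral_heat hε, integral_sub_right_eq_self env]

lemma SqBound.memLp_moll (hf : SqBound f a) (hε : 0 < ε) :
    MemLp (moll ε f) 2 volume := by
  obtain ⟨K, hK0, hK⟩ := hf.moll_le
  obtain ⟨B, hB0, hB⟩ := hf.moll_bounded hε
  have hm := aestronglyMeasurable_moll hf.1 ε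
  rw [memLp_two_iff_integrable_sq hm]
  refine ((integrable_env.comp_sub_right a).const_mul (K * (B + K))).mono' (hm.pow 2) ?_
  have hae : ∀ᵐ x : Space, x ≠ a := by
    rw [ae_iff]; simp
  filter_upwards [hae] with x hx
  have hp : 0 < ‖x - a‖ := norm_pos_iff.2 (sub_ne_zero.2 hx)
  have h1 := hK ε hε x hx
  have h2 := hB x
  rw [norm_of_nonneg (sq_nonneg _), ← sq_abs, env]
  set w := |moll ε f x|
  have hw : 0 ≤ w := abs_nonneg _
  rw [← div_eq_mul_inv, le_div_iff₀ (by positivity)]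
  rw [← div_eq_mul_inv, le_div_iff₀ (by positivity)] at h1
  have h3 : w * (1 + ‖x - a‖ ^ 2) ≤ B + K := by linarith
  calc _ = (w * ‖x - a‖ ^ 2) * (w * (1 + ‖x - a‖ ^ 2)) := by ring
    _ ≤ _ := mul_le_mul h1 h3 (by positivity) hK0

/-- Functions that are integrable with respect to an inverse fourth power weight. -/
def WeightInt (f : SR) : Prop :=
  AEStronglyMeasurable f volume ∧ Integrable fun x => ‖(f x : ℂ)‖ / (1 + ‖x‖) ^ 4

lemma SqBound.weightInt (hf : SqBound f a) : WeightInt f :=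
  ⟨hf.1, hf.integrable_div⟩

lemma WeightInt.isTempered (hf : WeightInt f) : Tempered fun x => (f x : ℂ) :=
  ⟨continuous_ofReal.comp_aestronglyMeasurable hf.1, 4, hf.2⟩

lemma WeightInt.tendsto_moll (hf : WeightInt f)
    (hy : ContinuousAt f y) : Tendsto (fun ε => moll ε f y) (𝓝[>] 0) (𝓝 (f y)) := by
  rw [Metric.tendsto_nhds]
  intro η hη
  obtain ⟨δ, hδ, hδf⟩ := Metric.continuousAt_iff.1 hy (η / 2) (by positivity)
  set g : SR := fun x => (ball y δ)ᶜ.indicator (fun x => |f x - f y| * (‖x - y‖ ^ 4)⁻¹) x with hg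
  have hgi : Integrable g := by
    rw [hg, integrable_indicator_iff isOpen_ball.measurableSet.compl]
    set c := (1 + (1 + ‖y‖) / δ) ^ 4
    have hi : Integrable fun x => c * (‖(f x : ℂ)‖ / (1 + ‖x‖) ^ 4 + |f y| * (1 / (1 + ‖x‖) ^ 4)) :=
      (hf.2.add (integrable_one_div_pow.const_mul |f y|)).const_mul c
    have hm : Measurable fun x : Space => (‖x - y‖ ^ 4)⁻¹ := by fun_prop
    refine hi.integrableOn.mono' ((((hf.1.sub aestronglyMeasurable_const).norm).mul
      hm.aestronglyMeasurable).restrict) ?_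
    refine (ae_restrict_iff' isOpen_ball.measurableSet.compl).2 (ae_of_all _ fun x hx => ?_)
    have hx : δ ≤ ‖x - y‖ := by simpa [dist_eq_norm] using hx
    have hp : 0 < ‖x - y‖ := hδ.trans_le hx
    have h1 : 1 + ‖x‖ ≤ (1 + (1 + ‖y‖) / δ) * ‖x - y‖ := by
      have h2 : ‖x‖ ≤ ‖x - y‖ + ‖y‖ := by simpa using norm_add_le (x - y) y
      have h3 : 1 + ‖y‖ ≤ (1 + ‖y‖) / δ * ‖x - y‖ := by
        rw [div_mul_eq_mul_div, le_div_iff₀ hδ]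
        exact mul_le_mul_of_nonneg_left hx (by positivity)
      linarith
    have h4 : (1 + ‖x‖) ^ 4 ≤ c * ‖x - y‖ ^ 4 := by
      rw [← mul_pow]; exact pow_le_pow_left₀ (by positivity) h1 4
    have h5 : (‖x - y‖ ^ 4)⁻¹ ≤ c * (1 / (1 + ‖x‖) ^ 4) := by
      rw [mul_one_div, inv_eq_one_div, div_le_div_iff₀ (by positivity) (by positivity)]
      linarith
    rw [norm_of_nonneg (by positivity), norm_real, norm_eq_abs]
    calc _ ≤ (|f x| + |f y|) * (c * (1 / (1 + ‖x‖) ^ 4)) :=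
          mul_le_mul (abs_sub _ _) h5 (by positivity) (by positivity)
      _ = _ := by ring
  have hlim : Tendsto (fun ε : ℝ => √(4 * π * ε) * ∫ x, g x) (𝓝[>] 0) (𝓝 0) := by
    have : Continuous fun ε : ℝ => √(4 * π * ε) * ∫ x, g x := by fun_prop
    have h0 := this.tendsto 0
    simp only [mul_zero, Real.sqrt_zero, zero_mul] at h0
    exact h0.mono_left nhdsWithin_le_nhds
  filter_upwards [self_mem_nhdsWithin, hlim.eventually_lt_const (show (0 : ℝ) < η / 2 by positivity)] with ε hε hε2
  have hε : 0 < ε := hε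
  have i1 := hf.isTempered.integrable_mul_heat hε y
  have i2 := (integrable_heat hε y).const_mul (f y)
  have e1 : moll ε f y - f y = ∫ x, (f x - f y) * heat ε (x - y) := by
    simp only [sub_mul]
    rw [integral_sub i1 i2, integral_const_mul, integral_heat hε, mul_one]; rfl
  rw [Real.dist_eq, e1, ← norm_eq_abs]
  have i3 : Integrable fun x => η / 2 * heat ε (x - y) + √(4 * π * ε) * g x :=
    ((integrable_heat hε y).const_mul _).add (hgi.const_mul _)
  refine (norm_integral_le_of_norm_le i3 (ae_of_all _ fun x => ?_)).trans_lt ?_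
  · have hh := heat_nonneg hε (x - y)
    rw [norm_mul, norm_of_nonneg hh, norm_eq_abs]
    by_cases hx : x ∈ ball y δ
    · have h1 := hδf hx
      rw [Real.dist_eq] at h1
      have : g x = 0 := by simp only [hg]; rw [indicator_of_notMem]; simpa using hx
      rw [this, mul_zero, add_zero]
      exact mul_le_mul_of_nonneg_right h1.le hh
    · have h1 : g x = |f x - f y| * (‖x - y‖ ^ 4)⁻¹ := by
        simp only [hg]; rw [indicator_of_mem]; exact hx
      have h2 : x - y ≠ 0 := by
        intro h0; apply hx; rw [mem_ball, dist_eq_norm, h0]; simpa using hδ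
      have h3 := mul_le_mul_of_nonneg_left (heat_le_inv_pow_four hε h2) (abs_nonneg (f x - f y))
      rw [h1]
      have h4 : 0 ≤ η / 2 * heat ε (x - y) := by positivity
      linarith
  · rw [integral_add ((integrable_heat hε y).const_mul _) (hgi.const_mul _), integral_const_mul,
      integral_const_mul, integral_heat hε]
    linarith

lemma SqBound.tendsto_moll (hf : SqBound f a)
    (hy : ContinuousAt f y) : Tendsto (fun ε => moll ε f y) (𝓝[>] 0) (𝓝 (f y)) :=
  hf.weightInt.tendsto_moll hy

end

section

/-! ### Finite parts at the charges -/

lemma HasRLimZero.add {f g : ℝ → ℝ} (hf : HasRLimZero f b) (hg : HasRLimZero g c) :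
    HasRLimZero (fun r => f r + g r) (b + c) := by
  obtain ⟨a, ha⟩ := hf
  obtain ⟨a', ha'⟩ := hg
  refine ⟨a + a', (ha.add ha').congr_left fun r => ?_⟩
  ring

lemma HasRLimZero.const_mul {f : ℝ → ℝ} (hf : HasRLimZero f b) (c : ℝ) :
    HasRLimZero (fun r => c * f r) (c * b) := by
  obtain ⟨a, ha⟩ := hf
  refine ⟨c * a, (ha.const_mul_left c).congr_left fun r => ?_⟩
  ring

lemma hasRLimZero_const (b : ℝ) : HasRLimZero (fun _ => b) b :=
  ⟨0, by simpa using isBigO_zero _ _⟩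

lemma HasRLimZero.sum {ι : Type*} {s : Finset ι} {f : ι → ℝ → ℝ} {b : ι → ℝ} (h : ∀ i ∈ s, HasRLimZero (f i) (b i)) :
    HasRLimZero (fun r => ∑ i ∈ s, f i r) (∑ i ∈ s, b i) := by
  classical
  induction s using induction_on with
  | empty => simpa using hasRLimZero_const 0
  | insert i s hi ih =>
    simp only [sum_insert hi]
    exact (h i (by simp)).add (ih fun j hj => h j (by simp [hj]))

lemma HasRLimZero.congr' {f g : ℝ → ℝ} (hf : HasRLimZero f b) (h : f =ᶠ[𝓝[>] 0] g) : HasRLimZero g b := by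
  obtain ⟨a, ha⟩ := hf
  refine ⟨a, ha.congr' ?_ EventuallyEq.rfl⟩
  filter_upwards [h] with r hr
  rw [hr]

variable {N : ℕ} {z : Fin N → Space}
variable {b c K : ℝ} {f g G : SR}

lemma measurableSet_outside (z : Fin N → Space) (r : ℝ) : MeasurableSet (outside z r) := by
  have : outside z r = ⋂ n, {x | r < ‖x - z n‖} := by ext x; simp [outside]
  rw [this]
  exact MeasurableSet.iInter fun n => measurableSet_lt (by fun_prop) (by fun_prop)

lemma HasRIntegral.congr_ae (hf : HasRIntegral z f b)
    (h : f =ᵐ[volume] g) : HasRIntegral z g b := by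
  refine ⟨fun r hr => (hf.1 r hr).congr (ae_restrict_of_ae h), ?_⟩
  have : (fun r => ∫ x in outside z r, f x) = fun r => ∫ x in outside z r, g x := by
    ext r; exact integral_congr_ae (ae_restrict_of_ae h)
  rw [← this]; exact hf.2

lemma HasRIntegral.sum {ι : Type*} {s : Finset ι} {f : ι → SR} {b : ι → ℝ}
    (h : ∀ i ∈ s, HasRIntegral z (f i) (b i)) :
    HasRIntegral z (fun x => ∑ i ∈ s, f i x) (∑ i ∈ s, b i) := by
  refine ⟨fun r hr => integrable_finsetSum s fun i hi => (h i hi).1 r hr, ?_⟩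
  refine (HasRLimZero.sum fun i hi => (h i hi).2).congr' ?_
  filter_upwards [self_mem_nhdsWithin] with r hr
  rw [integral_finsetSum s fun i hi => (h i hi).1 r hr]

lemma HasRIntegral.const_mul (hf : HasRIntegral z f b) (c : ℝ) :
    HasRIntegral z (fun x => c * f x) (c * b) := by
  refine ⟨fun r hr => (hf.1 r hr).const_mul c, ?_⟩
  simp only [integral_const_mul]
  exact hf.2.const_mul c

lemma HasRIntegral.add (hf : HasRIntegral z f b)
    (hg : HasRIntegral z g c) : HasRIntegral z (fun x => f x + g x) (b + c) := by
  refine ⟨fun r hr => (hf.1 r hr).add (hg.1 r hr), ?_⟩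
  refine (hf.2.add hg.2).congr' ?_
  filter_upwards [self_mem_nhdsWithin] with r hr
  rw [integral_add (hf.1 r hr) (hg.1 r hr)]

lemma integral_closedBall_env_le (a b : Space) : ∃ C, 0 ≤ C ∧ ∀ r > 0,
    ∫ x in closedBall a r, env (x - b) ≤ C * r := by
  set v := volume.real (ball (0 : Space) 1)
  refine ⟨3 * v + v, by positivity, fun r hr => ?_⟩
  have hball : volume.real (closedBall a r) = r ^ 3 * v := by
    rw [Measure.real, Measure.addHaar_closedBall _ _ hr.le, finrank_euclideanSpace_fin,
      toReal_mul, toReal_ofReal (by positivity)]; rfl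
  have hms : MeasurableSet (closedBall a r) := Metric.isClosed_closedBall.measurableSet
  rw [← integral_indicator hms]
  have i0 := (integrable_indicator_iff isOpen_ball.measurableSet).2 (integrableOn_inv_sq r).1
  have i1 := i0.comp_sub_right b
  have i2 : Integrable ((closedBall a r).indicator fun _ => (r ^ 2)⁻¹) :=
    (integrable_indicator_iff hms).2 (integrableOn_const (isCompact_closedBall a r).measure_lt_top.ne)
  refine (integral_mono ((integrable_indicator_iff hms).2 (integrable_env.comp_sub_right b).integrableOn)
    (i1.add i2) fun x => ?_).trans (le_of_eq ?_)
  · simp only [Pi.add_apply]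
    have he : env (x - b) ≤ (‖x - b‖ ^ 2)⁻¹ := by
      unfold env; rw [mul_inv]
      exact mul_le_of_le_one_right (by positivity) (inv_le_one_of_one_le₀ (by nlinarith [norm_nonneg (x - b)]))
    have h0 : 0 ≤ (ball (0 : Space) r).indicator (fun x : Space => (‖x‖ ^ 2)⁻¹) (x - b) :=
      Set.indicator_nonneg (fun _ _ => by positivity) _
    by_cases hx : x ∈ closedBall a r
    · rw [indicator_of_mem hx, indicator_of_mem hx]
      by_cases hb : x - b ∈ ball (0 : Space) r
      · rw [indicator_of_mem hb]
        have : 0 ≤ (r ^ 2)⁻¹ := by positivity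
        linarith
      · rw [mem_ball_zero_iff, not_lt] at hb
        have : (‖x - b‖ ^ 2)⁻¹ ≤ (r ^ 2)⁻¹ := by gcongr
        linarith
    · rw [indicator_of_notMem hx, indicator_of_notMem hx]; linarith
  · simp only [Pi.add_apply]
    rw [integral_add i1 i2, integral_sub_right_eq_self ((ball (0 : Space) r).indicator fun x : Space => (‖x‖ ^ 2)⁻¹),
      integral_indicator isOpen_ball.measurableSet,
      (integrableOn_inv_sq r).2 hr.le, integral_indicator hms, setIntegral_const, hball, smul_eq_mul]
    field_simp
    simp only [v]; ring

lemma hasRIntegral_of_le_env (hG : AEStronglyMeasurable G volume) {a b : Space}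
    (h : ∀ᵐ x, |G x| ≤ K * (env (x - a) + env (x - b))) : Integrable G ∧ HasRIntegral z G (∫ x, G x) := by
  have iW : Integrable fun x => K * (env (x - a) + env (x - b)) :=
    ((integrable_env.comp_sub_right a).add (integrable_env.comp_sub_right b)).const_mul K
  have iG : Integrable G := iW.mono' hG h
  refine ⟨iG, fun r _ => iG.integrableOn, 0, ?_⟩
  choose Ca hCa0 hCa using fun n => integral_closedBall_env_le (z n) a
  choose Cb hCb0 hCb using fun n => integral_closedBall_env_le (z n) b
  refine IsBigO.of_bound (∑ n, |K| * (Ca n + Cb n)) ?_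
  filter_upwards [self_mem_nhdsWithin] with r hr
  have hr : 0 < r := hr
  have hms := measurableSet_outside z r
  have hsub : (outside z r)ᶜ ⊆ ⋃ n, closedBall (z n) r := by
    intro x hx
    simp only [outside, Set.mem_compl_iff, mem_ofPred_eq, not_forall, not_lt] at hx
    simpa [dist_eq_norm] using hx
  have h1 : (∫ x in outside z r, G x) - (0 / r + ∫ x, G x) = -∫ x in (outside z r)ᶜ, G x := by
    rw [← integral_add_compl hms iG]; ring
  rw [h1, norm_neg, norm_of_nonneg hr.le]
  calc _ ≤ ∫ x in (outside z r)ᶜ, ‖G x‖ := norm_integral_le_integral_norm _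
    _ ≤ ∑ n, ∫ x in closedBall (z n) r, ‖G x‖ := by
        have hb : ∀ n, MeasurableSet (closedBall (z n) r) := fun n =>
          Metric.isClosed_closedBall.measurableSet
        rw [← integral_indicator hms.compl]
        simp only [← integral_indicator (hb _)]
        have hi : ∀ n, Integrable ((closedBall (z n) r).indicator fun x => ‖G x‖) := fun n =>
          iG.norm.indicator (hb n)
        rw [← integral_finsetSum _ fun n _ => hi n]
        refine integral_mono (iG.norm.indicator hms.compl) (integrable_finsetSum _ fun n _ => hi n) fun x => ?_
        have h0 : ∀ n, 0 ≤ (closedBall (z n) r).indicator (fun x => ‖G x‖) x := fun n =>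
          Set.indicator_nonneg (fun _ _ => norm_nonneg _) _
        by_cases hx : x ∈ (outside z r)ᶜ
        · obtain ⟨n, hn⟩ := Set.mem_iUnion.1 (hsub hx)
          rw [indicator_of_mem hx]
          refine le_trans (le_of_eq ?_) (Finset.single_le_sum (fun n _ => h0 n) (mem_univ n))
          rw [indicator_of_mem hn]
        · rw [indicator_of_notMem hx]
          exact Finset.sum_nonneg fun n _ => h0 n
    _ ≤ ∑ n, |K| * (Ca n + Cb n) * r := by
        refine Finset.sum_le_sum fun n _ => ?_
        have j1 := (integrable_env.comp_sub_right a).integrableOn (s := closedBall (z n) r)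
        have j2 := (integrable_env.comp_sub_right b).integrableOn (s := closedBall (z n) r)
        have j3 : IntegrableOn (fun x => |K| * (env (x - a) + env (x - b))) (closedBall (z n) r) :=
          (j1.add j2).const_mul _
        refine (integral_mono_ae iG.norm.integrableOn j3 (ae_restrict_of_ae (h.mono fun x hx => ?_))).trans ?_
        · refine hx.trans (mul_le_mul_of_nonneg_right (le_abs_self K) ?_)
          exact add_nonneg (env_nonneg _) (env_nonneg _)
        · rw [integral_const_mul, integral_add j1 j2, mul_assoc]
          refine mul_le_mul_of_nonneg_left ?_ (abs_nonneg _)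
          have := hCa n r hr; have := hCb n r hr; linarith
    _ = _ := by rw [sum_mul]

lemma hasRIntegral_of_single (hz : Injective z) (n : Fin N)
    (hG : AEStronglyMeasurable G volume) (hK : ∀ x, x ≠ z n → |G x| ≤ K * (‖x - z n‖ ^ 4)⁻¹)
    {a : ℝ} (h : ∀ᶠ r in 𝓝[>] (0 : ℝ), ∫ x in {x | r < ‖x - z n‖}, G x = a / r + b) :
    HasRIntegral z G b := by
  have hK0 : ∀ x, x ≠ z n → |G x| ≤ |K| * (‖x - z n‖ ^ 4)⁻¹ := fun x hx =>
    (hK x hx).trans (mul_le_mul_of_nonneg_right (le_abs_self K) (by positivity))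
  have hms : ∀ r, MeasurableSet {x : Space | r < ‖x - z n‖} := fun r =>
    measurableSet_lt (by fun_prop) (by fun_prop)
  have hint : ∀ r > 0, IntegrableOn G {x | r < ‖x - z n‖} := by
    intro r hr
    refine (((integrable_env.comp_sub_right (z n)).const_mul (|K| * (1 + (r ^ 2)⁻¹))).integrableOn).mono'
      hG.restrict ((ae_restrict_iff' (hms r)).2 (ae_of_all _ fun x hx => ?_))
    have hx : r < ‖x - z n‖ := hx
    have hp : 0 < ‖x - z n‖ := hr.trans hx
    refine (hK0 x (sub_ne_zero.1 (norm_pos_iff.1 hp))).trans ?_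
    rw [mul_assoc]
    refine mul_le_mul_of_nonneg_left ?_ (abs_nonneg _)
    unfold env
    have h1 : (‖x - z n‖ ^ 2)⁻¹ ≤ (r ^ 2)⁻¹ := by gcongr
    calc (‖x - z n‖ ^ 4)⁻¹ = (1 + (‖x - z n‖ ^ 2)⁻¹) * (‖x - z n‖ ^ 2 * (1 + ‖x - z n‖ ^ 2))⁻¹ := by
          field_simp; ring
      _ ≤ _ := by gcongr
  have hsub : ∀ r, outside z r ⊆ {x | r < ‖x - z n‖} := fun r x hx => hx n
  refine ⟨fun r hr => (hint r hr).mono_set (hsub r), a, ?_⟩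
  obtain ⟨δ, hδ, hδz⟩ : ∃ δ > 0, ∀ m, m ≠ n → δ ≤ ‖z m - z n‖ := by
    have : ∀ᶠ δ in 𝓝[>] (0 : ℝ), ∀ m, m ≠ n → δ ≤ ‖z m - z n‖ := by
      rw [eventually_all]
      intro m
      by_cases hm : m = n
      · simp [hm]
      · have hp : 0 < ‖z m - z n‖ := norm_pos_iff.2 (sub_ne_zero.2 (hz.ne hm))
        filter_upwards [Ioo_mem_nhdsGT hp] with δ hδ _
        exact hδ.2.le
    obtain ⟨δ, h1, h2⟩ := (this.and self_mem_nhdsWithin).exists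
    exact ⟨δ, h2, h1⟩
  set v := volume.real (ball (0 : Space) 1)
  refine IsBigO.of_bound (|K| * ((δ / 2) ^ 4)⁻¹ * (N * v)) ?_
  filter_upwards [h, self_mem_nhdsWithin, Ioo_mem_nhdsGT (show 0 < δ / 2 by positivity), Ioo_mem_nhdsGT one_pos]
    with r hr hr0 hrδ hr1
  have hr0 : 0 < r := hr0
  have h1 : (∫ x in outside z r, G x) - (a / r + b) = -∫ x in {x | r < ‖x - z n‖} \ outside z r, G x := by
    rw [← hr, setIntegral_sdiff (measurableSet_outside z r) (hint r hr0) (hsub r)]; ring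
  have hD : {x | r < ‖x - z n‖} \ outside z r ⊆ ⋃ m ∈ (univ.erase n), closedBall (z m) r := by
    rintro x ⟨hx1, hx2⟩
    simp only [outside, mem_ofPred_eq, not_forall, not_lt] at hx2 hx1
    obtain ⟨m, hm⟩ := hx2
    have : m ≠ n := by rintro rfl; linarith
    simp only [Set.mem_iUnion, Finset.mem_erase, mem_univ, and_true]
    exact ⟨m, this, by simpa [dist_eq_norm] using hm⟩
  have hvol : volume.real ({x | r < ‖x - z n‖} \ outside z r) ≤ N * v * r := by
    have hball : ∀ m, volume.real (closedBall (z m) r) = r ^ 3 * v := fun m => by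
      rw [Measure.real, Measure.addHaar_closedBall _ _ hr0.le, finrank_euclideanSpace_fin,
        toReal_mul, toReal_ofReal (by positivity)]; rfl
    calc _ ≤ volume.real (⋃ m ∈ (univ.erase n), closedBall (z m) r) := by
          refine measureReal_mono hD ((measure_biUnion_finset_le _ _).trans_lt ?_).ne
          exact ENNReal.sum_lt_top.2 fun m _ => (isCompact_closedBall _ _).measure_lt_top
      _ ≤ ∑ m ∈ univ.erase n, volume.real (closedBall (z m) r) :=
          measureReal_biUnion_finset_le _ _
      _ ≤ ∑ m : Fin N, volume.real (closedBall (z m) r) :=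
          Finset.sum_le_sum_of_subset_of_nonneg (Finset.erase_subset _ _) fun _ _ _ => measureReal_nonneg
      _ = N * (r ^ 3 * v) := by simp [hball]
      _ ≤ N * (r * v) := by
          have : r ^ 3 ≤ r := pow_le_of_le_one hr0.le hr1.2.le (by norm_num)
          gcongr
      _ = _ := by ring
  have hfin : volume ({x | r < ‖x - z n‖} \ outside z r) < ⊤ := by
    refine (measure_mono hD).trans_lt ((measure_biUnion_finset_le _ _).trans_lt ?_)
    exact ENNReal.sum_lt_top.2 fun m _ => (isCompact_closedBall _ _).measure_lt_top
  rw [h1, norm_neg, norm_of_nonneg hr0.le]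
  refine (norm_setIntegral_le_of_norm_le_const hfin (C := |K| * ((δ / 2) ^ 4)⁻¹) fun x hx => ?_).trans ?_
  · obtain ⟨m, hm⟩ := Set.mem_iUnion.1 (hD hx)
    simp only [Set.mem_iUnion, Finset.mem_erase, mem_univ, and_true] at hm
    obtain ⟨hmn, hxm⟩ := hm
    have hxm : ‖x - z m‖ ≤ r := by simpa [dist_eq_norm] using hxm
    have h2 : δ / 2 ≤ ‖x - z n‖ := by
      have h3 := hδz m hmn
      have h4 : ‖z m - z n‖ ≤ ‖x - z n‖ + ‖x - z m‖ := by
        have := norm_sub_le (x - z n) (x - z m); simpa using this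
      have := hrδ.2
      linarith
    refine (hK0 x (sub_ne_zero.1 (norm_pos_iff.1 (lt_of_lt_of_le (by positivity) h2)))).trans ?_
    gcongr
  · have := mul_le_mul_of_nonneg_left hvol (show 0 ≤ |K| * ((δ / 2) ^ 4)⁻¹ by positivity)
    linarith

end

section

variable {N : ℕ} {z : Fin N → Space}
variable {K : ℝ} {s f p g : SR}

/-- The finite part of `∫ f g` at the points `z` agrees with the finite part of the integral of the
product of the Gaussian means. -/
def Matched (z : Fin N → Space) (f g : SR) : Prop :=
  ∃ d, HasRIntegral z (fun x => f x * g x) d ∧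
    ∃ c : ℝ, Tendsto (fun ε => (∫ x, moll ε f x * moll ε g x) - c / √ε) (𝓝[>] 0) (𝓝 d)

lemma Matched.symm (h : Matched z f g) : Matched z g f := by
  obtain ⟨d, h1, c, h2⟩ := h
  refine ⟨d, by simpa only [mul_comm] using h1, c, by simpa only [mul_comm] using h2⟩

lemma Matched.sum {ι : Type*} [Fintype ι] {F : ι → SR} {a : ι → Space}
    (hF : ∀ i, SqBound (F i) (a i)) (h : ∀ i j, Matched z (F i) (F j)) :
    Matched z (fun x => ∑ i, F i x) (fun x => ∑ i, F i x) := by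
  choose d hd c hc using h
  refine ⟨∑ i, ∑ j, d i j, ?_, ∑ i, ∑ j, c i j, ?_⟩
  · have := HasRIntegral.sum (s := univ) fun i _ =>
      HasRIntegral.sum (s := univ) fun j _ => hd i j
    simpa only [sum_mul_sum] using this
  · refine (tendsto_finsetSum univ fun i _ => tendsto_finsetSum univ fun j _ => hc i j).congr' ?_
    filter_upwards [self_mem_nhdsWithin] with ε hε
    have hε : 0 < ε := hε
    simp only [moll_sum (fun i _ => (hF i).isTempered) hε, sum_mul_sum]
    have hij : ∀ i j, Integrable fun x => moll ε (F i) x * moll ε (F j) x := fun i j =>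
      ((hF i).memLp_moll hε).integrable_mul ((hF j).memLp_moll hε)
    rw [integral_finsetSum _ fun i _ => integrable_finsetSum _ fun j _ => hij i j]
    simp only [integral_finsetSum _ fun j _ => hij _ j, Finset.sum_sub_distrib, Finset.sum_div]

/-- `w` is a majorant of `f` and of all its Gaussian means. -/
def Maj (f w : SR) : Prop :=
  (∀ᵐ x, |f x| ≤ w x) ∧ ∀ ε > 0, ∀ᵐ x, |moll ε f x| ≤ w x

lemma matched_of_maj {wf wg : SR} {a b a' b' : Space} (hf : SqBound f a') (hg : SqBound g b')
    (cf : ∀ᵐ x, ContinuousAt f x) (cg : ∀ᵐ x, ContinuousAt g x) (hwf : Maj f wf) (hwg : Maj g wg)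
    (hw : ∀ᵐ x, wf x * wg x ≤ K * (env (x - a) + env (x - b))) : Matched z f g := by
  have hb : ∀ᵐ x, |f x * g x| ≤ K * (env (x - a) + env (x - b)) := by
    filter_upwards [hwf.1, hwg.1, hw] with x h1 h2 h3
    rw [abs_mul]
    exact (mul_le_mul h1 h2 (abs_nonneg _) ((abs_nonneg _).trans h1)).trans h3
  refine ⟨_, (hasRIntegral_of_le_env (hf.1.mul hg.1) hb).2, 0, ?_⟩
  simp only [zero_div, sub_zero]
  refine tendsto_integral_filter_of_dominated_convergence (fun x => K * (env (x - a) + env (x - b))) ?_ ?_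
    (((integrable_env.comp_sub_right a).add (integrable_env.comp_sub_right b)).const_mul K) ?_
  · exact Eventually.of_forall fun ε =>
      (aestronglyMeasurable_moll hf.1 ε).mul (aestronglyMeasurable_moll hg.1 ε)
  · filter_upwards [self_mem_nhdsWithin] with ε hε
    filter_upwards [hwf.2 ε hε, hwg.2 ε hε, hw] with x h1 h2 h3
    rw [norm_eq_abs, abs_mul]
    exact (mul_le_mul h1 h2 (abs_nonneg _) ((abs_nonneg _).trans h1)).trans h3
  · filter_upwards [cf, cg] with x h1 h2
    exact (hf.tendsto_moll h1).mul (hg.tendsto_moll h2)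

lemma ae_ne (a : Space) : ∀ᵐ x : Space, x ≠ a := by rw [ae_iff]; simp

lemma env_prod_aux {u v D : ℝ} (hu : 0 < u) (huv : u ≤ v) (hD : 0 < D) (h : D ≤ u + v) :
    (u ^ 2)⁻¹ * (v ^ 2)⁻¹ ≤ (4 / D ^ 2 + 1) * (u ^ 2 * (1 + u ^ 2))⁻¹ := by
  have hv : 0 < v := hu.trans_le huv
  have h1 : D / 2 ≤ v := by linarith
  have h2 : 1 + u ^ 2 ≤ (4 / D ^ 2 + 1) * v ^ 2 := by
    have h3 : (D / 2) ^ 2 ≤ v ^ 2 := pow_le_pow_left₀ (by positivity) h1 2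
    have h4 : u ^ 2 ≤ v ^ 2 := pow_le_pow_left₀ hu.le huv 2
    have h5 : 1 ≤ 4 / D ^ 2 * v ^ 2 := by
      rw [div_mul_eq_mul_div, le_div_iff₀ (by positivity)]; linarith
    linarith
  rw [mul_inv, ← mul_assoc, mul_comm (4 / D ^ 2 + 1), mul_assoc]
  refine mul_le_mul_of_nonneg_left ?_ (by positivity)
  rw [← div_eq_mul_inv, inv_eq_one_div, div_le_div_iff₀ (by positivity) (by positivity)]
  linarith

lemma inv_sq_mul_inv_sq_le {a b : Space} (hab : a ≠ b) :
    ∃ K, ∀ᵐ x, (‖x - a‖ ^ 2)⁻¹ * (‖x - b‖ ^ 2)⁻¹ ≤ K * (env (x - a) + env (x - b)) := by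
  have hD : 0 < ‖a - b‖ := norm_pos_iff.2 (sub_ne_zero.2 hab)
  refine ⟨4 / ‖a - b‖ ^ 2 + 1, ?_⟩
  filter_upwards [ae_ne a, ae_ne b] with x hxa hxb
  have ha : 0 < ‖x - a‖ := norm_pos_iff.2 (sub_ne_zero.2 hxa)
  have hb : 0 < ‖x - b‖ := norm_pos_iff.2 (sub_ne_zero.2 hxb)
  have h : ‖a - b‖ ≤ ‖x - a‖ + ‖x - b‖ := by
    have := norm_sub_le (x - b) (x - a); simp only [sub_sub_sub_cancel_left] at this; linarith
  have e1 := env_nonneg (x - a)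
  have e2 := env_nonneg (x - b)
  have hc : 0 < 4 / ‖a - b‖ ^ 2 + 1 := by positivity
  rcases le_total ‖x - a‖ ‖x - b‖ with hl | hl
  · refine (env_prod_aux ha hl hD h).trans (mul_le_mul_of_nonneg_left ?_ hc.le)
    change env (x - a) ≤ _; linarith
  · rw [mul_comm]
    refine (env_prod_aux hb hl hD (by linarith)).trans (mul_le_mul_of_nonneg_left ?_ hc.le)
    change env (x - b) ≤ _; linarith

/-! ### The three kinds of terms -/

/-- Majorant of a homogeneous function of degree `-2`. -/
def majSq (K : ℝ) (a x : Space) : ℝ := K * (‖x - a‖ ^ 2)⁻¹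

/-- Majorant of a truncated homogeneous function of degree `-1`. -/
def majInv (K : ℝ) (a x : Space) : ℝ := min (K * ‖x - a‖⁻¹) (K * (‖x - a‖ ^ 2)⁻¹)

/-- Majorant of a bounded function with inverse square decay. -/
def majBdd (K : ℝ) (x : Space) : ℝ := min K (K * (‖x‖ ^ 2)⁻¹)

lemma majInv_sq_le (hK : 0 ≤ K) (a x : Space) : majInv K a x ^ 2 ≤ 2 * K ^ 2 * env (x - a) := by
  rcases eq_or_ne x a with rfl | hx
  · simp [majInv, env]
  have hp : 0 < ‖x - a‖ := norm_pos_iff.2 (sub_ne_zero.2 hx)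
  unfold majInv env
  set u := ‖x - a‖
  have h0 : 0 ≤ min (K * u⁻¹) (K * (u ^ 2)⁻¹) := le_min (by positivity) (by positivity)
  rw [show 2 * K ^ 2 * (u ^ 2 * (1 + u ^ 2))⁻¹ = 2 * K ^ 2 / (u ^ 2 * (1 + u ^ 2)) from
    (div_eq_mul_inv _ _).symm, le_div_iff₀ (by positivity)]
  rcases le_total u 1 with h | h
  · have h1 := pow_le_pow_left₀ h0 (min_le_left _ _) 2
    calc _ ≤ (K * u⁻¹) ^ 2 * (u ^ 2 * (1 + u ^ 2)) := mul_le_mul_of_nonneg_right h1 (by positivity)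
      _ = K ^ 2 * (1 + u ^ 2) := by field_simp
      _ ≤ K ^ 2 * 2 := by gcongr; have := pow_le_one₀ (n := 2) hp.le h; linarith
      _ = _ := by ring
  · have h1 := pow_le_pow_left₀ h0 (min_le_right _ _) 2
    have h2 : (u ^ 2)⁻¹ ≤ 1 := inv_le_one_of_one_le₀ (one_le_pow₀ h)
    calc _ ≤ (K * (u ^ 2)⁻¹) ^ 2 * (u ^ 2 * (1 + u ^ 2)) := mul_le_mul_of_nonneg_right h1 (by positivity)
      _ = K ^ 2 * (1 + (u ^ 2)⁻¹) := by field_simp; ring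
      _ ≤ K ^ 2 * 2 := by gcongr; linarith
      _ = _ := by ring

lemma majBdd_le (hK : 0 ≤ K) (x : Space) (hx : x ≠ 0) : majBdd K x ≤ 2 * K / (1 + ‖x‖ ^ 2) := by
  have hp : 0 < ‖x‖ := norm_pos_iff.2 hx
  unfold majBdd
  rw [le_div_iff₀ (by positivity)]
  rcases le_total ‖x‖ 1 with h | h
  · refine (mul_le_mul_of_nonneg_right (min_le_left _ _) (by positivity)).trans ?_
    have := pow_le_one₀ (n := 2) hp.le h
    nlinarith
  · refine (mul_le_mul_of_nonneg_right (min_le_right _ _) (by positivity)).trans ?_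
    have h2 : (‖x‖ ^ 2)⁻¹ ≤ 1 := inv_le_one_of_one_le₀ (one_le_pow₀ h)
    calc _ = K * ((‖x‖ ^ 2)⁻¹ + 1) := by field_simp
      _ ≤ K * 2 := by gcongr; linarith
      _ = _ := by ring

lemma majBdd_nonneg (hK : 0 ≤ K) (x : Space) : 0 ≤ majBdd K x := le_min hK (by positivity)

lemma majBdd_sq_le (hK : 0 ≤ K) (x : Space) (hx : x ≠ 0) : majBdd K x ^ 2 ≤ 4 * K ^ 2 * env x := by
  have hp : 0 < ‖x‖ := norm_pos_iff.2 hx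
  refine (pow_le_pow_left₀ (majBdd_nonneg hK x) (majBdd_le hK x hx) 2).trans ?_
  unfold env
  rw [div_pow, div_eq_mul_inv]
  have : ((1 + ‖x‖ ^ 2) ^ 2)⁻¹ ≤ (‖x‖ ^ 2 * (1 + ‖x‖ ^ 2))⁻¹ := by
    refine inv_anti₀ (by positivity) ?_
    rw [sq (1 + ‖x‖ ^ 2)]
    exact mul_le_mul_of_nonneg_right (by linarith) (by positivity)
  calc _ ≤ (2 * K) ^ 2 * (‖x‖ ^ 2 * (1 + ‖x‖ ^ 2))⁻¹ := by gcongr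
    _ = _ := by ring

lemma majSq_mul_majBdd_le {L : ℝ} (hK : 0 ≤ K) (hL : 0 ≤ L) (a x : Space) (hx : x ≠ 0) :
    majSq K a x * majBdd L x ≤ (4 * K * L * (1 + ‖a‖ ^ 2)) * (env (x - a) + env (x - a)) := by
  rcases eq_or_ne x a with rfl | hxa
  · have : majSq K x x = 0 := by simp [majSq]
    rw [this, zero_mul]; have := env_nonneg (x - x); positivity
  have hp : 0 < ‖x - a‖ := norm_pos_iff.2 (sub_ne_zero.2 hxa)
  have h1 : 1 + ‖x - a‖ ^ 2 ≤ 2 * (1 + ‖a‖ ^ 2) * (1 + ‖x‖ ^ 2) := by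
    have h2 := pow_le_pow_left₀ (norm_nonneg _) (norm_sub_le x a) 2
    nlinarith [sq_nonneg (‖x‖ - ‖a‖), mul_nonneg (sq_nonneg ‖x‖) (sq_nonneg ‖a‖)]
  have h3 : 2 * L / (1 + ‖x‖ ^ 2) ≤ 4 * L * (1 + ‖a‖ ^ 2) * (1 + ‖x - a‖ ^ 2)⁻¹ := by
    rw [← div_eq_mul_inv, div_le_div_iff₀ (by positivity) (by positivity)]
    have := mul_le_mul_of_nonneg_left h1 (show 0 ≤ 2 * L by positivity)
    linarith
  have h4 := env_nonneg (x - a)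
  have h5 : 0 ≤ 4 * K * L * (1 + ‖a‖ ^ 2) := by positivity
  calc _ ≤ K * (‖x - a‖ ^ 2)⁻¹ * (4 * L * (1 + ‖a‖ ^ 2) * (1 + ‖x - a‖ ^ 2)⁻¹) := by
        unfold majSq
        exact mul_le_mul_of_nonneg_left ((majBdd_le hL x hx).trans h3) (by positivity)
    _ = (4 * K * L * (1 + ‖a‖ ^ 2)) * env (x - a) := by unfold env; rw [mul_inv]; ring
    _ ≤ _ := by nlinarith

/-- Continuous off the origin, homogeneous of degree `-2` and odd. -/
def HomOdd (s : SR) : Prop :=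
  ContinuousOn s {0}ᶜ ∧ (∀ r > 0, ∀ x, s (r • x) = (r ^ 2)⁻¹ * s x) ∧ ∀ x, s (-x) = -s x

/-- Continuous off the origin, homogeneous of degree `-1` and even. -/
def HomEven (p : SR) : Prop :=
  ContinuousOn p {0}ᶜ ∧ (∀ r > 0, ∀ x, p (r • x) = r⁻¹ * p x) ∧ ∀ x, p (-x) = p x

/-- Bounded with inverse square decay. -/
def BddDecay (b : SR) : Prop :=
  AEStronglyMeasurable b volume ∧ (∃ C, 0 ≤ C ∧ ∀ᵐ x, |b x| ≤ C / (1 + ‖x‖ ^ 2)) ∧ ∀ᵐ x, ContinuousAt b x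

/-- The homogeneous function truncated to the unit ball. -/
def trunc (p : SR) : SR := (ball (0 : Space) 1).indicator p

lemma exists_bound_of_continuousOn (hs : ContinuousOn s {0}ᶜ) :
    ∃ C, 0 ≤ C ∧ ∀ x : Space, ‖x‖ = 1 → |s x| ≤ C := by
  obtain ⟨C, hC⟩ := (isCompact_sphere (0 : Space) 1).exists_bound_of_continuousOn (hs.mono fun x hx => by
      have : ‖x‖ = 1 := by simpa using hx
      exact norm_pos_iff.1 (by rw [this]; exact one_pos))
  exact ⟨|C|, abs_nonneg _, fun x hx => (hC x (by simpa using hx)).trans (le_abs_self C)⟩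

lemma HomOdd.exists_bound (hs : HomOdd s) : ∃ C, 0 ≤ C ∧ ∀ x, |s x| ≤ C * (‖x‖ ^ 2)⁻¹ := by
  obtain ⟨C, hC0, hC⟩ := exists_bound_of_continuousOn hs.1
  refine ⟨C, hC0, fun x => ?_⟩
  rcases eq_or_ne x 0 with rfl | hx
  · have h := hs.2.1 2 two_pos 0
    rw [smul_zero] at h
    have : s 0 = 0 := by linarith
    rw [this]; simp
  · have hp : 0 < ‖x‖ := norm_pos_iff.2 hx
    have h := hs.2.1 ‖x‖ hp (‖x‖⁻¹ • x)
    rw [smul_smul, mul_inv_cancel₀ hp.ne', one_smul] at h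
    rw [h, abs_mul, abs_of_nonneg (by positivity), mul_comm]
    refine mul_le_mul_of_nonneg_right (hC _ ?_) (by positivity)
    rw [norm_smul, norm_inv, norm_norm, inv_mul_cancel₀ hp.ne']

lemma HomEven.exists_bound (hs : HomEven s) : ∃ C, 0 ≤ C ∧ ∀ x, |s x| ≤ C * ‖x‖⁻¹ := by
  obtain ⟨C, hC0, hC⟩ := exists_bound_of_continuousOn hs.1
  refine ⟨C, hC0, fun x => ?_⟩
  rcases eq_or_ne x 0 with rfl | hx
  · have h := hs.2.1 2 two_pos 0
    rw [smul_zero] at h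
    have : s 0 = 0 := by linarith
    rw [this]; simp
  · have hp : 0 < ‖x‖ := norm_pos_iff.2 hx
    have h := hs.2.1 ‖x‖ hp (‖x‖⁻¹ • x)
    rw [smul_smul, mul_inv_cancel₀ hp.ne', one_smul] at h
    rw [h, abs_mul, abs_of_nonneg (by positivity), mul_comm]
    refine mul_le_mul_of_nonneg_right (hC _ ?_) (by positivity)
    rw [norm_smul, norm_inv, norm_norm, inv_mul_cancel₀ hp.ne']

lemma ae_comp_sub {P : Space → Prop} (h : ∀ᵐ x, P x) (a : Space) : ∀ᵐ x, P (x - a) :=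
  (measurePreserving_sub_right volume a).quasiMeasurePreserving.ae h

lemma ae_continuousAt_comp_sub (h : ∀ᵐ x, ContinuousAt f x) (a : Space) :
    ∀ᵐ x, ContinuousAt (fun x => f (x - a)) x := by
  filter_upwards [ae_comp_sub h a] with x hx
  exact ContinuousAt.comp (f := fun x => x - a) (g := f) hx (by fun_prop)

lemma ae_continuousAt_of_continuousOn (h : ContinuousOn f {0}ᶜ) : ∀ᵐ x, ContinuousAt f x := by
  filter_upwards [ae_ne 0] with x hx
  exact h.continuousAt (isOpen_compl_singleton.mem_nhds hx)

lemma HomEven.ae_continuousAt_trunc (hp : HomEven p) : ∀ᵐ x, ContinuousAt (trunc p) x := by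
  have hs : ∀ᵐ x : Space, x ∉ 𝕊 :=
    measure_eq_zero_iff_ae_notMem.1 (Measure.addHaar_sphere vol 0 1)
  filter_upwards [ae_continuousAt_of_continuousOn hp.1, hs] with x hx hxs
  have hxs : ‖x‖ ≠ 1 := by simpa using hxs
  rcases lt_or_gt_of_ne hxs with h | h
  · refine hx.congr ?_
    filter_upwards [isOpen_ball.mem_nhds (show x ∈ ball (0 : Space) 1 by simpa using h)] with y hy
    rw [trunc, indicator_of_mem hy]
  · refine (continuousAt_const (y := (0 : ℝ))).congr ?_
    have : {y : Space | 1 < ‖y‖} ∈ 𝓝 x := (isOpen_lt continuous_const continuous_norm).mem_nhds h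
    filter_upwards [this] with y hy
    have hy : 1 < ‖y‖ := hy
    rw [trunc, indicator_of_notMem (by simpa using hy.le)]

lemma HomOdd.sqBound (hs : HomOdd s) (a : Space) : SqBound (fun x => s (x - a)) a := by
  obtain ⟨C, hC0, hC⟩ := hs.exists_bound
  refine ⟨?_, C, hC0, ae_of_all _ fun x => hC _⟩
  exact (aesm_of_continuousOn hs.1).comp_measurePreserving (measurePreserving_sub_right volume a)

lemma HomEven.trunc_bounds (hp : HomEven p) : ∃ C, 0 ≤ C ∧ ∀ x, |trunc p x| ≤ C * ‖x‖⁻¹ ∧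
    |trunc p x| ≤ C * (‖x‖ ^ 2)⁻¹ := by
  obtain ⟨C, hC0, hC⟩ := hp.exists_bound
  refine ⟨C, hC0, fun x => ?_⟩
  by_cases hx : x ∈ ball (0 : Space) 1
  · rw [trunc, indicator_of_mem hx]
    refine ⟨hC x, (hC x).trans (mul_le_mul_of_nonneg_left ?_ hC0)⟩
    rcases eq_or_ne x 0 with rfl | h0
    · simp
    · have hx : ‖x‖ < 1 := by simpa using hx
      refine inv_anti₀ (pow_pos (norm_pos_iff.2 h0) 2) ?_
      exact pow_le_of_le_one (norm_nonneg _) hx.le two_ne_zero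
  · rw [trunc, indicator_of_notMem hx, abs_zero]
    constructor <;> positivity

lemma HomEven.sqBound (hp : HomEven p) (a : Space) : SqBound (fun x => trunc p (x - a)) a := by
  obtain ⟨C, hC0, hC⟩ := hp.trunc_bounds
  refine ⟨?_, C, hC0, ae_of_all _ fun x => (hC _).2⟩
  exact ((aesm_of_continuousOn hp.1).indicator isOpen_ball.measurableSet).comp_measurePreserving
    (measurePreserving_sub_right volume a)

lemma BddDecay.sqBound {b : SR} (hb : BddDecay b) : SqBound b 0 := by
  obtain ⟨hm, ⟨C, hC0, hC⟩, -⟩ := hb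
  refine ⟨hm, C, hC0, ?_⟩
  filter_upwards [hC, ae_ne 0] with x hx h0
  have : 0 < ‖x‖ := norm_pos_iff.2 h0
  rw [sub_zero]
  refine hx.trans ?_
  rw [div_eq_mul_inv]
  gcongr; linarith

lemma HomOdd.maj (hs : HomOdd s) (a : Space) : ∃ K, 0 ≤ K ∧ Maj (fun x => s (x - a)) (majSq K a) := by
  obtain ⟨C, hC0, hC⟩ := hs.exists_bound
  obtain ⟨K, hK0, hK⟩ := (hs.sqBound a).moll_le
  refine ⟨max C K, hC0.trans (le_max_left _ _), ae_of_all _ fun x => ?_, fun ε hε => ?_⟩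
  · exact (hC _).trans (mul_le_mul_of_nonneg_right (le_max_left _ _) (by positivity))
  · filter_upwards [ae_ne a] with x hx
    exact (hK ε hε x hx).trans (mul_le_mul_of_nonneg_right (le_max_right _ _) (by positivity))

lemma HomEven.maj (hp : HomEven p) (a : Space) :
    ∃ K, 0 ≤ K ∧ Maj (fun x => trunc p (x - a)) (majInv K a) := by
  obtain ⟨C, hC0, hC⟩ := hp.trunc_bounds
  obtain ⟨K, hK0, hK⟩ := (hp.sqBound a).moll_le
  obtain ⟨L, hL0, hL⟩ := moll_le_of_inv (f := fun x => trunc p (x - a)) (a := a) hC0 (ae_of_all _ fun x => (hC _).1)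
  have h1 : C ≤ max C (max K L) := le_max_left _ _
  have h2 : K ≤ max C (max K L) := (le_max_left _ _).trans (le_max_right _ _)
  have h3 : L ≤ max C (max K L) := (le_max_right _ _).trans (le_max_right _ _)
  refine ⟨max C (max K L), hC0.trans h1, ae_of_all _ fun x => le_min ?_ ?_, fun ε hε => ?_⟩
  · exact (hC _).1.trans (mul_le_mul_of_nonneg_right h1 (by positivity))
  · exact (hC _).2.trans (mul_le_mul_of_nonneg_right h1 (by positivity))
  · filter_upwards [ae_ne a] with x hx
    exact le_min ((hL ε hε x hx).trans (mul_le_mul_of_nonneg_right h3 (by positivity)))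
      ((hK ε hε x hx).trans (mul_le_mul_of_nonneg_right h2 (by positivity)))

lemma BddDecay.maj {b : SR} (hb : BddDecay b) : ∃ K, 0 ≤ K ∧ Maj b (majBdd K) := by
  obtain ⟨S, hS0, hS⟩ := hb.sqBound.2
  obtain ⟨K, hK0, hK⟩ := hb.sqBound.moll_le
  obtain ⟨hm, ⟨C, hC0, hC⟩, -⟩ := hb
  have hC' : ∀ᵐ x, |b x| ≤ C := by
    filter_upwards [hC] with x hx
    exact hx.trans (div_le_self hC0 (by nlinarith [norm_nonneg x]))
  have h1 : C ≤ max C (max K S) := le_max_left _ _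
  have h2 : K ≤ max C (max K S) := (le_max_left _ _).trans (le_max_right _ _)
  have h3 : S ≤ max C (max K S) := (le_max_right _ _).trans (le_max_right _ _)
  simp only [sub_zero] at hS hK
  refine ⟨max C (max K S), hC0.trans h1, ?_, fun ε hε => ?_⟩
  · filter_upwards [hC', hS] with x hx hx'
    exact le_min (hx.trans h1) (hx'.trans (mul_le_mul_of_nonneg_right h3 (by positivity)))
  · filter_upwards [ae_ne 0] with x hx
    exact le_min ((moll_le_of_bound hC' hε x).trans h1)
      ((hK ε hε x hx).trans (mul_le_mul_of_nonneg_right h2 (by positivity)))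

end

section

variable {N : ℕ} {z : Fin N → Space}
variable {f s b g : SR} {ε : ℝ}

lemma integral_eq_zero_of_odd (a : Space) (h : ∀ x, f (a + -x) = -f (a + x)) : ∫ x, f x = 0 := by
  have h1 : ∫ x, f (a + -x) = ∫ x, f x := by
    rw [integral_neg_eq_self (fun x => f (a + x)), integral_add_left_eq_self f]
  have h2 : ∫ x, f (a + x) = ∫ x, f x := integral_add_left_eq_self f a
  simp only [h] at h1
  rw [integral_neg, h2] at h1
  linarith

lemma moll_neg (ε : ℝ) (f : SR) (y : Space) : moll ε f (-y) = moll ε (fun x => f (-x)) y := by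
  unfold moll
  rw [← integral_neg_eq_self]
  congr 1; ext x
  rw [← heat_neg]; congr 2; abel

lemma heat_smul_sqrt (hε : 0 < ε) (x : Space) : heat ε (√ε • x) = (√ε ^ 3)⁻¹ * heat 1 x := by
  have h0 : 0 < √ε := sqrt_pos.2 hε
  rw [heat_eq hε, heat_eq one_pos, Real.sqrt_mul (by positivity) ε, mul_one, norm_smul, norm_of_nonneg h0.le]
  have h1 : √ε * ‖x‖ / (√(4 * π) * √ε) = ‖x‖ / √(4 * π) := by
    field_simp
  rw [h1, mul_pow, mul_inv]; ring

lemma HomOdd.moll_smul (hs : HomOdd s) (hε : 0 < ε) (y : Space) :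
    moll ε s (√ε • y) = ε⁻¹ * moll 1 s y := by
  have h0 : 0 < √ε := sqrt_pos.2 hε
  unfold moll
  have h := Measure.integral_comp_smul vol (fun x => s x * heat ε (x - √ε • y)) √ε
  rw [finrank_euclideanSpace_fin, abs_of_pos (by positivity), smul_eq_mul, eq_comm, inv_mul_eq_iff_eq_mul₀ (by positivity)] at h
  rw [h, ← integral_const_mul, ← integral_const_mul]
  congr 1; ext x
  rw [← smul_sub, heat_smul_sqrt hε, hs.2.1 _ h0, sq_sqrt hε.le]
  field_simp

lemma HomOdd.matched_self (hz : Injective z) (hs : HomOdd s) (n : Fin N) :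
    Matched z (fun x => s (x - z n)) (fun x => s (x - z n)) := by
  have hsb := hs.sqBound (z n)
  obtain ⟨C, hC0, hC⟩ := hs.exists_bound
  refine ⟨0, ?_, ∫ y, moll 1 s y ^ 2, ?_⟩
  · refine hasRIntegral_of_single hz n (G := fun x => s (x - z n) * s (x - z n)) (hsb.1.mul hsb.1) (K := C * C)
      (a := ∫ x in {x : Space | 1 < ‖x‖}, s x ^ 2) (fun x hx => ?_) ?_
    · rw [abs_mul]
      refine (mul_le_mul (hC _) (hC _) (abs_nonneg _) (by positivity)).trans (le_of_eq ?_)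
      rw [show (4 : ℕ) = 2 + 2 from rfl, pow_add, mul_inv]; ring
    · filter_upwards [self_mem_nhdsWithin] with r hr
      have hr : 0 < r := hr
      have hms : ∀ (ρ : ℝ) (a : Space), MeasurableSet {x : Space | ρ < ‖x - a‖} := fun ρ a =>
        measurableSet_lt (by fun_prop) (by fun_prop)
      have hms0 : ∀ (ρ : ℝ), MeasurableSet {x : Space | ρ < ‖x‖} := fun ρ =>
        measurableSet_lt (by fun_prop) (by fun_prop)
      have h1 : ∫ x in {x | r < ‖x - z n‖}, s (x - z n) * s (x - z n) = ∫ x in {x : Space | r < ‖x‖}, s x ^ 2 := by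
        rw [← integral_indicator (hms _ _), ← integral_indicator (hms0 _),
          ← integral_sub_right_eq_self ({x : Space | r < ‖x‖}.indicator fun x => s x ^ 2) (z n)]
        congr 1; ext x
        simp only [Set.indicator, mem_ofPred_eq, sq]
      have h2 := Measure.integral_comp_smul vol
        ({x : Space | 1 < ‖x‖}.indicator fun x => s x ^ 2) r⁻¹
      rw [integral_indicator (hms0 _), finrank_euclideanSpace_fin, smul_eq_mul, inv_pow, inv_inv,
        abs_of_pos (by positivity)] at h2
      have h3 : ∀ x : Space, ({x : Space | 1 < ‖x‖}.indicator fun x => s x ^ 2) (r⁻¹ • x)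
          = r ^ 4 * ({x : Space | r < ‖x‖}.indicator fun x => s x ^ 2) x := by
        intro x
        have hiff : 1 < ‖r⁻¹ • x‖ ↔ r < ‖x‖ := by
          rw [norm_smul, norm_inv, norm_of_nonneg hr.le, ← div_eq_inv_mul, one_lt_div hr]
        by_cases hx : r < ‖x‖
        · rw [indicator_of_mem (show _ ∈ {x : Space | 1 < ‖x‖} from hiff.2 hx),
            indicator_of_mem (show x ∈ {x : Space | r < ‖x‖} from hx), hs.2.1 _ (inv_pos.2 hr)]
          field_simp
        · rw [indicator_of_notMem (show _ ∉ {x : Space | 1 < ‖x‖} from fun h => hx (hiff.1 h)),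
            indicator_of_notMem (show x ∉ {x : Space | r < ‖x‖} from hx), mul_zero]
      simp only [h3] at h2
      rw [integral_const_mul, integral_indicator (hms0 _)] at h2
      rw [h1, add_zero, eq_div_iff hr.ne']
      have h4 : r ^ 3 * ((∫ x in {x : Space | r < ‖x‖}, s x ^ 2) * r) = r ^ 3 * ∫ x in {x : Space | 1 < ‖x‖}, s x ^ 2 := by
        rw [← h2]; ring
      exact mul_left_cancel₀ (by positivity) h4
  · refine tendsto_const_nhds.congr' ?_
    filter_upwards [self_mem_nhdsWithin] with ε hε
    have hε : 0 < ε := hε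
    have h0 : 0 < √ε := sqrt_pos.2 hε
    simp only [moll_comp_sub]
    rw [integral_sub_right_eq_self (fun y => moll ε s y * moll ε s y)]
    have h := Measure.integral_comp_smul vol (fun y => moll ε s y * moll ε s y) √ε
    rw [finrank_euclideanSpace_fin, abs_of_pos (by positivity), smul_eq_mul, eq_comm, inv_mul_eq_iff_eq_mul₀ (by positivity)] at h
    rw [h]
    simp only [hs.moll_smul hε]
    have h5 : ∫ x, ε⁻¹ * moll 1 s x * (ε⁻¹ * moll 1 s x) = ε⁻¹ ^ 2 * ∫ x, moll 1 s x ^ 2 := by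
      rw [← integral_const_mul]; congr 1; ext x; ring
    rw [h5]
    have h6 : ε⁻¹ = (√ε ^ 2)⁻¹ := by rw [sq_sqrt hε.le]
    rw [h6]
    field_simp
    ring

lemma matched_homOdd_homEven (hz : Injective z) {p : SR} (hs : HomOdd s) (hp : HomEven p)
    (n : Fin N) : Matched z (fun x => s (x - z n)) (fun x => trunc p (x - z n)) := by
  have hsb := hs.sqBound (z n)
  have hpb := hp.sqBound (z n)
  obtain ⟨C, hC0, hC⟩ := hs.exists_bound
  obtain ⟨D, hD0, hD⟩ := hp.trunc_bounds
  have htr : ∀ x, trunc p (-x) = trunc p x := fun x => by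
    unfold trunc
    by_cases hx : x ∈ ball (0 : Space) 1
    · rw [indicator_of_mem hx, indicator_of_mem (by simpa using hx), hp.2.2]
    · rw [indicator_of_notMem hx, indicator_of_notMem (by simpa using hx)]
  refine ⟨0, ?_, 0, ?_⟩
  · refine hasRIntegral_of_single hz n (G := fun x => s (x - z n) * trunc p (x - z n)) (hsb.1.mul hpb.1) (K := C * D) (a := 0) (fun x hx => ?_) ?_
    · rw [abs_mul]
      refine (mul_le_mul (hC _) (hD _).2 (abs_nonneg _) (by positivity)).trans (le_of_eq ?_)
      rw [show (4 : ℕ) = 2 + 2 from rfl, pow_add, mul_inv]; ring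
    · refine Eventually.of_forall fun r => ?_
      rw [zero_div, add_zero, ← integral_indicator (measurableSet_lt (by fun_prop) (by fun_prop))]
      refine integral_eq_zero_of_odd (z n) fun x => ?_
      simp only [Set.indicator, mem_ofPred_eq, add_sub_cancel_left, norm_neg, htr, hs.2.2]
      split_ifs <;> simp
  · refine tendsto_const_nhds.congr' ?_
    filter_upwards [self_mem_nhdsWithin] with ε hε
    rw [zero_div, sub_zero, eq_comm]
    refine integral_eq_zero_of_odd (z n) fun x => ?_
    simp only [moll_comp_sub, add_sub_cancel_left]
    rw [moll_neg, moll_neg]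
    simp only [hs.2.2, htr]
    have : moll ε (fun x => -s x) x = -moll ε s x := by
      unfold moll; simp only [neg_mul]; rw [integral_neg]
    rw [this]; ring

/-- Functions with at most inverse square singularities of the type of the gradients of
Lienard-Wiechert potentials at the points `z n`, and with inverse square decay. -/
def SingExp (z : Fin N → Space) (f : SR) : Prop :=
  ∃ (s p : Fin N → SR) (b : SR), (∀ n, HomOdd (s n)) ∧ (∀ n, HomEven (p n)) ∧ BddDecay b ∧
    f =ᵐ[volume] fun x => (∑ n, s n (x - z n)) + (∑ n, trunc (p n) (x - z n)) + b x

lemma majInv_mul_majInv_le {K L : ℝ} (hK : 0 ≤ K) (hL : 0 ≤ L) (a b x : Space) :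
    majInv K a x * majInv L b x ≤ (2 * K ^ 2 + 2 * L ^ 2) * (env (x - a) + env (x - b)) := by
  have h1 := majInv_sq_le hK a x
  have h2 := majInv_sq_le hL b x
  have h3 := env_nonneg (x - a); have h4 := env_nonneg (x - b)
  nlinarith [sq_nonneg (majInv K a x - majInv L b x), mul_nonneg (sq_nonneg K) h4, mul_nonneg (sq_nonneg L) h3,
    sq_nonneg (majInv K a x), sq_nonneg (majInv L b x)]

lemma SingExp.matched (hz : Injective z) (hf : SingExp z f) :
    Matched z f f ∧ (∀ ε > 0, MemLp (moll ε f) 2 volume) ∧ Tempered fun x => (f x : ℂ) := by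
  obtain ⟨s, p, b, hs, hp, hb, he⟩ := hf
  set F : Fin N ⊕ Fin N ⊕ Unit → SR := Sum.elim (fun n x => s n (x - z n))
    (Sum.elim (fun n x => trunc (p n) (x - z n)) fun _ => b) with hF
  set a : Fin N ⊕ Fin N ⊕ Unit → Space := Sum.elim z (Sum.elim z fun _ => 0) with ha
  have hsum : ∀ x, ∑ i, F i x = (∑ n, s n (x - z n)) + (∑ n, trunc (p n) (x - z n)) + b x := by
    intro x
    simp only [hF, Fintype.sum_sum_type, Sum.elim_inl, Sum.elim_inr, Finset.univ_unique, Finset.sum_singleton]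
    ring
  have hFe : f =ᵐ[volume] fun x => ∑ i, F i x := by simpa only [hsum] using he
  have hSq : ∀ i, SqBound (F i) (a i) := by
    rintro (n | n | _)
    · exact (hs n).sqBound (z n)
    · exact (hp n).sqBound (z n)
    · exact hb.sqBound
  have cs : ∀ n, ∀ᵐ x, ContinuousAt (fun x => s n (x - z n)) x := fun n =>
    ae_continuousAt_comp_sub (ae_continuousAt_of_continuousOn (hs n).1) _
  have cp : ∀ n, ∀ᵐ x, ContinuousAt (fun x => trunc (p n) (x - z n)) x := fun n =>
    ae_continuousAt_comp_sub (hp n).ae_continuousAt_trunc _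
  choose Ks hKs hms using fun n => (hs n).maj (z n)
  choose Kp hKp hmp using fun n => (hp n).maj (z n)
  obtain ⟨Kb, hKb, hmb⟩ := hb.maj
  have hdist : ∀ {K L : ℝ} {a b : Space}, 0 ≤ K → 0 ≤ L → a ≠ b →
      ∃ M, ∀ᵐ x, majSq K a x * majSq L b x ≤ M * (env (x - a) + env (x - b)) := by
    intro K L a b hK hL hab
    obtain ⟨M, hM⟩ := inv_sq_mul_inv_sq_le hab
    refine ⟨K * L * M, ?_⟩
    filter_upwards [hM] with x hx
    calc majSq K a x * majSq L b x = K * L * ((‖x - a‖ ^ 2)⁻¹ * (‖x - b‖ ^ 2)⁻¹) := by unfold majSq; ring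
      _ ≤ K * L * (M * (env (x - a) + env (x - b))) := by gcongr
      _ = _ := by ring
  have hss : ∀ n m, Matched z (fun x => s n (x - z n)) (fun x => s m (x - z m)) := by
    intro n m
    rcases eq_or_ne n m with rfl | hnm
    · exact (hs n).matched_self hz n
    · obtain ⟨M, hM⟩ := hdist (hKs n) (hKs m) (hz.ne hnm)
      exact matched_of_maj ((hs n).sqBound _) ((hs m).sqBound _) (cs n) (cs m) (hms n) (hms m) hM
  have hsp : ∀ n m, Matched z (fun x => s n (x - z n)) (fun x => trunc (p m) (x - z m)) := by
    intro n m
    rcases eq_or_ne n m with rfl | hnm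
    · exact matched_homOdd_homEven hz (hs n) (hp n) n
    · obtain ⟨M, hM⟩ := hdist (hKs n) (hKp m) (hz.ne hnm)
      refine matched_of_maj ((hs n).sqBound _) ((hp m).sqBound _) (cs n) (cp m) (hms n) (hmp m) (K := M)
        (a := z n) (b := z m) ?_
      filter_upwards [hM] with x hx
      refine le_trans (mul_le_mul_of_nonneg_left (min_le_right _ _) ?_) hx
      have := hKs n; unfold majSq; positivity
  have hsb : ∀ n, Matched z (fun x => s n (x - z n)) b := by
    intro n
    refine matched_of_maj ((hs n).sqBound _) hb.sqBound (cs n) hb.2.2 (hms n) hmb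
      (K := 4 * Ks n * Kb * (1 + ‖z n‖ ^ 2)) (a := z n) (b := z n) ?_
    filter_upwards [ae_ne 0] with x hx
    exact majSq_mul_majBdd_le (hKs n) hKb _ _ hx
  have hpp : ∀ n m, Matched z (fun x => trunc (p n) (x - z n)) (fun x => trunc (p m) (x - z m)) := fun n m =>
    matched_of_maj ((hp n).sqBound _) ((hp m).sqBound _) (cp n) (cp m) (hmp n) (hmp m)
      (ae_of_all _ fun x => majInv_mul_majInv_le (hKp n) (hKp m) _ _ x)
  have hpb : ∀ n, Matched z (fun x => trunc (p n) (x - z n)) b := by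
    intro n
    refine matched_of_maj ((hp n).sqBound _) hb.sqBound (cp n) hb.2.2 (hmp n) hmb
      (K := 2 * Kp n ^ 2 + 4 * Kb ^ 2) (a := z n) (b := 0) ?_
    filter_upwards [ae_ne 0] with x hx
    have h1 := majInv_sq_le (hKp n) (z n) x
    have h2 := majBdd_sq_le hKb x hx
    have h3 := env_nonneg (x - z n); have h4 := env_nonneg x
    rw [sub_zero]
    nlinarith [sq_nonneg (majInv (Kp n) (z n) x - majBdd Kb x), mul_nonneg (sq_nonneg (Kp n)) h4,
      mul_nonneg (sq_nonneg Kb) h3, sq_nonneg (majInv (Kp n) (z n) x), sq_nonneg (majBdd Kb x)]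
  have hbb : Matched z b b := by
    refine matched_of_maj hb.sqBound hb.sqBound hb.2.2 hb.2.2 hmb hmb (K := 4 * Kb ^ 2) (a := 0) (b := 0) ?_
    filter_upwards [ae_ne 0] with x hx
    have h2 := majBdd_sq_le hKb x hx
    have h4 := env_nonneg x
    rw [sub_zero]
    nlinarith [mul_nonneg (sq_nonneg Kb) h4]
  have hall : ∀ i j, Matched z (F i) (F j) := by
    rintro (n | n | _) (m | m | _)
    exacts [hss n m, hsp n m, hsb n, (hsp m n).symm, hpp n m, hpb n, (hsb m).symm, (hpb m).symm, hbb]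
  have hM := Matched.sum hSq hall
  have hmol : ∀ ε, moll ε f = moll ε fun x => ∑ i, F i x := fun ε =>
    funext fun y => moll_congr_ae hFe ε y
  refine ⟨?_, fun ε hε => ?_, ?_⟩
  · obtain ⟨d, h1, c, h2⟩ := hM
    refine ⟨d, h1.congr_ae ?_, c, ?_⟩
    · filter_upwards [hFe] with x hx
      rw [hx]
    · simpa only [hmol] using h2
  · rw [hmol]
    have : moll ε (fun x => ∑ i, F i x) = fun y => ∑ i, moll ε (F i) y := by
      ext y; exact moll_sum (fun i _ => (hSq i).isTempered) hε y
    rw [this]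
    exact memLp_finsetSum _ fun i _ => (hSq i).memLp_moll hε
  · have : Tempered fun x => ∑ i, (F i x : ℂ) := Tempered.sum fun i _ => (hSq i).isTempered
    refine this.congr ?_
    filter_upwards [hFe] with x hx
    rw [hx]; push_cast; rfl

lemma BddDecay.add {c : SR} (hb : BddDecay b) (hc : BddDecay c) : BddDecay fun x => b x + c x := by
  obtain ⟨hm, ⟨C, hC0, hC⟩, h⟩ := hb
  obtain ⟨hm', ⟨C', hC0', hC'⟩, h'⟩ := hc
  refine ⟨hm.add hm', ⟨C + C', by positivity, ?_⟩, ?_⟩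
  · filter_upwards [hC, hC'] with x h1 h2
    rw [add_div]
    exact (abs_add_le _ _).trans (add_le_add h1 h2)
  · filter_upwards [h, h'] with x h1 h2
    exact h1.add h2

lemma BddDecay.const_mul (hb : BddDecay b) (c : ℝ) : BddDecay fun x => c * b x := by
  obtain ⟨hm, ⟨C, hC0, hC⟩, h⟩ := hb
  refine ⟨hm.const_mul c, ⟨|c| * C, by positivity, ?_⟩, ?_⟩
  · filter_upwards [hC] with x h1
    rw [abs_mul, mul_div_assoc]
    exact mul_le_mul_of_nonneg_left h1 (abs_nonneg _)
  · filter_upwards [h] with x h1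
    exact continuousAt_const.mul h1

lemma SingExp.add (hf : SingExp z f)
    (hg : SingExp z g) : SingExp z fun x => f x + g x := by
  obtain ⟨s, p, b, hs, hp, hb, he⟩ := hf
  obtain ⟨s', p', b', hs', hp', hb', he'⟩ := hg
  refine ⟨fun n x => s n x + s' n x, fun n x => p n x + p' n x, fun x => b x + b' x,
    fun n => ⟨(hs n).1.add (hs' n).1, fun r hr x => ?_, fun x => ?_⟩,
    fun n => ⟨(hp n).1.add (hp' n).1, fun r hr x => ?_, fun x => ?_⟩, hb.add hb', ?_⟩
  · simp only [(hs n).2.1 r hr, (hs' n).2.1 r hr]; ring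
  · simp only [(hs n).2.2, (hs' n).2.2]; ring
  · simp only [(hp n).2.1 r hr, (hp' n).2.1 r hr]; ring
  · simp only [(hp n).2.2, (hp' n).2.2]
  · filter_upwards [he, he'] with x h1 h2
    have h3 : ∀ n, trunc (fun x => p n x + p' n x) (x - z n) = trunc (p n) (x - z n) + trunc (p' n) (x - z n) :=
      fun n => by unfold trunc; exact congrFun (Set.indicator_add _ (p n) (p' n)) _
    simp only [h1, h2, h3, sum_add_distrib]; ring

lemma SingExp.const_mul (hf : SingExp z f) (c : ℝ) :
    SingExp z fun x => c * f x := by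
  obtain ⟨s, p, b, hs, hp, hb, he⟩ := hf
  refine ⟨fun n x => c * s n x, fun n x => c * p n x, fun x => c * b x,
    fun n => ⟨continuousOn_const.mul (hs n).1, fun r hr x => ?_, fun x => ?_⟩,
    fun n => ⟨continuousOn_const.mul (hp n).1, fun r hr x => ?_, fun x => ?_⟩, hb.const_mul c, ?_⟩
  · simp only [(hs n).2.1 r hr]; ring
  · simp only [(hs n).2.2]; ring
  · simp only [(hp n).2.1 r hr]; ring
  · simp only [(hp n).2.2]
  · filter_upwards [he] with x h1
    have h3 : ∀ n, trunc (fun x => c * p n x) (x - z n) = c * trunc (p n) (x - z n) :=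
      fun n => by unfold trunc; exact Set.indicator_const_mul _ (p n) c _
    simp only [h1, h3, mul_add, mul_sum]

lemma BddDecay.singExp (hb : BddDecay b) : SingExp z b :=
  ⟨fun _ _ => 0, fun _ _ => 0, b, fun _ => ⟨continuousOn_const, by simp, by simp⟩,
    fun _ => ⟨continuousOn_const, by simp, by simp⟩, hb, by
      refine ae_of_all _ fun x => ?_
      simp [trunc]⟩

lemma SingExp.congr_ae (hf : SingExp z f) (h : f =ᵐ[volume] g) :
    SingExp z g := by
  obtain ⟨s, p, b, hs, hp, hb, he⟩ := hf
  exact ⟨s, p, b, hs, hp, hb, h.symm.trans he⟩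

lemma SingExp.sum {ι : Type*} {S : Finset ι} {f : ι → SR}
    (h : ∀ i ∈ S, SingExp z (f i)) : SingExp z fun x => ∑ i ∈ S, f i x := by
  classical
  induction S using induction_on with
  | empty =>
    simp only [sum_empty]
    exact BddDecay.singExp ⟨aestronglyMeasurable_const, ⟨0, le_rfl, by simp⟩, ae_of_all _ fun x => continuousAt_const⟩
  | insert i S hi ih =>
    simp only [sum_insert hi]
    exact (h i (by simp)).add (ih fun j hj => h j (by simp [hj]))

/-! ### Finite parts in space and in wave-vector space -/

lemma eq_of_tendsto_sub_div_sqrt {F : ℝ → ℂ} {c c' d d' : ℂ}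
    (h : Tendsto (fun ε : ℝ => F ε - c / (√ε : ℂ)) (𝓝[>] 0) (𝓝 d))
    (h' : Tendsto (fun ε : ℝ => F ε - c' / (√ε : ℂ)) (𝓝[>] 0) (𝓝 d')) : d = d' := by
  have h1 : Tendsto (fun ε : ℝ => (√ε : ℂ)) (𝓝[>] 0) (𝓝 0) := by
    have : Continuous fun ε : ℝ => (√ε : ℂ) := by fun_prop
    have h0 := this.tendsto 0
    simp only [Real.sqrt_zero, ofReal_zero] at h0
    exact h0.mono_left nhdsWithin_le_nhds
  have h2 : c = c' := by
    have h3 := (h'.sub h).mul h1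
    rw [mul_zero] at h3
    have h4 : Tendsto (fun _ : ℝ => c - c') (𝓝[>] 0) (𝓝 0) := by
      refine h3.congr' ?_
      filter_upwards [self_mem_nhdsWithin] with ε hε
      have : (√ε : ℂ) ≠ 0 := by exact_mod_cast (sqrt_pos.2 hε).ne'
      field_simp; ring
    exact sub_eq_zero.1 (tendsto_nhds_unique tendsto_const_nhds h4)
  subst h2
  exact tendsto_nhds_unique h h'

lemma SingExp.parseval (hz : Injective z) {u : SC}
    (hf : SingExp z f) (hu : WeakFT (fun x => (f x : ℂ)) u) {b : ℂ}
    (hb : HasRIntegralK (fun k => ((‖u k‖ ^ 2 : ℝ) : ℂ)) b) :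
    ∃ d : ℝ, HasRIntegral z (fun x => f x ^ 2) d ∧ b = (2 * π : ℂ) ^ 3 * d := by
  obtain ⟨⟨d, hd, c, hc⟩, hm, -⟩ := hf.matched hz
  refine ⟨d, by simpa only [sq] using hd, ?_⟩
  have hP : ∀ ε > 0, Integrable (fun k => ‖u k‖ ^ 2 * gs ε ‖k‖) ∧
      ∫ k, ‖u k‖ ^ 2 * gs ε ‖k‖ = (2 * π) ^ 3 * ∫ x, moll (ε / 2) f x ^ 2 := by
    intro ε hε
    have := hu.integral_sq_gaussian (half_pos hε) (hm _ (half_pos hε))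
    rwa [mul_div_cancel₀ ε two_ne_zero] at this
  obtain ⟨c', hc'⟩ := hb.tendsto_gaussian fun ε hε => by
    refine (hP ε hε).1.ofReal.congr (ae_of_all _ fun k => ?_)
    simp
  have hhalf : Tendsto (fun ε : ℝ => ε / 2) (𝓝[>] 0) (𝓝[>] 0) := by
    refine tendsto_nhdsWithin_iff.2 ⟨?_, ?_⟩
    · have : Continuous fun ε : ℝ => ε / 2 := by fun_prop
      have h0 := this.tendsto 0
      rw [zero_div] at h0
      exact h0.mono_left nhdsWithin_le_nhds
    · filter_upwards [self_mem_nhdsWithin] with ε hε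
      exact half_pos (show 0 < ε from hε)
  have h2 := ((continuous_ofReal.tendsto d).comp (hc.comp hhalf)).const_mul ((2 * π : ℂ) ^ 3)
  refine eq_of_tendsto_sub_div_sqrt hc' (c' := (2 * π : ℂ) ^ 3 * (c * √2)) (h2.congr' ?_)
  filter_upwards [self_mem_nhdsWithin] with ε hε
  have hε : 0 < ε := hε
  have h3 := (hP ε hε).2
  have h4 : ∫ k, (((‖u k‖ ^ 2 : ℝ) : ℂ)) * (gs ε ‖k‖ : ℂ)
      = (((2 * π) ^ 3 * ∫ x, moll (ε / 2) f x ^ 2 : ℝ) : ℂ) := by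
    rw [← h3, ← integral_complex_ofReal]; congr 1; ext k; simp
  rw [h4]
  simp only [comp_apply, ← sq]
  have h5 : √(ε / 2) = √ε / √2 := Real.sqrt_div hε.le 2
  rw [h5]
  have h6 : (√ε : ℂ) ≠ 0 := by exact_mod_cast (sqrt_pos.2 hε).ne'
  push_cast
  field_simp

end

section

variable {f : SR} {a : Space} {c C : ℝ}

lemma WeightInt.add {g : SR} (hf : WeightInt f) (hg : WeightInt g) : WeightInt fun x => f x + g x := by
  refine ⟨hf.1.add hg.1, (hf.2.add hg.2).mono' (aesm_norm_div (f := fun x => ((f x + g x : ℝ) : ℂ))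
      (continuous_ofReal.comp_aestronglyMeasurable (hf.1.add hg.1)) 4) (ae_of_all _ fun x => ?_)⟩
  rw [norm_of_nonneg (by positivity)]
  simp only [Pi.add_apply]
  rw [← add_div, Complex.ofReal_add]
  gcongr
  exact norm_add_le _ _

lemma WeightInt.const_mul (hf : WeightInt f) (c : ℝ) : WeightInt fun x => c * f x := by
  refine ⟨hf.1.const_mul c, (hf.2.const_mul ‖c‖).congr (ae_of_all _ fun x => ?_)⟩
  simp only [norm_real, norm_mul]; ring

lemma weightInt_of_bound (hf : AEStronglyMeasurable f volume)
    (hC : ∀ᵐ x, |f x| ≤ C) : WeightInt f := by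
  refine ⟨hf, (integrable_one_div_pow.const_mul C).mono'
    (aesm_norm_div (continuous_ofReal.comp_aestronglyMeasurable hf) 4) ?_⟩
  filter_upwards [hC] with x hx
  rw [norm_of_nonneg (by positivity), mul_one_div, norm_real, norm_eq_abs]
  gcongr

lemma WeightInt.sum {ι : Type*} {S : Finset ι} {f : ι → SR}
    (h : ∀ i ∈ S, WeightInt (f i)) : WeightInt fun x => ∑ i ∈ S, f i x := by
  classical
  induction S using induction_on with
  | empty =>
    simp only [sum_empty]
    exact weightInt_of_bound (C := 0) aestronglyMeasurable_const (by simp)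
  | insert i S hi ih =>
    simp only [sum_insert hi]
    exact (h i (by simp)).add (ih fun j hj => h j (by simp [hj]))

lemma weightInt_of_inv_bound (hf : AEStronglyMeasurable f volume) {D : ℝ}
    (hC : ∀ᵐ x, |f x| ≤ C * ‖x - a‖⁻¹ + D) : WeightInt f := by
  have h1 : WeightInt fun x : Space => |C| * (‖x - a‖ ^ 2)⁻¹ := by
    have hm : Measurable fun x : Space => |C| * (‖x - a‖ ^ 2)⁻¹ := by fun_prop
    refine SqBound.weightInt (a := a) ⟨hm.aestronglyMeasurable, |C|, abs_nonneg C, ae_of_all _ fun x => ?_⟩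
    rw [abs_of_nonneg (by positivity)]
  have h2 : WeightInt fun _ : Space => |C| + |D| :=
    weightInt_of_bound (C := |C| + |D|) aestronglyMeasurable_const (ae_of_all _ fun x => by rw [abs_of_nonneg (by positivity)])
  refine ⟨hf, (h1.add h2).2.mono' (aesm_norm_div (continuous_ofReal.comp_aestronglyMeasurable hf) 4) ?_⟩
  filter_upwards [hC] with x hx
  rw [norm_of_nonneg (by positivity), norm_real, norm_real, norm_eq_abs, norm_of_nonneg (by positivity)]
  gcongr
  have h3 : ‖x - a‖⁻¹ ≤ (‖x - a‖ ^ 2)⁻¹ + 1 := by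
    rw [← inv_pow]; nlinarith [sq_nonneg (‖x - a‖⁻¹ - 1), sq_nonneg (‖x - a‖⁻¹)]
  have h4 : C * ‖x - a‖⁻¹ ≤ |C| * ((‖x - a‖ ^ 2)⁻¹ + 1) :=
    (mul_le_mul_of_nonneg_right (le_abs_self C) (by positivity)).trans (mul_le_mul_of_nonneg_left h3 (abs_nonneg C))
  have := le_abs_self D
  linarith

/-- Continuous off the origin, homogeneous of degree `0` and odd. -/
def HomOddZero (o : SR) : Prop :=
  ContinuousOn o {0}ᶜ ∧ (∀ r : ℝ, 0 < r → ∀ x, o (r • x) = o x) ∧ ∀ x, o (-x) = -o x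

/-- The form of a potential near a charge: an even Coulomb singularity, an odd bounded function,
and the regular value `c`. -/
def LocExp (f : SR) (a : Space) (c : ℝ) : Prop :=
  ∃ (e o : SR) (C δ : ℝ), 0 < δ ∧ HomEven e ∧ HomOddZero o ∧
    ∀ y, y ≠ 0 → ‖y‖ < δ → |f (a + y) - (e y + o y + c)| ≤ C * ‖y‖

lemma HomOddZero.exists_bound {o : SR} (ho : HomOddZero o) : ∃ C, 0 ≤ C ∧ ∀ x, |o x| ≤ C := by
  obtain ⟨C, hC0, hC⟩ := exists_bound_of_continuousOn ho.1
  refine ⟨C, hC0, fun x => ?_⟩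
  rcases eq_or_ne x 0 with rfl | hx
  · have h := ho.2.2 0
    rw [neg_zero] at h
    have : o 0 = 0 := by linarith
    rw [this]; simpa
  · have hp : 0 < ‖x‖ := norm_pos_iff.2 hx
    rw [← ho.2.1 ‖x‖⁻¹ (inv_pos.2 hp)]
    exact hC _ (by rw [norm_smul, norm_inv, norm_norm, inv_mul_cancel₀ hp.ne'])

lemma HomEven.moll_zero {e : SR} (he : HomEven e) {ε : ℝ} (hε : 0 < ε) :
    moll ε e 0 = moll 1 e 0 / √ε := by
  have h0 : 0 < √ε := sqrt_pos.2 hε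
  unfold moll
  have h := Measure.integral_comp_smul vol (fun x => e x * heat ε (x - 0)) √ε
  rw [finrank_euclideanSpace_fin, abs_of_pos (by positivity), smul_eq_mul, eq_comm, inv_mul_eq_iff_eq_mul₀ (by positivity)] at h
  rw [h, ← integral_const_mul, ← integral_div]
  congr 1; ext x
  rw [sub_zero, sub_zero, heat_smul_sqrt hε, he.2.1 _ h0]
  field_simp

lemma LocExp.tendsto_moll (h : LocExp f a c)
    (hf : WeightInt f) : ∃ c', Tendsto (fun ε => moll ε f a - c' / √ε) (𝓝[>] 0) (𝓝 c) := by
  obtain ⟨e, o, C, δ, hδ, he, ho, hb⟩ := h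
  obtain ⟨Ce, hCe0, hCe⟩ := he.exists_bound
  obtain ⟨Co, hCo0, hCo⟩ := ho.exists_bound
  have hsh := measurePreserving_sub_right vol a
  have we : WeightInt fun x => e (x - a) :=
    weightInt_of_inv_bound (C := Ce) (D := 0) (a := a)
      ((aesm_of_continuousOn he.1).comp_measurePreserving hsh)
      (ae_of_all _ fun x => by rw [add_zero]; exact hCe _)
  have wo : WeightInt fun x => o (x - a) :=
    weightInt_of_bound (C := Co) ((aesm_of_continuousOn ho.1).comp_measurePreserving hsh)
      (ae_of_all _ fun x => hCo _)
  have wc : WeightInt fun _ : Space => c :=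
    weightInt_of_bound (C := |c|) aestronglyMeasurable_const (ae_of_all _ fun _ => le_rfl)
  set ρ : SR := fun x => f x + -1 * (e (x - a) + o (x - a) + c) with hρ
  have wρ : WeightInt ρ := hf.add (((we.add wo).add wc).const_mul (-1))
  set ρ' : SR := Function.update ρ a 0 with hρ'
  have hae : ρ' =ᵐ[volume] ρ := by
    filter_upwards [ae_ne a] with x hx
    rw [hρ', Function.update_of_ne hx]
  have wρ' : WeightInt ρ' := by
    refine ⟨wρ.1.congr hae.symm, wρ.2.congr ?_⟩
    filter_upwards [hae] with x hx
    rw [hx]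
  have hcont : ContinuousAt ρ' a := by
    rw [ContinuousAt, hρ', Function.update_self, tendsto_zero_iff_norm_tendsto_zero]
    have h1 : Tendsto (fun x : Space => |C| * ‖x - a‖) (𝓝 a) (𝓝 0) := by
      have : Continuous fun x : Space => |C| * ‖x - a‖ := by fun_prop
      simpa using this.tendsto a
    refine squeeze_zero' (Eventually.of_forall fun _ => norm_nonneg _) ?_ h1
    filter_upwards [ball_mem_nhds a hδ] with x hx
    rcases eq_or_ne x a with rfl | hxa
    · simp
    · rw [Function.update_of_ne hxa, norm_eq_abs]
      have h2 := hb (x - a) (sub_ne_zero.2 hxa) (by rwa [mem_ball, dist_eq_norm] at hx)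
      rw [add_sub_cancel] at h2
      simp only [hρ]
      rw [show f x + -1 * (e (x - a) + o (x - a) + c) = f x - (e (x - a) + o (x - a) + c) by ring]
      exact h2.trans (mul_le_mul_of_nonneg_right (le_abs_self C) (norm_nonneg _))
  have ht := wρ'.tendsto_moll hcont
  rw [hρ', Function.update_self] at ht
  refine ⟨moll 1 e 0, ?_⟩
  have ht2 := ht.add_const c
  rw [zero_add] at ht2
  refine ht2.congr' ?_
  filter_upwards [self_mem_nhdsWithin] with ε hε
  have hε : 0 < ε := hε
  rw [← hρ', moll_congr_ae hae]
  have hfe : f = fun x => (((e (x - a) + o (x - a)) + c) + ρ x) := by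
    ext x; simp only [hρ]; ring
  have h3 : moll ε f a = moll ε (fun x => e (x - a)) a + moll ε (fun x => o (x - a)) a
      + moll ε (fun _ => c) a + moll ε ρ a := by
    conv_lhs => rw [hfe]
    rw [moll_add ((we.add wo).add wc).isTempered wρ.isTempered hε,
      moll_add (we.add wo).isTempered wc.isTempered hε, moll_add we.isTempered wo.isTempered hε]
  have h4 : moll ε (fun x => e (x - a)) a = moll 1 e 0 / √ε := by
    rw [moll_comp_sub, sub_self, he.moll_zero hε]
  have h5 : moll ε (fun x => o (x - a)) a = 0 := by
    refine integral_eq_zero_of_odd a fun x => ?_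
    simp only [add_sub_cancel_left, ho.2.2, heat_neg]; ring
  have h6 : moll ε (fun _ => c) a = c := by
    unfold moll; rw [integral_const_mul, integral_heat hε, mul_one]
  rw [h3, h4, h5, h6]; ring

lemma LocExp.parseval (h : LocExp f a c)
    (hf : WeightInt f) {α : SC} (hα : WeakFT (fun x => (f x : ℂ)) α) {d : ℂ}
    (hd : HasRIntegralK (fun k => (((α k * phase a 1 k).re : ℝ) : ℂ)) d) :
    d = (2 * π : ℂ) ^ 3 * c := by
  obtain ⟨c', hc'⟩ := h.tendsto_moll hf
  have hph : ∀ k, phase a 1 k = exp (I * ⟪k,a⟫) := fun k => by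
    unfold phase; rw [one_mul]
  have hgi : ∀ ε > 0, Integrable fun k => α k * phase a 1 k * (gs ε ‖k‖ : ℂ) := by
    intro ε hε
    refine ((hα.2.1.integrable_mul_gaussian hε).mul_bdd (c := 1) (g := fun k => phase a 1 k)
      (Continuous.aestronglyMeasurable ?_) (ae_of_all _ fun k => ?_)).congr (ae_of_all _ fun k => ?_)
    · simp only [hph]; fun_prop
    · rw [norm_phase]
    · simp only; ring
  have hre : ∀ ε > 0, ∀ k, ((α k * phase a 1 k * (gs ε ‖k‖ : ℂ)).re : ℂ)
      = (((α k * phase a 1 k).re : ℝ) : ℂ) * (gs ε ‖k‖ : ℂ) := by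
    intro ε _ k
    rw [Complex.re_mul_ofReal]; push_cast; rfl
  obtain ⟨c'', hc''⟩ := hd.tendsto_gaussian fun ε hε => by
    have := (hgi ε hε).re.ofReal (𝕜 := ℂ)
    exact this.congr (ae_of_all _ fun k => hre ε hε k)
  have hP : ∀ ε > 0, ∫ k, (((α k * phase a 1 k).re : ℝ) : ℂ) * (gs ε ‖k‖ : ℂ)
      = (2 * π : ℂ) ^ 3 * (moll ε f a : ℂ) := by
    intro ε hε
    have h1 := hα.moll_eq hε a
    have h2 : ∫ k, (((α k * phase a 1 k).re : ℝ) : ℂ) * (gs ε ‖k‖ : ℂ)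
        = ((∫ k, α k * phase a 1 k * (gs ε ‖k‖ : ℂ)).re : ℂ) := by
      have h3 := integral_re (hgi ε hε)
      rw [show (∫ k, α k * phase a 1 k * (gs ε ‖k‖ : ℂ)).re
        = RCLike.re (∫ k, α k * phase a 1 k * (gs ε ‖k‖ : ℂ)) from rfl, ← h3, ← integral_complex_ofReal]
      exact integral_congr_ae (ae_of_all _ fun k => (hre ε hε k).symm)
    have h4 : ∫ k, α k * phase a 1 k * (gs ε ‖k‖ : ℂ) = (2 * π : ℂ) ^ 3 * (moll ε f a : ℂ) := by
      rw [h1, ← mul_assoc, mul_one_div_cancel (by have := pi_ne_zero; simp [this]), one_mul]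
      congr 1; ext k; rw [hph]; ring
    rw [h2, h4]
    rw [show (2 * π : ℂ) ^ 3 * (moll ε f a : ℂ) = (((2 * π) ^ 3 * moll ε f a : ℝ) : ℂ) by push_cast; ring,
      ofReal_re]
  have h2 := ((continuous_ofReal.tendsto c).comp hc').const_mul ((2 * π : ℂ) ^ 3)
  refine eq_of_tendsto_sub_div_sqrt hc'' (c' := (2 * π : ℂ) ^ 3 * c') (h2.congr' ?_)
  filter_upwards [self_mem_nhdsWithin] with ε hε
  rw [hP ε hε]
  simp only [comp_apply]
  push_cast; ring

lemma LocExp.hasRLimZero (h : LocExp f a c)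
    {δ : ℝ} (hδ : 0 < δ) (hf : ∀ x, x ≠ a → ‖x - a‖ < δ → ContinuousAt f x) :
    (∀ᶠ r in 𝓝[>] (0 : ℝ), Integrable (fun w : 𝕊 => f (a + r • (w : Space)))
      (vol).toSphere) ∧
    HasRLimZero (fun r => ⨍ w : 𝕊, f (a + r • (w : Space))
      ∂(vol).toSphere) c := by
  obtain ⟨e, o, C, δ', hδ', he, ho, hb⟩ := h
  have : CompactSpace 𝕊 := isCompact_iff_compactSpace.1 (isCompact_sphere _ _)
  set μ := (vol).toSphere
  have : NeZero μ := ⟨Measure.toSphere_ne_zero _⟩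
  have hw : ∀ w : 𝕊, ‖(w : Space)‖ = 1 := fun w => by simp
  have hw0 : ∀ w : 𝕊, (w : Space) ≠ 0 := fun w =>
    norm_pos_iff.1 (by rw [hw]; exact one_pos)
  have hci : ∀ {g : 𝕊 → ℝ}, Continuous g → Integrable g μ := fun hg =>
    hg.integrable_of_hasCompactSupport (HasCompactSupport.of_compactSpace _)
  have hce : Continuous fun w : 𝕊 => e w := he.1.comp_continuous continuous_subtype_val hw0
  have hco : Continuous fun w : 𝕊 => o w := ho.1.comp_continuous continuous_subtype_val hw0
  have hint : ∀ r, 0 < r → r < δ → Integrable (fun w : 𝕊 => f (a + r • (w : Space))) μ := by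
    intro r hr hrδ
    refine hci (continuous_iff_continuousAt.2 fun w => ?_)
    refine ContinuousAt.comp (g := f) (f := fun w : 𝕊 => a + r • (w : Space)) (hf _ ?_ ?_) (by fun_prop)
    · simpa [hr.ne'] using hw0 w
    · rw [add_sub_cancel_left, norm_smul, hw, norm_of_nonneg hr.le, mul_one]; exact hrδ
  constructor
  · filter_upwards [Ioo_mem_nhdsGT hδ] with r hr
    exact hint r hr.1 hr.2
  · have hodd : ⨍ w, o w ∂μ = 0 := by
      have h1 : ∫ w : 𝕊, o w ∂μ = ∫ w, o w ∂σ := by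
        unfold σ; rw [measurableEmbedding_sphere.integral_map]
      have h2 := (measurePreserving_linearIsometryEquiv_σ (LinearIsometryEquiv.neg ℝ)).integral_comp'
        (f := (LinearIsometryEquiv.neg ℝ : Space ≃ₗᵢ[ℝ] Space).toMeasurableEquiv) o
      simp only [LinearIsometryEquiv.coe_toMeasurableEquiv, LinearIsometryEquiv.coe_neg, ho.2.2] at h2
      rw [integral_neg] at h2
      have h3 : ∫ w, o w ∂σ = 0 := by linarith
      rw [average_eq, h1, h3, smul_zero]
    refine ⟨⨍ w : 𝕊, e w ∂μ, IsBigO.of_bound |C| ?_⟩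
    filter_upwards [Ioo_mem_nhdsGT hδ, Ioo_mem_nhdsGT hδ'] with r hr hr'
    have hr0 := hr.1
    have hi := hint r hr.1 hr.2
    have heq : (⨍ w : 𝕊, f (a + r • (w : Space)) ∂μ) - ((⨍ w : 𝕊, e w ∂μ) / r + c)
        = ⨍ w : 𝕊, (f (a + r • (w : Space)) - (e (r • (w : Space)) + o (r • (w : Space)) + c)) ∂μ := by
      have hcst : ⨍ _w : 𝕊, c ∂μ = c := average_const _ _
      simp only [he.2.1 r hr0, ho.2.1 r hr0]
      have i1 : Integrable (fun w : 𝕊 => r⁻¹ * e w) μ := (hci hce).const_mul _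
      have i2 : Integrable (fun w : 𝕊 => r⁻¹ * e w + o w) μ := i1.add (hci hco)
      have i3 : Integrable (fun w : 𝕊 => r⁻¹ * e w + o w + c) μ :=
        i2.add (integrable_const c)
      rw [average_eq] at hodd hcst
      simp only [average_eq] at *
      rw [integral_sub hi i3, integral_add i2 (integrable_const c), integral_add i1 (hci hco), integral_const_mul]
      simp only [smul_eq_mul] at hodd hcst ⊢
      linear_combination hodd + hcst
    rw [heq, norm_of_nonneg hr0.le]
    have hbd : ∀ w : 𝕊,
        ‖f (a + r • (w : Space)) - (e (r • (w : Space)) + o (r • (w : Space)) + c)‖ ≤ |C| * r := by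
      intro w
      have hn : ‖r • (w : Space)‖ = r := by rw [norm_smul, hw, norm_of_nonneg hr0.le, mul_one]
      have := hb (r • (w : Space)) (by simpa [hr0.ne'] using hw0 w) (by rw [hn]; exact hr'.2)
      rw [hn] at this
      exact this.trans (mul_le_mul_of_nonneg_right (le_abs_self C) hr0.le)
    rw [average_eq, norm_smul, norm_inv, norm_of_nonneg measureReal_nonneg]
    have hm : 0 < μ.real Set.univ := by
      rw [measureReal_def, ENNReal.toReal_pos_iff]
      exact ⟨Measure.measure_univ_pos.2 (NeZero.ne μ), measure_lt_top _ _⟩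
    rw [inv_mul_le_iff₀ hm, mul_comm]
    exact norm_integral_le_of_norm_le_const (ae_of_all _ hbd)

end

section

variable {p : Spacetime} {s s' : ℝ} {F : ℝ → ℝ}

/-! ### Retarded times -/

/-- A smooth subluminal world-line that meets every past light cone. -/
structure WorldLine (z : ℝ → Space) : Prop where
  smooth : C∞ z
  subluminal : ∀ s, ‖deriv z s‖ < 1
  exists_retarded : ∀ t x, ∃ s, t - s = ‖x - z s‖

namespace WorldLine

variable {z : ℝ → Space}

lemma contDiff_deriv (hz : WorldLine z) : C∞ (deriv z) :=
  ((contDiff_infty_iff_deriv).1 hz.smooth).2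

lemma hasDerivAt (hz : WorldLine z) (s : ℝ) : HasDerivAt z (deriv z s) s :=
  (hz.smooth.differentiable (by simp) s).hasDerivAt

lemma hasDerivAt_deriv (hz : WorldLine z) (s : ℝ) : HasDerivAt (deriv z) (deriv (deriv z) s) s :=
  (hz.contDiff_deriv.differentiable (by simp) s).hasDerivAt

lemma exists_speed_bound (hz : WorldLine z) (a b : ℝ) : ∃ c, 0 ≤ c ∧ c < 1 ∧ (∀ s ∈ Icc a b, ‖deriv z s‖ ≤ c) ∧
      ∀ s ∈ Icc a b, ∀ s' ∈ Icc a b, ‖z s' - z s‖ ≤ c * |s' - s| := by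
  obtain ⟨c, hc0, hc1, hc⟩ : ∃ c, 0 ≤ c ∧ c < 1 ∧ ∀ s ∈ Icc a b, ‖deriv z s‖ ≤ c := by
    rcases (Icc a b).eq_empty_or_nonempty with h | h
    · exact ⟨0, le_rfl, one_pos, by simp [h]⟩
    · obtain ⟨s, -, hs⟩ := isCompact_Icc.exists_isMaxOn h hz.contDiff_deriv.continuous.norm.continuousOn
      exact ⟨_, norm_nonneg _, hz.subluminal s, fun s' hs' => hs hs'⟩
  refine ⟨c, hc0, hc1, hc, fun s hs s' hs' => ?_⟩
  have := (convex_Icc a b).norm_image_sub_le_of_norm_deriv_le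
    (fun s _ => hz.smooth.differentiable (by simp) s) hc hs hs'
  simpa [norm_eq_abs] using this

lemma norm_sub_lt (hz : WorldLine z) (h : s < s') : ‖z s' - z s‖ < s' - s := by
  obtain ⟨c, -, hc1, -, hc⟩ := hz.exists_speed_bound s s'
  have := hc s (by simp [h.le]) s' (by simp [h.le])
  rw [abs_of_pos (sub_pos.2 h)] at this
  nlinarith [sub_pos.2 h]

lemma unique_retarded (hz : WorldLine z) {t : ℝ} {x : Space} (h : t - s = ‖x - z s‖)
    (h' : t - s' = ‖x - z s'‖) : s = s' := by
  by_contra hne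
  wlog hlt : s < s' generalizing s s'
  · exact this h' h (Ne.symm hne) (lt_of_le_of_ne (not_lt.1 hlt) (Ne.symm hne))
  have h1 := hz.norm_sub_lt hlt
  have h2 : ‖x - z s‖ ≤ ‖x - z s'‖ + ‖z s' - z s‖ := by
    simpa using norm_add_le (x - z s') (z s' - z s)
  linarith

lemma retardedTime_eq (hz : WorldLine z) (h : p.1 - s = ‖p.2 - z s‖) :
    retardedTime z p = s := by
  have : {s : ℝ | p.1 - s = ‖p.2 - z s‖} = {s} := by
    ext s'
    exact ⟨fun h' => hz.unique_retarded h' h, fun h' => by rw [Set.mem_singleton_iff.1 h']; exact h⟩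
  rw [retardedTime, this, csSup_singleton]

lemma retardedTime_spec (hz : WorldLine z) (p : Spacetime) :
    p.1 - retardedTime z p = ‖p.2 - z (retardedTime z p)‖ := by
  obtain ⟨s, hs⟩ := hz.exists_retarded p.1 p.2
  rw [hz.retardedTime_eq hs]; exact hs

lemma sub_ne_zero_of_ne (hz : WorldLine z) (hp : p.2 ≠ z p.1) : p.2 - z (retardedTime z p) ≠ 0 := by
  intro h
  have h1 := hz.retardedTime_spec p
  rw [h, norm_zero] at h1
  rw [← sub_eq_zero.1 h1] at h
  exact hp (sub_eq_zero.1 h)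

lemma inner_lt (hz : WorldLine z) {R : Space} (hR : R ≠ 0) (s : ℝ) : ⟪R,deriv z s⟫ < ‖R‖ := by
  have h1 := real_inner_le_norm R (deriv z s)
  have h2 := norm_pos_iff.2 hR
  nlinarith [hz.subluminal s]

lemma contDiffAt_retardedTime (hz : WorldLine z) (hp : p.2 ≠ z p.1) :
    ContDiffAt ℝ ∞ (retardedTime z) p := by
  set s := retardedTime z p with hs
  have hR := hz.sub_ne_zero_of_ne hp
  set R := p.2 - z s with hRdef
  let f : Spacetime × ℝ → ℝ := fun q => q.1.1 - q.2 - ‖q.1.2 - z q.2‖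
  have hf : ContDiffAt ℝ ∞ f (p, s) := by
    have h1 : ContDiffAt ℝ ∞ (fun q : Spacetime × ℝ => q.1.2 - z q.2) (p, s) :=
      (contDiff_fst.snd.sub (hz.smooth.comp contDiff_snd)).contDiffAt
    exact (contDiff_fst.fst.sub contDiff_snd).contDiffAt.sub (h1.norm ℝ hR)
  have hder : HasDerivAt (fun s' => f (p, s')) (-1 + ⟪R,deriv z s⟫ / ‖R‖) s := by
    have h1 : HasDerivAt (fun s' => ‖p.2 - z s'‖ ^ 2) (2 * ⟪R,-deriv z s⟫) s :=
      ((hz.hasDerivAt s).const_sub p.2).norm_sq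
    have h2 := h1.sqrt (by positivity)
    have h3 : (fun s' => √(‖p.2 - z s'‖ ^ 2)) = fun s' => ‖p.2 - z s'‖ := by
      funext s'; rw [sqrt_sq (norm_nonneg _)]
    rw [h3, sqrt_sq (norm_nonneg _)] at h2
    refine (((hasDerivAt_id s).const_sub p.1).sub h2).congr_deriv ?_
    rw [inner_neg_right, ← hRdef]
    have := norm_pos_iff.2 hR
    field_simp
    ring
  have hne : -1 + ⟪R,deriv z s⟫ / ‖R‖ ≠ 0 := by
    have := (div_lt_one (norm_pos_iff.2 hR)).2 (hz.inner_lt hR s)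
    intro h; linarith
  have hinv : (fderiv ℝ f (p, s) ∘L .inr ℝ Spacetime ℝ).IsInvertible := by
    refine ⟨ContinuousLinearEquiv.unitsEquivAut ℝ (Units.mk0 _ hne), ?_⟩
    ext
    have h1 : HasFDerivAt (fun s' : ℝ => (p, s')) (ContinuousLinearMap.inr ℝ Spacetime ℝ) s :=
      hasFDerivAt_prodMk_right p s
    have h2 := (((hf.differentiableAt (by simp)).hasFDerivAt.comp s h1).hasDerivAt).unique hder
    simpa using h2.symm
  refine (hf.contDiffAt_implicitFunction (by simp) hinv).congr_of_eventuallyEq ?_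
  have h0 : f (p, s) = 0 := sub_eq_zero.2 (hz.retardedTime_spec p)
  filter_upwards [hf.eventually_apply_implicitFunction (by simp) hinv] with q hq
  rw [h0] at hq
  exact hz.retardedTime_eq (sub_eq_zero.1 hq)

/-- The denominator `|R| - R · v` of the retarded potential. -/
def denom (z : ℝ → Space) (p : Spacetime) : ℝ :=
  ‖p.2 - z (retardedTime z p)‖ - ⟪p.2 - z (retardedTime z p),deriv z (retardedTime z p)⟫

lemma denom_pos (hz : WorldLine z) (hp : p.2 ≠ z p.1) : 0 < denom z p :=
  sub_pos.2 (hz.inner_lt (hz.sub_ne_zero_of_ne hp) _)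

lemma fderiv_retardedTime (hz : WorldLine z) (hp : p.2 ≠ z p.1) (m : Spacetime) :
    denom z p * fderiv ℝ (retardedTime z) p m
      = ‖p.2 - z (retardedTime z p)‖ * m.1 - ⟪p.2 - z (retardedTime z p),m.2⟫ := by
  have hs := ((hz.contDiffAt_retardedTime hp).differentiableAt (by simp)).hasFDerivAt
  set s' := fderiv ℝ (retardedTime z) p
  have h1 : HasFDerivAt (fun q : Spacetime => (q.1 - retardedTime z q) ^ 2) _ p :=
    (hasFDerivAt_fst.sub hs).pow 2
  have h2 : HasFDerivAt (fun q : Spacetime => ‖q.2 - z (retardedTime z q)‖ ^ 2) _ p :=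
    (hasFDerivAt_snd.sub ((hz.hasDerivAt _).hasFDerivAt.comp p hs)).norm_sq
  have h3 : (fun q : Spacetime => (q.1 - retardedTime z q) ^ 2) = fun q => ‖q.2 - z (retardedTime z q)‖ ^ 2 := by
    funext q; rw [hz.retardedTime_spec]
  rw [h3] at h1
  have h4 := congrArg (fun l : Spacetime →L[ℝ] ℝ => l m) (h1.unique h2)
  simp only [Pi.sub_apply, hz.retardedTime_spec p, smul_apply, sub_apply,
    ContinuousLinearMap.comp_apply, coe_fst', coe_snd',
    innerSL_apply_apply, inner_sub_right, smul_eq_mul, comp_apply,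
    toSpanSingleton_apply, inner_smul_right] at h4
  rw [denom]
  simp at h4
  linear_combination (-1 / 2) * h4

/-- The retarded field `F(s) / (|R| - R · v)` of a source of time-dependent strength `F`. -/
def lw (z : ℝ → Space) (F : ℝ → ℝ) (p : Spacetime) : ℝ := F (retardedTime z p) / denom z p

lemma contDiffAt_denom (hz : WorldLine z) (hp : p.2 ≠ z p.1) : ContDiffAt ℝ ∞ (denom z) p := by
  have hs := hz.contDiffAt_retardedTime hp
  have h1 : ContDiffAt ℝ ∞ (fun q : Spacetime => q.2 - z (retardedTime z q)) p :=
    contDiffAt_snd.sub (hz.smooth.contDiffAt.comp p hs)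
  exact (h1.norm ℝ (hz.sub_ne_zero_of_ne hp)).sub (h1.inner ℝ (hz.contDiff_deriv.contDiffAt.comp p hs))

lemma contDiffAt_lw (hz : WorldLine z) (hF : C∞ F)
    (hp : p.2 ≠ z p.1) : ContDiffAt ℝ ∞ (lw z F) p :=
  (hF.contDiffAt.comp p (hz.contDiffAt_retardedTime hp)).div (hz.contDiffAt_denom hp) (hz.denom_pos hp).ne'

lemma fderiv_denom (hz : WorldLine z) (hp : p.2 ≠ z p.1) :
    fderiv ℝ (denom z) p (1, deriv z (retardedTime z p))
      = -⟪p.2 - z (retardedTime z p),deriv (deriv z) (retardedTime z p)⟫ := by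
  have hs := ((hz.contDiffAt_retardedTime hp).differentiableAt (by simp)).hasFDerivAt
  have hm := hz.fderiv_retardedTime hp (1, deriv z (retardedTime z p))
  have hm1 : fderiv ℝ (retardedTime z) p (1, deriv z (retardedTime z p)) = 1 := by
    refine mul_left_cancel₀ (hz.denom_pos hp).ne' (hm.trans ?_)
    rw [denom]; ring
  set s' := fderiv ℝ (retardedTime z) p
  have h0 : denom z = fun q : Spacetime => (q.1 - retardedTime z q)
      - ⟪q.2 - z (retardedTime z q),deriv z (retardedTime z q)⟫ := by
    funext q; rw [denom, hz.retardedTime_spec]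
  have h1 : HasFDerivAt (fun q : Spacetime => q.2 - z (retardedTime z q)) _ p :=
    hasFDerivAt_snd.sub ((hz.hasDerivAt _).hasFDerivAt.comp p hs)
  have h2 : HasFDerivAt (fun q : Spacetime => deriv z (retardedTime z q)) _ p :=
    (hz.hasDerivAt_deriv _).hasFDerivAt.comp p hs
  have h3 : HasFDerivAt (fun q : Spacetime => (q.1 - retardedTime z q)
      - ⟪q.2 - z (retardedTime z q),deriv z (retardedTime z q)⟫) _ p :=
    (hasFDerivAt_fst.sub hs).sub (h1.inner ℝ h2)
  rw [h0, h3.fderiv]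
  simp [hm1]

lemma fderiv_lw (hz : WorldLine z) (hF : C∞ F)
    (hp : p.2 ≠ z p.1) (m : Spacetime) :
    fderiv ℝ (lw z F) p m = deriv F (retardedTime z p) * fderiv ℝ (retardedTime z) p m / denom z p
      - F (retardedTime z p) * fderiv ℝ (denom z) p m / denom z p ^ 2 := by
  have hs := ((hz.contDiffAt_retardedTime hp).differentiableAt (by simp)).hasFDerivAt
  have hD := ((hz.contDiffAt_denom hp).differentiableAt (by simp)).hasFDerivAt
  have hFs : HasFDerivAt (fun q => F (retardedTime z q)) _ p :=
    (hF.differentiable (by simp) (retardedTime z p)).hasDerivAt.hasFDerivAt.comp p hs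
  have h0 : lw z F = fun q => F (retardedTime z q) * (denom z q)⁻¹ := by
    funext q; rw [lw, div_eq_mul_inv]
  have hi : HasFDerivAt (fun q => (denom z q)⁻¹) _ p :=
    (hasDerivAt_inv (hz.denom_pos hp).ne').hasFDerivAt.comp p hD
  have hFi : HasFDerivAt (fun q => F (retardedTime z q) * (denom z q)⁻¹) _ p := hFs.mul hi
  rw [h0, hFi.fderiv]
  simp
  field_simp
  ring

lemma pd_zero_lw (hz : WorldLine z) (hF : C∞ F)
    (hp : p.2 ≠ z p.1) :
    pd 0 (lw z F) p = lw z (deriv F) p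
      - ∑ i : Fin 3, pd i.succ (lw z fun s => deriv z s i * F s) p := by
  have hdec : ∀ w : Space, (∑ i : Fin 3, w i • basisVec i.succ) = ((0 : ℝ), w) := by
    intro w
    have : ∀ i : Fin 3, w i • basisVec i.succ = ContinuousLinearMap.inr ℝ ℝ Space (single i (w i)) := by
      intro i
      have : single i (w i) = w i • single i (1 : ℝ) := by
        ext j; by_cases h : j = i <;> simp [h]
      simp [basisVec, this]
    rw [sum_congr rfl fun i _ => this i, ← map_sum]
    have h2 : ∑ i, single i (w i) = w := by
      ext j; simp [Finset.sum_apply]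
    rw [h2]; rfl
  have hD := (hz.denom_pos hp).ne'
  have hds := hz.fderiv_retardedTime hp
  have hdD := hz.fderiv_denom hp
  set s := retardedTime z p with hs
  set v := deriv z s with hv
  set acc := deriv (deriv z) s with hacc
  have hvi : ∀ i : Fin 3, C∞ fun s => deriv z s i := fun i =>
    (EuclideanSpace.proj (𝕜 := ℝ) i).contDiff.comp hz.contDiff_deriv
  have hvd : ∀ i : Fin 3, deriv (fun s => deriv z s i * F s) s = acc i * F s + v i * deriv F s := by
    intro i
    have h1 : HasDerivAt (fun s => deriv z s i) (acc i) s :=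
      ((EuclideanSpace.proj (𝕜 := ℝ) i).hasFDerivAt.comp_hasDerivAt s (hz.hasDerivAt_deriv s))
    exact (h1.mul (hF.differentiable (by simp) s).hasDerivAt).deriv
  have h1 : ∀ i : Fin 3, pd i.succ (lw z fun s => deriv z s i * F s) p
      = v i * fderiv ℝ (lw z F) p (basisVec i.succ)
        + F s / denom z p * (acc i * fderiv ℝ (retardedTime z) p (basisVec i.succ)) := by
    intro i
    rw [pd, hz.fderiv_lw ((hvi i).mul hF) hp, hz.fderiv_lw hF hp, ← hs, hvd]
    ring
  have h2 : ∀ (l : Spacetime →L[ℝ] ℝ) (w : Space), ∑ i : Fin 3, w i * l (basisVec i.succ) = l (0, w) := by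
    intro l w
    rw [← hdec w, map_sum]
    exact sum_congr rfl fun i _ => by simp
  rw [sum_congr rfl fun i _ => h1 i, sum_add_distrib, ← mul_sum, h2, h2]
  have h3 : pd 0 (lw z F) p + fderiv ℝ (lw z F) p (0, v)
      = fderiv ℝ (lw z F) p (1, v) := by
    rw [pd, ← map_add]
    simp [basisVec]
  have h4 : fderiv ℝ (retardedTime z) p (1, v) = 1 := by
    refine mul_left_cancel₀ hD ((hds _).trans ?_)
    rw [denom]; ring
  have h5 : denom z p * fderiv ℝ (retardedTime z) p (0, acc) = -⟪p.2 - z s,acc⟫ := by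
    rw [hds]; simp
  have h6 : fderiv ℝ (lw z F) p (1, v) = lw z (deriv F) p
      - F s / denom z p * fderiv ℝ (retardedTime z) p (0, acc) := by
    rw [hz.fderiv_lw hF hp, h4, hdD, ← h5, lw, ← hs]
    field_simp
  linarith

end WorldLine

end

section

/-! ### Taylor expansion in a parameter -/

/-- The moments of a function along a segment from the origin. -/
def segmentMoment {E : Type*} [NormedAddCommGroup E] [NormedSpace ℝ E] (j : ℕ) (f : ℝ → E) (x : ℝ) : E :=
  ∫ τ in (0 : ℝ)..1, τ ^ j • f (τ * x)

lemma hasDerivAt_segmentMoment {E : Type*} [NormedAddCommGroup E] [NormedSpace ℝ E] [CompleteSpace E]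
    (j : ℕ) {f : ℝ → E} (hf : ContDiff ℝ 1 f) (x : ℝ) :
    HasDerivAt (segmentMoment j f) (segmentMoment (j + 1) (deriv f) x) x := by
  have hf' : Continuous (deriv f) := hf.continuous_deriv (by simp)
  obtain ⟨C, hC⟩ := (isCompact_Icc (a := -(|x| + 1)) (b := |x| + 1)).exists_bound_of_continuousOn hf'.continuousOn
  have hCy : ∀ τ ∈ Set.uIoc (0 : ℝ) 1, ∀ y ∈ ball x 1, ‖τ ^ (j + 1) • deriv f (τ * y)‖ ≤ C := by
    intro τ hτ y hy
    rw [Set.uIoc_of_le zero_le_one] at hτ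
    rw [mem_ball, Real.dist_eq] at hy
    have h1 : |τ * y| ≤ |x| + 1 := by
      rw [abs_mul, abs_of_pos hτ.1]
      have : |y| ≤ |x| + 1 := by
        have := abs_sub_abs_le_abs_sub y x
        linarith
      nlinarith [hτ.1, hτ.2, abs_nonneg y]
    rw [norm_smul, norm_of_nonneg (by have := hτ.1; positivity)]
    calc τ ^ (j + 1) * ‖deriv f (τ * y)‖ ≤ 1 * ‖deriv f (τ * y)‖ := by
          gcongr
          exact pow_le_one₀ hτ.1.le hτ.2
      _ ≤ C := by rw [one_mul]; exact hC _ (abs_le.1 h1)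
  have hcont : ∀ y : ℝ, Continuous fun τ : ℝ => τ ^ j • f (τ * y) := fun y =>
    (continuous_pow j).smul (hf.continuous.comp (continuous_id.mul continuous_const))
  refine (intervalIntegral.hasDerivAt_integral_of_dominated_loc_of_deriv_le (bound := fun _ => C)
    (F' := fun y τ => τ ^ (j + 1) • deriv f (τ * y)) (ball_mem_nhds x one_pos)
    (Eventually.of_forall fun y => (hcont y).aestronglyMeasurable) ((hcont x).intervalIntegrable _ _)
    ?_ (ae_of_all _ hCy) intervalIntegrable_const (ae_of_all _ fun τ _ y _ => ?_)).2
  · exact ((continuous_pow _).smul (hf'.comp (continuous_id.mul continuous_const))).aestronglyMeasurable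
  · have h1 : HasDerivAt (fun y => f (τ * y)) (τ • deriv f (τ * y)) y := by
      have := (hf.differentiable (by simp) (τ * y)).hasDerivAt.scomp y ((hasDerivAt_id y).const_mul τ)
      simpa [comp_def] using this
    refine (h1.const_smul (τ ^ j)).congr_deriv ?_
    rw [smul_smul, pow_succ]

lemma contDiff_segmentMoment {E : Type*} [NormedAddCommGroup E] [NormedSpace ℝ E] [CompleteSpace E]
    (j : ℕ) {f : ℝ → E} (hf : C∞ f) : C∞ (segmentMoment j f) := by
  rw [contDiff_infty]
  intro n
  induction n generalizing j f with
  | zero =>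
    exact contDiff_zero.2 (continuous_iff_continuousAt.2 fun x =>
      (hasDerivAt_segmentMoment j (hf.of_le (by simp)) x).continuousAt)
  | succ n ih =>
    have h1 := fun x => hasDerivAt_segmentMoment j (hf.of_le (by simp)) x
    push_cast
    refine contDiff_succ_iff_deriv.2 ⟨fun x => (h1 x).differentiableAt, by simp, ?_⟩
    rw [show deriv (segmentMoment j f) = segmentMoment (j + 1) (deriv f) from funext fun x => (h1 x).deriv]
    exact ih _ (contDiff_infty_iff_deriv.1 hf).2

lemma exists_smooth_slope {E : Type*} [NormedAddCommGroup E] [NormedSpace ℝ E] [CompleteSpace E]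
    {f : ℝ → E} (hf : C∞ f) :
    ∃ η : ℝ → E, C∞ η ∧ (∀ ρ, f ρ - f 0 = ρ • η ρ) ∧ η 0 = deriv f 0 ∧
      deriv η 0 = (1 / 2 : ℝ) • deriv (deriv f) 0 := by
  have hf' := (contDiff_infty_iff_deriv.1 hf).2
  refine ⟨segmentMoment 0 (deriv f), contDiff_segmentMoment 0 hf', fun ρ => ?_, ?_, ?_⟩
  · have h1 : ∀ τ ∈ Set.uIcc (0 : ℝ) 1, HasDerivAt (fun τ => f (τ * ρ)) (ρ • deriv f (τ * ρ)) τ := by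
      intro τ _
      have := (hf.differentiable (by simp) (τ * ρ)).hasDerivAt.scomp τ ((hasDerivAt_id τ).mul_const ρ)
      simpa [comp_def] using this
    have hc : Continuous fun τ : ℝ => deriv f (τ * ρ) := hf'.continuous.comp (continuous_id.mul continuous_const)
    have h2 := intervalIntegral.integral_eq_sub_of_hasDerivAt h1 ((hc.const_smul ρ).intervalIntegrable _ _)
    rw [intervalIntegral.integral_smul] at h2
    simp only [one_mul, zero_mul] at h2
    simp only [segmentMoment, pow_zero, one_smul, h2]
  · simp [segmentMoment]
  · rw [(hasDerivAt_segmentMoment 0 (hf'.of_le (by simp)) 0).deriv]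
    simp only [segmentMoment, mul_zero, zero_add, pow_one]
    rw [intervalIntegral.integral_smul_const, integral_id]
    norm_num

/-- The domain of functions of a parameter and a direction. -/
def rayDom : Set (ℝ × Space) := {p | p.2 ≠ 0}

lemma isOpen_rayDom : IsOpen rayDom := isOpen_compl_singleton.preimage continuous_snd

section Rays

variable {E : Type*} [NormedAddCommGroup E] [NormedSpace ℝ E]

/-- The derivative in the parameter. -/
def pder (g : ℝ × Space → E) (p : ℝ × Space) : E := fderiv ℝ g p (1, 0)

lemma contDiffOn_pder {g : ℝ × Space → E} (hg : ContDiffOn ℝ ∞ g rayDom) :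
    ContDiffOn ℝ ∞ (pder g) rayDom :=
  (hg.fderiv_of_isOpen isOpen_rayDom (by simp)).clm_apply contDiffOn_const

lemma hasDerivAt_param {g : ℝ × Space → E} (hg : ContDiffOn ℝ ∞ g rayDom) {w : Space} (hw : w ≠ 0)
    (ρ : ℝ) : HasDerivAt (fun ρ => g (ρ, w)) (pder g (ρ, w)) ρ := by
  have h1 := ((hg.contDiffAt (isOpen_rayDom.mem_nhds (show (ρ, w) ∈ rayDom from hw))).differentiableAt
    (by simp)).hasFDerivAt
  exact h1.comp_hasDerivAt ρ ((hasDerivAt_id ρ).prodMk (hasDerivAt_const ρ w))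

lemma exists_bound_on_rays {E : Type*} [NormedAddCommGroup E] {g : ℝ × Space → E} (hg : ContinuousOn g rayDom) (B : ℝ) :
    ∃ C, 0 ≤ C ∧ ∀ ρ ∈ Icc 0 B, ∀ w : Space, ‖w‖ = 1 → ‖g (ρ, w)‖ ≤ C := by
  have hK : IsCompact (Icc (0 : ℝ) B ×ˢ 𝕊) := isCompact_Icc.prod (isCompact_sphere _ _)
  obtain ⟨C, hC⟩ := hK.exists_bound_of_continuousOn (hg.mono fun p hp => by
    have : ‖p.2‖ = 1 := by simpa using hp.2
    exact norm_ne_zero_iff.1 (by rw [this]; exact one_ne_zero))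
  exact ⟨|C|, abs_nonneg C, fun ρ hρ w hw => (hC (ρ, w) ⟨hρ, by simpa using hw⟩).trans (le_abs_self C)⟩

lemma norm_le_of_pder_le {g : ℝ × Space → E} (hg : ContDiffOn ℝ ∞ g rayDom) {w : Space} (hw : w ≠ 0)
    (h0 : g (0, w) = 0) {ρ C : ℝ} (hρ : 0 ≤ ρ) (hC : ∀ r ∈ Icc 0 ρ, ‖pder g (r, w)‖ ≤ C) :
    ‖g (ρ, w)‖ ≤ C * ρ := by
  have := (convex_Icc (0 : ℝ) ρ).norm_image_sub_le_of_norm_hasDerivWithin_le (f := fun r => g (r, w))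
    (fun r _ => (hasDerivAt_param hg hw r).hasDerivWithinAt) hC (x := 0) (y := ρ) (by simp [hρ]) (by simp [hρ])
  simpa [h0, abs_of_nonneg hρ] using this

lemma exists_quadratic_bound_aux {g : ℝ × Space → E} (hg : ContDiffOn ℝ ∞ g rayDom)
    (h0 : ∀ w ≠ 0, g (0, w) = 0) (h1 : ∀ w ≠ 0, pder g (0, w) = 0) :
    ∃ C, 0 ≤ C ∧ ∀ ρ ∈ Icc (0 : ℝ) 1, ∀ w : Space, ‖w‖ = 1 →
      ‖pder g (ρ, w)‖ ≤ C * ρ ∧ ‖g (ρ, w)‖ ≤ C * ρ ^ 2 := by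
  have hg1 := contDiffOn_pder hg
  obtain ⟨C, hC0, hC⟩ := exists_bound_on_rays (contDiffOn_pder hg1).continuousOn 1
  refine ⟨C, hC0, fun ρ hρ w hw => ?_⟩
  have hw0 : w ≠ 0 := norm_ne_zero_iff.1 (by rw [hw]; exact one_ne_zero)
  have h2 : ∀ r ∈ Icc 0 ρ, ‖pder g (r, w)‖ ≤ C * r := fun r hr =>
    norm_le_of_pder_le hg1 hw0 (h1 w hw0) hr.1 fun r' hr' =>
      hC r' ⟨hr'.1, hr'.2.trans (hr.2.trans hρ.2)⟩ w hw
  refine ⟨h2 ρ ⟨hρ.1, le_rfl⟩, ?_⟩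
  rw [pow_two, ← mul_assoc]
  exact norm_le_of_pder_le hg hw0 (h0 w hw0) hρ.1 fun r hr =>
    (h2 r hr).trans (mul_le_mul_of_nonneg_left hr.2 hC0)

lemma exists_quadratic_bound {g : ℝ × Space → E} (hg : ContDiffOn ℝ ∞ g rayDom)
    (h0 : ∀ w ≠ 0, g (0, w) = 0) (h1 : ∀ w ≠ 0, pder g (0, w) = 0) :
    ∃ C, 0 ≤ C ∧ ∀ ρ ∈ Icc (0 : ℝ) 1, ∀ w : Space, ‖w‖ = 1 → ‖pder g (ρ, w)‖ ≤ C * ρ ∧ ‖g (ρ, w)‖ ≤ C * ρ ^ 2 ∧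
      ∀ m, ‖fderiv ℝ g (ρ, w) (0, m)‖ ≤ C * ρ ^ 2 * ‖m‖ := by
  have hgD : ContDiffOn ℝ ∞ (fderiv ℝ g) rayDom := hg.fderiv_of_isOpen isOpen_rayDom (by simp)
  let g' : ℝ × Space → (Space →L[ℝ] E) := fun p => (fderiv ℝ g p).comp (ContinuousLinearMap.inr ℝ ℝ Space)
  have hg' : ContDiffOn ℝ ∞ g' rayDom := hgD.clm_comp contDiffOn_const
  have hnhds : ∀ {w : Space}, w ≠ 0 → ∀ ρ : ℝ, rayDom ∈ 𝓝 (ρ, w) := fun hw ρ => isOpen_rayDom.mem_nhds hw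
  have hvan : ∀ {f : ℝ × Space → E}, ContDiffOn ℝ ∞ f rayDom → (∀ w ≠ 0, f (0, w) = 0) → ∀ w ≠ 0,
      ∀ m, fderiv ℝ f (0, w) (0, m) = 0 := by
    intro f hf hf0 w hw m
    have h2 := ((hf.contDiffAt (hnhds hw 0)).differentiableAt (by simp)).hasFDerivAt
    have h3 := h2.comp w (hasFDerivAt_prodMk_right (0 : ℝ) w)
    have h4 : (f ∘ fun u : Space => ((0 : ℝ), u)) =ᶠ[𝓝 w] fun _ => 0 := by
      filter_upwards [isOpen_ne.mem_nhds hw] with u hu using hf0 u hu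
    have h5 := (h3.congr_of_eventuallyEq h4.symm).unique (hasFDerivAt_const (0 : E) w)
    simpa using congrArg (fun l : Space →L[ℝ] E => l m) h5
  obtain ⟨C, hC0, hC⟩ := exists_quadratic_bound_aux hg h0 h1
  obtain ⟨C', hC0', hC'⟩ := exists_quadratic_bound_aux hg'
    (fun w hw => by ext m; simpa [g'] using hvan hg h0 w hw m) (fun w hw => by
      have hs : IsSymmSndFDerivAt ℝ g (0, w) := (hg.contDiffAt (hnhds hw 0)).isSymmSndFDerivAt
        (by rw [minSmoothness_of_isRCLikeNormedField]; exact WithTop.coe_le_coe.2 (le_top : (2 : ℕ∞) ≤ ⊤))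
      have hd := ((hgD.contDiffAt (hnhds hw 0)).differentiableAt (by simp)).hasFDerivAt
      ext m
      have h2 : HasFDerivAt g' _ (0, w) := hd.clm_comp (hasFDerivAt_const _ _)
      have h3 : HasFDerivAt (pder g) _ (0, w) := hd.clm_apply (hasFDerivAt_const (((1 : ℝ), (0 : Space))) _)
      have h4 := hvan (contDiffOn_pder hg) h1 w hw m
      rw [h3.fderiv] at h4
      rw [pder, h2.fderiv]
      have h5 := hs.eq ((1 : ℝ), (0 : Space)) (0, m)
      simp at h4 ⊢
      rw [h5, h4])
  refine ⟨C + C', by positivity, fun ρ hρ w hw => ⟨(hC ρ hρ w hw).1.trans ?_, (hC ρ hρ w hw).2.trans ?_, fun m => ?_⟩⟩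
  · have := mul_nonneg hC0' hρ.1; linarith
  · have := mul_nonneg hC0' (sq_nonneg ρ); linarith
  · have h2 := (g' (ρ, w)).le_of_opNorm_le (hC' ρ hρ w hw).2 m
    refine h2.trans ?_
    gcongr
    linarith

end Rays

end

section

variable {v y : Space}

/-! ### Lag coordinates -/

lemma hasFDerivAt_norm_of_ne (hy : y ≠ 0) :
    HasFDerivAt (fun y : Space => ‖y‖) (‖y‖⁻¹ • innerSL ℝ y) y := by
  have h1 := (hasFDerivAt_id y).norm_sq.sqrt (by simpa using hy)
  simp only [id, sqrt_sq (norm_nonneg _)] at h1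
  refine h1.congr_fderiv ?_
  ext m
  simp
  field_simp

/-- The event at time `t` reached by light emitted from the world-line `z` with relative position `y`. -/
def lagMap (z : ℝ → Space) (t : ℝ) (y : Space) : Space := y + z (t - ‖y‖)

namespace WorldLine

variable {z : ℝ → Space}

lemma retardedTime_lagMap (hz : WorldLine z) (t : ℝ) (y : Space) : retardedTime z (t, lagMap z t y) = t - ‖y‖ :=
  hz.retardedTime_eq (by simp [lagMap])

lemma lagMap_injective (hz : WorldLine z) (t : ℝ) : Injective (lagMap z t) := by
  intro y y' h
  have h1 := hz.retardedTime_lagMap t y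
  rw [h, hz.retardedTime_lagMap] at h1
  have h2 : ‖y‖ = ‖y'‖ := by linarith
  rw [lagMap, lagMap, h2] at h
  exact add_right_cancel h

lemma exists_lagMap_eq (hz : WorldLine z) (t : ℝ) (x : Space) : ∃ y, lagMap z t y = x := by
  refine ⟨x - z (retardedTime z (t, x)), ?_⟩
  have := hz.retardedTime_spec (t, x)
  simp only at this
  rw [lagMap, ← this]
  simp

lemma lagMap_zero (z : ℝ → Space) (t : ℝ) : lagMap z t 0 = z t := by simp [lagMap]

lemma lagMap_ne (hz : WorldLine z) (t : ℝ) (hy : y ≠ 0) : lagMap z t y ≠ z t := by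
  rw [← lagMap_zero z t]
  exact fun h => hy (hz.lagMap_injective t h)

lemma denom_lagMap (hz : WorldLine z) (t : ℝ) (y : Space) :
    denom z (t, lagMap z t y) = ‖y‖ - ⟪y,deriv z (t - ‖y‖)⟫ := by
  rw [denom, hz.retardedTime_lagMap]
  simp [lagMap]

lemma lw_lagMap (hz : WorldLine z) (F : ℝ → ℝ) (t : ℝ) (y : Space) :
    lw z F (t, lagMap z t y) = F (t - ‖y‖) / (‖y‖ - ⟪y,deriv z (t - ‖y‖)⟫) := by
  rw [lw, hz.denom_lagMap, hz.retardedTime_lagMap]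

lemma hasFDerivAt_lagMap (hz : WorldLine z) (t : ℝ) (hy : y ≠ 0) :
    HasFDerivAt (lagMap z t) (ContinuousLinearMap.id ℝ Space
      + (-(‖y‖⁻¹ • innerSL ℝ y)).smulRight (deriv z (t - ‖y‖))) y := by
  have h1 := (hz.hasDerivAt (t - ‖y‖)).hasFDerivAt.comp y ((hasFDerivAt_norm_of_ne hy).const_sub t)
  refine ((hasFDerivAt_id y).add h1).congr_fderiv ?_
  ext m
  simp
  ring

lemma exists_lag_bound (hz : WorldLine z) (t : ℝ) :
    ∃ c δ, 0 ≤ c ∧ c < 1 ∧ 0 < δ ∧ (∀ s ∈ Icc (t - 1) t, ‖deriv z s‖ ≤ c) ∧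
      ∀ y y', lagMap z t y = z t + y' → ‖y'‖ < δ → ‖y‖ < 1 ∧ ‖y‖ ≤ ‖y'‖ / (1 - c) := by
  obtain ⟨c, hc0, hc1, hc, hcl⟩ := hz.exists_speed_bound (t - 1) t
  refine ⟨c, 1 - c, hc0, hc1, by linarith, hc, fun y y' h hy' => ?_⟩
  have hy : y = y' + (z t - z (t - ‖y‖)) := by
    rw [lagMap] at h
    exact (eq_sub_of_add_eq h).trans (by abel)
  have h1 : ‖y‖ ≤ 1 := by
    by_contra! h1
    have h2 := hcl (t - 1) (by simp) t (by simp)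
    have h3 := hz.norm_sub_lt (show t - ‖y‖ < t - 1 by linarith)
    have h4 : ‖y‖ ≤ ‖y'‖ + (‖z t - z (t - 1)‖ + ‖z (t - 1) - z (t - ‖y‖)‖) := by
      conv_lhs => rw [hy]
      refine (norm_add_le _ _).trans ?_
      gcongr
      exact norm_sub_le_norm_sub_add_norm_sub _ _ _
    norm_num at h2
    linarith
  have h5 : ‖y‖ ≤ ‖y'‖ / (1 - c) := by
    rw [le_div_iff₀ (by linarith)]
    have h2 := hcl (t - ‖y‖) ⟨by linarith, by simp⟩ t (by simp)
    have h4 : ‖y‖ ≤ ‖y'‖ + ‖z t - z (t - ‖y‖)‖ := by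
      conv_lhs => rw [hy]
      exact norm_add_le _ _
    simp only [sub_sub_cancel, abs_norm] at h2
    linarith
  refine ⟨h5.trans_lt ((div_lt_one (by linarith)).2 hy'), h5⟩

lemma abs_fderiv_le_of_lagMap (hz : WorldLine z) {t c B : ℝ} {W : SR} (hy : y ≠ 0)
    (hc1 : c < 1) (hc : ‖deriv z (t - ‖y‖)‖ ≤ c) (hW : DifferentiableAt ℝ W (lagMap z t y))
    (hB : ∀ m, |fderiv ℝ (fun y => W (lagMap z t y)) y m| ≤ B * ‖m‖) (m : Space) :
    |fderiv ℝ W (lagMap z t y) m| ≤ B * (1 + (1 - c)⁻¹) * ‖m‖ := by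
  set v := deriv z (t - ‖y‖)
  have hy0 : 0 < ‖y‖ := norm_pos_iff.2 hy
  have hc0 : 0 ≤ c := (norm_nonneg _).trans hc
  have hB0 : 0 ≤ B := by
    have h1 := (abs_nonneg _).trans (hB y)
    exact nonneg_of_mul_nonneg_left h1 hy0
  have hinner : ∀ m' : Space, |‖y‖⁻¹ * ⟪y,m'⟫| ≤ ‖m'‖ := by
    intro m'
    rw [abs_mul, abs_of_pos (inv_pos.2 hy0), inv_mul_le_iff₀ hy0]
    exact abs_real_inner_le_norm _ _
  set p := ‖y‖⁻¹ * ⟪y,v⟫ with hp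
  have hp1 : p ≤ c := (le_abs_self _).trans ((hinner v).trans hc)
  set q := ‖y‖⁻¹ * ⟪y,m⟫ with hq
  let m' := m + (q / (1 - p)) • v
  have h1p : 0 < 1 - p := by linarith
  have h1 := (hW.hasFDerivAt.comp y (hz.hasFDerivAt_lagMap t hy)).fderiv
  have h2 : fderiv ℝ (fun y => W (lagMap z t y)) y m' = fderiv ℝ W (lagMap z t y) m := by
    have h3 : (fun y => W (lagMap z t y)) = W ∘ lagMap z t := rfl
    rw [h3, h1, ContinuousLinearMap.comp_apply]
    congr 1
    have h4 : ‖y‖⁻¹ * ⟪y,m'⟫ = q / (1 - p) := by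
      rw [inner_add_right, inner_smul_right, mul_add, ← hq, mul_left_comm, ← hp]
      field_simp
      ring
    simp only [add_apply, id_apply, ContinuousLinearMap.smulRight_apply,
      neg_apply, smul_apply, innerSL_apply_apply, smul_eq_mul, h4]
    simp [m', v]
  rw [← h2]
  refine (hB m').trans ?_
  rw [mul_assoc]
  gcongr
  calc ‖m'‖ ≤ ‖m‖ + ‖(q / (1 - p)) • v‖ := norm_add_le _ _
    _ ≤ ‖m‖ + (1 - c)⁻¹ * ‖m‖ := by
      gcongr
      rw [norm_smul, norm_eq_abs, abs_div, abs_of_pos h1p, div_eq_inv_mul, mul_assoc]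
      have h5 : |q| * ‖v‖ ≤ ‖m‖ := by
        calc |q| * ‖v‖ ≤ ‖m‖ * 1 := by
              gcongr
              · exact hinner m
              · exact hc.trans hc1.le
          _ = ‖m‖ := mul_one _
      gcongr
    _ = _ := by ring

end WorldLine

/-! ### The field of a charge near the charge -/

/-- The denominator of the Coulomb field of a charge of velocity `v`. -/
def boosted (v y : Space) : ℝ := √((1 - ‖v‖ ^ 2) * ‖y‖ ^ 2 + ⟪v,y⟫ ^ 2)

/-- The odd bounded term of the field of a charge of velocity `v` and acceleration `a`, for a source of strength
`F₀` and rate of change `F₁`. -/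
def retardationTerm (v a : Space) (F₀ F₁ : ℝ) (y : Space) : ℝ :=
  -(F₁ * ⟪v,y⟫ / ((1 - ‖v‖ ^ 2) * boosted v y)) - F₀ / 2 * (⟪a,y⟫ * ‖y‖ ^ 2 / boosted v y ^ 3
      + ⟪v,a⟫ * (3 * ⟪v,y⟫ * boosted v y ^ 2 - ⟪v,y⟫ ^ 3) / ((1 - ‖v‖ ^ 2) ^ 2 * boosted v y ^ 3))

lemma boosted_radicand_pos (hv : ‖v‖ < 1) (hy : y ≠ 0) :
    0 < (1 - ‖v‖ ^ 2) * ‖y‖ ^ 2 + ⟪v,y⟫ ^ 2 := by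
  have h1 : 0 < 1 - ‖v‖ ^ 2 := by nlinarith [norm_nonneg v]
  have h2 := norm_pos_iff.2 hy
  positivity

lemma boosted_pos (hv : ‖v‖ < 1) (hy : y ≠ 0) : 0 < boosted v y :=
  sqrt_pos.2 (boosted_radicand_pos hv hy)

lemma boosted_smul (v : Space) {r : ℝ} (hr : 0 < r) (y : Space) : boosted v (r • y) = r * boosted v y := by
  rw [boosted, norm_smul, inner_smul_right, norm_of_nonneg hr.le,
    show (1 - ‖v‖ ^ 2) * (r * ‖y‖) ^ 2 + (r * ⟪v,y⟫) ^ 2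
      = r ^ 2 * ((1 - ‖v‖ ^ 2) * ‖y‖ ^ 2 + ⟪v,y⟫ ^ 2) by ring,
    Real.sqrt_mul (sq_nonneg r), sqrt_sq hr.le, boosted]

lemma boosted_neg (v y : Space) : boosted v (-y) = boosted v y := by simp [boosted]

lemma contDiffOn_boosted (hv : ‖v‖ < 1) : Sm₀ (boosted v) := by
  have h1 : C∞ fun y : Space => (1 - ‖v‖ ^ 2) * ‖y‖ ^ 2 + ⟪v,y⟫ ^ 2 :=
    (contDiff_const.mul (contDiff_norm_sq ℝ)).add ((contDiff_const.inner ℝ contDiff_id).pow 2)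
  exact h1.contDiffOn.sqrt fun y hy => (boosted_radicand_pos hv hy).ne'

lemma contDiffOn_div_boosted (hv : ‖v‖ < 1) (F : ℝ) : Sm₀ (fun y => F / boosted v y) :=
  contDiffOn_const.div (contDiffOn_boosted hv) fun _ hy => (boosted_pos hv hy).ne'

lemma homEven_div_boosted (hv : ‖v‖ < 1) (F : ℝ) : HomEven fun y => F / boosted v y := by
  refine ⟨(contDiffOn_div_boosted hv F).continuousOn, fun r hr y => ?_, fun y => by beta_reduce; rw [boosted_neg]⟩
  beta_reduce
  rw [boosted_smul v hr, div_mul_eq_div_div_swap, div_eq_inv_mul _ r]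

lemma contDiffOn_retardationTerm (hv : ‖v‖ < 1) (a : Space) (F₀ F₁ : ℝ) :
    Sm₀ (retardationTerm v a F₀ F₁) := by
  have hs := contDiffOn_boosted hv
  have hk : (1 - ‖v‖ ^ 2) ≠ 0 := by nlinarith [norm_nonneg v]
  have h0 : ∀ y ∈ ({0}ᶜ : Set Space), boosted v y ≠ 0 := fun y hy => (boosted_pos hv hy).ne'
  have hi : ∀ w : Space, Sm₀ (fun y : Space => ⟪w,y⟫) := fun w =>
    (contDiff_const.inner ℝ contDiff_id).contDiffOn
  refine ContDiffOn.sub (ContDiffOn.neg (ContDiffOn.div (contDiffOn_const.mul (hi v)) (contDiffOn_const.mul hs) ?_))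
    (contDiffOn_const.mul (ContDiffOn.add (ContDiffOn.div ((hi a).mul (contDiff_norm_sq ℝ).contDiffOn) (hs.pow 3) ?_)
      (ContDiffOn.div (contDiffOn_const.mul (((contDiffOn_const.mul (hi v)).mul (hs.pow 2)).sub ((hi v).pow 3)))
        (contDiffOn_const.mul (hs.pow 3)) ?_)))
  · exact fun y hy => mul_ne_zero hk (h0 y hy)
  · exact fun y hy => pow_ne_zero 3 (h0 y hy)
  · exact fun y hy => mul_ne_zero (pow_ne_zero 2 hk) (pow_ne_zero 3 (h0 y hy))

lemma homOddZero_retardationTerm (hv : ‖v‖ < 1) (a : Space) (F₀ F₁ : ℝ) :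
    HomOddZero (retardationTerm v a F₀ F₁) := by
  refine ⟨(contDiffOn_retardationTerm hv a F₀ F₁).continuousOn, fun r hr y => ?_, fun y => ?_⟩
  · rcases eq_or_ne y 0 with rfl | hy
    · simp
    have hs := boosted_pos hv hy
    have hk : (1 - ‖v‖ ^ 2) ≠ 0 := by nlinarith [norm_nonneg v]
    simp only [retardationTerm, boosted_smul v hr, inner_smul_right, norm_smul, norm_of_nonneg hr.le]
    field_simp
  · simp only [retardationTerm, boosted_neg, inner_neg_right, norm_neg]
    ring

lemma retardation_identity {F₀ F₁ κ s α β : ℝ} (hκ : κ ≠ 0) (hs : s ≠ 0) :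
    -(F₁ / s) - F₀ * (β + α) / s ^ 2 + F₀ * (κ * β + (κ - s) * α) / (2 * s ^ 3)
      - (-(F₁ * (κ - s) / (κ * s)) - F₀ / 2 * (β * (2 * s - κ) / s ^ 3
          + α * (3 * (κ - s) * s ^ 2 - (κ - s) ^ 3) / (κ ^ 2 * s ^ 3))
        + (-(F₁ / κ) - F₀ * α / κ ^ 2)) = 0 := by
  field_simp
  ring

end

section

lemma contDiffOn_rayDom_snd {E : Type*} [NormedAddCommGroup E] [NormedSpace ℝ E] {f : Space → E}
    (hf : Sm₀ f) : ContDiffOn ℝ ∞ (fun p : ℝ × Space => f p.2) rayDom :=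
  hf.comp contDiff_snd.contDiffOn fun _ hp => hp

lemma fderiv_smul_snd {g : ℝ × Space → ℝ} (hg : ContDiffOn ℝ ∞ g rayDom)
    (hh : ∀ ρ, ∀ r : ℝ, 0 < r → ∀ w, g (ρ, r • w) = g (ρ, w)) {r : ℝ} (hr : 0 < r) {w : Space} (hw : w ≠ 0)
    (ρ τ : ℝ) (m : Space) : fderiv ℝ g (ρ, r • w) (τ, m) = fderiv ℝ g (ρ, w) (τ, r⁻¹ • m) := by
  have hd : ∀ {w : Space}, w ≠ 0 → HasFDerivAt g (fderiv ℝ g (ρ, w)) (ρ, w) := fun hw =>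
    ((hg.contDiffAt (isOpen_rayDom.mem_nhds (show (ρ, _) ∈ rayDom from hw))).differentiableAt
      (by simp)).hasFDerivAt
  let S : ℝ × Space →L[ℝ] ℝ × Space := (ContinuousLinearMap.fst ℝ ℝ Space).prod (r • ContinuousLinearMap.snd ℝ ℝ Space)
  have hS : HasFDerivAt S S (ρ, w) := S.hasFDerivAt
  have h1 : HasFDerivAt (g ∘ S) ((fderiv ℝ g (ρ, r • w)).comp S) (ρ, w) :=
    HasFDerivAt.comp (ρ, w) (hd (smul_ne_zero hr.ne' hw)) hS
  have h2 : g ∘ S = g := by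
    funext p; exact hh p.1 r hr p.2
  rw [h2] at h1
  rw [(hd hw).unique h1]
  simp [S, smul_smul, hr.ne']

lemma exists_lag_remainder_bound {g : ℝ × Space → ℝ} (hg : ContDiffOn ℝ ∞ g rayDom)
    (hh : ∀ ρ, ∀ r : ℝ, 0 < r → ∀ w, g (ρ, r • w) = g (ρ, w))
    (h0 : ∀ w ≠ 0, g (0, w) = 0) (h1 : ∀ w ≠ 0, pder g (0, w) = 0) :
    ∃ C, 0 ≤ C ∧ ∀ y : Space, y ≠ 0 → ‖y‖ ≤ 1 → |g (‖y‖, y) / ‖y‖| ≤ C * ‖y‖ ∧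
      ∀ m, |fderiv ℝ (fun y => g (‖y‖, y) / ‖y‖) y m| ≤ C * ‖m‖ := by
  obtain ⟨C, hC0, hC⟩ := exists_quadratic_bound hg h0 h1
  refine ⟨3 * C, by positivity, fun y hy hy1 => ?_⟩
  have hy0 : 0 < ‖y‖ := norm_pos_iff.2 hy
  obtain ⟨b1, b2, b3⟩ := hC ‖y‖ ⟨hy0.le, hy1⟩ (khat y) (norm_khat hy)
  have hkh : ‖y‖ • khat y = y := by rw [khat, smul_smul, mul_inv_cancel₀ hy0.ne', one_smul]
  have hk0 : khat y ≠ 0 := norm_ne_zero_iff.1 (by rw [norm_khat hy]; exact one_ne_zero)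
  have e2 : g (‖y‖, y) = g (‖y‖, khat y) := by
    have := hh ‖y‖ ‖y‖ hy0 (khat y)
    rwa [hkh] at this
  have hder : ∀ τ m, fderiv ℝ g (‖y‖, y) (τ, m) = fderiv ℝ g (‖y‖, khat y) (τ, ‖y‖⁻¹ • m) := by
    intro τ m
    have := fderiv_smul_snd hg hh hy0 hk0 ‖y‖ τ m
    rwa [hkh] at this
  have b2' : |g (‖y‖, y)| ≤ C * ‖y‖ ^ 2 := by rw [e2]; exact b2
  refine ⟨?_, fun m => ?_⟩
  · rw [abs_div, abs_norm, div_le_iff₀ hy0]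
    nlinarith [mul_nonneg hC0 (sq_nonneg ‖y‖)]
  have hgd : HasFDerivAt g (fderiv ℝ g (‖y‖, y)) (‖y‖, y) :=
    ((hg.contDiffAt (isOpen_rayDom.mem_nhds (show (‖y‖, y) ∈ rayDom from hy))).differentiableAt
      (by simp)).hasFDerivAt
  have hn := hasFDerivAt_norm_of_ne hy
  have h2 : HasFDerivAt (fun y : Space => g (‖y‖, y)) _ y :=
    HasFDerivAt.comp y hgd (hn.prodMk (hasFDerivAt_id y))
  have h3 : HasFDerivAt (fun y : Space => (‖y‖)⁻¹) _ y := (hasDerivAt_inv hy0.ne').hasFDerivAt.comp y hn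
  have h4 : HasFDerivAt (fun y : Space => g (‖y‖, y) * (‖y‖)⁻¹) _ y := h2.mul h3
  have hq : |‖y‖⁻¹ * ⟪y,m⟫| ≤ ‖m‖ := by
    rw [abs_mul, abs_of_pos (inv_pos.2 hy0), inv_mul_le_iff₀ hy0]
    exact abs_real_inner_le_norm _ _
  set q := ‖y‖⁻¹ * ⟪y,m⟫ with hqd
  have h5 : fderiv ℝ (fun y => g (‖y‖, y) / ‖y‖) y m
      = ‖y‖⁻¹ * (q * pder g (‖y‖, khat y)) + ‖y‖⁻¹ * fderiv ℝ g (‖y‖, khat y) (0, ‖y‖⁻¹ • m)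
        - g (‖y‖, y) * ‖y‖⁻¹ ^ 2 * q := by
    simp only [div_eq_mul_inv]
    rw [h4.fderiv]
    have h6 : fderiv ℝ g (‖y‖, y) (q, m) = q * pder g (‖y‖, khat y)
        + fderiv ℝ g (‖y‖, khat y) (0, ‖y‖⁻¹ • m) := by
      rw [hder, pder, ← smul_eq_mul, ← map_smul, ← map_add]
      simp
    simp only [add_apply, smul_apply, ContinuousLinearMap.comp_apply, ContinuousLinearMap.prod_apply,
      innerSL_apply_apply, smul_eq_mul, ← hqd, toSpanSingleton_apply,
      id_apply, h6]
    ring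
  rw [h5]
  have c1 : |‖y‖⁻¹ * (q * pder g (‖y‖, khat y))| ≤ C * ‖m‖ := by
    rw [abs_mul, abs_of_pos (inv_pos.2 hy0), inv_mul_le_iff₀ hy0, abs_mul]
    calc |q| * |pder g (‖y‖, khat y)| ≤ ‖m‖ * (C * ‖y‖) := by
          gcongr
          exact b1
      _ = _ := by ring
  have c2 : |‖y‖⁻¹ * fderiv ℝ g (‖y‖, khat y) (0, ‖y‖⁻¹ • m)| ≤ C * ‖m‖ := by
    rw [abs_mul, abs_of_pos (inv_pos.2 hy0), inv_mul_le_iff₀ hy0]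
    refine (b3 _).trans (le_of_eq ?_)
    rw [norm_smul, norm_inv, norm_norm]
    field_simp
  have c3 : |g (‖y‖, y) * ‖y‖⁻¹ ^ 2 * q| ≤ C * ‖m‖ := by
    rw [abs_mul, abs_mul, abs_of_pos (pow_pos (inv_pos.2 hy0) 2)]
    calc |g (‖y‖, y)| * ‖y‖⁻¹ ^ 2 * |q| ≤ (C * ‖y‖ ^ 2) * ‖y‖⁻¹ ^ 2 * ‖m‖ := by gcongr
      _ = C * ‖m‖ := by field_simp
  calc _ ≤ |‖y‖⁻¹ * (q * pder g (‖y‖, khat y)) + ‖y‖⁻¹ * fderiv ℝ g (‖y‖, khat y) (0, ‖y‖⁻¹ • m)|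
        + |g (‖y‖, y) * ‖y‖⁻¹ ^ 2 * q| := abs_sub _ _
    _ ≤ _ := by
      have := abs_add_le (‖y‖⁻¹ * (q * pder g (‖y‖, khat y))) (‖y‖⁻¹ * fderiv ℝ g (‖y‖, khat y) (0, ‖y‖⁻¹ • m))
      linarith

namespace WorldLine

variable {z : ℝ → Space}

lemma exists_local_expansion (hz : WorldLine z) {F : ℝ → ℝ} (hF : C∞ F) (t : ℝ) :
    ∃ (e o : SR) (k C δ : ℝ), 0 < δ ∧ 0 ≤ C ∧ Sm₀ e ∧ Sm₀ o ∧
      HomEven e ∧ HomOddZero o ∧ ∀ y, y ≠ 0 → ‖y‖ < δ →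
        |lw z F (t, z t + y) - (e y + o y + k)| ≤ C * ‖y‖ ∧
        ∀ m, |fderiv ℝ (fun x => lw z F (t, x)) (z t + y) m - fderiv ℝ e y m - fderiv ℝ o y m|
          ≤ C * ‖m‖ := by
  set v := deriv z t with hv
  set a := deriv (deriv z) t with ha
  have hv1 : ‖v‖ < 1 := hz.subluminal t
  have hκ : 0 < 1 - ‖v‖ ^ 2 := by nlinarith [norm_nonneg v]
  set F₀ := F t with hF0
  set F₁ := deriv F t with hF1
  set e : SR := fun y => F₀ / boosted v y with he
  set o := retardationTerm v a F₀ F₁ with ho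
  set k := -(F₁ / (1 - ‖v‖ ^ 2)) - F₀ * ⟪v,a⟫ / (1 - ‖v‖ ^ 2) ^ 2 with hk
  have hee := homEven_div_boosted hv1 F₀
  have hoo := homOddZero_retardationTerm hv1 a F₀ F₁
  have hes := contDiffOn_div_boosted hv1 F₀
  have hos := contDiffOn_retardationTerm hv1 a F₀ F₁
  rw [← he] at hee hes
  rw [← ho] at hoo hos
  have hrev : C∞ fun ρ : ℝ => t - ρ := contDiff_const.sub contDiff_id
  have hrevd : ∀ ρ : ℝ, HasDerivAt (fun ρ : ℝ => t - ρ) (-1) ρ := fun ρ => (hasDerivAt_id ρ).const_sub t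
  have hζ : C∞ fun ρ => z (t - ρ) := hz.smooth.comp hrev
  have hζ' : ∀ ρ, HasDerivAt (fun ρ => z (t - ρ)) (-deriv z (t - ρ)) ρ := fun ρ => by
    simpa [comp_def] using (hz.hasDerivAt (t - ρ)).scomp ρ (hrevd ρ)
  have hζ'' : ∀ ρ, HasDerivAt (fun ρ => deriv z (t - ρ)) (-deriv (deriv z) (t - ρ)) ρ := fun ρ => by
    simpa [comp_def] using (hz.hasDerivAt_deriv (t - ρ)).scomp ρ (hrevd ρ)
  have hF' : ∀ ρ, HasDerivAt (fun ρ => F (t - ρ)) (-deriv F (t - ρ)) ρ := fun ρ => by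
    simpa [comp_def] using (hF.differentiable (by simp) (t - ρ)).hasDerivAt.scomp ρ (hrevd ρ)
  obtain ⟨η, hη, hηρ, hη0, hη1⟩ := exists_smooth_slope hζ
  have hdζ : deriv (fun ρ => z (t - ρ)) = fun ρ => -deriv z (t - ρ) := funext fun ρ => (hζ' ρ).deriv
  rw [hdζ] at hη0 hη1
  rw [(hζ'' 0).fun_neg.deriv] at hη1
  simp only [sub_zero, neg_neg, ← hv, ← ha] at hη0 hη1 hηρ
  have hη_lt : ∀ ρ, ‖η ρ‖ < 1 := by
    intro ρ
    rcases lt_trichotomy ρ 0 with h | rfl | h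
    · have h1 := hz.norm_sub_lt (show t < t - ρ by linarith)
      rw [hηρ, norm_smul, Real.norm_of_nonpos h.le] at h1
      nlinarith
    · rw [hη0, norm_neg]; exact hv1
    · have h1 := hz.norm_sub_lt (show t - ρ < t by linarith)
      rw [norm_sub_rev, hηρ, norm_smul, norm_of_nonneg h.le] at h1
      nlinarith
  let X : ℝ × Space → Space := fun p => khat p.2 + η p.1
  have hX0 : ∀ p ∈ rayDom, X p ≠ 0 := by
    intro p hp h
    have h1 := norm_khat hp
    rw [eq_neg_of_add_eq_zero_left h, norm_neg] at h1
    exact (hη_lt p.1).ne h1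
  have hXs : ContDiffOn ℝ ∞ X rayDom :=
    (contDiffOn_rayDom_snd contDiffOn_khat).add (hη.comp contDiff_fst).contDiffOn
  let d : ℝ × Space → ℝ := fun p => 1 - ⟪khat p.2,deriv z (t - p.1)⟫
  have hd0 : ∀ p ∈ rayDom, 0 < d p := by
    intro p hp
    have := hz.inner_lt (R := khat p.2) (norm_ne_zero_iff.1 (by rw [norm_khat hp]; exact one_ne_zero)) (t - p.1)
    rw [norm_khat hp] at this
    exact sub_pos.2 this
  have hds : ContDiffOn ℝ ∞ d rayDom :=
    contDiffOn_const.sub ((contDiffOn_rayDom_snd contDiffOn_khat).inner ℝ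
      ((hz.contDiff_deriv.comp hrev).comp contDiff_fst).contDiffOn)
  let g : ℝ × Space → ℝ := fun p => F (t - p.1) / d p - e (X p) - p.1 * (o (X p) + k)
  have hgs : ContDiffOn ℝ ∞ g rayDom :=
    ((((hF.comp hrev).comp contDiff_fst).contDiffOn.div hds fun p hp => (hd0 p hp).ne').sub
      (hes.comp hXs hX0)).sub (contDiff_fst.contDiffOn.mul ((hos.comp hXs hX0).add contDiffOn_const))
  have hkh : ∀ r : ℝ, 0 < r → ∀ w : Space, khat (r • w) = khat w := by
    intro r hr w
    rw [khat, khat, norm_smul, norm_of_nonneg hr.le, smul_smul, mul_inv, mul_right_comm,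
      inv_mul_cancel₀ hr.ne', one_mul]
  have hgh : ∀ ρ, ∀ r : ℝ, 0 < r → ∀ w, g (ρ, r • w) = g (ρ, w) := by
    intro ρ r hr w
    simp only [g, d, X, hkh r hr]
  have hcore : ∀ w : Space, w ≠ 0 → g (0, w) = 0 ∧ pder g (0, w) = 0 := by
    intro w hw
    set u := khat w with hu
    have hu1 : ‖u‖ = 1 := norm_khat hw
    set p := ⟪u,v⟫ with hp
    have hp1 : 0 < 1 - p := by simpa [d, ← hu, ← hv] using hd0 (0, w) hw
    have hXv : X (0, w) = u - v := by simp [X, ← hu, hη0, sub_eq_add_neg]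
    have hc : ⟪v,u - v⟫ = (1 - ‖v‖ ^ 2) - (1 - p) := by
      rw [inner_sub_right, real_inner_self_eq_norm_sq, real_inner_comm]; ring
    have hn : ‖u - v‖ ^ 2 = 2 * (1 - p) - (1 - ‖v‖ ^ 2) := by
      rw [norm_sub_sq_real, hu1]; ring
    have hrad : (1 - ‖v‖ ^ 2) * ‖u - v‖ ^ 2 + ⟪v,u - v⟫ ^ 2 = (1 - p) ^ 2 := by
      rw [hc, hn]; ring
    have hs : boosted v (u - v) = 1 - p := by
      rw [boosted, hrad, sqrt_sq hp1.le]
    set α := ⟪v,a⟫ with hα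
    have hβ : ⟪u,a⟫ = ⟪a,u - v⟫ + α := by
      rw [hα, inner_sub_right, real_inner_comm a u, real_inner_comm a v]; ring
    set β := ⟪a,u - v⟫ with hβd
    refine ⟨?_, ?_⟩
    · simp only [g, hXv, he, hs, zero_mul, sub_zero, d, ← hu, ← hv, ← hp]
      exact sub_self _
    · rw [← (hasDerivAt_param hgs hw 0).deriv]
      have hX' : HasDerivAt (fun ρ => u + η ρ) ((1 / 2 : ℝ) • a) 0 := by
        have := (hη.differentiable (by simp) 0).hasDerivAt.const_add u
        rwa [hη1] at this
      have hXd : HasDerivAt (fun ρ => (1 - ‖v‖ ^ 2) * ‖u + η ρ‖ ^ 2 + ⟪v,u + η ρ⟫ ^ 2)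
          ((1 - ‖v‖ ^ 2) * β + ((1 - ‖v‖ ^ 2) - (1 - p)) * α) 0 := by
        have h1 := (hX'.norm_sq.const_mul (1 - ‖v‖ ^ 2)).add (((hasDerivAt_const (0 : ℝ) v).inner ℝ hX').pow 2)
        refine h1.congr_deriv ?_
        rw [hη0, ← sub_eq_add_neg, hc]
        simp only [inner_smul_right, inner_zero_left, add_zero, ← hα, real_inner_comm a (u - v), ← hβd]
        simp only [Nat.cast_ofNat]
        ring
      have hval : (1 - ‖v‖ ^ 2) * ‖u + η 0‖ ^ 2 + ⟪v,u + η 0⟫ ^ 2 = (1 - p) ^ 2 := by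
        rw [hη0, ← sub_eq_add_neg, hrad]
      have hsd := hXd.sqrt (by rw [hval]; positivity)
      rw [hval, sqrt_sq hp1.le] at hsd
      have hs0 : boosted v (u + η 0) = 1 - p := by rw [hη0, ← sub_eq_add_neg, hs]
      have hed : HasDerivAt (fun ρ => e (u + η ρ)) _ 0 :=
        (hasDerivAt_const (0 : ℝ) F₀).div hsd (by change boosted v (u + η 0) ≠ 0; rw [hs0]; exact hp1.ne')
      change HasDerivAt _ ((0 * boosted v (u + η 0) - _) / boosted v (u + η 0) ^ 2) 0 at hed
      rw [hs0] at hed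
      have hdd : HasDerivAt (fun ρ => 1 - ⟪u,deriv z (t - ρ)⟫) (⟪u,a⟫) 0 := by
        have := ((hasDerivAt_const (0 : ℝ) u).inner ℝ (hζ'' 0)).const_sub 1
        refine this.congr_deriv ?_
        simp [← ha]
      have hFd : HasDerivAt (fun ρ => F (t - ρ) / (1 - ⟪u,deriv z (t - ρ)⟫)) _ 0 :=
        (hF' 0).div hdd (by simp only [sub_zero, ← hv, ← hp]; exact hp1.ne')
      have hod : DifferentiableAt ℝ (fun ρ => o (u + η ρ)) 0 := by
        have h1 : ContDiffAt ℝ ∞ o (u + η 0) := hos.contDiffAt (isOpen_compl_singleton.mem_nhds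
          (by simpa [X] using hX0 (0, w) hw))
        exact DifferentiableAt.comp (0 : ℝ) (h1.differentiableAt (by simp)) hX'.differentiableAt
      have hpd : HasDerivAt (fun ρ : ℝ => ρ * (o (u + η ρ) + k)) _ 0 :=
        (hasDerivAt_id (0 : ℝ)).mul (hod.hasDerivAt.add_const k)
      have hall : HasDerivAt (fun ρ => g (ρ, w)) _ 0 := (hFd.sub hed).sub hpd
      rw [hall.deriv]
      simp only [sub_zero, ← hv, ← hp, ← hF0, ← hF1, hη0, ← sub_eq_add_neg, id, zero_mul, add_zero, one_mul, zero_sub]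
      rw [hβ, ← retardation_identity (F₀ := F₀) (F₁ := F₁) (α := α) (β := β) hκ.ne' hp1.ne', ho, retardationTerm,
        hs, hc, hn, hk, ← hα, ← hβd]
      have := hp1.ne'
      field_simp
      ring
  obtain ⟨C, hC0, hC⟩ := exists_lag_remainder_bound hgs hgh (fun w hw => (hcore w hw).1) (fun w hw => (hcore w hw).2)
  obtain ⟨c, δ, hc0, hc1, hδ, hcb, hlag⟩ := hz.exists_lag_bound t
  let W : SR := fun x => lw z F (t, x) - (e (x - z t) + o (x - z t) + k)
  have hWg : ∀ y : Space, y ≠ 0 → W (lagMap z t y) = g (‖y‖, y) / ‖y‖ := by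
    intro y hy
    have hy0 : 0 < ‖y‖ := norm_pos_iff.2 hy
    have h1 : lagMap z t y - z t = ‖y‖ • X (‖y‖, y) := by
      simp only [X, smul_add, ← hηρ, khat, smul_smul, mul_inv_cancel₀ hy0.ne', one_smul, lagMap]
      abel
    have h2 : ‖y‖ - ⟪y,deriv z (t - ‖y‖)⟫ = ‖y‖ * d (‖y‖, y) := by
      simp only [d, khat, inner_smul_left, mul_sub, conj_trivial]
      field_simp
    have h3 := (hd0 (‖y‖, y) hy).ne'
    simp only [W, g, hz.lw_lagMap, h1, hee.2.1 _ hy0, hoo.2.1 _ hy0, h2]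
    field_simp
    ring
  have hWd : ∀ x ≠ z t, HasFDerivAt W (fderiv ℝ (fun x => lw z F (t, x)) x
      - (fderiv ℝ e (x - z t) + fderiv ℝ o (x - z t))) x := by
    intro x hx
    have h1 : ∀ {f : SR}, Sm₀ f → HasFDerivAt (fun x => f (x - z t)) (fderiv ℝ f (x - z t)) x := by
      intro f hf
      have h2 := ((hf.contDiffAt (isOpen_compl_singleton.mem_nhds (sub_ne_zero.2 hx))).differentiableAt
        (by simp)).hasFDerivAt
      exact HasFDerivAt.comp x h2 ((hasFDerivAt_id x).sub_const (z t))
    have h3 : DifferentiableAt ℝ (fun x => lw z F (t, x)) x :=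
      ((hz.contDiffAt_lw hF (p := (t, x)) hx).differentiableAt (by simp)).comp x
        (differentiableAt_const t |>.prodMk differentiableAt_id)
    exact h3.hasFDerivAt.sub (((h1 hes).add (h1 hos)).add_const k)
  refine ⟨e, o, k, C * (1 + (1 - c)⁻¹), δ, hδ, ?_, hes, hos, hee, hoo, fun y' hy' hyδ => ?_⟩
  · have : 0 < 1 - c := by linarith
    positivity
  obtain ⟨y, hy⟩ := hz.exists_lagMap_eq t (z t + y')
  have hy0 : y ≠ 0 := by
    rintro rfl
    rw [lagMap_zero] at hy
    exact hy' (by simpa using hy)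
  obtain ⟨hl1, hl2⟩ := hlag y y' hy hyδ
  obtain ⟨hb1, hb2⟩ := hC y hy0 hl1.le
  have h1c : 0 < 1 - c := by linarith
  refine ⟨?_, fun m => ?_⟩
  · have h1 : W (z t + y') = lw z F (t, z t + y') - (e y' + o y' + k) := by simp [W]
    rw [← h1, ← hy, hWg y hy0]
    refine hb1.trans ?_
    rw [mul_assoc]
    gcongr
    rw [div_eq_inv_mul] at hl2
    nlinarith [norm_nonneg y']
  · have hne : lagMap z t y ≠ z t := hz.lagMap_ne t hy0
    have h1 : ∀ m, |fderiv ℝ (fun y => W (lagMap z t y)) y m| ≤ C * ‖m‖ := by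
      intro m
      have h2 : (fun y => W (lagMap z t y)) =ᶠ[𝓝 y] fun y => g (‖y‖, y) / ‖y‖ := by
        filter_upwards [isOpen_ne.mem_nhds hy0] with u hu using hWg u hu
      rw [h2.fderiv_eq]
      exact hb2 m
    have h3 := hz.abs_fderiv_le_of_lagMap hy0 hc1 (hcb _ ⟨by linarith, by simp⟩) (hWd _ hne).differentiableAt h1 m
    rw [(hWd _ hne).fderiv, hy] at h3
    simpa [sub_sub] using h3

end WorldLine

end

section

variable {f D : ℝ × Space → ℝ} {X ρ : SC} {C : ℝ}

/-! ### Criteria for remainders -/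

lemma tailBound_inv_pow_four : TailBound fun k : Space => ofReal (‖k‖ ^ 4)⁻¹ := by
  let f : ℝ → SR := fun L => (tailSet L).indicator fun k => (‖k‖ ^ 4)⁻¹
  have hfi : Integrable (f 1) := by
    refine (integrable_env.const_mul 2).mono' ?_ (ae_of_all _ fun k => ?_)
    · exact ((by fun_prop : Measurable fun k : Space => (‖k‖ ^ 4)⁻¹).indicator
        (measurableSet_tailSet 1)).aestronglyMeasurable
    · by_cases hk : k ∈ tailSet 1
      · simp only [f, indicator_of_mem hk]
        have hk1 : 1 ≤ ‖k‖ := hk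
        rw [norm_of_nonneg (by positivity), env, ← div_eq_mul_inv, le_div_iff₀ (by positivity),
          inv_mul_le_iff₀ (by positivity)]
        nlinarith [one_le_pow₀ hk1 (n := 2), sq_nonneg ‖k‖]
      · simp only [f, indicator_of_notMem hk, norm_zero]
        exact mul_nonneg zero_le_two (env_nonneg k)
  refine ⟨(∫ k, f 1 k).toNNReal, fun L hL => ?_⟩
  have hL0 : 0 < L := by linarith
  have hsc : ∀ k, f L k = (L ^ 4)⁻¹ * f 1 (L⁻¹ • k) := by
    intro k
    have hmem : L⁻¹ • k ∈ tailSet 1 ↔ k ∈ tailSet L := by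
      simp only [tailSet, mem_ofPred_eq, norm_smul, norm_inv, norm_of_nonneg hL0.le]
      rw [le_inv_mul_iff₀ hL0, mul_one]
    by_cases hk : k ∈ tailSet L
    · simp only [f, indicator_of_mem hk, indicator_of_mem (hmem.2 hk), norm_smul, norm_inv, norm_of_nonneg hL0.le]
      field_simp
    · simp only [f, indicator_of_notMem hk, indicator_of_notMem (fun h => hk (hmem.1 h)), mul_zero]
  have hfL : Integrable (f L) := by
    rw [show f L = fun k => (L ^ 4)⁻¹ * f 1 (L⁻¹ • k) from funext hsc]
    exact (hfi.comp_smul (inv_ne_zero hL0.ne')).const_mul _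
  have h0 : ∀ L k, 0 ≤ f L k := fun L k => Set.indicator_nonneg (fun k _ => by positivity) k
  have h1 : ∫⁻ k in tailSet L, ofReal (‖k‖ ^ 4)⁻¹ = ∫⁻ k, ofReal (f L k) := by
    rw [← lintegral_indicator (measurableSet_tailSet L)]
    refine lintegral_congr fun k => ?_
    by_cases hk : k ∈ tailSet L <;> simp [f, hk]
  rw [h1, ← ofReal_integral_eq_lintegral_ofReal hfL (ae_of_all _ (h0 L)), integral_congr_ae (ae_of_all _ hsc),
    integral_const_mul, Measure.integral_comp_smul, finrank_euclideanSpace_fin, ofNNReal_toNNReal,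
    ← ofReal_mul (integral_nonneg (h0 1))]
  refine ofReal_le_ofReal (le_of_eq ?_)
  rw [abs_of_pos (by positivity), smul_eq_mul]
  field_simp

lemma tailBound_inv_mul_sq (hX : MemLp X 2) : TailBound fun k => ofReal ‖k‖⁻¹ * ‖X k‖ₑ ^ 2 := by
  have hfin : ∫⁻ k, ‖X k‖ₑ ^ 2 < ⊤ := by
    have h1 := hX.integrable_norm_pow (p := 2) (by simp)
    have h2 := h1.2
    rw [hasFiniteIntegral_iff_enorm] at h2
    simpa using h2
  refine ⟨(∫⁻ k, ‖X k‖ₑ ^ 2).toNNReal, fun L hL => ?_⟩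
  rw [ENNReal.coe_toNNReal hfin.ne, mul_comm]
  calc ∫⁻ k in tailSet L, ofReal ‖k‖⁻¹ * ‖X k‖ₑ ^ 2 ≤ ∫⁻ k in tailSet L, ofReal L⁻¹ * ‖X k‖ₑ ^ 2 := by
        refine setLIntegral_mono' (measurableSet_tailSet L) fun k hk => ?_
        have hk' : L ≤ ‖k‖ := hk
        gcongr
    _ ≤ ∫⁻ k, ofReal L⁻¹ * ‖X k‖ₑ ^ 2 := setLIntegral_le_lintegral _ _
    _ = _ := lintegral_const_mul' _ _ ENNReal.ofReal_ne_top

lemma isRemainder_of_inv_cube (h : ∀ k, 1 ≤ ‖k‖ → ‖ρ k‖ ≤ C * (‖k‖ ^ 3)⁻¹) :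
    Remainder ρ := by
  have hC : ∀ k : Space, 1 ≤ ‖k‖ → C * (‖k‖ ^ 3)⁻¹ ≤ |C| * (‖k‖ ^ 3)⁻¹ := fun k _ => by
    gcongr; exact le_abs_self C
  constructor
  · refine (tailBound_inv_pow_four.const_mul |C|.toNNReal).mono fun k hk => ?_
    rw [← ofReal_norm, ← ofReal_mul (norm_nonneg _), ofNNReal_toNNReal, ← ofReal_mul (abs_nonneg C)]
    refine ofReal_le_ofReal ?_
    have hk0 : 0 < ‖k‖ := by linarith
    calc ‖ρ k‖ * ‖k‖⁻¹ ≤ |C| * (‖k‖ ^ 3)⁻¹ * ‖k‖⁻¹ := by gcongr; exact (h k hk).trans (hC k hk)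
      _ = _ := by field_simp
  · refine (tailBound_inv_pow_four.const_mul (|C| ^ 2).toNNReal).mono fun k hk => ?_
    rw [← ofReal_norm, ← ofReal_pow (norm_nonneg _), ofNNReal_toNNReal, ← ofReal_mul (by positivity)]
    refine ofReal_le_ofReal ?_
    have hk0 : 0 < ‖k‖ := by linarith
    calc ‖ρ k‖ ^ 2 ≤ (|C| * (‖k‖ ^ 3)⁻¹) ^ 2 := by gcongr; exact (h k hk).trans (hC k hk)
      _ = |C| ^ 2 * (‖k‖ ^ 6)⁻¹ := by field_simp
      _ ≤ _ := by gcongr; (first | exact hk | norm_num)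

lemma isRemainder_of_memLp (hX : MemLp X 2)
    (h : ∀ k, 1 ≤ ‖k‖ → ‖ρ k‖ ≤ C * (‖k‖ ^ 2)⁻¹ * ‖X k‖) : Remainder ρ := by
  have hC : ∀ k : Space, 1 ≤ ‖k‖ → ‖ρ k‖ ≤ |C| * (‖k‖ ^ 2)⁻¹ * ‖X k‖ := fun k hk => (h k hk).trans (by
    gcongr; exact le_abs_self C)
  have e2 : ∀ k, ‖X k‖ₑ ^ 2 = ofReal (‖X k‖ ^ 2) := fun k => by
    rw [← ofReal_norm, ofReal_pow (norm_nonneg _)]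
  have hT := tailBound_inv_mul_sq hX
  constructor
  · have hT4 := tailBound_inv_pow_four.add (by fun_prop) hT
    refine (hT4.const_mul |C|.toNNReal).mono fun k hk => ?_
    rw [e2, ← ofReal_norm, ← ofReal_mul (norm_nonneg _), ofNNReal_toNNReal,
      ← ofReal_mul (by positivity), ← ENNReal.ofReal_add (by positivity) (by positivity),
      ← ofReal_mul (abs_nonneg C)]
    refine ofReal_le_ofReal ?_
    have hk0 : 0 < ‖k‖ := by linarith
    have h1 : (‖k‖ ^ 2)⁻¹ * ‖X k‖ * ‖k‖⁻¹ ≤ (‖k‖ ^ 4)⁻¹ + ‖k‖⁻¹ * ‖X k‖ ^ 2 := by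
      set l := ‖k‖⁻¹ with hl
      have hl0 : 0 < l := inv_pos.2 hk0
      have hl1 : l ≤ 1 := inv_le_one_of_one_le₀ hk
      rw [← inv_pow, ← inv_pow, ← hl]
      have h2 : l ^ 5 ≤ l ^ 4 := pow_le_pow_of_le_one hl0.le hl1 (by norm_num)
      nlinarith [mul_nonneg hl0.le (sq_nonneg (l ^ 2 - ‖X k‖)), pow_pos hl0 5, mul_nonneg hl0.le (sq_nonneg ‖X k‖)]
    calc ‖ρ k‖ * ‖k‖⁻¹ ≤ |C| * (‖k‖ ^ 2)⁻¹ * ‖X k‖ * ‖k‖⁻¹ := by gcongr; exact hC k hk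
      _ = |C| * ((‖k‖ ^ 2)⁻¹ * ‖X k‖ * ‖k‖⁻¹) := by ring
      _ ≤ _ := by gcongr
  · refine (hT.const_mul (|C| ^ 2).toNNReal).mono fun k hk => ?_
    rw [e2, ← ofReal_norm, ← ofReal_pow (norm_nonneg _), ofNNReal_toNNReal,
      ← ofReal_mul (by positivity), ← ofReal_mul (by positivity)]
    refine ofReal_le_ofReal ?_
    have hk0 : 0 < ‖k‖ := by linarith
    calc ‖ρ k‖ ^ 2 ≤ (|C| * (‖k‖ ^ 2)⁻¹ * ‖X k‖) ^ 2 := by gcongr; exact hC k hk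
      _ = |C| ^ 2 * ((‖k‖ ^ 4)⁻¹ * ‖X k‖ ^ 2) := by field_simp
      _ ≤ _ := by
        gcongr
        exact le_self_pow₀ hk (by norm_num)

/-! ### Oscillatory integrals along rays -/

lemma integral_exp_mul_eq {f θ D : ℝ → ℝ} {B : ℝ} (hD : ∀ ρ, HasDerivAt θ (D ρ) ρ)
    (hDc : Continuous D) (hD0 : ∀ ρ, D ρ ≠ 0) {q : ℝ → ℝ}
    (hq : ∀ ρ, HasDerivAt (fun ρ => f ρ / D ρ) (q ρ) ρ) (hqc : Continuous q) (hB : f B = 0) {l : ℝ} (hl : l ≠ 0) :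
    ∫ ρ in (0 : ℝ)..B, (f ρ : ℂ) * exp (I * (l * θ ρ : ℝ)) = I / l * ((f 0 / D 0 : ℝ) * exp (I * (l * θ 0 : ℝ))
        + ∫ ρ in (0 : ℝ)..B, (q ρ : ℂ) * exp (I * (l * θ ρ : ℝ))) := by
  have hθ : Continuous θ := continuous_iff_continuousAt.2 fun ρ => (hD ρ).continuousAt
  have hec : Continuous fun ρ => exp (I * (l * θ ρ : ℝ)) := by fun_prop
  have he : ∀ ρ, HasDerivAt (fun ρ => exp (I * (l * θ ρ : ℝ)))
      (exp (I * (l * θ ρ : ℝ)) * (I * (l * D ρ : ℝ))) ρ := fun ρ =>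
    (((hD ρ).const_mul l).ofReal_comp.const_mul I).cexp
  have h1 := intervalIntegral.integral_mul_deriv_eq_deriv_mul (a := 0) (b := B)
    (u := fun ρ => ((f ρ / D ρ : ℝ) : ℂ)) (fun ρ _ => (hq ρ).ofReal_comp) (fun ρ _ => he ρ)
    ((continuous_ofReal.comp hqc).intervalIntegrable _ _)
    ((hec.mul (by fun_prop : Continuous fun ρ => I * (l * D ρ : ℝ))).intervalIntegrable _ _)
  have h2 : ∀ ρ, ((f ρ / D ρ : ℝ) : ℂ) * (exp (I * (l * θ ρ : ℝ)) * (I * (l * D ρ : ℝ)))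
      = I * l * ((f ρ : ℂ) * exp (I * (l * θ ρ : ℝ))) := by
    intro ρ
    have : (D ρ : ℂ) ≠ 0 := by exact_mod_cast hD0 ρ
    push_cast
    field_simp
  rw [integral_congr fun ρ _ => h2 ρ, intervalIntegral.integral_const_mul, hB] at h1
  have hl' : (l : ℂ) ≠ 0 := by exact_mod_cast hl
  have hI : I / l * (I * l) = -1 := by
    field_simp; exact I_sq
  have h3 := congrArg (fun w => I / l * w) h1
  rw [← mul_assoc, hI] at h3
  simp only [zero_div, ofReal_zero, zero_mul, zero_sub] at h3
  linear_combination -h3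

/-- The amplitude produced by an integration by parts. -/
def ibpStep (D f : ℝ × Space → ℝ) : ℝ × Space → ℝ := pder fun p => f p / D p

lemma contDiffOn_ibpStep (hD : ContDiffOn ℝ ∞ D rayDom)
    (hD0 : ∀ p ∈ rayDom, D p ≠ 0) (hf : ContDiffOn ℝ ∞ f rayDom) :
    ContDiffOn ℝ ∞ (ibpStep D f) rayDom := contDiffOn_pder (hf.div hD hD0)

lemma ibpStep_eq_zero {b : ℝ} (hf : ∀ ρ > b, ∀ w, f (ρ, w) = 0) :
    ∀ ρ > b, ∀ w, ibpStep D f (ρ, w) = 0 := by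
  intro ρ hρ w
  have h1 : (fun p => f p / D p) =ᶠ[𝓝 (ρ, w)] fun _ => 0 := by
    have : {p : ℝ × Space | b < p.1} ∈ 𝓝 (ρ, w) := (isOpen_lt continuous_const continuous_fst).mem_nhds hρ
    filter_upwards [this] with p hp
    rw [show p = (p.1, p.2) from rfl, hf p.1 hp p.2, zero_div]
  rw [ibpStep, pder, h1.fderiv_eq]
  simp

lemma continuous_param (hf : ContDiffOn ℝ ∞ f rayDom) {w : Space} (hw : w ≠ 0) :
    Continuous fun ρ => f (ρ, w) :=
  continuous_iff_continuousAt.2 fun ρ => (hasDerivAt_param hf hw ρ).continuousAt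

lemma exists_ray_expansion {θ : ℝ × Space → ℝ} (hf : ContDiffOn ℝ ∞ f rayDom)
    (hθ : ContDiffOn ℝ ∞ θ rayDom) (hθ0 : ∀ p ∈ rayDom, pder θ p ≠ 0)
    {b : ℝ} (hb : 0 < b) (hfb : ∀ ρ > b, ∀ w, f (ρ, w) = 0) :
    ∃ (g g' : SR) (C : ℝ), Sm₀ g ∧ Sm₀ g' ∧
      ∀ (l : ℝ) (w : Space), 1 ≤ l → ‖w‖ = 1 → ‖(∫ ρ in (0 : ℝ)..(b + 1), (f (ρ, w) : ℂ) * exp (I * (l * θ (ρ, w) : ℝ)))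
          - exp (I * (l * θ (0, w) : ℝ)) * (I * g w / l - g' w / l ^ 2)‖ ≤ C * (l ^ 3)⁻¹ := by
  set D := pder θ with hDdef
  have hD : ContDiffOn ℝ ∞ D rayDom := contDiffOn_pder hθ
  set f₁ := ibpStep D f
  set f₂ := ibpStep D f₁
  set f₃ := ibpStep D f₂
  have hf₁ : ContDiffOn ℝ ∞ f₁ rayDom := contDiffOn_ibpStep hD hθ0 hf
  have hf₂ : ContDiffOn ℝ ∞ f₂ rayDom := contDiffOn_ibpStep hD hθ0 hf₁
  have hf₃ : ContDiffOn ℝ ∞ f₃ rayDom := contDiffOn_ibpStep hD hθ0 hf₂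
  have z₁ : ∀ ρ > b, ∀ w, f₁ (ρ, w) = 0 := ibpStep_eq_zero hfb
  have z₂ : ∀ ρ > b, ∀ w, f₂ (ρ, w) = 0 := ibpStep_eq_zero z₁
  obtain ⟨C₂, hC₂, hb₂⟩ := exists_bound_on_rays (hf₂.div hD hθ0).continuousOn (b + 1)
  obtain ⟨C₃, hC₃, hb₃⟩ := exists_bound_on_rays hf₃.continuousOn (b + 1)
  have hray : Sm₀ (fun w : Space => ((0 : ℝ), w)) := contDiffOn_const.prodMk contDiffOn_id
  have hs : ∀ {h : ℝ × Space → ℝ}, ContDiffOn ℝ ∞ h rayDom →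
      Sm₀ (fun w => h (0, w) / D (0, w)) := fun hh =>
    ((hh.div hD hθ0).comp hray fun w hw => hw)
  refine ⟨fun w => f (0, w) / D (0, w), fun w => f₁ (0, w) / D (0, w), C₂ + C₃ * (b + 1), hs hf, hs hf₁,
    fun l w hl hw => ?_⟩
  have hw0 : w ≠ 0 := norm_ne_zero_iff.1 (by rw [hw]; exact one_ne_zero)
  have hl0 : 0 < l := by linarith
  have step : ∀ {h : ℝ × Space → ℝ}, ContDiffOn ℝ ∞ h rayDom → (∀ ρ > b, ∀ w, h (ρ, w) = 0) →
      ∫ ρ in (0 : ℝ)..(b + 1), (h (ρ, w) : ℂ) * exp (I * (l * θ (ρ, w) : ℝ))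
      = I / l * ((h (0, w) / D (0, w) : ℝ) * exp (I * (l * θ (0, w) : ℝ))
        + ∫ ρ in (0 : ℝ)..(b + 1), (ibpStep D h (ρ, w) : ℂ) * exp (I * (l * θ (ρ, w) : ℝ))) := by
    intro h hh hh0
    exact integral_exp_mul_eq (f := fun ρ => h (ρ, w)) (θ := fun ρ => θ (ρ, w)) (D := fun ρ => D (ρ, w))
      (fun ρ => hasDerivAt_param hθ hw0 ρ) (continuous_param hD hw0) (fun ρ => hθ0 (ρ, w) hw0)
      (fun ρ => hasDerivAt_param (hh.div hD hθ0) hw0 ρ)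
      (continuous_param (contDiffOn_ibpStep hD hθ0 hh) hw0) (hh0 _ (by linarith) w) hl0.ne'
  rw [step hf hfb, step hf₁ z₁, step hf₂ z₂]
  set e := exp (I * (l * θ (0, w) : ℝ)) with he
  set J := ∫ ρ in (0 : ℝ)..(b + 1), (ibpStep D f₂ (ρ, w) : ℂ) * exp (I * (l * θ (ρ, w) : ℝ))
  have hne : ∀ x : ℝ, ‖exp (I * (x : ℂ))‖ = 1 := fun x => by
    rw [mul_comm]; exact norm_exp_ofReal_mul_I x
  have hJ : ‖J‖ ≤ C₃ * (b + 1) := by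
    have := intervalIntegral.norm_integral_le_of_norm_le_const (a := 0) (b := b + 1) (C := C₃)
      (f := fun ρ => (ibpStep D f₂ (ρ, w) : ℂ) * exp (I * (l * θ (ρ, w) : ℝ))) (fun ρ hρ => by
        rw [Set.uIoc_of_le (by linarith)] at hρ
        rw [norm_mul, hne, mul_one, norm_real]
        exact hb₃ ρ ⟨hρ.1.le, hρ.2⟩ w hw)
    rwa [sub_zero, abs_of_pos (by linarith)] at this
  have hlc : (l : ℂ) ≠ 0 := by exact_mod_cast hl0.ne'
  have hI3 : I ^ 3 = -I := by rw [pow_succ, I_sq]; ring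
  have key : I / l * ((f (0, w) / D (0, w) : ℝ) * e + I / l * ((f₁ (0, w) / D (0, w) : ℝ) * e
        + I / l * ((f₂ (0, w) / D (0, w) : ℝ) * e + J)))
      - e * (I * (f (0, w) / D (0, w) : ℝ) / l - (f₁ (0, w) / D (0, w) : ℝ) / l ^ 2)
      = -I / l ^ 3 * ((f₂ (0, w) / D (0, w) : ℝ) * e + J) := by
    have hI2 := I_sq
    field_simp
    linear_combination (e * (l : ℂ) * ((f₁ (0, w) / D (0, w) : ℝ) : ℂ)
      + I * (e * ((f₂ (0, w) / D (0, w) : ℝ) : ℂ) + J)) * hI2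
  rw [key, norm_mul, norm_div, norm_neg, norm_I, norm_pow, Complex.norm_of_nonneg hl0.le, one_div, mul_comm]
  gcongr
  refine (norm_add_le _ _).trans (add_le_add ?_ hJ)
  rw [norm_mul, he, hne, mul_one, norm_real]
  exact hb₂ 0 ⟨le_rfl, by linarith⟩ w hw

end

section

variable {F : ℝ → ℝ} {t : ℝ}

/-! ### The transform of a retarded field -/

lemma restrict_compl_singleton (a : Space) : (vol).restrict {a}ᶜ = volume :=
  Measure.restrict_eq_self_of_ae_mem (by simp [ae_iff])

namespace WorldLine

variable {z : ℝ → Space}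

lemma image_lagMap (hz : WorldLine z) (t : ℝ) : lagMap z t '' {0}ᶜ = {z t}ᶜ := by
  ext x
  constructor
  · rintro ⟨y, hy, rfl⟩
    exact hz.lagMap_ne t hy
  · intro hx
    obtain ⟨y, rfl⟩ := hz.exists_lagMap_eq t x
    exact ⟨y, fun h => hx (by rw [Set.mem_singleton_iff.1 h, lagMap_zero]; rfl), rfl⟩

lemma det_fderiv_lagMap (z : ℝ → Space) (t : ℝ) (y : Space) :
    (ContinuousLinearMap.id ℝ Space + (-(‖y‖⁻¹ • innerSL ℝ y)).smulRight (deriv z (t - ‖y‖))).det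
      = 1 - ‖y‖⁻¹ * ⟪y,deriv z (t - ‖y‖)⟫ := by
  have h1 : ((ContinuousLinearMap.id ℝ Space
      + (-(‖y‖⁻¹ • innerSL ℝ y)).smulRight (deriv z (t - ‖y‖)) : Space →L[ℝ] Space) : Space →ₗ[ℝ] Space)
      = LinearMap.transvection (-(‖y‖⁻¹ • innerSL ℝ y) : Space →L[ℝ] ℝ).toLinearMap (deriv z (t - ‖y‖)) := by
    ext m
    simp [LinearMap.transvection]
  rw [ContinuousLinearMap.det, h1, LinearMap.transvection.det]
  simp [sub_eq_add_neg]

lemma lag_weight (hz : WorldLine z) (F : ℝ → ℝ) (t : ℝ) {y : Space} (hy : y ≠ 0) :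
    |(ContinuousLinearMap.id ℝ Space + (-(‖y‖⁻¹ • innerSL ℝ y)).smulRight (deriv z (t - ‖y‖))).det|
      * lw z F (t, lagMap z t y) = F (t - ‖y‖) / ‖y‖ := by
  have hy0 := norm_pos_iff.2 hy
  have h1 := hz.inner_lt hy (t - ‖y‖)
  have h2 : 1 - ‖y‖⁻¹ * ⟪y,deriv z (t - ‖y‖)⟫ = (‖y‖ - ⟪y,deriv z (t - ‖y‖)⟫) / ‖y‖ := by
    field_simp
  have h3 : 0 < ‖y‖ - ⟪y,deriv z (t - ‖y‖)⟫ := sub_pos.2 h1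
  rw [det_fderiv_lagMap, h2, abs_of_pos (by positivity), hz.lw_lagMap]
  field_simp

lemma integral_lw_smul (hz : WorldLine z) (F : ℝ → ℝ) (t : ℝ) (h : SC) :
    ∫ x, lw z F (t, x) • h x = ∫ y, (F (t - ‖y‖) / ‖y‖) • h (lagMap z t y) := by
  have h1 := integral_image_eq_integral_abs_det_fderiv_smul vol
    (measurableSet_singleton (0 : Space)).compl
    (fun y hy => (hz.hasFDerivAt_lagMap t (y := y) hy).hasFDerivWithinAt) (hz.lagMap_injective t).injOn
    fun x => lw z F (t, x) • h x
  rw [hz.image_lagMap, restrict_compl_singleton] at h1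
  have h2 : ∫ y, (F (t - ‖y‖) / ‖y‖) • h (lagMap z t y)
      = ∫ y in {0}ᶜ, (F (t - ‖y‖) / ‖y‖) • h (lagMap z t y) := by rw [restrict_compl_singleton]
  rw [h1, h2]
  refine setIntegral_congr_fun (measurableSet_singleton (0 : Space)).compl fun y hy => ?_
  beta_reduce
  rw [smul_smul, hz.lag_weight F t hy]

lemma integrable_div_norm_of_lag (hF : Continuous F) (hF0 : ∀ s < t - 2, F s = 0) :
    Integrable fun y : Space => F (t - ‖y‖) / ‖y‖ := by
  obtain ⟨C, hC⟩ := (isCompact_Icc (a := t - 2) (b := t)).exists_bound_of_continuousOn hF.continuousOn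
  refine (integrable_env.const_mul (|C| * 10)).mono'
    (by exact (Measurable.div (by fun_prop) measurable_norm).aestronglyMeasurable) (ae_of_all _ fun y => ?_)
  by_cases hy : ‖y‖ ≤ 2
  · rcases eq_or_ne y 0 with rfl | hy0
    · simp [env]
    have hp := norm_pos_iff.2 hy0
    have h2 := (hC (t - ‖y‖) ⟨by linarith, by linarith⟩).trans (le_abs_self C)
    rw [norm_div, norm_norm, env, ← div_eq_mul_inv, div_le_div_iff₀ hp (by positivity)]
    calc ‖F (t - ‖y‖)‖ * (‖y‖ ^ 2 * (1 + ‖y‖ ^ 2)) ≤ |C| * (2 * ‖y‖ * (1 + 2 ^ 2)) := by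
          gcongr
          nlinarith
      _ = |C| * 10 * ‖y‖ := by ring
  · rw [hF0 _ (by linarith [not_le.1 hy])]
    simp only [zero_div, norm_zero]
    have := env_nonneg y
    positivity

lemma integrable_lw (hz : WorldLine z) (hF : Continuous F)
    (hF0 : ∀ s < t - 2, F s = 0) : Integrable fun x => lw z F (t, x) := by
  have h1 := integrableOn_image_iff_integrableOn_abs_det_fderiv_smul vol
    (measurableSet_singleton (0 : Space)).compl
    (fun y hy => (hz.hasFDerivAt_lagMap t (y := y) hy).hasFDerivWithinAt) (hz.lagMap_injective t).injOn
    fun x => lw z F (t, x)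
  rw [hz.image_lagMap, IntegrableOn, restrict_compl_singleton] at h1
  refine h1.2 ((integrable_div_norm_of_lag hF hF0).integrableOn.congr_fun (fun y hy => ?_)
    (measurableSet_singleton (0 : Space)).compl)
  rw [smul_eq_mul, hz.lag_weight F t hy]

lemma norm_mul_fint_lw (hz : WorldLine z) (hF : C∞ F)
    (hF0 : ∀ s < t - 2, F s = 0) (k : Space) :
    (‖k‖ : ℂ) * fint (fun x => (lw z F (t, x) : ℂ)) (-k)
      = σ.real Set.univ * ∫ ρ in (0 : ℝ)..3,
        (F (t - ρ) : ℂ) * exp (-(I * ⟪k,z (t - ρ)⟫)) * sin (ρ * ‖k‖) := by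
  have hexp : ∀ x : ℝ, ‖exp (I * (x : ℂ))‖ = 1 := fun x => by
    rw [mul_comm]; exact norm_exp_ofReal_mul_I x
  let G : SC := fun y => (F (t - ‖y‖) / ‖y‖) • exp (I * ⟪-k,lagMap z t y⟫)
  have h1 : fint (fun x => (lw z F (t, x) : ℂ)) (-k) = ∫ y, G y := by
    rw [fint, ← hz.integral_lw_smul F t fun x => exp (I * ⟪-k,x⟫)]
    congr 1; ext x
    rw [real_smul, mul_comm]
  have hzc := hz.smooth.continuous
  have hG : Integrable G := by
    have h3 := integrable_div_norm_of_lag hF.continuous hF0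
    refine h3.mono ?_ (ae_of_all _ fun y => ?_)
    · refine h3.1.smul (Continuous.aestronglyMeasurable ?_)
      unfold lagMap
      fun_prop
    · rw [norm_smul, hexp, mul_one]
  have h4 : ∀ ρ ∈ Ioi (0 : ℝ), (‖k‖ : ℂ) * (ρ ^ 2 • ∫ w, G (ρ • w) ∂σ)
      = σ.real Set.univ * ((F (t - ρ) : ℂ) * exp (-(I * ⟪k,z (t - ρ)⟫)) * sin (ρ * ‖k‖)) := by
    intro ρ hρ
    have hρ0 : (0 : ℝ) < ρ := hρ
    have h5 : ∫ w, G (ρ • w) ∂σ = ∫ w, (F (t - ρ) / ρ : ℂ) * exp (-(I * ⟪k,z (t - ρ)⟫))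
          * ((1 : ℂ) * phase (-k) ρ w) ∂σ := by
      refine integral_congr_ae ?_
      filter_upwards [ae_σ] with w hw
      simp only [G, norm_smul, norm_of_nonneg hρ0.le, hw, mul_one, lagMap, phase, real_smul, one_mul]
      rw [mul_assoc, ← exp_add, inner_add_right, inner_smul_right, inner_neg_left, inner_neg_left,
        inner_neg_right, real_inner_comm w k]
      push_cast
      congr 2
      ring
    have h6 := osc_one (-k) ρ
    rw [norm_neg, osc] at h6
    rw [h5, integral_const_mul, real_smul]
    have hρc : (ρ : ℂ) ≠ 0 := by exact_mod_cast hρ0.ne'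
    have h7 : (ρ : ℂ) ^ 2 * (F (t - ρ) / ρ) = ρ * F (t - ρ) := by field_simp
    push_cast
    linear_combination (F (t - ρ) : ℂ) * exp (-(I * ⟪k,z (t - ρ)⟫)) * h6
      + (‖k‖ : ℂ) * exp (-(I * ⟪k,z (t - ρ)⟫)) * (∫ w, (1 : ℂ) * phase (-k) ρ w ∂σ) * h7
  rw [h1, integral_polar hG, ← integral_const_mul, setIntegral_congr_fun measurableSet_Ioi h4, integral_const_mul,
    integral_of_le (by norm_num)]
  congr 1
  refine (setIntegral_eq_of_subset_of_forall_sdiff_eq_zero measurableSet_Ioi Set.Ioc_subset_Ioi_self fun ρ hρ => ?_)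
  have : 3 < ρ := by
    by_contra! h
    exact hρ.2 ⟨hρ.1, h⟩
  rw [hF0 _ (by linarith)]
  simp

lemma hasKExpansion_lw (hz : WorldLine z) (hF : C∞ F)
    (hF0 : ∀ s < t - 2, F s = 0) {N : ℕ} {zs : Fin N → Space} (n : Fin N) (hn : zs n = z t) :
    KExp zs fun k => (‖k‖ : ℂ) * fint (fun x => (lw z F (t, x) : ℂ)) (-k) := by
  set M := σ.real Set.univ with hM
  let f : ℝ × Space → ℝ := fun p => F (t - p.1)
  have hrev : C∞ fun p : ℝ × Space => t - p.1 := contDiff_const.sub contDiff_fst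
  have hf : ContDiffOn ℝ ∞ f rayDom := (hF.comp hrev).contDiffOn
  let θ : ℝ → ℝ × Space → ℝ := fun ε p => ε * p.1 - ⟪khat p.2,z (t - p.1)⟫
  have hθ : ∀ ε, ContDiffOn ℝ ∞ (θ ε) rayDom := fun ε =>
    (contDiff_const.mul contDiff_fst).contDiffOn.sub
      ((contDiffOn_rayDom_snd contDiffOn_khat).inner ℝ (hz.smooth.comp hrev).contDiffOn)
  have hθ0 : ∀ ε : ℝ, |ε| = 1 → ∀ p ∈ rayDom, pder (θ ε) p ≠ 0 := by
    rintro ε hε ⟨ρ, w⟩ hw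
    have h1 : HasDerivAt (fun ρ => z (t - ρ)) (-deriv z (t - ρ)) ρ := by
      simpa [comp_def] using (hz.hasDerivAt (t - ρ)).scomp ρ ((hasDerivAt_id ρ).const_sub t)
    have h2 : HasDerivAt (fun ρ => θ ε (ρ, w)) _ ρ :=
      ((hasDerivAt_id ρ).const_mul ε).sub ((hasDerivAt_const ρ (khat w)).inner ℝ h1)
    rw [(hasDerivAt_param (hθ ε) hw ρ).unique h2]
    have h3 : |⟪khat w,deriv z (t - ρ)⟫| < 1 := by
      refine (abs_real_inner_le_norm _ _).trans_lt ?_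
      rw [norm_khat hw, one_mul]
      exact hz.subluminal _
    intro h
    simp only [mul_one, inner_neg_right, inner_zero_left, add_zero, sub_neg_eq_add] at h
    rw [eq_neg_of_add_eq_zero_left h, abs_neg] at hε
    exact h3.ne hε
  have hfb : ∀ ρ > (2 : ℝ), ∀ w, f (ρ, w) = 0 := fun ρ hρ w => hF0 _ (by linarith)
  obtain ⟨g₁, g₁', C₁, s₁, s₁', h₁⟩ := exists_ray_expansion hf (hθ 1) (hθ0 1 (by simp)) two_pos hfb
  obtain ⟨g₂, g₂', C₂, s₂, s₂', h₂⟩ := exists_ray_expansion hf (hθ (-1)) (hθ0 (-1) (by simp)) two_pos hfb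
  norm_num only at h₁ h₂
  have hcont : Continuous fun k => fint (fun x => (lw z F (t, x) : ℂ)) (-k) := by
    have hi : Integrable fun x => (lw z F (t, x) : ℂ) :=
      (hz.integrable_lw hF.continuous hF0).ofReal
    unfold fint
    refine continuous_of_dominated (bound := fun x => ‖(lw z F (t, x) : ℂ)‖) (fun k => ?_)
      (fun k => ae_of_all _ fun x => ?_) hi.norm (ae_of_all _ fun x => by fun_prop)
    · exact ((by fun_prop : Continuous fun x : Space =>
        exp (I * ⟪-k,x⟫)).aestronglyMeasurable).mul hi.1
    · rw [norm_mul, mul_comm I, norm_exp_ofReal_mul_I, one_mul]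
  classical
  refine ⟨((continuous_ofReal.comp continuous_norm).mul hcont).aestronglyMeasurable,
    fun m w => if m = n then M / 2 * (g₁ w - g₂ w) else 0, fun m w => if m = n then M / 2 * (g₁' w - g₂' w) else 0,
    fun m => ?_, fun m => ?_, isRemainder_of_inv_cube (C := M / 2 * (C₁ + C₂)) fun k hk => ?_⟩
  · by_cases h : m = n
    · simpa only [h, if_true] using contDiffOn_const.mul (s₁.sub s₂)
    · simpa only [h, if_false] using contDiffOn_const
  · by_cases h : m = n
    · simpa only [h, if_true] using contDiffOn_const.mul (s₁'.sub s₂')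
    · simpa only [h, if_false] using contDiffOn_const
  have hk0 : 0 < ‖k‖ := by linarith
  have hkne : k ≠ 0 := norm_pos_iff.1 hk0
  set w := khat k with hw
  have hw1 : ‖w‖ = 1 := norm_khat hkne
  have hkw : k = ‖k‖ • w := by rw [hw, khat, smul_smul, mul_inv_cancel₀ hk0.ne', one_smul]
  have hww : khat w = w := by rw [khat, hw1, inv_one, one_smul]
  have e0 : ∀ ε, exp (I * (‖k‖ * θ ε (0, w) : ℝ)) = phase (-zs n) 1 k := by
    intro ε
    rw [phase, hn]
    conv_rhs => rw [hkw]
    simp only [θ, hww, mul_zero, zero_sub, sub_zero, inner_neg_right, real_inner_smul_left, one_mul, mul_neg]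
  have hM0 : 0 ≤ M := measureReal_nonneg
  have b₁ := h₁ ‖k‖ w hk hw1
  have b₂ := h₂ ‖k‖ w hk hw1
  rw [e0] at b₁ b₂
  set J₁ := ∫ ρ in (0 : ℝ)..3, (f (ρ, w) : ℂ) * exp (I * (‖k‖ * θ 1 (ρ, w) : ℝ)) with hJ₁
  set J₂ := ∫ ρ in (0 : ℝ)..3, (f (ρ, w) : ℂ) * exp (I * (‖k‖ * θ (-1) (ρ, w) : ℝ)) with hJ₂
  have hzc := hz.smooth.continuous
  have hFc := hF.continuous
  have hJc : ∀ ε, Continuous fun ρ : ℝ => (f (ρ, w) : ℂ) * exp (I * (‖k‖ * θ ε (ρ, w) : ℝ)) := by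
    intro ε
    simp only [f, θ]
    fun_prop
  have hmain : (‖k‖ : ℂ) * fint (fun x => (lw z F (t, x) : ℂ)) (-k) = M * (-I / 2 * (J₁ - J₂)) := by
    rw [hz.norm_mul_fint_lw hF hF0, ← hM, hJ₁, hJ₂, ← intervalIntegral.integral_sub
      ((hJc 1).intervalIntegrable _ _) ((hJc (-1)).intervalIntegrable _ _)]
    congr 1
    rw [← intervalIntegral.integral_const_mul]
    refine integral_congr fun ρ _ => ?_
    have e1 : ⟪k,z (t - ρ)⟫ = ‖k‖ * ⟪w,z (t - ρ)⟫ := by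
      conv_lhs => rw [hkw]
      exact real_inner_smul_left _ _ _
    have e2 : ∀ ε : ℝ, exp (I * (‖k‖ * θ ε (ρ, w) : ℝ))
        = exp (-(I * ⟪k,z (t - ρ)⟫)) * exp ((ε : ℂ) * (ρ * ‖k‖ : ℂ) * I) := by
      intro ε
      rw [← exp_add, e1]
      simp only [θ, hww]
      push_cast
      congr 1
      ring
    simp only [e2, f, sin]
    push_cast
    rw [show -(1 : ℂ) * (ρ * ‖k‖) * I = -((ρ : ℂ) * ‖k‖) * I by ring, one_mul]
    ring
  beta_reduce
  rw [hmain]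
  have hmt : lead zs (fun m w => if m = n then M / 2 * (g₁ w - g₂ w) else 0)
      (fun m w => if m = n then M / 2 * (g₁' w - g₂' w) else 0) k
      = M * (-I / 2 * (phase (-zs n) 1 k * (I * g₁ w / ‖k‖ - g₁' w / (‖k‖ : ℂ) ^ 2)
        - phase (-zs n) 1 k * (I * g₂ w / ‖k‖ - g₂' w / (‖k‖ : ℂ) ^ 2))) := by
    rw [lead, Finset.sum_eq_single n (fun m _ hm => by simp [hm]) (by simp)]
    simp only [if_true, ← hw]
    push_cast
    have hI2 := I_sq
    linear_combination (M : ℂ) / 2 * phase (-zs n) 1 k * (g₁ w - g₂ w) / ‖k‖ * hI2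
  rw [hmt, ← mul_sub, ← mul_sub, norm_mul, norm_mul, Complex.norm_of_nonneg hM0, norm_div, norm_neg, norm_I]
  rw [show J₁ - J₂ - (phase (-zs n) 1 k * (I * g₁ w / ‖k‖ - g₁' w / (‖k‖ : ℂ) ^ 2)
        - phase (-zs n) 1 k * (I * g₂ w / ‖k‖ - g₂' w / (‖k‖ : ℂ) ^ 2))
      = (J₁ - phase (-zs n) 1 k * (I * g₁ w / ‖k‖ - g₁' w / (‖k‖ : ℂ) ^ 2))
        - (J₂ - phase (-zs n) 1 k * (I * g₂ w / ‖k‖ - g₂' w / (‖k‖ : ℂ) ^ 2)) by ring]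
  have h5 := (norm_sub_le (J₁ - phase (-zs n) 1 k * (I * g₁ w / ‖k‖ - g₁' w / (‖k‖ : ℂ) ^ 2))
    (J₂ - phase (-zs n) 1 k * (I * g₂ w / ‖k‖ - g₂' w / (‖k‖ : ℂ) ^ 2))).trans (add_le_add b₁ b₂)
  rw [← mul_assoc, mul_assoc (M / 2)]
  rw [show M * (1 / ‖(2 : ℂ)‖) = M / 2 by simp; ring, add_mul]
  gcongr

end WorldLine

end

section

section Pairs

variable {N : ℕ} {z : Fin N → Space}
variable {g h : SC} {b : ℂ} {G K G' K' : SR}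

/-! ### Quadratic expressions in the fields and in their transforms -/

lemma HasRIntegralK.add {c : ℂ} (hg : HasRIntegralK g b) (hh : HasRIntegralK h c) :
    HasRIntegralK (fun k => g k + h k) (b + c) := by
  refine ⟨fun L hL => (hg.1 L hL).add (hh.1 L hL), (hg.2.add hh.2).congr ?_⟩
  filter_upwards [eventually_gt_atTop 0] with L hL
  exact (integral_add (hg.1 L hL) (hh.1 L hL)).symm

lemma HasRIntegralK.const_mul (hg : HasRIntegralK g b) (c : ℂ) :
    HasRIntegralK (fun k => c * g k) (c * b) := by
  refine ⟨fun L hL => (hg.1 L hL).const_mul c, (hg.2.const_mul c).congr ?_⟩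
  filter_upwards with L
  exact (integral_const_mul _ _).symm

lemma HasRIntegralK.congr_ae (hg : HasRIntegralK g b) (e : g =ᵐ[volume] h) :
    HasRIntegralK h b := by
  refine ⟨fun L hL => (hg.1 L hL).congr (ae_restrict_of_ae e), hg.2.congr ?_⟩
  filter_upwards with L
  exact integral_congr_ae (ae_restrict_of_ae e)

lemma HasRIntegralK.of_symm (hi : ∀ L > 0, IntegrableOn g (ball 0 L))
    (h : HasRIntegralK (fun k => 1 / 2 * (g k + g (-k))) b) : HasRIntegralK g b := by
  refine ⟨hi, h.2.congr ?_⟩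
  filter_upwards [eventually_gt_atTop 0] with L hL
  have hind : ∀ k, (ball (0 : Space) L).indicator g (-k) = (ball (0 : Space) L).indicator (fun k => g (-k)) k := by
    intro k
    by_cases hk : k ∈ ball (0 : Space) L
    · rw [indicator_of_mem hk, indicator_of_mem (by simpa using hk)]
    · rw [indicator_of_notMem hk, indicator_of_notMem (by simpa using hk)]
  have h1 : IntegrableOn (fun k => g (-k)) (ball 0 L) := by
    have : Integrable fun k => (ball (0 : Space) L).indicator g (-k) :=
      ((integrable_indicator_iff isOpen_ball.measurableSet).2 (hi L hL)).comp_neg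
    rw [funext hind] at this
    exact (integrable_indicator_iff isOpen_ball.measurableSet).1 this
  have h2 : ∫ k in ball (0 : Space) L, g (-k) = ∫ k in ball (0 : Space) L, g k := by
    rw [← integral_indicator isOpen_ball.measurableSet, ← integral_indicator isOpen_ball.measurableSet,
      ← integral_neg_eq_self ((ball (0 : Space) L).indicator g), funext hind]
  rw [integral_const_mul, integral_add (hi L hL) h1, h2]
  ring

/-- A space density `G` and a wave-vector density `K` with the same finite integral. -/
def Paired (z : Fin N → Space) (G K : SR) : Prop :=
  ∃ d : ℝ, HasRIntegral z G d ∧ HasRIntegralK (fun k => (K k : ℂ)) ((2 * π : ℂ) ^ 3 * d)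

lemma Paired.add (h : Paired z G K) (h' : Paired z G' K') :
    Paired z (fun x => G x + G' x) fun k => K k + K' k := by
  obtain ⟨d, h1, h2⟩ := h
  obtain ⟨d', h1', h2'⟩ := h'
  refine ⟨d + d', h1.add h1', ?_⟩
  have := h2.add h2'
  push_cast
  rwa [mul_add]

lemma Paired.const_mul (h : Paired z G K) (c : ℝ) :
    Paired z (fun x => c * G x) fun k => c * K k := by
  obtain ⟨d, h1, h2⟩ := h
  refine ⟨c * d, h1.const_mul c, ?_⟩
  have := h2.const_mul c
  push_cast
  rwa [mul_left_comm]

lemma Paired.congr (h : Paired z G K) (hG : G = G') (hK : K =ᵐ[volume] K') :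
    Paired z G' K' := by
  obtain ⟨d, h1, h2⟩ := h
  exact ⟨d, hG ▸ h1, h2.congr_ae (hK.mono fun k hk => by beta_reduce; rw [hk])⟩

lemma Paired.sum {ι : Type*} [Fintype ι] {G K : ι → SR} (h : ∀ i, Paired z (G i) (K i)) :
    Paired z (fun x => ∑ i, G i x) fun k => ∑ i, K i k := by
  choose d h1 h2 using h
  refine ⟨∑ i, d i, HasRIntegral.sum fun i _ => h1 i, ?_⟩
  push_cast
  rw [mul_sum]
  refine ⟨fun L hL => integrable_finsetSum _ fun i _ => (h2 i).1 L hL, (HasRLimTop.sum _ fun i _ => (h2 i).2).congr ?_⟩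
  filter_upwards [eventually_gt_atTop 0] with L hL
  exact (integral_finsetSum _ fun i _ => (h2 i).1 L hL).symm

/-- A field singular at the points `z n` and its transform `u`. -/
structure FieldFT (z : Fin N → Space) (f : SR) (u : SC) : Prop where
  expansion : SingExp z f
  weakFT : WeakFT (fun x => (f x : ℂ)) u
  kExpansion : KExp z fun k => -I * u k
  locSq : ∀ L > 0, IntegrableOn (fun k => ‖u k‖ ^ 2) (ball 0 L)

lemma integrableOn_sq_add {u v : SC} {s : Set Space} (hu : AEStronglyMeasurable u volume)
    (hv : AEStronglyMeasurable v volume) (h : IntegrableOn (fun k => ‖u k‖ ^ 2) s)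
    (h' : IntegrableOn (fun k => ‖v k‖ ^ 2) s) : IntegrableOn (fun k => ‖u k + v k‖ ^ 2) s := by
  have h1 : Integrable (fun k => 2 * (‖u k‖ ^ 2 + ‖v k‖ ^ 2)) (volume.restrict s) := (h.add h').const_mul 2
  refine h1.mono' (((hu.add hv).norm.pow 2).restrict) (ae_of_all _ fun k => ?_)
  rw [norm_of_nonneg (by positivity)]
  have := norm_add_le (u k) (v k)
  nlinarith [sq_nonneg (‖u k‖ - ‖v k‖), norm_nonneg (u k + v k)]

namespace FieldFT

variable {f g : SR} {u v : SC}

lemma add (hf : FieldFT z f u) (hg : FieldFT z g v) :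
    FieldFT z (fun x => f x + g x) fun k => u k + v k where
  expansion := hf.expansion.add hg.expansion
  weakFT := by push_cast; exact hf.weakFT.add hg.weakFT
  kExpansion := by
    have := hf.kExpansion.add hg.kExpansion
    simpa only [mul_add] using this
  locSq L hL := integrableOn_sq_add hf.weakFT.2.1.1 hg.weakFT.2.1.1 (hf.locSq L hL) (hg.locSq L hL)

lemma const_mul (hf : FieldFT z f u) (c : ℝ) :
    FieldFT z (fun x => c * f x) fun k => (c : ℂ) * u k where
  expansion := hf.expansion.const_mul c
  weakFT := by push_cast; exact hf.weakFT.const_mul c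
  kExpansion := by
    have := hf.kExpansion.const_mul c
    simpa only [mul_left_comm] using this
  locSq L hL := by
    simp only [norm_mul, mul_pow]
    exact (hf.locSq L hL).const_mul _

lemma congr {f' : SR} {u' : SC} (hf : FieldFT z f u) (h : f =ᵐ[volume] f')
    (hu : u =ᵐ[volume] u') : FieldFT z f' u' where
  expansion := hf.expansion.congr_ae h
  weakFT := hf.weakFT.congr (h.mono fun x hx => by beta_reduce; rw [hx]) hu
  kExpansion := hf.kExpansion.congr_ae (hu.mono fun k hk => by beta_reduce; rw [hk])
  locSq L hL := (hf.locSq L hL).congr (ae_restrict_of_ae (hu.mono fun k hk => by beta_reduce; rw [hk]))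

lemma sum {ι : Type*} {s : Finset ι} {f : ι → SR} {u : ι → SC}
    (h : ∀ i ∈ s, FieldFT z (f i) (u i)) :
    FieldFT z (fun x => ∑ i ∈ s, f i x) fun k => ∑ i ∈ s, u i k := by
  classical
  induction s using induction_on with
  | empty =>
    simp only [sum_empty]
    refine ⟨SingExp.sum (S := (∅ : Finset ι)) (f := f) (by simp), by simpa using weakFT_zero,
      by simpa using hasKExpansion_zero z, fun L hL => by simp⟩
  | insert i s hi ih =>
    simp only [sum_insert hi]
    exact (h i (by simp)).add (ih fun j hj => h j (by simp [hj]))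

lemma sq (hz : Injective z) (hf : FieldFT z f u) : Paired z (fun x => f x ^ 2) fun k => ‖u k‖ ^ 2 := by
  obtain ⟨b, hb⟩ := hf.kExpansion.exists_normSq hz (by simpa using hf.locSq)
  simp only [norm_mul, norm_neg, norm_I, one_mul] at hb
  obtain ⟨d, hd, rfl⟩ := hf.expansion.parseval hz hf.weakFT hb
  exact ⟨d, hd, hb⟩

lemma mul (hz : Injective z) (hf : FieldFT z f u) (hg : FieldFT z g v) :
    Paired z (fun x => f x * g x) fun k => (u k * star (v k)).re := by
  refine ((((hf.add hg).sq hz).const_mul (1 / 4)).add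
    (((hf.add (hg.const_mul (-1))).sq hz).const_mul (-1 / 4))).congr (by funext x; ring) (ae_of_all _ fun k => ?_)
  simp only [← Complex.normSq_eq_norm_sq, normSq_apply, star_def, mul_re, add_re,
    add_im, conj_re, conj_im, ofReal_neg, ofReal_one, neg_mul, one_mul,
    neg_re, neg_im]
  ring

end FieldFT

end Pairs

/-! ### Fourier amplitudes -/

lemma Tempered.star_neg {b : SC} (hb : Tempered b) : Tempered fun k => star (b (-k)) := by
  obtain ⟨hm, m, hi⟩ := hb
  refine ⟨(hm.comp_measurePreserving (Measure.measurePreserving_neg volume)).star, m, ?_⟩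
  have := hi.comp_neg
  simpa using this

lemma integral_amplitude {b : SC} (hb : Tempered b) (φ : SchwartzMap Space ℂ) (c : ℂ) :
    ∫ k, (b k * fint φ k + c * star (b k) * fint φ (-k))
      = ∫ k, (b k + c * star (b (-k))) * fint φ k := by
  have h1 := hb.integrable_mul_fint φ
  have h2 := (hb.star_neg.const_mul c).integrable_mul_fint φ
  have h3 : Integrable fun k => c * star (b k) * fint φ (-k) := by simpa using h2.comp_neg
  rw [integral_add h1 h3, ← integral_neg_eq_self fun k => c * star (b k) * fint φ (-k)]
  simp only [neg_neg, add_mul]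
  rw [integral_add h1 h2]

/-- The transform at time `t` of a potential of amplitude `a`. -/
def potFT (a : SC) (k : Space) : ℂ := (a k + star (a (-k))) / (2 * ‖k‖)

/-- The transform at time `t` of the time derivative of a potential of amplitude `a`. -/
def velFT (a : SC) (k : Space) : ℂ := -(I / 2) * (a k - star (a (-k)))

lemma isTempered_div_norm {a : SC} (hm : AEStronglyMeasurable a volume)
    (ht : ∃ m : ℕ, Integrable (fun k => ‖a k‖ / (‖k‖ * (1 + ‖k‖) ^ m))) :
    Tempered (fun k => a k / ‖k‖) ∧ Tempered a := by
  obtain ⟨m, hi⟩ := ht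
  have h1 : Tempered fun k => a k / ‖k‖ := by
    refine ⟨?_, m, by simpa [div_div] using hi⟩
    simp only [div_eq_mul_inv]
    exact hm.mul (Measurable.aestronglyMeasurable (by fun_prop))
  refine ⟨h1, h1.of_le hm (C := 1) (j := 1) ?_⟩
  filter_upwards [ae_ne 0] with k hk
  have h0 := norm_pos_iff.2 hk
  rw [norm_div, norm_real, norm_norm, one_mul, pow_one, mul_div_assoc', le_div_iff₀ h0]
  nlinarith [norm_nonneg (a k)]

lemma fint_neg (φ : SC) (k : Space) : ∫ x, exp (-(I * ⟪k,x⟫)) * φ x = fint φ (-k) := by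
  simp only [fint, inner_neg_left, ofReal_neg, mul_neg]

namespace ChargeSystem

variable {N : ℕ} {S : ChargeSystem N} {t : ℝ} {a : Space → Fin 4 → ℂ}

lemma IsFourierAmplitude.isTempered (ha : S.IsFourierAmplitude t a) (μ : Fin 4) :
    Tempered (fun k => a k μ / ‖k‖) ∧ Tempered fun k => a k μ :=
  isTempered_div_norm (ha.measurable μ) (ha.tempered.imp fun _ h => h μ)

lemma IsFourierAmplitude.weakFT_potential (ha : S.IsFourierAmplitude t a) {μ : Fin 4}
    (hA : Tempered fun x => (S.potential (t, x) μ : ℂ)) :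
    WeakFT (fun x => (S.potential (t, x) μ : ℂ)) (potFT fun k => a k μ) := by
  have hb := (ha.isTempered μ).1
  have e : ∀ k, potFT (fun k => a k μ) k = 1 / 2 * (a k μ / ‖k‖ + 1 * star (a (-k) μ / ‖-k‖)) := by
    intro k
    simp [potFT, div_eq_mul_inv]
    ring
  refine ⟨hA, ((hb.add (hb.star_neg.const_mul 1)).const_mul (1 / 2)).congr (ae_of_all _ fun k => ?_), fun φ => ?_⟩
  · exact (e k).symm
  rw [ha.potential_eq μ φ]
  have h1 := integral_amplitude hb φ 1
  have h2 : (fun k : Space => 1 / (‖k‖ : ℂ) * (a k μ * (∫ x, exp (I * ⟪k,x⟫) * φ x)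
      + star (a k μ) * (∫ x, exp (-(I * ⟪k,x⟫)) * φ x)))
      = fun k => a k μ / ‖k‖ * fint φ k + 1 * star (a k μ / ‖k‖) * fint φ (-k) := by
    funext k
    rw [fint_neg]
    simp [fint, div_eq_mul_inv]
    ring
  rw [h2, h1]
  have h3 : (fun k => potFT (fun k => a k μ) k * fint φ k)
      = fun k => 1 / 2 * ((a k μ / ‖k‖ + 1 * star (a (-k) μ / ‖-k‖)) * fint φ k) := by
    funext k; rw [e, mul_assoc]
  rw [h3, integral_const_mul]
  ring

lemma IsFourierAmplitude.weakFT_velocity (ha : S.IsFourierAmplitude t a) {μ : Fin 4}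
    (hA : Tempered fun x => (S.dA 0 μ (t, x) : ℂ)) :
    WeakFT (fun x => (S.dA 0 μ (t, x) : ℂ)) (velFT fun k => a k μ) := by
  have hb := (ha.isTempered μ).2
  have e : ∀ k, velFT (fun k => a k μ) k = -(I / 2) * (a k μ + -1 * star (a (-k) μ)) := by
    intro k; rw [velFT]; ring
  refine ⟨hA, ((hb.add (hb.star_neg.const_mul (-1))).const_mul (-(I / 2))).congr (ae_of_all _ fun k => ?_), fun φ => ?_⟩
  · exact (e k).symm
  rw [ha.deriv_eq μ φ]
  have h1 := integral_amplitude hb φ (-1)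
  have h2 : (fun k : Space => a k μ * (∫ x, exp (I * ⟪k,x⟫) * φ x)
      - star (a k μ) * (∫ x, exp (-(I * ⟪k,x⟫)) * φ x))
      = fun k => a k μ * fint φ k + -1 * star (a k μ) * fint φ (-k) := by
    funext k
    rw [fint_neg]
    simp only [fint]
    ring
  rw [h2, h1]
  have h3 : (fun k => velFT (fun k => a k μ) k * fint φ k)
      = fun k => -(I / 2) * ((a k μ + -1 * star (a (-k) μ)) * fint φ k) := by
    funext k; rw [e, mul_assoc]
  rw [h3, integral_const_mul]
  ring

end ChargeSystem

end

section

/-! ### Expansions of lower order -/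

section Expansions

variable {N : ℕ} {zs : Fin N → Space}
variable {u : SC} {j : ℕ} {R C : ℝ}

lemma KExp.of_isRemainder (hm : AEStronglyMeasurable u volume) (h : Remainder u) :
    KExp zs u :=
  ⟨hm, fun _ _ => 0, fun _ _ => 0, fun _ => contDiffOn_const, fun _ => contDiffOn_const, by simpa [lead] using h⟩

lemma KExp.lower (hu : KExp zs fun k => (‖k‖ : ℂ) * u k) :
    KExp zs fun k => -I * u k := by
  obtain ⟨hm, g, g', hg, hg', hr⟩ := hu
  have hi : ∀ c : ℂ, AEStronglyMeasurable (fun k : Space => c / (‖k‖ : ℂ)) volume := fun c =>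
    Measurable.aestronglyMeasurable (by fun_prop)
  have hu : AEStronglyMeasurable u volume := by
    refine ((hi 1).mul hm).congr ?_
    filter_upwards [ae_ne 0] with k hk
    have : (‖k‖ : ℂ) ≠ 0 := by exact_mod_cast norm_ne_zero_iff.2 hk
    simp only [Pi.mul_apply]
    field_simp
  choose C hC0 hC using fun n => exists_bound_of_continuousOn (hg' n).continuousOn
  refine ⟨hu.const_mul _, fun _ _ => 0, fun n w => -g n w, fun _ => contDiffOn_const, fun n => (hg n).neg, ?_⟩
  have hR : Remainder fun k : Space => ∑ n, phase (-zs n) 1 k * (g' n (khat k) / (‖k‖ : ℂ) ^ 3) := by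
    refine isRemainder_of_inv_cube (C := ∑ n, C n) fun k hk => ?_
    refine (norm_sum_le _ _).trans ?_
    rw [sum_mul]
    refine Finset.sum_le_sum fun n _ => ?_
    rw [norm_mul, norm_phase, one_mul, norm_div, norm_pow, norm_real, norm_real, norm_norm, div_eq_mul_inv]
    gcongr
    exact hC n _ (norm_khat (norm_pos_iff.1 (by linarith)))
  have hD : Remainder fun k : Space => -I / ‖k‖ * ((‖k‖ : ℂ) * u k - lead zs g g' k) := by
    refine hr.mono 1 fun k hk => ?_
    rw [enorm_mul, ENNReal.coe_one]
    gcongr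
    rw [← ofReal_norm, norm_div, norm_neg, norm_I, norm_real, norm_norm, ENNReal.ofReal_le_one]
    exact div_le_one_of_le₀ hk (norm_nonneg _)
  have hDm : AEStronglyMeasurable (fun k : Space => -I / ‖k‖ * ((‖k‖ : ℂ) * u k - lead zs g g' k)) volume :=
    (hi _).mul (hm.sub (aesm_of_continuousOn (continuousOn_lead zs hg hg')))
  refine (hD.add hDm hR).mono 1 fun k hk => ?_
  have hk0 : (‖k‖ : ℂ) ≠ 0 := by exact_mod_cast (by linarith : ‖k‖ ≠ 0)
  rw [ENNReal.coe_one, one_mul]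
  refine le_of_eq (congrArg _ ?_)
  have hs : ∑ n, phase (-zs n) 1 k * (g' n (khat k) / (‖k‖ : ℂ) ^ 3)
      = -I / ‖k‖ * lead zs g g' k - lead zs (fun _ _ => 0) (fun n w => -g n w) k := by
    simp only [lead]
    rw [mul_sum, ← Finset.sum_sub_distrib]
    refine sum_congr rfl fun n _ => ?_
    push_cast
    have hI2 := I_sq
    field_simp
    linear_combination ((g' n (khat k) : ℂ) * phase (-zs n) 1 k) * hI2
  rw [hs]
  field_simp
  ring

lemma singExp_of_local (n : Fin N) {g s p : SR} (hg : ContinuousOn g {zs n}ᶜ)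
    (hs : HomOdd s) (hp : HomEven p) {δ : ℝ} (hR : ∀ x, R ≤ ‖x - zs n‖ → g x = 0) (hδ : 0 < δ)
    (hloc : ∀ y, y ≠ 0 → ‖y‖ < δ → |g (zs n + y) - s y - p y| ≤ C) : SingExp zs g := by
  classical
  set a := zs n with ha
  let G : SR := fun y => g (y + a)
  have hG : ContinuousOn G {0}ᶜ := hg.comp (by fun_prop) fun y hy => by simpa using hy
  let B : SR := fun y => G y - s y - trunc p y
  obtain ⟨Cs, hCs, hs'⟩ := hs.exists_bound
  obtain ⟨Cp, hCp, hp'⟩ := hp.trunc_bounds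
  obtain ⟨η, hη, hη1, hηδ⟩ : ∃ η, 0 < η ∧ η ≤ 1 ∧ η ≤ δ := ⟨min 1 δ, lt_min one_pos hδ, min_le_left _ _, min_le_right _ _⟩
  have hK : IsCompact (closedBall (0 : Space) R \ ball 0 η) :=
    (isCompact_closedBall _ _).inter_right isOpen_ball.isClosed_compl
  obtain ⟨Cg, hCg⟩ := hK.exists_bound_of_continuousOn (hG.mono fun y hy h0 => hy.2 (by
    rw [Set.mem_singleton_iff.1 h0]; exact Metric.mem_ball_self hη))
  set K := |C| * 2 + |Cg| * (1 + R ^ 2) + (Cs + Cp) * (1 + (η ^ 2)⁻¹) with hKd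
  have hK0 : 0 ≤ K := by positivity
  have hB : ∀ y, y ≠ 0 → |B y| * (1 + ‖y‖ ^ 2) ≤ K := by
    intro y hy
    have t2 : 0 ≤ |Cg| * (1 + R ^ 2) := by positivity
    have t3 : 0 ≤ (Cs + Cp) * (1 + (η ^ 2)⁻¹) := by positivity
    rcases lt_or_ge ‖y‖ η with h | h
    · have h1 : trunc p y = p y := indicator_of_mem (by simpa using h.trans_le hη1) _
      have h2 := (hloc y hy (h.trans_le hηδ)).trans (le_abs_self C)
      simp only [B, G, h1, add_comm y a]
      have h3 : 1 + ‖y‖ ^ 2 ≤ 2 := by nlinarith [norm_nonneg y]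
      have := mul_le_mul h2 h3 (by positivity) (abs_nonneg C)
      linarith
    · have hy0 : 0 < ‖y‖ := hη.trans_le h
      have g1 : |G y| * (1 + ‖y‖ ^ 2) ≤ |Cg| * (1 + R ^ 2) := by
        rcases lt_or_ge ‖y‖ R with h4 | h4
        · have h5 := (hCg y ⟨by simpa using h4.le, by simpa using h⟩).trans (le_abs_self Cg)
          rw [norm_eq_abs] at h5
          gcongr
        · rw [show G y = 0 from hR _ (by simpa using h4)]
          simpa using t2
      have g2 : |s y| * (1 + ‖y‖ ^ 2) + |trunc p y| * (1 + ‖y‖ ^ 2) ≤ (Cs + Cp) * (1 + (η ^ 2)⁻¹) := by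
        have h6 : |s y| + |trunc p y| ≤ (Cs + Cp) * (‖y‖ ^ 2)⁻¹ := by linarith [hs' y, (hp' y).2]
        calc |s y| * (1 + ‖y‖ ^ 2) + |trunc p y| * (1 + ‖y‖ ^ 2) = (|s y| + |trunc p y|) * (1 + ‖y‖ ^ 2) := by ring
          _ ≤ (Cs + Cp) * (‖y‖ ^ 2)⁻¹ * (1 + ‖y‖ ^ 2) := by gcongr
          _ = (Cs + Cp) * (1 + (‖y‖ ^ 2)⁻¹) := by field_simp; ring
          _ ≤ _ := by gcongr
      have g3 : |B y| ≤ |G y| + |s y| + |trunc p y| := (abs_sub _ _).trans (by gcongr; exact abs_sub _ _)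
      have := mul_le_mul_of_nonneg_right g3 (show 0 ≤ 1 + ‖y‖ ^ 2 by positivity)
      have := abs_nonneg C
      linarith
  have hmG := aesm_of_continuousOn hG
  have hms := aesm_of_continuousOn hs.1
  have hmp := (aesm_of_continuousOn hp.1).indicator (s := ball (0 : Space) 1) measurableSet_ball
  have hmB : AEStronglyMeasurable B volume := (hmG.sub hms).sub hmp
  have hcB : ∀ᵐ y, ContinuousAt B y := by
    filter_upwards [ae_continuousAt_of_continuousOn hG, ae_continuousAt_of_continuousOn hs.1,
      hp.ae_continuousAt_trunc] with y h1 h2 h3 using (h1.sub h2).sub h3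
  refine ⟨fun m => if m = n then s else fun _ => 0, fun m => if m = n then p else fun _ => 0,
    fun x => B (x - a), fun m => ?_, fun m => ?_, ⟨?_, ⟨K * (2 * (1 + ‖a‖ ^ 2)), by positivity, ?_⟩,
    ae_continuousAt_comp_sub hcB a⟩, ae_of_all _ fun x => ?_⟩
  · by_cases h : m = n
    · simpa only [h, if_true] using hs
    · simp only [h, if_false]
      exact ⟨continuousOn_const, by simp, by simp⟩
  · by_cases h : m = n
    · simpa only [h, if_true] using hp
    · simp only [h, if_false]
      exact ⟨continuousOn_const, by simp, by simp⟩
  · exact hmB.comp_measurePreserving (measurePreserving_sub_right volume a)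
  · filter_upwards [ae_ne a] with x hx
    have h1 := hB (x - a) (sub_ne_zero.2 hx)
    rw [le_div_iff₀ (by positivity)]
    have h2 : 1 + ‖x‖ ^ 2 ≤ 2 * (1 + ‖a‖ ^ 2) * (1 + ‖x - a‖ ^ 2) := by
      have : ‖x‖ ≤ ‖x - a‖ + ‖a‖ := by simpa using norm_add_le (x - a) a
      nlinarith [norm_nonneg x, sq_nonneg (‖x - a‖ - ‖a‖), mul_nonneg (sq_nonneg ‖a‖) (sq_nonneg ‖x - a‖)]
    calc |B (x - a)| * (1 + ‖x‖ ^ 2) ≤ |B (x - a)| * (2 * (1 + ‖a‖ ^ 2) * (1 + ‖x - a‖ ^ 2)) := by gcongr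
      _ = |B (x - a)| * (1 + ‖x - a‖ ^ 2) * (2 * (1 + ‖a‖ ^ 2)) := by ring
      _ ≤ _ := by gcongr
  · beta_reduce
    rw [Finset.sum_eq_single n (fun m _ hm => by simp [hm]) (by simp),
      Finset.sum_eq_single n (fun m _ hm => by simp [hm, trunc]) (by simp)]
    simp only [if_true, B, G, ← ha, sub_add_cancel]
    ring

end Expansions

lemma HomEven.homOdd_fderiv {e : SR} (he : HomEven e) (hs : Sm₀ e) (m : Space) :
    HomOdd fun y => fderiv ℝ e y m := by
  refine ⟨((hs.fderiv_of_isOpen (m := ∞) isOpen_compl_singleton (by simp)).clm_apply contDiffOn_const).continuousOn,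
    fun r hr y => ?_, fun y => ?_⟩
  · have := invertibleOfNonzero (inv_ne_zero hr.ne')
    have h1 : fderiv ℝ (fun y => e (r • y)) y = fderiv ℝ (fun y => r⁻¹ * e y) y := by
      rw [show (fun y => e (r • y)) = fun y => r⁻¹ * e y from funext (he.2.1 r hr)]
    rw [fderiv_comp_smul, show (fun y => r⁻¹ * e y) = r⁻¹ • e from rfl, fderiv_const_smul_of_invertible] at h1
    have := congrArg (fun l : Space →L[ℝ] ℝ => l m) h1
    simp only [smul_apply, smul_eq_mul] at this
    rw [pow_two, mul_inv, mul_assoc, ← this]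
    field_simp
  · have h1 : fderiv ℝ (fun y => e (-y)) y = fderiv ℝ e y := by rw [show (fun y => e (-y)) = e from funext he.2.2]
    rw [show (fun y => e (-y)) = fun y => e ((-1 : ℝ) • y) by simp, fderiv_comp_smul] at h1
    beta_reduce
    rw [← h1]; simp

lemma HomOddZero.homEven_fderiv {o : SR} (ho : HomOddZero o) (hs : Sm₀ o) (m : Space) :
    HomEven fun y => fderiv ℝ o y m := by
  refine ⟨((hs.fderiv_of_isOpen (m := ∞) isOpen_compl_singleton (by simp)).clm_apply contDiffOn_const).continuousOn,
    fun r hr y => ?_, fun y => ?_⟩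
  · have h1 : fderiv ℝ (fun y => o (r • y)) y = fderiv ℝ o y := by
      rw [show (fun y => o (r • y)) = o from funext (ho.2.1 r hr)]
    rw [fderiv_comp_smul] at h1
    beta_reduce
    rw [← h1]
    simp only [smul_apply, smul_eq_mul]
    field_simp
  · have h1 : fderiv ℝ (fun y => o (-y)) y = fderiv ℝ (fun y => -o y) y := by
      rw [show (fun y => o (-y)) = fun y => -o y from funext ho.2.2]
    rw [show (fun y => o (-y)) = fun y => o ((-1 : ℝ) • y) by simp, fderiv_comp_smul, fderiv_fun_neg, neg_smul, one_smul,
      neg_inj, neg_one_smul] at h1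
    beta_reduce
    rw [h1]

/-! ### Smooth remainders -/

lemma bddDecay_of_continuous {h : SR} (hc : Continuous h)
    (hb : ∀ x, R ≤ ‖x‖ → |h x| ≤ C / ‖x‖ ^ 2) : BddDecay h := by
  obtain ⟨D, hD⟩ := (isCompact_closedBall (0 : Space) (max R 1)).exists_bound_of_continuousOn hc.continuousOn
  refine ⟨hc.aestronglyMeasurable, ⟨|D| * (1 + (max R 1) ^ 2) + |C| * 2, by positivity, ae_of_all _ fun x => ?_⟩,
    ae_of_all _ fun x => hc.continuousAt⟩
  rw [le_div_iff₀ (by positivity)]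
  rcases le_total ‖x‖ (max R 1) with hx | hx
  · have h1 := (hD x (by simpa using hx)).trans (le_abs_self D)
    rw [norm_eq_abs] at h1
    have : |h x| * (1 + ‖x‖ ^ 2) ≤ |D| * (1 + (max R 1) ^ 2) := by gcongr
    have := abs_nonneg C
    linarith
  · have h1 : 1 ≤ ‖x‖ := (le_max_right _ _).trans hx
    have h2 := (hb x ((le_max_left _ _).trans hx)).trans (div_le_div_of_nonneg_right (le_abs_self C) (sq_nonneg _))
    have : |h x| * (1 + ‖x‖ ^ 2) ≤ |C| * 2 := by
      calc |h x| * (1 + ‖x‖ ^ 2) ≤ |C| / ‖x‖ ^ 2 * (2 * ‖x‖ ^ 2) := by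
            gcongr
            nlinarith
        _ = |C| * 2 := by field_simp
    have : 0 ≤ |D| * (1 + (max R 1) ^ 2) := by positivity
    linarith

lemma BddDecay.memLp {b : SR} (hb : BddDecay b) : MemLp (fun x => (b x : ℂ)) 2 volume := by
  obtain ⟨hm, ⟨C, hC0, hC⟩, -⟩ := hb
  have hm' := continuous_ofReal.comp_aestronglyMeasurable hm
  refine (memLp_two_iff_integrable_sq_norm hm').2 ((integrable_env.const_mul (C ^ 2)).mono' (hm'.norm.pow 2) ?_)
  filter_upwards [hC, ae_ne 0] with x hx hx0
  have h0 := norm_pos_iff.2 hx0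
  rw [norm_of_nonneg (by positivity), norm_real, norm_eq_abs, env]
  calc |b x| ^ 2 ≤ (C / (1 + ‖x‖ ^ 2)) ^ 2 := by gcongr
    _ = C ^ 2 * ((1 + ‖x‖ ^ 2) * (1 + ‖x‖ ^ 2))⁻¹ := by field_simp
    _ ≤ _ := by
      gcongr
      linarith

/-- The derivative of order `j` in the direction `e` of a component of `r`. -/
def pureD (r : Space → Fin 4 → ℝ) (e : Space) (j : ℕ) (μ : Fin 4) (x : Space) : ℝ :=
  iteratedFDeriv ℝ j r x (fun _ => e) μ

section Pure

variable {r : Space → Fin 4 → ℝ} {e : Space} {μ : Fin 4} {u : SC} {j : ℕ} {R C : ℝ}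

lemma pureD_zero : pureD r e 0 μ = fun x => r x μ := by
  funext x; simp [pureD]

lemma continuous_pureD (hr : C∞ r) (j : ℕ) : Continuous (pureD r e j μ) := by
  have h1 : Continuous (iteratedFDeriv ℝ j r) := hr.continuous_iteratedFDeriv (by exact_mod_cast le_top)
  exact (continuous_apply μ).comp (h1.eval continuous_const)

lemma hasLineDerivAt_pureD (hr : C∞ r) (j : ℕ) (x : Space) :
    HasLineDerivAt ℝ (pureD r e j μ) (pureD r e (j + 1) μ x) x e := by
  have h1 := (hr.differentiable_iteratedFDeriv (m := j) (by exact_mod_cast ENat.natCast_lt_top j) x).hasFDerivAt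
  let L : ContinuousMultilinearMap ℝ (fun _ : Fin j => Space) (Fin 4 → ℝ) →L[ℝ] ℝ :=
    (ContinuousLinearMap.proj μ).comp (ContinuousMultilinearMap.apply ℝ (fun _ : Fin j => Space) (Fin 4 → ℝ) fun _ => e)
  exact (L.hasFDerivAt.comp x h1).hasLineDerivAt e

lemma abs_pureD_le (he : ‖e‖ = 1) (j : ℕ) (x : Space) :
    |pureD r e j μ x| ≤ ‖iteratedFDeriv ℝ j r x‖ := by
  refine (norm_le_pi_norm (iteratedFDeriv ℝ j r x fun _ => e) μ).trans ?_
  simpa [he] using (iteratedFDeriv ℝ j r x).le_opNorm fun _ => e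

lemma WeakFT.pureD (hr : C∞ r) (hu : WeakFT (fun x => (r x μ : ℂ)) u)
    (hb : ∀ i ≤ j, ∃ C, ∀ x, |pureD r e i μ x| ≤ C) :
    WeakFT (fun x => (pureD r e j μ x : ℂ)) fun k => (I * ⟪k,e⟫) ^ j * u k := by
  induction j with
  | zero => simpa [pureD_zero] using hu
  | succ j ih =>
    obtain ⟨C, hC⟩ := hb j (by simp)
    obtain ⟨C', hC'⟩ := hb (j + 1) le_rfl
    have hC0 : 0 ≤ C := (abs_nonneg _).trans (hC 0)
    have ht : Tempered fun x => (PointChargeED.pureD r e (j + 1) μ x : ℂ) :=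
      isTempered_of_bound (C := C') (j := 0) (continuous_ofReal.comp
        (continuous_pureD hr _)).aestronglyMeasurable (ae_of_all _ fun x => by simpa using hC' x)
    have h1 := (ih fun i hi => hb i (by omega)).hasLineDerivAt e ht 0 (fun x _ => by
      exact (hasLineDerivAt_pureD hr j x).ofReal_comp) (C := C) fun x hx hx0 => by
        rw [sub_zero] at hx ⊢
        rw [le_div_iff₀ (norm_pos_iff.2 hx0), norm_real, norm_eq_abs]
        nlinarith [hC x, norm_nonneg x, abs_nonneg (PointChargeED.pureD r e j μ x)]
    refine h1.congr (ae_of_all _ fun _ => rfl) (ae_of_all _ fun k => ?_)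
    beta_reduce
    rw [pow_succ']; ring

lemma memLp_pureD (hr : C∞ r) (hu : WeakFT (fun x => (r x μ : ℂ)) u)
    (hb : ∀ i ≤ j, ∃ C, ∀ x, |pureD r e i μ x| ≤ C) (hj : BddDecay (pureD r e j μ)) :
    MemLp (fun k => (I * ⟪k,e⟫) ^ j * u k) 2 volume := by
  obtain ⟨w, hw, hw', -⟩ := exists_weakFT_of_memLp hj.memLp
  exact hw.ae_eq (hw'.ae_eq (hu.pureD hr hb))

end Pure

lemma isRemainder_of_pureD {ρ u : SC} {j : ℕ}
    (hX : ∀ i : Fin 3, MemLp (fun k => (I * ⟪k,(single i (1 : ℝ))⟫) ^ (j + 1) * u k) 2)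
    (h : ∀ k, 1 ≤ ‖k‖ → ‖ρ k‖ ≤ (‖k‖ ^ 2)⁻¹ * (‖k‖ ^ (j + 1) * ‖u k‖)) : Remainder ρ := by
  have hs : MemLp (fun k => ∑ i : Fin 3, ((‖(I * ⟪k,(single i (1 : ℝ))⟫) ^ (j + 1) * u k‖ : ℝ) : ℂ)) 2 :=
    memLp_finsetSum _ fun i _ => (hX i).norm.ofReal
  refine isRemainder_of_memLp hs (C := 3 ^ j) fun k hk => (h k hk).trans ?_
  have h1 : ‖k‖ ≤ ∑ i : Fin 3, |k i| := by
    rw [norm_eq, Real.sqrt_le_left (by positivity)]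
    simpa using Finset.sum_sq_le_sq_sum_of_nonneg (s := univ) (f := fun i => |k i|) fun i _ => abs_nonneg _
  have h3 : ‖k‖ ^ (j + 1) ≤ 3 ^ j * ∑ i : Fin 3, |k i| ^ (j + 1) := by
    have := pow_sum_div_card_le_sum_pow (s := univ) (f := fun i : Fin 3 => |k i|) (fun i _ => abs_nonneg _) j
    rw [div_le_iff₀ (by simp), mul_comm] at this
    simp only [Finset.card_univ, Fintype.card_fin, Nat.cast_ofNat] at this
    exact (pow_le_pow_left₀ (norm_nonneg _) h1 _).trans this
  rw [← Complex.ofReal_sum, Complex.norm_of_nonneg (by positivity), mul_assoc, mul_left_comm (3 ^ j : ℝ)]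
  refine mul_le_mul_of_nonneg_left ?_ (by positivity)
  simp only [norm_mul, norm_pow, norm_I, one_mul, norm_real, norm_eq_abs, inner_single_right, conj_trivial, one_mul]
  rw [← sum_mul, ← mul_assoc]
  gcongr

end

section

lemma KExp.lineDeriv {N : ℕ} {zs : Fin N → Space} {u : SC}
    (hu : KExp zs fun k => (‖k‖ : ℂ) * u k) (m : Space) :
    KExp zs fun k => -I * (I * ⟪k,m⟫ * u k) := by
  refine (hu.dir_mul (c := fun w => ⟪w,m⟫) (contDiff_id.inner ℝ contDiff_const).contDiffOn).congr_ae ?_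
  filter_upwards [ae_ne 0] with k hk
  have hk0 : (‖k‖ : ℂ) ≠ 0 := by exact_mod_cast norm_ne_zero_iff.2 hk
  rw [khat, inner_smul_left]
  simp only [conj_trivial]
  push_cast
  field_simp
  linear_combination ((⟪k,m⟫ : ℂ) * u k) * I_sq

/-! ### The field of one charge with a source that vanishes in the remote past -/

namespace WorldLine

variable {z : ℝ → Space} {F : ℝ → ℝ} {t : ℝ}

lemma norm_lagMap_sub_le (hz : WorldLine z) (t : ℝ) (y : Space) : ‖lagMap z t y - z t‖ ≤ 2 * ‖y‖ := by
  obtain ⟨c, hc0, hc1, -, hc⟩ := hz.exists_speed_bound (t - ‖y‖) t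
  have h1 := hc t ⟨by linarith [norm_nonneg y], le_rfl⟩ (t - ‖y‖) ⟨le_rfl, by linarith [norm_nonneg y]⟩
  rw [sub_sub_cancel_left, abs_neg, abs_norm] at h1
  have h2 := norm_add_le y (z (t - ‖y‖) - z t)
  rw [lagMap, add_sub_assoc]
  nlinarith [norm_nonneg y]

lemma lw_eq_zero (hz : WorldLine z) (hF0 : ∀ s < t - 2, F s = 0) {x : Space} (hx : 5 ≤ ‖x - z t‖) :
    lw z F (t, x) = 0 := by
  obtain ⟨y, rfl⟩ := hz.exists_lagMap_eq t x
  have := hz.norm_lagMap_sub_le t y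
  rw [hz.lw_lagMap, hF0 _ (by linarith), zero_div]

lemma exists_inv_bound (hz : WorldLine z) (hF : Continuous F) (hF0 : ∀ s < t - 2, F s = 0) :
    ∃ C, ∀ x, x ≠ z t → |lw z F (t, x)| ≤ C / ‖x - z t‖ := by
  obtain ⟨D, hD⟩ := (isCompact_Icc (a := t - 2) (b := t)).exists_bound_of_continuousOn hF.continuousOn
  obtain ⟨c, hc0, hc1, hc, -⟩ := hz.exists_speed_bound (t - 2) t
  have hc' : 0 < 1 - c := by linarith
  refine ⟨2 * |D| / (1 - c), fun x hx => ?_⟩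
  obtain ⟨y, rfl⟩ := hz.exists_lagMap_eq t x
  have h1 := hz.norm_lagMap_sub_le t y
  have h0 : 0 < ‖lagMap z t y - z t‖ := norm_pos_iff.2 (sub_ne_zero.2 hx)
  have hy0 : 0 < ‖y‖ := by linarith
  rw [hz.lw_lagMap]
  rcases lt_or_ge 2 ‖y‖ with h | h
  · rw [hF0 _ (by linarith)]
    simp only [zero_div, abs_zero]
    positivity
  · have hs : t - ‖y‖ ∈ Icc (t - 2) t := ⟨by linarith, by linarith⟩
    have h2 : (1 - c) * ‖y‖ ≤ ‖y‖ - ⟪y,deriv z (t - ‖y‖)⟫ := by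
      have := real_inner_le_norm y (deriv z (t - ‖y‖))
      nlinarith [hc _ hs]
    have h3 := (hD _ hs).trans (le_abs_self D)
    rw [norm_eq_abs] at h3
    rw [abs_div, abs_of_pos ((by positivity : 0 < (1 - c) * ‖y‖).trans_le h2), div_div]
    calc |F (t - ‖y‖)| / (‖y‖ - ⟪y,deriv z (t - ‖y‖)⟫) ≤ |D| / ((1 - c) * ‖y‖) := by gcongr
      _ = 2 * |D| / ((1 - c) * (2 * ‖y‖)) := by field_simp
      _ ≤ _ := by gcongr

lemma contDiffAt_lw_space (hz : WorldLine z) (hF : C∞ F) {x : Space} (hx : x ≠ z t) :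
    ContDiffAt ℝ ∞ (fun x => lw z F (t, x)) x :=
  (hz.contDiffAt_lw (p := (t, x)) hF hx).comp x (by fun_prop)

lemma continuousOn_lw (hz : WorldLine z) (hF : C∞ F) :
    ContinuousOn (fun x => lw z F (t, x)) {z t}ᶜ := fun _ hx =>
  (hz.contDiffAt_lw_space hF hx).continuousAt.continuousWithinAt

variable {N : ℕ} {zs : Fin N → Space}

lemma continuous_fint {f : SC} (hf : Integrable f) : Continuous fun k => fint f (-k) := by
  unfold fint
  refine continuous_of_dominated (bound := fun x => ‖f x‖) (fun k => ?_) (fun k => ae_of_all _ fun x => ?_) hf.norm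
    (ae_of_all _ fun x => by fun_prop)
  · exact (Continuous.aestronglyMeasurable (by fun_prop)).mul hf.1
  · rw [norm_mul, mul_comm I, norm_exp_ofReal_mul_I, one_mul]

lemma isFieldTransform_lw (hz : WorldLine z) (hF : C∞ F) (hF0 : ∀ s < t - 2, F s = 0)
    (n : Fin N) (hn : zs n = z t) :
    FieldFT zs (fun x => lw z F (t, x))
      fun k => fint (fun x => (lw z F (t, x) : ℂ)) (-k) := by
  obtain ⟨e, o, c, C, δ, hδ, hC, hes, hos, he, ho, hb⟩ := hz.exists_local_expansion hF t
  have hi := (hz.integrable_lw hF.continuous hF0).ofReal (𝕜 := ℂ)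
  refine ⟨?_, weakFT_of_integrable hi, (hz.hasKExpansion_lw hF hF0 n hn).lower, fun L _ => ?_⟩
  · obtain ⟨Co, hCo0, hCo⟩ := ho.exists_bound
    refine singExp_of_local n (s := fun _ => 0) (p := e) (R := 5) (δ := δ) (C := C * δ + Co + |c|)
      (hn ▸ hz.continuousOn_lw hF) ⟨continuousOn_const, by simp, by simp⟩ he
      (fun x hx => hz.lw_eq_zero hF0 (hn ▸ hx)) hδ fun y hy hyδ => ?_
    have h1 := (hb y hy hyδ).1
    rw [hn, sub_zero]
    have h2 : lw z F (t, z t + y) - e y = (lw z F (t, z t + y) - (e y + o y + c)) + o y + c := by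
      ring
    rw [h2]
    refine (abs_add_le _ _).trans (add_le_add ((abs_add_le _ _).trans (add_le_add (h1.trans ?_) (hCo y))) le_rfl)
    gcongr
  · exact ((continuous_fint hi).norm.pow 2).locallyIntegrable.integrableOn_isCompact (isCompact_closedBall 0 L)
      |>.mono_set Metric.ball_subset_closedBall

lemma isFieldTransform_fderiv_lw (hz : WorldLine z) (hF : C∞ F)
    (hF0 : ∀ s < t - 2, F s = 0) (hzs : Injective zs) (n : Fin N) (hn : zs n = z t) (m : Space) :
    FieldFT zs (fun x => fderiv ℝ (fun x => lw z F (t, x)) x m)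
      fun k => I * ⟪k,m⟫ * fint (fun x => (lw z F (t, x) : ℂ)) (-k) := by
  obtain ⟨e, o, c, C, δ, hδ, hC, hes, hos, he, ho, hb⟩ := hz.exists_local_expansion hF t
  have hi := (hz.integrable_lw hF.continuous hF0).ofReal (𝕜 := ℂ)
  have hexp : SingExp zs fun x => fderiv ℝ (fun x => lw z F (t, x)) x m := by
    refine singExp_of_local n (s := fun y => fderiv ℝ e y m) (p := fun y => fderiv ℝ o y m) (R := 6) (δ := δ)
      (C := C * ‖m‖) (fun x hx => ?_) (he.homOdd_fderiv hes m) (ho.homEven_fderiv hos m) (fun x hx => ?_) hδ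
      fun y hy hyδ => ?_
    · have h1 := (hz.contDiffAt_lw_space hF (x := x) (hn ▸ hx)).fderiv_right (m := 0) (by simp)
      exact (h1.continuousAt.clm_apply continuousAt_const).continuousWithinAt
    · have h1 : (fun x => lw z F (t, x)) =ᶠ[𝓝 x] fun _ => 0 := by
        filter_upwards [ball_mem_nhds x one_pos] with y hy
        refine hz.lw_eq_zero hF0 ?_
        have h2 := norm_sub_norm_le (x - z t) (x - y)
        rw [sub_sub_sub_cancel_left] at h2
        rw [mem_ball_iff_norm'] at hy
        rw [hn] at hx
        linarith
      rw [h1.fderiv_eq]; simp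
    · rw [hn]
      exact (hb y hy hyδ).2 m
  obtain ⟨K, hK⟩ := hz.exists_inv_bound hF.continuous hF0
  refine ⟨hexp, ?_, ?_, fun L _ => ?_⟩
  · exact (weakFT_of_integrable hi).hasLineDerivAt m (hexp.matched hzs).2.2 (z t) (fun x hx =>
      (((hz.contDiffAt_lw_space hF hx).differentiableAt (by simp)).hasFDerivAt.hasLineDerivAt m).ofReal_comp)
      fun x _ hx => by simpa using hK x hx
  · exact (hz.hasKExpansion_lw hF hF0 n hn).lineDeriv m
  · exact (((by fun_prop : Continuous fun k : Space => I * (⟪k,m⟫ : ℂ)).mul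
      (continuous_fint hi)).norm.pow 2).locallyIntegrable.integrableOn_isCompact (isCompact_closedBall 0 L)
      |>.mono_set Metric.ball_subset_closedBall

end WorldLine

end

section

/-! ### Smooth fields that vanish at infinity -/

section Regular

variable {N : ℕ} {zs : Fin N → Space} {r : Space → Fin 4 → ℝ} {u : SC} {μ : Fin 4} {C R : ℝ}

lemma exists_bound_of_continuous {h : SR} (hc : Continuous h) (hb : ∀ x, R ≤ ‖x‖ → |h x| ≤ C) :
    ∃ D, ∀ x, |h x| ≤ D := by
  obtain ⟨D, hD⟩ := (isCompact_closedBall (0 : Space) R).exists_bound_of_continuousOn hc.continuousOn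
  refine ⟨max C D, fun x => ?_⟩
  rcases le_total R ‖x‖ with hx | hx
  · exact (hb x hx).trans (le_max_left _ _)
  · exact (hD x (by simpa using hx)).trans (le_max_right _ _)

lemma norm_single (i : Fin 3) : ‖(single i (1 : ℝ) : Space)‖ = 1 := by simp

lemma pureD_decay (hr : C∞ r) {e : Space} (he : ‖e‖ = 1) (j : ℕ)
    (h : ∀ x, R ≤ ‖x‖ → ‖iteratedFDeriv ℝ j r x‖ ≤ C / ‖x‖ ^ 2) :
    BddDecay (pureD r e j μ) ∧ ∃ D, ∀ x, |pureD r e j μ x| ≤ D := by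
  have h1 : ∀ x, R ≤ ‖x‖ → |pureD r e j μ x| ≤ C / ‖x‖ ^ 2 := fun x hx => (abs_pureD_le he j x).trans (h x hx)
  refine ⟨bddDecay_of_continuous (continuous_pureD hr j) h1,
    exists_bound_of_continuous (R := max R 1) (C := |C|) (continuous_pureD hr j) fun x hx => ?_⟩
  have h2 : 1 ≤ ‖x‖ := (le_max_right _ _).trans hx
  refine (h1 x ((le_max_left _ _).trans hx)).trans ((div_le_div_of_nonneg_right (le_abs_self C) (by positivity)).trans ?_)
  exact div_le_self (abs_nonneg C) (by nlinarith)

lemma isFieldTransform_of_decay (hr : C∞ r)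
    (h : ∀ j ≤ 2, ∀ x, R ≤ ‖x‖ → ‖iteratedFDeriv ℝ j r x‖ ≤ C / ‖x‖ ^ 2)
    (hu : WeakFT (fun x => (r x μ : ℂ)) u) : FieldFT zs (fun x => r x μ) u := by
  have hX : ∀ i : Fin 3, ∀ j ≤ 2, MemLp (fun k => (I * ⟪k,(single i (1 : ℝ))⟫) ^ j * u k) 2 := fun i j hj =>
    memLp_pureD hr hu (fun l hl => (pureD_decay hr (norm_single i) l (h l (by omega))).2)
      (pureD_decay hr (norm_single i) j (h j hj)).1
  have h0 : MemLp u 2 := by simpa using hX 0 0 (by omega)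
  refine ⟨?_, hu, ?_, fun L _ => ((memLp_two_iff_integrable_sq_norm h0.1).1 h0).integrableOn⟩
  · rw [← pureD_zero (r := r) (e := single 0 1)]
    exact (pureD_decay hr (norm_single 0) 0 (h 0 (by omega))).1.singExp
  · refine .of_isRemainder (h0.1.const_mul _) (isRemainder_of_pureD (j := 1) (fun i => hX i 2 le_rfl) fun k hk => ?_)
    have : 0 < ‖k‖ := by linarith
    rw [norm_mul, norm_neg, norm_I]
    exact le_of_eq (by field_simp)

lemma transform_of_decay (hr : C∞ r) (h0 : ∀ x, R ≤ ‖x‖ → ‖r x‖ ≤ C)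
    (h : ∀ j, 1 ≤ j → j ≤ 3 → ∀ x, R ≤ ‖x‖ → ‖iteratedFDeriv ℝ j r x‖ ≤ C / ‖x‖ ^ 2)
    (hu : WeakFT (fun x => (r x μ : ℂ)) u) :
    (KExp zs fun k => (‖k‖ : ℂ) * u k) ∧ ∀ i : Fin 3,
      FieldFT zs (fun x => fderiv ℝ (fun x => r x μ) x (single i 1))
        fun k => I * ⟪k,(single i (1 : ℝ))⟫ * u k := by
  have hB : ∀ i : Fin 3, ∀ j ≤ 3, ∃ D, ∀ x, |pureD r (single i 1) j μ x| ≤ D := by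
    intro i j hj
    rcases j.eq_zero_or_pos with rfl | hj0
    · refine exists_bound_of_continuous (continuous_pureD hr 0) (C := C) (R := R) fun x hx => ?_
      rw [pureD_zero]
      exact (norm_le_pi_norm (r x) μ).trans (h0 x hx)
    · exact (pureD_decay hr (norm_single i) j (h j hj0 hj)).2
  have hX : ∀ i : Fin 3, ∀ j, 1 ≤ j → j ≤ 3 →
      MemLp (fun k => (I * ⟪k,(single i (1 : ℝ))⟫) ^ j * u k) 2 := fun i j hj hj' =>
    memLp_pureD hr hu (fun l hl => hB i l (by omega)) (pureD_decay hr (norm_single i) j (h j hj hj')).1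
  have hk : KExp zs fun k => (‖k‖ : ℂ) * u k := by
    refine .of_isRemainder ((Measurable.aestronglyMeasurable (by fun_prop)).mul hu.2.1.1)
      (isRemainder_of_pureD (j := 2) (fun i => hX i 3 (by omega) le_rfl) fun k hk => ?_)
    have : 0 < ‖k‖ := by linarith
    rw [norm_mul, norm_real, norm_norm]
    exact le_of_eq (by field_simp; ring)
  refine ⟨hk, fun i => ?_⟩
  have e1 : (fun x => fderiv ℝ (fun x => r x μ) x (single i 1)) = pureD r (single i 1) 1 μ := by
    funext x
    have h1 := hasLineDerivAt_pureD (e := single i 1) (μ := μ) hr 0 x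
    rw [pureD_zero] at h1
    exact (((contDiff_pi.1 hr μ).differentiable (by simp) x).hasFDerivAt.hasLineDerivAt _).unique h1
  have h1 := hX i 1 le_rfl (by omega)
  simp only [pow_one] at h1
  rw [e1]
  refine ⟨(pureD_decay hr (norm_single i) 1 (h 1 le_rfl (by omega))).1.singExp, ?_, hk.lineDeriv _,
    fun L _ => ((memLp_two_iff_integrable_sq_norm h1.1).1 h1).integrableOn⟩
  simpa using hu.pureD hr (e := single i 1) (j := 1) fun l hl => hB i l (by omega)

end Regular

end

section

variable {x : Space} {t : ℝ}

/-! ### Separation of the recent past -/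

/-- The part of a source after time `t - 2`. -/
def near (t : ℝ) (F : ℝ → ℝ) (s : ℝ) : ℝ := Real.smoothTransition (s - (t - 2)) * F s

/-- The part of a source before time `t - 1`. -/
def far (t : ℝ) (F : ℝ → ℝ) (s : ℝ) : ℝ := (1 - Real.smoothTransition (s - (t - 2))) * F s

lemma contDiff_near {F : ℝ → ℝ} (hF : C∞ F) (t : ℝ) : C∞ (near t F) :=
  (Real.smoothTransition.contDiff.comp (contDiff_id.sub contDiff_const)).mul hF

lemma contDiff_far {F : ℝ → ℝ} (hF : C∞ F) (t : ℝ) : C∞ (far t F) :=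
  (contDiff_const.sub (Real.smoothTransition.contDiff.comp (contDiff_id.sub contDiff_const))).mul hF

lemma near_eq_zero (F : ℝ → ℝ) {s : ℝ} (h : s < t - 2) : near t F s = 0 := by
  rw [near, Real.smoothTransition.zero_of_nonpos (by linarith), zero_mul]

lemma far_eq_zero (F : ℝ → ℝ) {s : ℝ} (h : t - 1 ≤ s) : far t F s = 0 := by
  rw [far, Real.smoothTransition.one_of_one_le (by linarith), sub_self, zero_mul]

lemma lw_split (z : ℝ → Space) (F : ℝ → ℝ) (t : ℝ) (p : Spacetime) : WorldLine.lw z F p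
      = WorldLine.lw z (far t F) p + WorldLine.lw z (near t F) p := by
  simp only [WorldLine.lw, near, far]
  ring

lemma fderiv_slice {f : Spacetime → ℝ} (hf : DifferentiableAt ℝ f (t, x)) (i : Fin 3) :
    pd i.succ f (t, x) = fderiv ℝ (fun x => f (t, x)) x (single i 1) := by
  have h1 : HasFDerivAt (fun x : Space => ((t, x) : Spacetime)) (ContinuousLinearMap.inr ℝ ℝ Space) x :=
    hasFDerivAt_prodMk_right t x
  have h2 : HasFDerivAt (fun x => f (t, x)) _ x := HasFDerivAt.comp x hf.hasFDerivAt h1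
  rw [h2.fderiv, pd]
  simp [basisVec]

namespace WorldLine

variable {z : ℝ → Space} {F : ℝ → ℝ} {t : ℝ}

lemma contDiff_lw_far (hz : WorldLine z) (hF : C∞ F) (t : ℝ) :
    C∞ fun x => lw z (far t F) (t, x) := by
  refine contDiff_iff_contDiffAt.2 fun x => ?_
  by_cases hx : x = z t
  · obtain ⟨c, δ, -, -, hδ, -, h⟩ := hz.exists_lag_bound t
    have h1 : (fun x => lw z (far t F) (t, x)) =ᶠ[𝓝 x] fun _ => 0 := by
      filter_upwards [ball_mem_nhds x hδ] with y hy
      obtain ⟨w, rfl⟩ := hz.exists_lagMap_eq t y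
      have h2 := (h w (lagMap z t w - z t) (by abel) (by rw [← dist_eq_norm, ← hx]; exact hy)).1
      rw [hz.lw_lagMap, far_eq_zero _ (by linarith), zero_div]
    exact contDiffAt_const.congr_of_eventuallyEq h1
  · exact hz.contDiffAt_lw_space (contDiff_far hF t) hx

lemma fderiv_lw_split (hz : WorldLine z) (hF : C∞ F) (hx : x ≠ z t) (m : Space) :
    fderiv ℝ (fun x => lw z F (t, x)) x m = fderiv ℝ (fun x => lw z (far t F) (t, x)) x m
      + fderiv ℝ (fun x => lw z (near t F) (t, x)) x m := by
  rw [show (fun x => lw z F (t, x))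
      = fun x => lw z (far t F) (t, x) + lw z (near t F) (t, x) from
        funext fun x => lw_split z F t (t, x),
    fderiv_fun_add ((hz.contDiff_lw_far hF t).differentiable (by simp) x)
      ((hz.contDiffAt_lw_space (contDiff_near hF t) hx).differentiableAt (by simp))]
  rfl

/-- The time derivative of a retarded field. -/
def rate (z : ℝ → Space) (t : ℝ) (c : (ℝ → ℝ) → ℝ → ℝ) (F : ℝ → ℝ) (x : Space) : ℝ :=
  lw z (c (deriv F)) (t, x) - ∑ i : Fin 3,
    fderiv ℝ (fun x => lw z (c fun s => deriv z s i * F s) (t, x)) x (single i 1)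

lemma contDiff_component (hz : WorldLine z) (hF : C∞ F) (i : Fin 3) :
    C∞ fun s => deriv z s i * F s :=
  ((contDiff_euclidean (𝕜 := ℝ)).1 hz.contDiff_deriv i).mul hF

lemma pd_zero_eq (hz : WorldLine z) (hF : C∞ F) (hx : x ≠ z t) :
    pd 0 (lw z F) (t, x) = rate z t (far t) F x + rate z t (near t) F x := by
  have h0 := hz.pd_zero_lw hF (p := (t, x)) hx
  have h1 : ∀ i : Fin 3, pd i.succ (lw z fun s => deriv z s i * F s) (t, x) = _ := fun i =>
    (fderiv_slice ((hz.contDiffAt_lw (hz.contDiff_component hF i) (p := (t, x)) hx).differentiableAt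
      (by simp)) i).trans (hz.fderiv_lw_split (hz.contDiff_component hF i) hx _)
  rw [h0, sum_congr rfl fun i _ => h1 i, sum_add_distrib, lw_split z (deriv F) t, rate, rate]
  ring

lemma contDiff_rate_far (hz : WorldLine z) (hF : C∞ F) (t : ℝ) : C∞ (rate z t (far t) F) := by
  refine (hz.contDiff_lw_far (contDiff_infty_iff_deriv.1 hF).2 t).sub (ContDiff.sum fun i _ => ?_)
  exact ((hz.contDiff_lw_far (hz.contDiff_component hF i) t).fderiv_right (m := ∞) (by simp)).clm_apply
    contDiff_const

lemma exists_isFieldTransform_rate (hz : WorldLine z) (hF : C∞ F) {N : ℕ} {zs : Fin N → Space}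
    (hzs : Injective zs) (n : Fin N) (hn : zs n = z t) :
    ∃ u, FieldFT zs (rate z t (near t) F) u := by
  have h1 := hz.isFieldTransform_lw (contDiff_near (contDiff_infty_iff_deriv.1 hF).2 t)
    (fun s hs => near_eq_zero _ hs) n hn
  have h2 := FieldFT.sum (s := univ) fun (i : Fin 3) _ => hz.isFieldTransform_fderiv_lw
    (contDiff_near (hz.contDiff_component hF i) t) (fun s hs => near_eq_zero _ hs) hzs n hn (single i 1)
  exact ⟨_, (h1.add (h2.const_mul (-1))).congr (ae_of_all _ fun x => by simp only [rate]; ring) (ae_of_all _ fun _ => rfl)⟩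

lemma near_eventually_eq_zero (hz : WorldLine z) (F : ℝ → ℝ) (hx : 5 < ‖x - z t‖) :
    (fun x => lw z (near t F) (t, x)) =ᶠ[𝓝 x] fun _ => 0 := by
  have h1 : Continuous fun x => ‖x - z t‖ := by fun_prop
  filter_upwards [h1.continuousAt.eventually (lt_mem_nhds hx)] with y hy
  exact hz.lw_eq_zero (fun s hs => near_eq_zero F hs) hy.le

lemma rate_near_eq_zero (hz : WorldLine z) (F : ℝ → ℝ) (hx : 5 < ‖x - z t‖) :
    rate z t (near t) F x = 0 := by
  have h0 := (hz.near_eventually_eq_zero (deriv F) hx).self_of_nhds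
  beta_reduce at h0
  rw [rate, h0, zero_sub, neg_eq_zero]
  refine sum_eq_zero fun i _ => ?_
  rw [(hz.near_eventually_eq_zero (fun s => deriv z s i * F s) hx).fderiv_eq]
  simp

lemma hasLocalExpansion_lw (hz : WorldLine z) (hF : C∞ F) (t : ℝ) :
    ∃ c, LocExp (fun x => lw z F (t, x)) (z t) c := by
  obtain ⟨e, o, c, C, δ, hδ, hC, -, -, he, ho, hb⟩ := hz.exists_local_expansion hF t
  exact ⟨c, e, o, C, δ, hδ, he, ho, fun y hy hy' => (hb y hy hy').1⟩

end WorldLine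

lemma LocExp.add_differentiable {f g : SR} {a : Space} {c : ℝ} (hf : LocExp f a c)
    (hg : DifferentiableAt ℝ g a) : LocExp (fun x => f x + g x) a (c + g a) := by
  obtain ⟨e, o, C, δ, hδ, he, ho, hb⟩ := hf
  obtain ⟨K, hK⟩ := hg.isBigO_sub.bound
  obtain ⟨η, hη, h⟩ := Metric.eventually_nhds_iff.1 hK
  refine ⟨e, o, C + K, min δ η, lt_min hδ hη, he, ho, fun y hy hy' => ?_⟩
  have h1 := hb y hy (hy'.trans_le (min_le_left _ _))
  have h2 := h (y := a + y) (by simpa using hy'.trans_le (min_le_right _ _))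
  rw [add_sub_cancel_left, norm_eq_abs] at h2
  rw [show f (a + y) + g (a + y) - (e y + o y + (c + g a)) = (f (a + y) - (e y + o y + c)) + (g (a + y) - g a) by ring,
    add_mul]
  exact (abs_add_le _ _).trans (add_le_add h1 h2)

lemma weightInt_of_integrable {f : SR} (hf : Integrable f) : WeightInt f := by
  have hm := continuous_ofReal.comp_aestronglyMeasurable hf.1
  refine ⟨hf.1, hf.norm.mono' (aesm_norm_div (f := fun x => (f x : ℂ)) hm 4) (ae_of_all _ fun x => ?_)⟩
  rw [norm_of_nonneg (by positivity), norm_real]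
  exact div_le_self (norm_nonneg _) (one_le_pow₀ (by linarith [norm_nonneg x]))

end

section

/-! ### The fields of a system of charges -/

namespace ChargeSystem

open WorldLine

variable {N : ℕ} (S : ChargeSystem N) (t : ℝ)
variable {x : Space}

lemma worldLine (n : Fin N) : WorldLine (S.pos n) := ⟨S.pos_smooth n, S.subluminal n, S.exists_retarded n⟩

/-- The four-current of the `n`-th charge, divided by `4π`. -/
def source (n : Fin N) (μ : Fin 4) (s : ℝ) : ℝ :=
  S.charge n / (4 * π) * (Fin.cons (1 : ℝ) (fun i : Fin 3 => deriv (S.pos n) s i) : Fin 4 → ℝ) μ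

lemma contDiff_source (n : Fin N) (μ : Fin 4) : C∞ (S.source n μ) := by
  refine contDiff_const.mul ?_
  refine Fin.cases ?_ (fun i => ?_) μ
  · exact contDiff_const
  · exact (contDiff_euclidean (𝕜 := ℝ)).1 (S.worldLine n).contDiff_deriv i

lemma potential_eq (p : Spacetime) (μ : Fin 4) :
    S.potential p μ = S.inField p μ + ∑ n, lw (S.pos n) (S.source n μ) p := rfl

/-- The potential without the recent past of the charges. -/
def smoothPotential (x : Space) (μ : Fin 4) : ℝ :=
  S.inField (t, x) μ + ∑ n, lw (S.pos n) (far t (S.source n μ)) (t, x)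

/-- The time derivative of the potential without the recent past of the charges. -/
def smoothVelocity (x : Space) (μ : Fin 4) : ℝ :=
  pd 0 (fun p => S.inField p μ) (t, x) + ∑ n, rate (S.pos n) t (far t) (S.source n μ) x

lemma contDiff_inField (μ : Fin 4) : C∞ fun p => S.inField p μ := contDiff_pi.1 S.inField_smooth μ

lemma contDiff_smoothPotential : C∞ (S.smoothPotential t) :=
  contDiff_pi.2 fun μ => ((S.contDiff_inField μ).comp (contDiff_const.prodMk contDiff_id)).add
    (ContDiff.sum fun n _ => (S.worldLine n).contDiff_lw_far (S.contDiff_source n μ) t)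

lemma contDiff_smoothVelocity : C∞ (S.smoothVelocity t) := by
  refine contDiff_pi.2 fun μ => ContDiff.add ?_
    (ContDiff.sum fun n _ => (S.worldLine n).contDiff_rate_far (S.contDiff_source n μ) t)
  exact (((S.contDiff_inField μ).fderiv_right (m := ∞) (by simp)).clm_apply contDiff_const).comp
    (contDiff_const.prodMk contDiff_id)

lemma potential_split (x : Space) (μ : Fin 4) : S.potential (t, x) μ
    = S.smoothPotential t x μ + ∑ n, lw (S.pos n) (near t (S.source n μ)) (t, x) := by
  rw [potential_eq, smoothPotential, add_assoc, ← sum_add_distrib]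
  exact congrArg _ (sum_congr rfl fun n _ => lw_split _ _ t _)

variable {t}

lemma pd_potential (hx : ∀ n, x ≠ S.pos n t) (ν μ : Fin 4) : S.dA ν μ (t, x)
    = pd ν (fun p => S.inField p μ) (t, x) + ∑ n, pd ν (lw (S.pos n) (S.source n μ)) (t, x) := by
  have h1 : ∀ n ∈ univ, DifferentiableAt ℝ (lw (S.pos n) (S.source n μ)) (t, x) := fun n _ =>
    ((S.worldLine n).contDiffAt_lw (S.contDiff_source n μ) (p := (t, x)) (hx n)).differentiableAt (by simp)
  simp only [dA, pd, potential_eq]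
  rw [fderiv_fun_add ((S.contDiff_inField μ).differentiable (by simp) _) (DifferentiableAt.fun_sum h1), fderiv_fun_sum h1]
  simp

lemma dA_zero (hx : ∀ n, x ≠ S.pos n t) (μ : Fin 4) : S.dA 0 μ (t, x)
    = S.smoothVelocity t x μ + ∑ n, rate (S.pos n) t (near t) (S.source n μ) x := by
  rw [S.pd_potential hx, smoothVelocity, add_assoc, ← sum_add_distrib]
  exact congrArg _ (sum_congr rfl fun n _ => (S.worldLine n).pd_zero_eq (S.contDiff_source n μ) (hx n))

lemma contDiffAt_potential (hx : ∀ n, x ≠ S.pos n t) (μ : Fin 4) :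
    ContDiffAt ℝ ∞ (fun p => S.potential p μ) (t, x) :=
  (S.contDiff_inField μ).contDiffAt.add (ContDiffAt.sum fun n _ =>
    (S.worldLine n).contDiffAt_lw (S.contDiff_source n μ) (p := (t, x)) (hx n))

lemma dA_succ (hx : ∀ n, x ≠ S.pos n t) (i : Fin 3) (μ : Fin 4) : S.dA i.succ μ (t, x)
    = fderiv ℝ (fun x => S.smoothPotential t x μ) x (single i 1)
      + ∑ n, fderiv ℝ (fun x => lw (S.pos n) (near t (S.source n μ)) (t, x)) x (single i 1) := by
  have h1 : ∀ n ∈ univ, DifferentiableAt ℝ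
      (fun x => lw (S.pos n) (near t (S.source n μ)) (t, x)) x := fun n _ =>
    ((S.worldLine n).contDiffAt_lw_space (contDiff_near (S.contDiff_source n μ) t) (hx n)).differentiableAt
      (by simp)
  rw [dA, fderiv_slice ((S.contDiffAt_potential hx μ).differentiableAt (by simp)),
    show (fun x => S.potential (t, x) μ) = _ from funext fun x => S.potential_split t x μ,
    fderiv_fun_add ((contDiff_pi.1 (S.contDiff_smoothPotential t) μ).differentiable (by simp) x)
      (DifferentiableAt.fun_sum h1), fderiv_fun_sum h1]
  simp

lemma ae_ne_pos : ∀ᵐ x : Space, ∀ n, x ≠ S.pos n t := ae_all_iff.2 fun n => ae_ne (S.pos n t)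

lemma exists_decay (h : S.VanishesAtInfinity t) : ∃ C R, (∀ x, R ≤ ‖x‖ → ‖S.smoothPotential t x‖ ≤ C) ∧
    (∀ j, 1 ≤ j → j ≤ 3 → ∀ x, R ≤ ‖x‖ → ‖iteratedFDeriv ℝ j (S.smoothPotential t) x‖ ≤ C / ‖x‖ ^ 2) ∧
    ∀ j ≤ 2, ∀ x, R ≤ ‖x‖ → ‖iteratedFDeriv ℝ j (S.smoothVelocity t) x‖ ≤ C / ‖x‖ ^ 2 := by
  obtain ⟨C, R, h⟩ := h
  have hP : ∀ n, ∃ B, ∀ x : Space, B < ‖x‖ → 5 < ‖x - S.pos n t‖ := fun n =>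
    ⟨5 + ‖S.pos n t‖, fun x hx => by linarith [norm_sub_norm_le x (S.pos n t)]⟩
  choose B hB using hP
  have hfar : ∀ x : Space, 1 + ∑ n, |B n| ≤ ‖x‖ → ∀ n, 5 < ‖x - S.pos n t‖ := fun x hx n => by
    refine hB n x ((le_abs_self _).trans_lt ?_)
    linarith [Finset.single_le_sum (fun i _ => abs_nonneg (B i)) (mem_univ n) (f := fun n => |B n|)]
  have hev : ∀ x : Space, 2 + ∑ n, |B n| ≤ ‖x‖ → ∀ᶠ y in 𝓝 x, ∀ n, 5 < ‖y - S.pos n t‖ := fun x hx =>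
    (continuous_norm.continuousAt.eventually (lt_mem_nhds (by linarith : 1 + ∑ n, |B n| < ‖x‖))).mono
      fun y hy => hfar y hy.le
  have e1 : ∀ x : Space, 2 + ∑ n, |B n| ≤ ‖x‖ → (fun x => S.potential (t, x)) =ᶠ[𝓝 x] S.smoothPotential t := fun x hx => by
    filter_upwards [hev x hx] with y hy
    funext μ
    rw [potential_split, sum_eq_zero fun n _ => ?_, add_zero]
    exact ((S.worldLine n).near_eventually_eq_zero (S.source n μ) (hy n)).self_of_nhds
  have e2 : ∀ x : Space, 2 + ∑ n, |B n| ≤ ‖x‖ →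
      (fun (x : Space) (μ : Fin 4) => S.dA 0 μ (t, x)) =ᶠ[𝓝 x] S.smoothVelocity t := fun x hx => by
    filter_upwards [hev x hx] with y hy
    funext μ
    rw [S.dA_zero (fun n h => by have := hy n; rw [h, sub_self, norm_zero] at this; linarith),
      sum_eq_zero fun n _ => (S.worldLine n).rate_near_eq_zero (S.source n μ) (hy n), add_zero]
  refine ⟨|C|, max R (2 + ∑ n, |B n|), fun x hx => ?_, fun j hj hj' x hx => ?_, fun j hj x hx => ?_⟩
  all_goals
    have hx1 := (le_max_left _ _).trans hx
    have hx2 := (le_max_right _ _).trans hx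
    have hx3 : 1 ≤ ‖x‖ := by
      have := Finset.sum_nonneg fun n (_ : n ∈ univ) => abs_nonneg (B n)
      linarith
    obtain ⟨h1, h2, h3⟩ := h x hx1
  · rw [← (e1 x hx2).self_of_nhds]
    exact h1.trans ((div_le_div_of_nonneg_right (le_abs_self C) (by positivity)).trans (div_le_self (abs_nonneg C) hx3))
  · rw [← ((e1 x hx2).iteratedFDeriv ℝ j).self_of_nhds]
    exact (h2 j hj hj').trans (div_le_div_of_nonneg_right (le_abs_self C) (by positivity))
  · rw [← ((e2 x hx2).iteratedFDeriv ℝ j).self_of_nhds]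
    exact (h3 j hj).trans (div_le_div_of_nonneg_right (le_abs_self C) (by positivity))

lemma weightInt_potential (h : S.VanishesAtInfinity t) (μ : Fin 4) : WeightInt fun x => S.potential (t, x) μ := by
  obtain ⟨C, R, h0, -, -⟩ := S.exists_decay h
  have hc := (contDiff_pi.1 (S.contDiff_smoothPotential t) μ).continuous
  obtain ⟨D, hD⟩ := exists_bound_of_continuous hc fun x hx => (norm_le_pi_norm _ μ).trans (h0 x hx)
  rw [show (fun x => S.potential (t, x) μ) = _ from funext fun x => S.potential_split t x μ]
  exact (weightInt_of_bound hc.aestronglyMeasurable (ae_of_all _ hD)).add (WeightInt.sum fun n _ => weightInt_of_integrable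
    ((S.worldLine n).integrable_lw (contDiff_near (S.contDiff_source n μ) t).continuous
      fun s hs => near_eq_zero _ hs))

lemma transform_potential (h : S.VanishesAtInfinity t) (hz : Injective fun n => S.pos n t)
    {a : Space → Fin 4 → ℂ} (ha : S.IsFourierAmplitude t a) (μ : Fin 4) :
    (KExp (fun n => S.pos n t) fun k => (‖k‖ : ℂ) * potFT (fun k => a k μ) k) ∧
    ∀ i : Fin 3, FieldFT (fun n => S.pos n t) (fun x => S.dA i.succ μ (t, x))
      fun k => I * (k i : ℝ) * potFT (fun k => a k μ) k := by
  obtain ⟨C, R, h0, h1, -⟩ := S.exists_decay h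
  set z := fun n => S.pos n t with hzd
  set U : Fin N → SC := fun n k =>
    fint (fun x => (lw (S.pos n) (near t (S.source n μ)) (t, x) : ℂ)) (-k) with hU
  have hF := fun n => contDiff_near (S.contDiff_source n μ) t
  have hF0 := fun n s hs => near_eq_zero (t := t) (s := s) (S.source n μ) hs
  have hs := WeakFT.sum (s := univ) fun n _ =>
    ((S.worldLine n).isFieldTransform_lw (hF n) (hF0 n) (zs := z) n rfl).weakFT
  have hw := (ha.weakFT_potential (S.weightInt_potential h μ).isTempered).sub hs
  have hr := transform_of_decay (zs := z) (μ := μ) (S.contDiff_smoothPotential t) h0 h1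
    (hw.congr (ae_of_all _ fun x => by
      beta_reduce
      rw [potential_split]
      push_cast
      ring) (ae_of_all _ fun _ => rfl))
  refine ⟨?_, fun i => ?_⟩
  · refine (hr.1.add (KExp.sum univ fun n _ =>
      (S.worldLine n).hasKExpansion_lw (hF n) (hF0 n) (zs := z) n rfl)).congr_ae (ae_of_all _ fun k => ?_)
    beta_reduce
    rw [← mul_sum]
    ring
  · refine ((hr.2 i).add (FieldFT.sum (s := univ) fun n _ =>
      (S.worldLine n).isFieldTransform_fderiv_lw (hF n) (hF0 n) hz n rfl (single i 1))).congr
      ?_ (ae_of_all _ fun k => ?_)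
    · filter_upwards [S.ae_ne_pos] with x hx using (S.dA_succ hx i μ).symm
    · beta_reduce
      rw [← mul_sum, inner_single_right]
      simp only [conj_trivial, one_mul]
      ring

lemma transform_velocity (h : S.VanishesAtInfinity t) (hz : Injective fun n => S.pos n t)
    {a : Space → Fin 4 → ℂ} (ha : S.IsFourierAmplitude t a) (μ : Fin 4) :
    FieldFT (fun n => S.pos n t) (fun x => S.dA 0 μ (t, x)) (velFT fun k => a k μ) := by
  obtain ⟨C, R, -, -, h2⟩ := S.exists_decay h
  choose V hV using fun n => (S.worldLine n).exists_isFieldTransform_rate (t := t) (S.contDiff_source n μ) hz n rfl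
  have hs := FieldFT.sum (s := univ) fun n _ => hV n
  have hc := contDiff_pi.1 (S.contDiff_smoothVelocity t) μ
  have hsplit : (fun x => ((S.smoothVelocity t x μ + ∑ n, rate (S.pos n) t (near t) (S.source n μ) x : ℝ) : ℂ))
      =ᵐ[volume] fun x => (S.dA 0 μ (t, x) : ℂ) := by
    filter_upwards [S.ae_ne_pos] with x hx
    rw [S.dA_zero hx]
  have hb := (pureD_decay (μ := μ) (S.contDiff_smoothVelocity t) (norm_single 0) 0 (h2 0 (by omega))).1.memLp
  rw [pureD_zero] at hb
  have ht : Tempered fun x => (S.dA 0 μ (t, x) : ℂ) :=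
    (hb.isTempered.add hs.weakFT.1).congr (by simpa using hsplit)
  have hw := ((ha.weakFT_velocity ht).sub hs.weakFT).congr (g := fun x => (S.smoothVelocity t x μ : ℂ))
    (hsplit.mono fun x hx => by beta_reduce at hx ⊢; rw [← hx]; push_cast; ring) (ae_of_all _ fun _ => rfl)
  refine ((isFieldTransform_of_decay (S.contDiff_smoothVelocity t) h2 hw).add hs).congr ?_ (ae_of_all _ fun k => ?_)
  · filter_upwards [S.ae_ne_pos] with x hx using (S.dA_zero hx μ).symm
  · beta_reduce; ring

lemma hasLocalExpansion_potential (hz : Injective fun n => S.pos n t) (n : Fin N) (μ : Fin 4) :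
    (∃ c, LocExp (fun x => S.potential (t, x) μ) (S.pos n t) c) ∧
    ∃ δ > 0, ∀ x, x ≠ S.pos n t → ‖x - S.pos n t‖ < δ → ContinuousAt (fun x => S.potential (t, x) μ) x := by
  classical
  constructor
  · obtain ⟨c, hc⟩ := (S.worldLine n).hasLocalExpansion_lw (S.contDiff_source n μ) t
    have hg : DifferentiableAt ℝ (fun x => S.inField (t, x) μ + ∑ m ∈ univ.erase n,
        lw (S.pos m) (S.source m μ) (t, x)) (S.pos n t) := by
      refine DifferentiableAt.add ?_ (DifferentiableAt.fun_sum fun m hm => ?_)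
      · exact ((S.contDiff_inField μ).differentiable (by simp) _).comp (S.pos n t) (f := fun x : Space => ((t, x) : Spacetime))
          (by fun_prop)
      · exact ((S.worldLine m).contDiffAt_lw_space (S.contDiff_source m μ)
          fun h => Finset.ne_of_mem_erase hm (hz h).symm).differentiableAt (by simp)
    have e : ∀ x, lw (S.pos n) (S.source n μ) (t, x) + (S.inField (t, x) μ + ∑ m ∈ univ.erase n,
        lw (S.pos m) (S.source m μ) (t, x)) = S.potential (t, x) μ := fun x => by
      rw [potential_eq, ← Finset.add_sum_erase _ _ (mem_univ n)]
      ring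
    have h := hc.add_differentiable hg
    simp only [e] at h
    exact ⟨_, h⟩
  · have h1 : ∀ᶠ x in 𝓝 (S.pos n t), ∀ m, m ≠ n → x ≠ S.pos m t := eventually_all.2 fun m => by
      by_cases hm : m = n
      · exact Eventually.of_forall fun x h => absurd hm h
      · exact (isOpen_ne.eventually_mem fun h => hm (hz h).symm).mono fun x hx _ => hx
    obtain ⟨δ, hδ, h⟩ := Metric.eventually_nhds_iff.1 h1
    refine ⟨δ, hδ, fun x hx hxδ => ?_⟩
    have h2 := S.contDiffAt_potential (t := t) (x := x) (fun m => by
      by_cases hm : m = n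
      · exact hm ▸ hx
      · exact h (by simpa [dist_eq_norm] using hxδ) m hm) μ
    exact h2.continuousAt.comp (f := fun x : Space => ((t, x) : Spacetime)) (by fun_prop)

end ChargeSystem

end

section

/-! ### Wave-vector densities -/

section Amplitudes

variable {a : Space → Fin 4 → ℂ} {k : Space}

lemma potFT_eq (b : SC) (k : Space) :
    potFT b k = (((2 * ‖k‖)⁻¹ : ℝ) : ℂ) * (b k + star (b (-k))) := by
  rw [potFT, div_eq_inv_mul]
  push_cast
  rfl

lemma sq_add_sq_transform (b : SC) (hk : k ≠ 0) :
    ‖k‖ ^ 2 * ‖potFT b k‖ ^ 2 + ‖velFT b k‖ ^ 2 = 1 / 2 * (‖b k‖ ^ 2 + ‖b (-k)‖ ^ 2) := by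
  have h0 := norm_ne_zero_iff.2 hk
  rw [potFT_eq, velFT]
  simp only [Complex.sq_norm, normSq_apply, star_def, mul_re, mul_im, add_re,
    add_im, sub_re, sub_im, conj_re, conj_im, ofReal_re,
    ofReal_im, neg_re, neg_im, Complex.div_ofNat_re, Complex.div_ofNat_im, I_re,
    I_im]
  field_simp
  ring

lemma re_velocity_mul (b : SC) (hk : k ≠ 0) (c : ℝ) :
    (velFT b k * star (I * (c : ℂ) * potFT b k)).re
      = -(c / (4 * ‖k‖)) * (‖b k‖ ^ 2 - ‖b (-k)‖ ^ 2) := by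
  have h0 := norm_ne_zero_iff.2 hk
  rw [potFT_eq, velFT]
  simp only [Complex.sq_norm, normSq_apply, star_def, mul_re, mul_im, add_re,
    add_im, sub_re, sub_im, conj_re, conj_im, ofReal_re,
    ofReal_im, neg_re, neg_im, Complex.div_ofNat_re, Complex.div_ofNat_im, I_re,
    I_im]
  field_simp
  ring

lemma waveDensity_eq (a : Space → Fin 4 → ℂ) (μ : Fin 4) (k : Space) :
    waveDensity a μ k = ((waveVec k μ / ‖k‖ * ∑ ν, eta ν * ‖a k ν‖ ^ 2 : ℝ) : ℂ) := by
  rw [waveDensity, Complex.ofReal_mul, Complex.ofReal_sum]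
  refine congrArg _ (sum_congr rfl fun ν _ => ?_)
  rw [star_def, Complex.mul_conj']
  push_cast
  rfl

lemma waveVec_div_neg (μ : Fin 4) (k : Space) :
    waveVec (-k) μ / ‖-k‖ = (if μ = 0 then 1 else -1) * (waveVec k μ / ‖k‖) := by
  refine Fin.cases ?_ (fun i => ?_) μ
  · simp [waveVec]
  · simp [waveVec, Fin.succ_ne_zero, neg_div]

lemma abs_waveVec_le (μ : Fin 4) (k : Space) : |waveVec k μ / ‖k‖| ≤ 1 := by
  rw [abs_div, abs_norm]
  refine div_le_one_of_le₀ ?_ (norm_nonneg k)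
  refine Fin.cases ?_ (fun i => ?_) μ
  · simp [waveVec]
  · simpa [waveVec] using PiLp.norm_apply_le k i

lemma planeWaves_symm (a : Space → Fin 4 → ℂ) (x : Space) (μ : Fin 4) (k : Space) :
    1 / 2 * (planeWaves a x μ k + planeWaves a x μ (-k))
      = 2 * (((potFT (fun k => a k μ) k * phase x 1 k).re : ℝ) : ℂ) := by
  have h1 : star (phase x 1 k) = exp (-(I * ⟪k,x⟫)) := by
    rw [phase, star_def, ← Complex.exp_conj, map_mul, conj_I, conj_ofReal, one_mul, neg_mul]
  have h2 : phase x 1 k = exp (I * ⟪k,x⟫) := by rw [phase, one_mul]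
  have h3 := Complex.add_conj (potFT (fun k => a k μ) k * phase x 1 k)
  rw [Complex.ofReal_mul, Complex.ofReal_ofNat] at h3
  rw [← h3, ← star_def, star_mul', h1, h2, planeWaves, planeWaves, potFT]
  simp only [norm_neg, inner_neg_left, ofReal_neg, mul_neg, neg_neg, star_div₀, star_add, star_mul', star_ofNat,
    star_def, conj_ofReal, Complex.conj_conj]
  ring

end Amplitudes

namespace ChargeSystem

variable {N : ℕ} (S : ChargeSystem N) {t : ℝ} {a : Space → Fin 4 → ℂ}

/-- The transforms of the derivatives `∂_ν A^μ`. -/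
def gradFT (a : Space → Fin 4 → ℂ) (ν μ : Fin 4) (k : Space) : ℂ :=
  (Fin.cons (velFT (fun k => a k μ) k)
    fun i : Fin 3 => I * (k i : ℝ) * potFT (fun k => a k μ) k : Fin 4 → ℂ) ν

lemma isFieldTransform_dA (h : S.VanishesAtInfinity t) (hz : Injective fun n => S.pos n t)
    (ha : S.IsFourierAmplitude t a) (ν μ : Fin 4) :
    FieldFT (fun n => S.pos n t) (fun x => S.dA ν μ (t, x)) (gradFT a ν μ) :=
  Fin.cases (S.transform_velocity h hz ha μ) (fun i => (S.transform_potential h hz ha μ).2 i) ν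

lemma sum_gradFT_sq (a : Space → Fin 4 → ℂ) (μ : Fin 4) (k : Space) :
    ∑ i : Fin 3, ‖gradFT a i.succ μ k‖ ^ 2 = ‖k‖ ^ 2 * ‖potFT (fun k => a k μ) k‖ ^ 2 := by
  simp only [gradFT, Fin.cons_succ, norm_mul, norm_I, one_mul, norm_real, mul_pow]
  rw [← sum_mul, EuclideanSpace.real_norm_sq_eq]
  simp

lemma integrableOn_amplitude_sq (h : S.VanishesAtInfinity t) (hz : Injective fun n => S.pos n t)
    (ha : S.IsFourierAmplitude t a) (μ : Fin 4) {L : ℝ} (hL : 0 < L) :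
    IntegrableOn (fun k => ‖a k μ‖ ^ 2) (ball 0 L) := by
  have h1 : IntegrableOn (fun k => 2 * ∑ ν, ‖gradFT a ν μ k‖ ^ 2) (ball 0 L) :=
    (integrable_finsetSum _ fun ν _ => (S.isFieldTransform_dA h hz ha ν μ).locSq L hL).const_mul 2
  refine h1.mono' (((ha.measurable μ).norm.pow 2).restrict) (ae_restrict_of_ae ?_)
  filter_upwards [ae_ne 0] with k hk
  rw [norm_of_nonneg (by positivity), Fin.sum_univ_succ, sum_gradFT_sq, gradFT, Fin.cons_zero,
    add_comm, sq_add_sq_transform _ hk]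
  nlinarith [sq_nonneg ‖a (-k) μ‖]

lemma integrableOn_waveDensity (h : S.VanishesAtInfinity t) (hz : Injective fun n => S.pos n t)
    (ha : S.IsFourierAmplitude t a) (μ : Fin 4) {L : ℝ} (hL : 0 < L) :
    IntegrableOn (waveDensity a μ) (ball 0 L) := by
  have h1 : IntegrableOn (fun k => ∑ ν, eta ν * ‖a k ν‖ ^ 2) (ball (0 : Space) L) :=
    integrable_finsetSum _ fun ν _ => (S.integrableOn_amplitude_sq h hz ha ν hL).const_mul _
  have hm : Measurable fun k : Space => waveVec k μ / ‖k‖ := by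
    refine Measurable.div ?_ measurable_norm
    refine Fin.cases ?_ (fun i => ?_) μ
    · exact measurable_norm
    · simp only [waveVec, Fin.cons_succ]
      fun_prop
  have h2 : IntegrableOn (fun k => waveVec k μ / ‖k‖ * ∑ ν, eta ν * ‖a k ν‖ ^ 2) (ball (0 : Space) L) :=
    h1.bdd_mul (c := 1) hm.aestronglyMeasurable (ae_of_all _ fun k => abs_waveVec_le μ k)
  rw [funext (waveDensity_eq a μ)]
  exact h2.ofReal

lemma paired_fieldDensity (h : S.VanishesAtInfinity t) (hz : Injective fun n => S.pos n t)
    (ha : S.IsFourierAmplitude t a) (μ : Fin 4) : ∃ K : SR,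
    Paired (fun n => S.pos n t) (fun x => S.fieldDensity (t, x) μ) K ∧
    ∀ k ≠ 0, 1 / 2 * (waveDensity a μ k + waveDensity a μ (-k)) = 2 * (K k : ℂ) := by
  have hT := S.isFieldTransform_dA h hz ha
  have hM : ∀ ν μ ν' μ', Paired (fun n => S.pos n t) (fun x => S.dA ν μ (t, x) * S.dA ν' μ' (t, x)) _ := fun ν μ ν' μ' =>
    (hT ν μ).mul hz (hT ν' μ')
  have hS : ∀ ν μ, Paired (fun n => S.pos n t) (fun x => S.dA ν μ (t, x) ^ 2) _ := fun ν μ => (hT ν μ).sq hz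
  refine Fin.cases ?_ (fun j => ?_) μ
  · have h1 := Paired.sum fun ν => ((hS 0 ν).add (Paired.sum fun i : Fin 3 => hS i.succ ν)).const_mul (1 / 2 * eta ν)
    have h2 := Paired.sum fun i : Fin 3 => Paired.sum fun j : Fin 3 =>
      ((hM i.succ i.succ j.succ j.succ).add ((hM i.succ j.succ j.succ i.succ).const_mul (-1))).const_mul (1 / 2)
    refine ⟨fun k => ∑ ν, 1 / 2 * eta ν * (1 / 2 * (‖a k ν‖ ^ 2 + ‖a (-k) ν‖ ^ 2)), (h1.add h2).congr ?_ ?_, fun k hk => ?_⟩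
    · funext x
      simp only [fieldDensity, fieldMomentum, fieldTensor, eta, Fin.sum_univ_succ, Fin.cons_zero, Fin.cons_succ,
        Matrix.cons_val_zero, Matrix.cons_val_succ, Finset.univ_eq_empty, sum_empty]
      ring
    · filter_upwards [ae_ne 0] with k hk
      rw [sum_eq_zero (s := (univ : Finset (Fin 3))) fun i _ => sum_eq_zero fun j _ => ?_, add_zero]
      · refine sum_congr rfl fun ν _ => ?_
        rw [sum_gradFT_sq, gradFT, Fin.cons_zero, add_comm, sq_add_sq_transform _ hk]
      · simp only [gradFT, Fin.cons_succ, star_def, mul_re, mul_im, conj_re,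
          conj_im, ofReal_re, ofReal_im, I_re, I_im]
        ring
    · have h0 := norm_ne_zero_iff.2 hk
      have hw : waveVec k 0 / ‖k‖ = 1 := div_self h0
      rw [waveDensity_eq, waveDensity_eq, waveVec_div_neg, hw]
      simp only [if_true, one_mul]
      push_cast
      simp only [mul_sum, ← sum_add_distrib]
      exact sum_congr rfl fun ν _ => by ring
  · have h1 := Paired.sum fun ν => (hM 0 ν j.succ ν).const_mul (-eta ν)
    have h2 := Paired.sum fun i : Fin 3 =>
      (hM i.succ i.succ j.succ 0).add ((hM i.succ 0 j.succ i.succ).const_mul (-1))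
    refine ⟨fun k => ∑ ν, eta ν * (k j / (4 * ‖k‖)) * (‖a k ν‖ ^ 2 - ‖a (-k) ν‖ ^ 2), (h1.add h2).congr ?_ ?_,
      fun k hk => ?_⟩
    · funext x
      simp only [fieldDensity, fieldMomentum, fieldTensor, eta, Fin.sum_univ_succ, Fin.cons_zero, Fin.cons_succ,
        Matrix.cons_val_zero, Matrix.cons_val_succ, Finset.univ_eq_empty, sum_empty]
      ring
    · filter_upwards [ae_ne 0] with k hk
      rw [sum_eq_zero (s := (univ : Finset (Fin 3))) fun i _ => ?_, add_zero]
      · refine sum_congr rfl fun ν _ => ?_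
        rw [gradFT, gradFT, Fin.cons_zero, Fin.cons_succ, re_velocity_mul _ hk]
        ring
      · simp only [gradFT, Fin.cons_succ, star_def, mul_re, mul_im, conj_re,
          conj_im, ofReal_re, ofReal_im, I_re, I_im]
        ring
    · have hw : waveVec k j.succ = k j := rfl
      rw [waveDensity_eq, waveDensity_eq, waveVec_div_neg, hw, if_neg (Fin.succ_ne_zero j)]
      push_cast
      simp only [mul_sum, ← sum_add_distrib]
      exact sum_congr rfl fun ν _ => by ring

lemma exists_fieldDensity_integral (h : S.VanishesAtInfinity t) (hz : Injective fun n => S.pos n t)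
    (ha : S.IsFourierAmplitude t a) (μ : Fin 4) : ∃ d : ℝ,
    HasRIntegral (fun n => S.pos n t) (fun x => S.fieldDensity (t, x) μ) d ∧
    HasRIntegralK (waveDensity a μ) (2 * (2 * π : ℂ) ^ 3 * d) := by
  obtain ⟨K, ⟨d, h1, h2⟩, h3⟩ := S.paired_fieldDensity h hz ha μ
  refine ⟨d, h1, .of_symm (fun L hL => S.integrableOn_waveDensity h hz ha μ hL) ?_⟩
  rw [mul_assoc]
  exact (h2.const_mul 2).congr_ae ((ae_ne 0).mono fun k hk => (h3 k hk).symm)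

lemma integrableOn_planeWaves (ha : S.IsFourierAmplitude t a) (x : Space) (μ : Fin 4) (L : ℝ) :
    IntegrableOn (planeWaves a x μ) (ball 0 L) := by
  have h1 : IntegrableOn (fun k => a k μ / ‖k‖) (ball (0 : Space) L) :=
    ((ha.isTempered μ).1.locallyIntegrable.integrableOn_isCompact (isCompact_closedBall 0 L)).mono_set
      Metric.ball_subset_closedBall
  have he : ∀ s : ℝ, ‖exp (I * s)‖ = 1 := fun s => by rw [mul_comm, norm_exp_ofReal_mul_I]
  have h2 : IntegrableOn (fun k => exp (I * ⟪k,x⟫) * (a k μ / ‖k‖)) (ball (0 : Space) L) :=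
    h1.bdd_mul (c := 1) (Continuous.aestronglyMeasurable (by fun_prop)) (ae_of_all _ fun k => (he _).le)
  have h4 : IntegrableOn (fun k => star (a k μ / ‖k‖)) (ball (0 : Space) L) :=
    Integrable.mono h1 h1.1.star (ae_of_all _ fun k => by simp)
  have h3 : IntegrableOn (fun k => exp (-(I * ⟪k,x⟫)) * star (a k μ / ‖k‖)) (ball (0 : Space) L) :=
    h4.bdd_mul (c := 1) (Continuous.aestronglyMeasurable (by fun_prop)) (ae_of_all _ fun k => by
      rw [← mul_neg, ← ofReal_neg]; exact (he _).le)
  refine (h2.add h3).congr (ae_of_all _ fun k => ?_)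
  simp only [Pi.add_apply, planeWaves, star_div₀, star_def, conj_ofReal]
  ring

lemma exists_regularizedPotential (h : S.VanishesAtInfinity t) (hz : Injective fun n => S.pos n t)
    (ha : S.IsFourierAmplitude t a) (n : Fin N) (μ : Fin 4) : ∃ c : ℝ, S.IsRegularizedPotential t n μ c ∧
    HasRIntegralK (planeWaves a (S.pos n t) μ) (2 * (2 * π : ℂ) ^ 3 * c) := by
  obtain ⟨⟨c, hc⟩, δ, hδ, hcont⟩ := S.hasLocalExpansion_potential hz n μ
  refine ⟨c, hc.hasRLimZero hδ hcont, .of_symm (fun L _ => S.integrableOn_planeWaves ha _ μ L) ?_⟩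
  have hw := ha.weakFT_potential (S.weightInt_potential h μ).isTempered
  obtain ⟨d, hd⟩ := (S.transform_potential h hz ha μ).1.exists_planeWave hz n fun L _ =>
    (hw.2.1.locallyIntegrable.integrableOn_isCompact (isCompact_closedBall 0 L)).mono_set Metric.ball_subset_closedBall
  rw [mul_assoc, ← hc.parseval (S.weightInt_potential h μ) hw hd]
  exact (hd.const_mul 2).congr_ae (ae_of_all _ fun k => (planeWaves_symm a _ μ k).symm)

end ChargeSystem

end

end PointChargeED

end

theorem theorem4 {N : ℕ} (S : PointChargeED.ChargeSystem N) (t : ℝ)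
    (hdistinct : Function.Injective fun n => S.pos n t)
    (hdecay : S.VanishesAtInfinity t)
    (a : PointChargeED.Space → Fin 4 → ℂ) (ha : S.IsFourierAmplitude t a) :
    ∃ (At : Fin N → Fin 4 → ℝ) (P : Fin 4 → ℝ),
      (∀ n μ, S.IsRegularizedPotential t n μ (At n μ)) ∧
      S.IsCanonicalEnergyMomentum t At P ∧
      (∀ μ, ∃ K : ℂ, PointChargeED.HasRIntegralK (PointChargeED.waveDensity a μ) K ∧
        (P μ : ℂ) = 1 / (2 * (2 * (Real.pi : ℂ)) ^ 3) * K + (S.particleTerm t At μ : ℂ)) ∧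
      (∀ n μ, ∃ B : ℂ, PointChargeED.HasRIntegralK
          (PointChargeED.planeWaves a (S.pos n t) μ) B ∧
        (At n μ : ℂ) = 1 / (2 * (2 * (Real.pi : ℂ)) ^ 3) * B) := by
  have hpi : (2 * (2 * (Real.pi : ℂ)) ^ 3) ≠ 0 := by simp [Real.pi_ne_zero]
  choose At hAt hB using S.exists_regularizedPotential hdecay hdistinct ha
  choose G hG hK using S.exists_fieldDensity_integral hdecay hdistinct ha
  refine ⟨At, fun μ => G μ + S.particleTerm t At μ, hAt, ⟨G, hG, fun μ => rfl⟩, fun μ => ⟨_, hK μ, ?_⟩,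
    fun n μ => ⟨_, hB n μ, ?_⟩⟩
  · push_cast
    field_simp
  · field_simp
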